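/- **Setting.** Let $0<q<1$, let $m\ge 1$ be an integer and put $\mu=1+q^{2-m}$. For $u\in\mathbb R$, $n\in\mathbb N$ and $0<p<1$ put $[u]_p=\frac{p^u-1}{p-1}$, $[n]_p!=[1]_p\cdots[n]_p$, $(a;p)_\infty=\prod_{k\ge0}(1-ap^k)$, $\Gamma_p(t)=\frac{(p;p)_\infty}{(p^t;p)_\infty}(1-p)^{1-t}$, $E_p(t)=\sum_{j\ge0}p^{j(j-1)/2}\frac{t^j}{[j]_p!}$ and $e_p(t)=\sum_{j\ge 0}\frac{t^j}{[j]_p!}$, where the function $e_p$ is continued analytically by $e_p(t)=1/E_p(-t)$. Put $\int_0^{\gamma\cdot\infty}f(t)\,d_pt=(1-p)\gamma\sum_{k\in\mathbb Z}f(p^k\gamma)p^k$ and $$J^{(2)}_\nu(x|q^2)=q^{\nu^2}\Big(\frac x{1+q}\Big)^{\nu}\sum_{i\ge0}\frac{q^{2i(i+\nu)}(-1)^i}{[i]_{q^2}!\,\Gamma_{q^2}(i+\nu+1)}\Big(\frac x{1+q}\Big)^{2i}.$$ **Quantum Euclidean space.** For $1\le i\le m$ let $i'=m+1-i$, and let $\rho_i=\frac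 m2-i$ if $i<i'$, $\rho_i=0$ if $i=i'$, $\rho_i=-\rho_{i'}$ if $i>i'$. The metric is $C_{ij}=C^{ij}=q^{-\rho_i}\delta_{j,i'}$. The braid matrix of $O_q(m)$ is $\hat R^{ij}_{kl}=R^{ji}_{kl}$, where $R^{ab}_{cd}$ is the coefficient of $e_{ac}\otimes e_{bd}$ in $$q\sum_{i\ne i'}e_{ii}\otimes e_{ii}+\sum_{i=i'}e_{ii}\otimes e_{ii}+\sum_{i\ne j,j'}e_{ii}\otimes e_{jj}+q^{-1}\sum_{i\ne i'}e_{i'i'}\otimes e_{ii}+(q-q^{-1})\sum_{i>j}\big(e_{ij}\otimes e_{ji}-q^{\rho_i-\rho_j}e_{ij}\otimes e_{i'j'}\big).$$ Let $(\mathcal P_1)^{ij}_{kl}=C^{ij}C_{kl}/(C^{ab}C_{ab})$ and define $\mathcal P_A$ (and $\mathcal P_S$) by $\hat R=q\mathcal P_S-q^{-1}\mathcal P_A+q^{1-m}\mathcal P_1$, $1=\mathcal P_S+\mathcal P_A+\mathcal P_1$; repeated indices are summed. $\mathcal P$ is the algebra over $\mathbb C$ with generators $x^1,\dots,x^m$ and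 relations $(\mathcal P_A)^{ij}_{kl}x^kx^l=0$, graded by degree, and $\mathcal O_q$ is its completion, the formal power series. Put $\mathbf x^2=x^iC_{ij}x^j$. The partial derivatives $\partial^i$ and $\overline{\partial}{}^i$ are the linear operators with $\partial^i1=\overline\partial{}^i1=0$ and, as operators, $$\partial^ix^j=C^{ij}+q(\hat R^{-1})^{ij}_{kl}x^k\partial^l,\qquad \overline\partial{}^ix^j=C^{ij}+q^{-1}\hat R^{ij}_{kl}x^k\overline\partial{}^l .$$ Put $\Delta=\partial^iC_{ij}\partial^j$, $(\partial^j)^*=-q^{-m}\overline\partial{}^kC_{kj}$, $\Delta^*=C_{ij}(\partial^j)^*(\partial^i)^*$, $h=\frac12(-\Delta+\mathbf x^2)$, $h^*=\frac12(-\Delta^*+\mathbf x^2)$. All these act on $\mathcal O_q$. Let $\mathcal S_k$ be the space of $S\in\mathcal P$ homogeneous of degree $k$ with $\Delta S=0$. A second copy of the coordinates is denoted by $y$. **Function spaces.** For $\alpha,\beta>0$ put $\overline{\mathcal V}_\beta=\mathcal P\cdot E_{q^2}(-\beta\mathbf x^2/\mu)\subset\mathcal O_q$, $\mathcal V_\alpha=\mathcal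 P\cdot e_{q^2}(-\alpha q^2\mathbf x^2/\mu)\subset\mathcal O_q$, $\overline{\mathcal V}_{[\beta]}=\bigcup_{j\ge0}\overline{\mathcal V}_{q^{2j}\beta}$ and $\mathcal V_{[\alpha]}=\bigcup_{j\ge0}\mathcal V_{q^{-2j}\alpha}$. **Integration.** For $R\in\mathcal P$ put $$\int_{\mathbb S^{m-1}_q}R=\sum_{k\ge0}\frac{2\,\Gamma_{q^2}(\frac12)^m}{\mu^{2k}[k]_{q^2}!\,\Gamma_{q^2}(k+\frac m2)}(\Delta^kR)(0),$$ and for $R_d$ homogeneous of degree $d$ and a function $f$ put $\int_{\gamma\cdot\mathbb R^m_q}R_d(\mathbf x)f(\mathbf x^2)=\int_0^{\gamma\cdot\infty}d_qr\,r^{m+d-1}f(r^2)\int_{\mathbb S^{m-1}_q}R_d$, extended linearly. **First Fourier transform.** Let $\exp(\mathbf x|\mathbf y)$ be the formal power series, with all $x$ written to the left of all $y$ (so with components in $\mathcal P\otimes\mathcal P$), determined by $\exp(0|\mathbf y)=1$ and $\partial_x^j\exp(\mathbf x|\mathbf y)=\exp(\mathbf x|\mathbf y)y^j$. For $f\in\overline{\mathcal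 V}_{[\beta]}$ let $$\overline{\mathcal F}^{\pm}[f](\mathbf y)=\frac{1+q}{2\mu^{m/2}\Gamma_{q^2}(\frac12)^m}\int_{\gamma_\beta\cdot\mathbb R^m_q}f(\mathbf x)\exp(\pm i\mathbf x|\mathbf y),\qquad \gamma_\beta=\sqrt{\frac{\mu}{(1-q^2)\beta}},$$ a formal power series in $\mathbf y$, the integral being taken term by term in the degree in $\mathbf y$. **Second Fourier transform.** Fix $\gamma>0$. The linear map $\mathcal F^\pm$ on $\mathcal V_{[\alpha]}$ is determined by $$\mathcal F^\pm[S_k(\mathbf y)\psi(\mathbf y^2)](\mathbf x)=(\pm i)^kS_k(\mathbf x)\,\frac1c\,\mathcal F^{q,\gamma}_{\frac m2+k-1}[\psi](\mathbf x^2)$$ for $k\ge0$, $S_k\in\mathcal S_k$ and $\psi$ a polynomial times $u\mapsto e_{q^2}(-q^{-2j}\alpha q^2u/\mu)$, $j\in\mathbb N$. Here $$\mathcal F^{q,\gamma}_\nu[\psi](r^2)=\frac{1+q}\mu\int_0^{\gamma\cdot\infty}d_qt\,\frac{J^{(2)}_\nu\big(q\frac{1+q}\mu rt|q^2\big)}{(rt)^\nu}\,t^{2\nu+1}\psi(t^2),$$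 which is an analytic function of $r^2$, into which $\mathbf x^2$ is substituted by Taylor expansion at $0$, and $$c=\frac{q^{(\frac m2-1)\frac m2}}{\Gamma_{q^2}(\frac m2)}\int_0^{\frac{\alpha q^2\gamma^2}\mu\cdot\infty}d_{q^2}u\,u^{\frac m2-1}e_{q^2}(-u).$$ **Theorem.** Let $\alpha,\beta,\gamma>0$, $f\in\overline{\mathcal V}_{[\beta]}$, $g\in\mathcal V_{[\alpha]}$ and $1\le j\le m$. Then $x^jf,\ \overline\partial{}^jf\in\overline{\mathcal V}_{[\beta]}$ and $y^jg,\ \partial^jg\in\mathcal V_{[\alpha]}$, and for each choice of sign 1. $\overline{\mathcal F}^\pm[x^jf]=\mp i\,\partial_y^j\,\overline{\mathcal F}^\pm[f]$; 2. $\mathcal F^\pm[y^jg]=\mp i\,q^{-m}\,\overline\partial{}_x^j\,\mathcal F^\pm[g]$; 3. $\overline{\mathcal F}^\pm[\overline\partial{}_x^jf]=\mp i\,q^m\,y^j\,\overline{\mathcal F}^\pm[f]$; 4. $\mathcal F^\pm[\partial_y^jg]=\mp i\,x^j\,\mathcal F^\pm[g]$. Consequently, on $\overline{\mathcal V}_{[\beta]}$,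 $$\overline{\mathcal F}^\pm\circ\mathbf x^2=-\Delta_{\mathbf y}\circ\overline{\mathcal F}^\pm,\qquad \overline{\mathcal F}^\pm\circ\Delta^*_{\mathbf x}=-\mathbf y^2\circ\overline{\mathcal F}^\pm,\qquad \overline{\mathcal F}^\pm\circ h^*_{\mathbf x}=h_{\mathbf y}\circ\overline{\mathcal F}^\pm,$$ and on $\mathcal V_{[\alpha]}$, $$\mathcal F^\pm\circ\mathbf y^2=-\Delta^*_{\mathbf x}\circ\mathcal F^\pm,\qquad \mathcal F^\pm\circ\Delta_{\mathbf y}=-\mathbf x^2\circ\mathcal F^\pm,\qquad \mathcal F^\pm\circ h_{\mathbf y}=h^*_{\mathbf x}\circ\mathcal F^\pm .$$ -/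

import Mathlib

open scoped TensorProduct

namespace QEuclid

noncomputable section

/-! ### q-calculus in one real variable -/

/-- The `p`-number `[u]_p = (p ^ u - 1) / (p - 1)`. -/
def qNumber (p u : ℝ) : ℝ := (p ^ u - 1) / (p - 1)

/-- The `p`-factorial `[n]_p! = [1]_p [2]_p ⋯ [n]_p`. -/
def qFactorial (p : ℝ) (n : ℕ) : ℝ := ∏ k ∈ Finset.range n, qNumber p ((k : ℝ) + 1)

/-- `(a ; p)_∞ = ∏_{k ≥ 0} (1 - a p ^ k)`. -/
def qPochInf (a p : ℝ) : ℝ := ∏' k : ℕ, (1 - a * p ^ k)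

/-- The `p`-Gamma function `Γ_p(t) = (p ; p)_∞ / (p ^ t ; p)_∞ * (1 - p) ^ (1 - t)`. -/
def qGamma (p t : ℝ) : ℝ := qPochInf p p / qPochInf (p ^ t) p * (1 - p) ^ (1 - t)

/-- The power series `e_p(t) = ∑ t ^ j / [j]_p!`. -/
def smallExpSeries (p : ℝ) : PowerSeries ℝ := PowerSeries.mk fun j => 1 / qFactorial p j

/-- The power series `E_p(t) = ∑ p ^ (j (j - 1) / 2) t ^ j / [j]_p!`. -/
def bigExpSeries (p : ℝ) : PowerSeries ℝ :=
  PowerSeries.mk fun j => p ^ (j * (j - 1) / 2) / qFactorial p j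

/-- The entire function `E_p`. -/
def bigExp (p t : ℝ) : ℝ := ∑' j : ℕ, PowerSeries.coeff j (bigExpSeries p) * t ^ j

/-- The function `e_p`, analytically continued beyond the disc of convergence of its series
by `e_p(t) = 1 / E_p(-t)`. -/
def smallExp (p t : ℝ) : ℝ := 1 / bigExp p (-t)

/-- The infinite Jackson integral `∫_0^{γ·∞} f(t) d_p t`. -/
def jackson (p γ : ℝ) (f : ℝ → ℝ) : ℝ := (1 - p) * γ * ∑' k : ℤ, f (p ^ k * γ) * p ^ k

/-- The coefficients of `J_ν^{(2)}(· | q²)`, without the prefactor. -/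
def besselCoeff (q ν : ℝ) (i : ℕ) : ℝ :=
  q ^ (2 * (i : ℝ) * ((i : ℝ) + ν)) * (-1) ^ i /
    (qFactorial (q ^ 2) i * qGamma (q ^ 2) ((i : ℝ) + ν + 1))

/-- The second `q`-Bessel function `J_ν^{(2)}(x | q²)`, for `x > 0`. -/
def besselTwo (q ν x : ℝ) : ℝ :=
  q ^ (ν ^ 2) * (x / (1 + q)) ^ ν * ∑' i : ℕ, besselCoeff q ν i * (x / (1 + q)) ^ (2 * i)

/-- The entire function `w ↦ B_ν(w)` with `J_ν^{(2)}(x | q²) = x ^ ν * B_ν(x²)`. -/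
def besselTwoReduced (q ν w : ℝ) : ℝ :=
  q ^ (ν ^ 2) / (1 + q) ^ ν * ∑' i : ℕ, besselCoeff q ν i * (w / (1 + q) ^ 2) ^ i

theorem besselTwo_eq {q x : ℝ} (hq : 0 < q) (hx : 0 < x) (ν : ℝ) :
    besselTwo q ν x = x ^ ν * besselTwoReduced q ν (x ^ 2) := by
  unfold besselTwo besselTwoReduced
  rw [Real.div_rpow hx.le (by linarith)]
  simp only [← div_pow, ← pow_mul]
  ring

/-- `μ = 1 + q ^ (2 - m)`. -/
def mu (q : ℝ) (m : ℕ) : ℝ := 1 + q ^ (2 - (m : ℤ))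

/-- The second `q`-Hankel transform `H_ν^{q,γ}[f](r)`, for `r > 0`. -/
def hankelTwo (q : ℝ) (m : ℕ) (ν γ : ℝ) (f : ℝ → ℝ) (r : ℝ) : ℝ :=
  (1 + q) / mu q m * jackson q γ fun t =>
    besselTwo q ν (q * ((1 + q) / mu q m) * (r * t)) / (r * t) ^ ν * t ^ (2 * ν + 1) * f t

/-- The transform `ψ ↦ 𝓕_ν^{q,γ}[ψ]` on functions of the squared radius, characterized by
`𝓕_ν^{q,γ}[ψ](r²) = H_ν^{q,γ}[t ↦ ψ(t²)](r)` (see `radialHankel_sq`). It is written with the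
entire function `w ↦ B_ν(w)`, so that it is defined (and analytic) around `u = 0`. -/
def radialHankel (q : ℝ) (m : ℕ) (ν γ : ℝ) (ψ : ℝ → ℝ) (u : ℝ) : ℝ :=
  (1 + q) / mu q m * jackson q γ fun t =>
    (q * ((1 + q) / mu q m)) ^ ν *
      besselTwoReduced q ν ((q * ((1 + q) / mu q m)) ^ 2 * u * t ^ 2) * t ^ (2 * ν + 1) * ψ (t ^ 2)

theorem radialHankel_sq {q γ r : ℝ} (hq : 0 < q) (hγ : 0 < γ) (hr : 0 < r) (m : ℕ) (ν : ℝ)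
    (ψ : ℝ → ℝ) :
    radialHankel q m ν γ ψ (r ^ 2) = hankelTwo q m ν γ (fun t => ψ (t ^ 2)) r := by
  have hmu : 0 < mu q m := by unfold mu; positivity
  unfold radialHankel hankelTwo jackson
  congr 3
  funext k
  have ht : 0 < q ^ k * γ := by positivity
  have hκ : 0 < q * ((1 + q) / mu q m) := by positivity
  have hrt : 0 < r * (q ^ k * γ) := mul_pos hr ht
  beta_reduce
  rw [besselTwo_eq hq (mul_pos hκ hrt), Real.mul_rpow hκ.le hrt.le]
  have h0 : (r * (q ^ k * γ)) ^ ν ≠ 0 := (Real.rpow_pos_of_pos hrt ν).ne'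
  have hsq : (q * ((1 + q) / mu q m)) ^ 2 * r ^ 2 * (q ^ k * γ) ^ 2
      = (q * ((1 + q) / mu q m) * (r * (q ^ k * γ))) ^ 2 := by ring
  rw [hsq]
  field_simp

/-- The Taylor series at the origin of a function of one real variable. -/
def taylorAtZero (G : ℝ → ℝ) : PowerSeries ℝ :=
  PowerSeries.mk fun n => iteratedDeriv n G 0 / (n.factorial : ℝ)

/-! ### The braid matrix of the quantum orthogonal group and the metric

Indices run over `Fin m`; the conjugate index of `i` is `Fin.rev i`. -/

/-- The numbers `ρ_i`: `(m/2 - 1, m/2 - 2, …, 1 - m/2)`, with middle entries `1/2, 0, -1/2` for odd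
`m` and `0, 0` for even `m`. -/
def rho (m : ℕ) (i : Fin m) : ℝ :=
  if 2 * (i : ℕ) + 1 < m then (m : ℝ) / 2 - 1 - (i : ℕ)
  else if 2 * (i : ℕ) + 1 = m then 0
  else (m : ℝ) / 2 - (i : ℕ)

/-- The metric `C_{ij} = C^{ij} = q ^ (-ρ_i) δ_{j, i'}`. -/
def metric (q : ℝ) (m : ℕ) (i j : Fin m) : ℝ := if j = i.rev then q ^ (-rho m i) else 0

/-- The `R`-matrix of `O_q(m)`: the coefficient `R^{ab}_{cd}` of `e_{ac} ⊗ e_{bd}`. -/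
def rMatrix (q : ℝ) (m : ℕ) (a b c d : Fin m) : ℝ :=
  (if a = c ∧ b = d then
      (if a = b then (if a = a.rev then 1 else q) else (if b = a.rev then q⁻¹ else 1))
    else 0)
  + (if c < a ∧ b = c ∧ d = a then q - q⁻¹ else 0)
  - (if c < a ∧ b = a.rev ∧ d = c.rev then (q - q⁻¹) * q ^ (rho m a - rho m c) else 0)

/-- The braid matrix, `R̂^{ij}_{kl} = R^{ji}_{kl}`. -/
def braid (q : ℝ) (m : ℕ) : Matrix (Fin m × Fin m) (Fin m × Fin m) ℝ :=
  Matrix.of fun ij kl => rMatrix q m ij.2 ij.1 kl.1 kl.2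

/-- The singlet projection `(P_1)^{ij}_{kl} = C^{ij} C_{kl} / (C^{ab} C_{ab})`. -/
def singletProj (q : ℝ) (m : ℕ) : Matrix (Fin m × Fin m) (Fin m × Fin m) ℝ :=
  Matrix.of fun ij kl =>
    metric q m ij.1 ij.2 * metric q m kl.1 kl.2 / ∑ a, ∑ b, metric q m a b * metric q m a b

/-- The antisymmetric projection `P_A`, obtained by eliminating `P_S` from
`R̂ = q P_S - q⁻¹ P_A + q ^ (1 - m) P_1` and `1 = P_S + P_A + P_1`. -/
def antisymProj (q : ℝ) (m : ℕ) : Matrix (Fin m × Fin m) (Fin m × Fin m) ℝ :=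
  (q + q⁻¹)⁻¹ • (q • (1 : Matrix (Fin m × Fin m) (Fin m × Fin m) ℝ) - braid q m
    + (q ^ (1 - (m : ℤ)) - q) • singletProj q m)

/-! ### Polynomials on quantum Euclidean space -/

/-- The defining relations `(P_A)^{ij}_{kl} x^k x^l = 0`. -/
inductive Rel (q : ℝ) (m : ℕ) : FreeAlgebra ℂ (Fin m) → FreeAlgebra ℂ (Fin m) → Prop
  | comm (i j : Fin m) :
      Rel q m
        (∑ k, ∑ l, ((antisymProj q m (i, j) (k, l) : ℝ) : ℂ) •
          (FreeAlgebra.ι ℂ k * FreeAlgebra.ι ℂ l)) 0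

/-- The algebra `𝒫` of polynomials on `ℝ^m_q`. -/
abbrev Pol (q : ℝ) (m : ℕ) : Type := RingQuot (Rel q m)

/-- The coordinate `x^j`. -/
def x (q : ℝ) (m : ℕ) (j : Fin m) : Pol q m :=
  RingQuot.mkAlgHom ℂ (Rel q m) (FreeAlgebra.ι ℂ j)

theorem x_rel (q : ℝ) (m : ℕ) (i j : Fin m) :
    ∑ k, ∑ l, ((antisymProj q m (i, j) (k, l) : ℝ) : ℂ) • (x q m k * x q m l) = 0 := by
  have h := RingQuot.mkAlgHom_rel ℂ (Rel.comm (q := q) (m := m) i j)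
  simpa only [x, map_sum, map_smul, map_mul, map_zero] using h

/-- The norm squared `𝐱² = x^i C_{ij} x^j`. -/
def normSq (q : ℝ) (m : ℕ) : Pol q m :=
  ∑ i, ∑ j, ((metric q m i j : ℝ) : ℂ) • (x q m i * x q m j)

/-- Evaluation at the origin. -/
def evalZero (q : ℝ) (m : ℕ) : Pol q m →ₐ[ℂ] ℂ :=
  RingQuot.liftAlgHom ℂ ⟨FreeAlgebra.lift ℂ fun _ => (0 : ℂ), by
    rintro _ _ ⟨i, j⟩
    simp only [map_sum, map_smul, map_mul, FreeAlgebra.lift_ι_apply, mul_zero, smul_zero,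
      Finset.sum_const_zero, map_zero]⟩

/-- The grading of `𝒫`: the algebra homomorphism `x^j ↦ x^j T` into `𝒫[T]`. The coefficient of
`T ^ d` in the image of `P` is the homogeneous component of degree `d` of `P`. -/
def grade (q : ℝ) (m : ℕ) : Pol q m →ₐ[ℂ] Polynomial (Pol q m) :=
  RingQuot.liftAlgHom ℂ ⟨FreeAlgebra.lift ℂ fun j => Polynomial.monomial 1 (x q m j), by
    rintro _ _ ⟨i, j⟩
    simp only [map_sum, map_smul, map_mul, FreeAlgebra.lift_ι_apply, map_zero,
      Polynomial.monomial_mul_monomial, Polynomial.smul_monomial]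
    simp only [← map_sum, x_rel, map_zero]⟩

/-- `D` is a family of partial derivatives on `𝒫` for the braiding `A` and the parameter `p`:
`D^i(1) = 0` and `D^i x^j = C^{ij} + p A^{ij}_{kl} x^k D^l` as operators on `𝒫`. As `𝒫` is spanned
by the words in the `x^j`, there is at most one such family. -/
def IsPartial (q : ℝ) (m : ℕ) (A : Matrix (Fin m × Fin m) (Fin m × Fin m) ℝ) (p : ℝ)
    (D : Fin m → Pol q m →ₗ[ℂ] Pol q m) : Prop :=
  (∀ i, D i 1 = 0) ∧
  ∀ i j f, D i (x q m j * f) = ((metric q m i j : ℝ) : ℂ) • f +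
    (p : ℂ) • ∑ k, ∑ l, ((A (i, j) (k, l) : ℝ) : ℂ) • (x q m k * D l f)

/-- The partial derivatives `∂^i`: the family determined by
`∂^i x^j = C^{ij} + q (R̂⁻¹)^{ij}_{kl} x^k ∂^l`. -/
def pd (q : ℝ) (m : ℕ) : Fin m → Pol q m →ₗ[ℂ] Pol q m :=
  Classical.epsilon (IsPartial q m (braid q m)⁻¹ q)

/-- The partial derivatives `∂̄^i` of the second calculus: the family determined by
`∂̄^i x^j = C^{ij} + q⁻¹ R̂^{ij}_{kl} x^k ∂̄^l`. -/
def pdBar (q : ℝ) (m : ℕ) : Fin m → Pol q m →ₗ[ℂ] Pol q m :=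
  Classical.epsilon (IsPartial q m (braid q m) q⁻¹)

/-- The Laplace operator `Δ = ∂^i C_{ij} ∂^j` on `𝒫`. -/
def laplacePol (q : ℝ) (m : ℕ) : Module.End ℂ (Pol q m) :=
  ∑ i, ∑ j, ((metric q m i j : ℝ) : ℂ) • (pd q m i ∘ₗ pd q m j)

/-- `S ∈ 𝒮_k`: homogeneous of degree `k` and annihilated by `Δ`. -/
def IsSpherical (q : ℝ) (m : ℕ) (k : ℕ) (S : Pol q m) : Prop :=
  grade q m S = Polynomial.monomial k S ∧ laplacePol q m S = 0

/-! ### Formal power series on quantum Euclidean space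

A formal power series is stored as the sequence of its homogeneous components, as the series
`∑_d f_d T ^ d` over `𝒫` with `f_d` of degree `d`. -/

/-- Formal power series in the coordinates. -/
abbrev Ser (q : ℝ) (m : ℕ) : Type := PowerSeries (Pol q m)

/-- A polynomial as a formal power series. -/
def ofPol (q : ℝ) (m : ℕ) (P : Pol q m) : Ser q m := (grade q m P : PowerSeries (Pol q m))

/-- `φ(𝐱²)` for a power series `φ` in one variable. -/
def radial (q : ℝ) (m : ℕ) (φ : PowerSeries ℝ) : Ser q m :=
  PowerSeries.mk fun d =>
    if Even d then ((PowerSeries.coeff (d / 2) φ : ℝ) : ℂ) • normSq q m ^ (d / 2) else 0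

/-- Extension to formal power series of a linear map on `𝒫` that lowers degrees by one. -/
def extend {q : ℝ} {m : ℕ} (D : Pol q m →ₗ[ℂ] Pol q m) (f : Ser q m) : Ser q m :=
  PowerSeries.mk fun d => D (PowerSeries.coeff (d + 1) f)

/-- Multiplication by the coordinate `x^j`. -/
def mulX (q : ℝ) (m : ℕ) (j : Fin m) (f : Ser q m) : Ser q m := ofPol q m (x q m j) * f

/-- Multiplication by `𝐱²`. -/
def mulNormSq (q : ℝ) (m : ℕ) (f : Ser q m) : Ser q m := ofPol q m (normSq q m) * f

/-- The operator `∂^j`. -/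
def dx (q : ℝ) (m : ℕ) (j : Fin m) (f : Ser q m) : Ser q m := extend (pd q m j) f

/-- The operator `∂̄^j`. -/
def dxBar (q : ℝ) (m : ℕ) (j : Fin m) (f : Ser q m) : Ser q m := extend (pdBar q m j) f

/-- The Laplace operator `Δ = ∂^i C_{ij} ∂^j`. -/
def laplace (q : ℝ) (m : ℕ) (f : Ser q m) : Ser q m :=
  ∑ i, ∑ j, ((metric q m i j : ℝ) : ℂ) • dx q m i (dx q m j f)

/-- The operator `(∂^j)^* = -q ^ (-m) ∂̄^k C_{kj}`. -/
def dxStar (q : ℝ) (m : ℕ) (j : Fin m) (f : Ser q m) : Ser q m :=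
  -(((q ^ m)⁻¹ : ℝ) : ℂ) • ∑ k, ((metric q m k j : ℝ) : ℂ) • dxBar q m k f

/-- The operator `Δ^* = C_{ij} (∂^j)^* (∂^i)^*`. -/
def laplaceStar (q : ℝ) (m : ℕ) (f : Ser q m) : Ser q m :=
  ∑ i, ∑ j, ((metric q m i j : ℝ) : ℂ) • dxStar q m j (dxStar q m i f)

/-- The Hamiltonian `h = (-Δ + 𝐱²) / 2`. -/
def ham (q : ℝ) (m : ℕ) (f : Ser q m) : Ser q m :=
  (1 / 2 : ℂ) • (-laplace q m f + mulNormSq q m f)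

/-- The Hamiltonian `h^* = (-Δ^* + 𝐱²) / 2`. -/
def hamStar (q : ℝ) (m : ℕ) (f : Ser q m) : Ser q m :=
  (1 / 2 : ℂ) • (-laplaceStar q m f + mulNormSq q m f)

/-! ### Integration -/

/-- The integral over the quantum sphere, by the Pizzetti formula
`∫ R = ∑_k 2 Γ_{q²}(1/2)^m / (μ^{2k} [k]_{q²}! Γ_{q²}(k + m/2)) (Δ^k R)(0)`. On the homogeneous
component of degree `d` the terms with `k > d` vanish, as `Δ` lowers degrees by two. -/
def sphereInt (q : ℝ) (m : ℕ) : Pol q m →ₗ[ℂ] ℂ :=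
  Polynomial.lsum (fun d : ℕ => ∑ k ∈ Finset.range (d + 1),
    ((2 * qGamma (q ^ 2) (1 / 2) ^ m /
      (mu q m ^ (2 * k) * qFactorial (q ^ 2) k * qGamma (q ^ 2) ((k : ℝ) + (m : ℝ) / 2)) : ℝ) : ℂ) •
      ((evalZero q m).toLinearMap ∘ₗ (laplacePol q m ^ k)))
  ∘ₗ (grade q m).toLinearMap

/-- The integral of `R(𝐱) φ(𝐱²)` over `γ · ℝ^m_q`, as a linear functional of the polynomial `R`:
for `R` homogeneous of degree `d` it is `∫_0^{γ·∞} d_q r r ^ (m + d - 1) φ(r²)` times the integral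
of `R` over the quantum sphere. -/
def spaceInt (q : ℝ) (m : ℕ) (γ : ℝ) (φ : ℝ → ℝ) : Pol q m →ₗ[ℂ] ℂ :=
  Polynomial.lsum (fun d : ℕ =>
    ((jackson q γ fun r => r ^ (m + d - 1) * φ (r ^ 2) : ℝ) : ℂ) • sphereInt q m)
  ∘ₗ (grade q m).toLinearMap

/-! ### The Fourier kernel -/

/-- `e = (e_l)_l` are the components (of degree `l` in `𝐱`) of the exponential `exp(𝐱|𝐲)`, written
with all `𝐱` on the left of all `𝐲`, that is, in `𝒫 ⊗ 𝒫`: `exp(0|𝐲) = 1` and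
`∂_x^j exp(𝐱|𝐲) = exp(𝐱|𝐲) y^j`. There is at most one such sequence. -/
def IsKernel (q : ℝ) (m : ℕ) (e : ℕ → Pol q m ⊗[ℂ] Pol q m) : Prop :=
  e 0 = 1 ∧
  (∀ l, (evalZero q m).toLinearMap.rTensor (Pol q m) (e (l + 1)) = 0) ∧
  ∀ l j, (pd q m j).rTensor (Pol q m) (e (l + 1)) = e l * (1 ⊗ₜ[ℂ] x q m j)

/-- The exponential `exp(𝐱|𝐲)`. -/
def kernel (q : ℝ) (m : ℕ) : ℕ → Pol q m ⊗[ℂ] Pol q m :=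
  Classical.epsilon (IsKernel q m)

/-! ### The function spaces -/

/-- The Gaussian `E_{q²}(-b 𝐱² / μ)`. -/
def bigGauss (q : ℝ) (m : ℕ) (b : ℝ) : Ser q m :=
  radial q m (PowerSeries.rescale (-(b / mu q m)) (bigExpSeries (q ^ 2)))

/-- The Gaussian `e_{q²}(-a q² 𝐱² / μ)`. -/
def smallGauss (q : ℝ) (m : ℕ) (a : ℝ) : Ser q m :=
  radial q m (PowerSeries.rescale (-(a * q ^ 2 / mu q m)) (smallExpSeries (q ^ 2)))

/-- The space `V̄_b = 𝒫 ⊗ E_{q²}(-b 𝐱² / μ)`. -/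
def VBar (q : ℝ) (m : ℕ) (b : ℝ) : Set (Ser q m) :=
  {f | ∃ P : Pol q m, f = ofPol q m P * bigGauss q m b}

/-- The space `V̄_{[β]} = ⋃_j V̄_{q ^ (2 j) β}`. -/
def VBarClass (q : ℝ) (m : ℕ) (β : ℝ) : Set (Ser q m) := ⋃ j : ℕ, VBar q m (q ^ (2 * j) * β)

/-- The space `V_a = 𝒫 ⊗ e_{q²}(-a q² 𝐱² / μ)`. -/
def V (q : ℝ) (m : ℕ) (a : ℝ) : Set (Ser q m) :=
  {f | ∃ P : Pol q m, f = ofPol q m P * smallGauss q m a}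

/-- The space `V_{[α]} = ⋃_j V_{q ^ (-2 j) α}`. -/
def VClass (q : ℝ) (m : ℕ) (α : ℝ) : Set (Ser q m) := ⋃ j : ℕ, V q m ((q ^ (2 * j))⁻¹ * α)

/-! ### The Fourier transforms

The sign `±` is a unit `s` of `ℤ`. The target is a second copy of the formal power series. -/

/-- The number `± i`. -/
def signI (s : ℤˣ) : ℂ := ((s : ℤ) : ℂ) * Complex.I

/-- The first Fourier integral of `P(𝐱) E_{q²}(-b 𝐱² / μ)`:
`(1 + q) / (2 μ^{m/2} Γ_{q²}(1/2)^m) ∫ P(𝐱) E_{q²}(-b 𝐱² / μ) exp(± i 𝐱|𝐲)`,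
where the integral is over `γ · ℝ^m_q` with `γ = √(μ / ((1 - q²) β))`. -/
def fourierBarRep (q : ℝ) (m : ℕ) (s : ℤˣ) (β b : ℝ) (P : Pol q m) : Ser q m :=
  PowerSeries.mk fun l =>
    (((1 + q) / (2 * mu q m ^ ((m : ℝ) / 2) * qGamma (q ^ 2) (1 / 2) ^ m) : ℝ) : ℂ) •
      signI s ^ l •
        TensorProduct.lid ℂ (Pol q m)
          ((spaceInt q m (√(mu q m / ((1 - q ^ 2) * β)))
              fun u => bigExp (q ^ 2) (-(b / mu q m) * u)).rTensor (Pol q m)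
            ((P ⊗ₜ[ℂ] 1) * kernel q m l))

open Classical in
/-- The first Fourier transform `𝓕̄^±` on `V̄_{[β]}` (and zero elsewhere): write
`f = P(𝐱) E_{q²}(-q ^ (2 j) β 𝐱² / μ)` and take the Fourier integral. The result does not depend on
the representation. -/
def fourierBar (q : ℝ) (m : ℕ) (s : ℤˣ) (β : ℝ) (f : Ser q m) : Ser q m :=
  if h : ∃ r : ℕ × Pol q m, f = ofPol q m r.2 * bigGauss q m (q ^ (2 * r.1) * β) then
    fourierBarRep q m s β (q ^ (2 * h.choose.1) * β) h.choose.2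
  else 0

/-- The normalization
`c = q ^ ((m/2 - 1) m/2) / Γ_{q²}(m/2) ∫_0^{(α q² γ² / μ)·∞} d_{q²}u u ^ (m/2 - 1) e_{q²}(-u)`. -/
def normConst (q : ℝ) (m : ℕ) (α γ : ℝ) : ℝ :=
  q ^ (((m : ℝ) / 2 - 1) * ((m : ℝ) / 2)) / qGamma (q ^ 2) ((m : ℝ) / 2) *
    jackson (q ^ 2) (α * q ^ 2 * γ ^ 2 / mu q m) fun u =>
      u ^ ((m : ℝ) / 2 - 1) * smallExp (q ^ 2) (-u)

/-- Bochner's relation: the second Fourier transform of `S_k(𝐲) ψ(𝐲²)` is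
`(± i)^k S_k(𝐱) c⁻¹ 𝓕_{m/2+k-1}^{q,γ}[ψ](𝐱²)`, where the last factor is a formal power series by
Taylor expansion. -/
def bochner (q : ℝ) (m : ℕ) (s : ℤˣ) (α γ : ℝ) (k : ℕ) (S : Pol q m) (ψ : ℝ → ℝ) : Ser q m :=
  signI s ^ k • (((normConst q m α γ)⁻¹ : ℝ) : ℂ) •
    (ofPol q m S * radial q m (taylorAtZero (radialHankel q m ((m : ℝ) / 2 + k - 1) γ ψ)))

/-- `g = ∑_{k,n} S_{k,n}(𝐲) 𝐲^{2n} e_{q²}(-a q² 𝐲² / μ)` with `S_{k,n} ∈ 𝒮_k`, finitely many of them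
nonzero. -/
def IsHarmonicRep (q : ℝ) (m : ℕ) (a : ℝ) (S : (ℕ × ℕ) →₀ Pol q m) (g : Ser q m) : Prop :=
  (∀ k n, IsSpherical q m k (S (k, n))) ∧
  g = ofPol q m (S.sum fun kn P => P * normSq q m ^ kn.2) * smallGauss q m a

open Classical in
/-- The second Fourier transform `𝓕^±` on `V_{[α]}` (and zero elsewhere), computed with the
auxiliary parameter `γ`: write `g = ∑_{k,n} S_{k,n}(𝐲) 𝐲^{2n} e_{q²}(-a q² 𝐲² / μ)` with
`a = q ^ (-2 j) α` and apply Bochner's relation to each term. The result does not depend on the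
representation. -/
def fourier (q : ℝ) (m : ℕ) (s : ℤˣ) (α γ : ℝ) (g : Ser q m) : Ser q m :=
  if h : ∃ r : ℕ × ((ℕ × ℕ) →₀ Pol q m),
      IsHarmonicRep q m ((q ^ (2 * r.1))⁻¹ * α) r.2 g then
    h.choose.2.sum fun kn S => bochner q m s α γ kn.1 S fun u =>
      u ^ kn.2 * smallExp (q ^ 2) (-((q ^ (2 * h.choose.1))⁻¹ * α * q ^ 2 / mu q m) * u)
  else 0

end

end QEuclid

/-!
Both Fourier transforms are determined by Bochner's relations: on `S_k(𝐱) ψ(𝐱²)` with `S_k`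
spherical of degree `k`, they reproduce `S_k` up to `(± i)^k` and act on the radial factor `ψ`
alone. Once this is known, the exchange relations are identities between the radial
coefficients, and the statements about `𝐱²`, `Δ` and the Hamiltonians follow by applying the
exchange relations twice.

*The calculus.* The entries of `R̂` are explicit (`rEntry_eq`). The skein relation `R̂ - R̂⁻¹ =
(q - q⁻¹) (1 - K)`, `K^{ij}_{kl} = C^{ij} C_{kl}`, gives the inverse (`sum_rEntry_rInv`), and
`R̂` and `R̂⁻¹` are exchanged when a crossing is turned by a quarter (`rInv_crossing`). Together
they prove the Yang–Baxter equation without a case distinction over six indices: its defect does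
not change if two crossings are inverted (`ybDefect_eq_mixed`), hence its six indices can be
rotated (`ybDefect_rotate`), and the largest index can be brought to a corner, where the defect
is zero for trivial reasons (`ybDefect_max`). By the Yang–Baxter equation the derivatives `∂^i`
exist (`isPartial_pd`) and satisfy the same quadratic relations as the coordinates
(`isQuad_pd`). Crossing symmetry alone shows that `𝐱²` is central (`IsQuad.sqOf_comm`). The
derivative `∂̄^j` is the dilation by `q⁻²` composed with `∂^j - (1 - q²) μ⁻¹ x^j Δ`
(`pdBar_apply`), so that the second calculus reduces to the first.

*Spherical polynomials.* From the commutation of `Δ` and `𝐱²` one gets the Fischer decomposition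
of `𝒫` into the spaces `𝒮_k 𝐱^{2n}` (`fischerEquiv`). For `S ∈ 𝒮_k`, the number `(Δ^N (S h))(0)`
is a multiple of `(S(∂) Δ^{N-k} h)(0)` (`evalZero_laplace_mul`). Applied to the exponential, on
which `S(∂)` acts as multiplication by `S(𝐲)` (`rTensor_diffOp_kernel`), this gives Bochner's
relations for the first transform (`lid_spaceInt_kernel`). The second transform has them by
definition; there the `q`-Hankel transform has to be expanded by termwise integration
(`taylorAtZero_radialHankel`).

*The exchange relations.* Both transforms are therefore of the form `bochnerTransform`, with
some coefficients `a_{k,i}` and the Jackson moments `ν_N` of a Gaussian. As the lattice of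
integration is invariant under dilations by `q`, the functional equation of the `q`-exponentials
gives a recursion for `ν_N` (`moment_recursion`). Multiplication by `x^j` becomes a derivative
by the recursions of `a_{k,i}` in `k` and `i` (`bochnerTransform_x_mul`); a derivative becomes
multiplication by `x^j` if the recursion of the moments is used in addition
(`bochnerTransform_gaussDeriv`). The functional equation also shows that the transform of a
polynomial times a Gaussian does not depend on the choice of the Gaussian in its class
(`IsGaussFamily.transform_eq`).
-/

open scoped TensorProduct

namespace QEuclid

noncomputable section

/-! ### The braid matrix -/

/-- The weight `w_i = q ^ (-ρ_i)`; it is the only nonzero entry of the `i`-th row of the metric. -/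
def wt (q : ℝ) (m : ℕ) (i : Fin m) : ℝ := q ^ (-rho m i)

theorem metric_eq (q : ℝ) (m : ℕ) (i j : Fin m) :
    metric q m i j = if j = i.rev then wt q m i else 0 := rfl

theorem rho_rev {m : ℕ} (i : Fin m) : rho m i.rev = -rho m i := by
  have hi := i.isLt
  unfold rho
  have hv : ((i.rev : Fin m) : ℕ) = m - (i + 1) := Fin.val_rev i
  rw [hv]
  have hc : ((m - (i + 1) : ℕ) : ℝ) = m - (i + 1) := by
    rw [Nat.cast_sub (by omega)]; push_cast; ring
  rw [hc]
  split_ifs <;> first | omega | ring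

theorem wt_pos {q : ℝ} (hq : 0 < q) {m : ℕ} (i : Fin m) : 0 < wt q m i :=
  Real.rpow_pos_of_pos hq _

theorem wt_mul_rev {q : ℝ} (hq : 0 < q) {m : ℕ} (i : Fin m) : wt q m i * wt q m i.rev = 1 := by
  unfold wt
  rw [rho_rev, ← Real.rpow_add hq]
  simp

/-- The coefficient `α_{kl}` with which the braid matrix exchanges `e_k ⊗ e_l`. -/
def swapCoeff (q : ℝ) {m : ℕ} (k l : Fin m) : ℝ :=
  if k = l then (if k = k.rev then 1 else q) else if l = k.rev then q⁻¹ else 1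

/-- The entry `R̂^{ij}_{kl}`. -/
def rEntry (q : ℝ) (m : ℕ) (i j k l : Fin m) : ℝ := braid q m (i, j) (k, l)

/-- The three parts of the braid matrix: an exchange, a multiple of the identity and a truncation
of `K`. -/
theorem rEntry_eq {q : ℝ} (hq : 0 < q) {m : ℕ} (i j k l : Fin m) :
    rEntry q m i j k l = (if i = l ∧ j = k then swapCoeff q k l else 0)
      + (if k < l ∧ i = k ∧ j = l then q - q⁻¹ else 0)
      - (if j = i.rev ∧ l = k.rev ∧ i < k.rev then (q - q⁻¹) * (wt q m i * wt q m k) else 0) := by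
  have h3 : (if k < j ∧ i = j.rev ∧ l = k.rev then (q - q⁻¹) * q ^ (rho m j - rho m k) else 0) =
      (if j = i.rev ∧ l = k.rev ∧ i < k.rev then (q - q⁻¹) * (wt q m i * wt q m k) else 0) := by
    have hcond : (k < j ∧ i = j.rev ∧ l = k.rev) ↔ (j = i.rev ∧ l = k.rev ∧ i < k.rev) := by
      simp only [Fin.ext_iff, Fin.lt_def, Fin.val_rev]; omega
    by_cases h : k < j ∧ i = j.rev ∧ l = k.rev
    · rw [if_pos h, if_pos (hcond.1 h), h.2.1]
      unfold wt
      rw [rho_rev, ← Real.rpow_add hq]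
      congr 2; ring
    · rw [if_neg h, if_neg (fun h' => h (hcond.2 h'))]
  simp only [rEntry, braid, Matrix.of_apply, rMatrix]
  rw [h3]
  congr 1
  congr 1
  · unfold swapCoeff
    by_cases h : j = k ∧ i = l
    · obtain ⟨rfl, rfl⟩ := h
      simp
    · rw [if_neg h, if_neg (fun h' => h ⟨h'.2, h'.1⟩)]
  · congr 1
    simp only [Fin.ext_iff, Fin.lt_def, eq_iff_iff]; omega

theorem swapCoeff_comm {q : ℝ} {m : ℕ} (k l : Fin m) : swapCoeff q k l = swapCoeff q l k := by
  unfold swapCoeff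
  simp only [Fin.ext_iff, Fin.val_rev]
  split_ifs <;> first | rfl | (exfalso; omega)

theorem swapCoeff_rev {q : ℝ} {m : ℕ} (k l : Fin m) :
    swapCoeff q k.rev l.rev = swapCoeff q k l := by
  unfold swapCoeff
  simp only [Fin.ext_iff, Fin.val_rev]
  split_ifs <;> first | rfl | (exfalso; omega)

theorem swapCoeff_mul_rev {q : ℝ} (hq : 0 < q) {m : ℕ} (k l : Fin m) :
    swapCoeff q k l * swapCoeff q k l.rev = 1 := by
  unfold swapCoeff
  simp only [Fin.ext_iff, Fin.val_rev]
  split_ifs <;> first | (exfalso; omega) | simp [hq.ne']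

theorem rEntry_transpose {q : ℝ} (hq : 0 < q) {m : ℕ} (i j k l : Fin m) :
    rEntry q m i j k l = rEntry q m k l i j := by
  rw [rEntry_eq hq, rEntry_eq hq]
  congr 1
  · congr 1
    · by_cases h : i = l ∧ j = k
      · obtain ⟨rfl, rfl⟩ := h; simp [swapCoeff_comm]
      · rw [if_neg h, if_neg (fun h' => h ⟨h'.2.symm, h'.1.symm⟩)]
    · congr 1
      simp only [Fin.ext_iff, Fin.lt_def, eq_iff_iff]; omega
  · have : (j = i.rev ∧ l = k.rev ∧ i < k.rev) ↔ (l = k.rev ∧ j = i.rev ∧ k < i.rev) := by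
      simp only [Fin.ext_iff, Fin.lt_def, Fin.val_rev]; omega
    simp only [this, mul_comm (wt q m i)]

theorem rEntry_flip {q : ℝ} (hq : 0 < q) {m : ℕ} (i j k l : Fin m) :
    rEntry q m j.rev i.rev l.rev k.rev = rEntry q m i j k l := by
  rw [rEntry_eq hq, rEntry_eq hq]
  congr 1
  · congr 1
    · by_cases h : i = l ∧ j = k
      · obtain ⟨rfl, rfl⟩ := h; simp [swapCoeff_rev, swapCoeff_comm]
      · rw [if_neg h, if_neg (fun h' => h ⟨Fin.rev_injective h'.2, Fin.rev_injective h'.1⟩)]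
    · congr 1
      simp only [Fin.ext_iff, Fin.lt_def, Fin.val_rev, eq_iff_iff]; omega
  · by_cases h : j = i.rev ∧ l = k.rev ∧ i < k.rev
    · rw [if_pos h, if_pos]
      · rw [h.1, h.2.1]; simp
      · revert h; simp only [Fin.ext_iff, Fin.lt_def, Fin.val_rev]; omega
    · rw [if_neg h, if_neg]
      revert h; simp only [Fin.ext_iff, Fin.lt_def, Fin.val_rev]; omega

/-- The braid matrix preserves weights; this is the form needed for the `w_i`. -/
theorem rEntry_wt {q : ℝ} (hq : 0 < q) {m : ℕ} (i j k l : Fin m) :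
    rEntry q m i j k l * (wt q m i * wt q m j) = rEntry q m i j k l * (wt q m k * wt q m l) := by
  by_cases h1 : i = l ∧ j = k
  · obtain ⟨rfl, rfl⟩ := h1; ring
  by_cases h2 : i = k ∧ j = l
  · obtain ⟨rfl, rfl⟩ := h2; ring
  by_cases h3 : j = i.rev ∧ l = k.rev
  · obtain ⟨rfl, rfl⟩ := h3; rw [wt_mul_rev hq, wt_mul_rev hq]
  have : rEntry q m i j k l = 0 := by
    rw [rEntry_eq hq, if_neg h1, if_neg (fun h => h2 h.2), if_neg (fun h => h3 ⟨h.1, h.2.1⟩)]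
    simp
  rw [this]; simp

/-- The entries `C^{ij} C_{kl}`. -/
def kEntry (q : ℝ) (m : ℕ) (i j k l : Fin m) : ℝ := metric q m i j * metric q m k l

theorem kEntry_eq {q : ℝ} {m : ℕ} (i j k l : Fin m) :
    kEntry q m i j k l = if j = i.rev ∧ l = k.rev then wt q m i * wt q m k else 0 := by
  unfold kEntry
  rw [metric_eq, metric_eq]
  split_ifs <;> simp_all

/-- The entries of the inverse braid matrix, given by the skein relation
`R̂⁻¹ = R̂ - (q - q⁻¹) (1 - K)` with `K^{ij}_{kl} = C^{ij} C_{kl}`. -/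
def rInv (q : ℝ) (m : ℕ) (i j k l : Fin m) : ℝ :=
  rEntry q m i j k l - (q - q⁻¹) * ((if i = k ∧ j = l then 1 else 0) - kEntry q m i j k l)

theorem rInv_eq {q : ℝ} (hq : 0 < q) {m : ℕ} (i j k l : Fin m) :
    rInv q m i j k l = (if i = l ∧ j = k then swapCoeff q k l else 0)
      - (if l ≤ k ∧ i = k ∧ j = l then q - q⁻¹ else 0)
      + (if j = i.rev ∧ l = k.rev ∧ k.rev ≤ i then (q - q⁻¹) * (wt q m i * wt q m k) else 0) := by
  have h1 : (if k < l ∧ i = k ∧ j = l then q - q⁻¹ else 0)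
      = (q - q⁻¹) * (if i = k ∧ j = l then 1 else 0)
        - (if l ≤ k ∧ i = k ∧ j = l then q - q⁻¹ else 0) := by
    simp only [Fin.ext_iff, Fin.lt_def, Fin.le_def]
    split_ifs <;> first | (exfalso; omega) | ring
  have h2 : (if j = i.rev ∧ l = k.rev ∧ i < k.rev then (q - q⁻¹) * (wt q m i * wt q m k) else 0)
      = (q - q⁻¹) * (if j = i.rev ∧ l = k.rev then wt q m i * wt q m k else 0)
        - (if j = i.rev ∧ l = k.rev ∧ k.rev ≤ i then (q - q⁻¹) * (wt q m i * wt q m k) else 0) := by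
    simp only [Fin.ext_iff, Fin.lt_def, Fin.le_def]
    split_ifs <;> first | (exfalso; omega) | ring
  rw [rInv, rEntry_eq hq, kEntry_eq, h1, h2]
  ring

theorem wt_eq_one {q : ℝ} {m : ℕ} {i : Fin m} (hi : i = i.rev) : wt q m i = 1 := by
  have h : rho m i = 0 := by
    have := rho_rev i
    rw [← hi] at this; linarith
  simp [wt, h]

/-- Crossing symmetry of the braid matrix. -/
theorem rInv_crossing {q : ℝ} (hq : 0 < q) {m : ℕ} (i j k l : Fin m) :
    rInv q m i j k l = wt q m i / wt q m l * rEntry q m j l.rev i.rev k := by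
  have hlp := (wt_pos hq l).ne'
  rw [rInv_eq hq, rEntry_eq hq]
  -- The two families of terms are exchanged, up to their diagonal parts.
  have hm1 := i.isLt
  have hm2 := k.isLt
  have e2 : (if l ≤ k ∧ i = k ∧ j = l then q - q⁻¹ else 0) = wt q m i / wt q m l *
      (if l.rev = j.rev ∧ k = i.rev.rev ∧ j < i.rev.rev then
        (q - q⁻¹) * (wt q m j * wt q m i.rev) else 0)
      + (if (i = l ∧ j = k) ∧ i = k then q - q⁻¹ else 0) := by
    simp only [Fin.rev_rev, Fin.rev_inj]
    by_cases h : l = j ∧ k = i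
    · obtain ⟨rfl, rfl⟩ := h
      have hk := wt_mul_rev hq k
      have hc : wt q m k / wt q m l * ((q - q⁻¹) * (wt q m l * wt q m k.rev)) = q - q⁻¹ := by
        field_simp
        linear_combination (q ^ 2 - 1) * hk
      simp only [Fin.ext_iff, Fin.lt_def, Fin.le_def, true_and, and_true]
      split_ifs <;> first | (exfalso; omega) | simp [hc]
    · rw [if_neg (fun h' => h ⟨h'.2.2.symm, h'.2.1.symm⟩), if_neg (fun h' => h ⟨h'.1, h'.2.1⟩),
        if_neg]
      · simp
      · rintro ⟨⟨rfl, rfl⟩, rfl⟩; exact h ⟨rfl, rfl⟩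
  have e3 : (if j = i.rev ∧ l = k.rev ∧ k.rev ≤ i then (q - q⁻¹) * (wt q m i * wt q m k) else 0)
      = wt q m i / wt q m l * (if i.rev < k ∧ j = i.rev ∧ l.rev = k then q - q⁻¹ else 0)
      + (if (i = l ∧ j = k) ∧ k = i.rev then q - q⁻¹ else 0) := by
    by_cases h : j = i.rev ∧ l = k.rev
    · obtain ⟨rfl, rfl⟩ := h
      have hk := wt_mul_rev hq k
      have hc : wt q m i / wt q m k.rev = wt q m i * wt q m k := by
        field_simp
        linear_combination -wt q m i * hk
      have hd : i = k.rev → wt q m i * wt q m k = 1 := by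
        rintro rfl; rw [mul_comm]; exact hk
      rw [hc]
      by_cases h1 : i = k.rev
      · rw [hd h1, if_pos, if_neg, if_pos]
        · simp
        · subst h1; simp
        · subst h1; simp
        · subst h1; simp
      · simp only [Fin.ext_iff, Fin.lt_def, Fin.le_def, Fin.val_rev, true_and] at h1 ⊢
        split_ifs <;> first | (exfalso; omega) | ring
    · rw [if_neg (fun h' => h ⟨h'.1, h'.2.1⟩), if_neg, if_neg]
      · simp
      · rintro ⟨⟨rfl, rfl⟩, rfl⟩; simp at h
      · rintro ⟨_, rfl, rfl⟩; simp at h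
  have e1 : (if i = l ∧ j = k then swapCoeff q k l else 0) =
      wt q m i / wt q m l * (if j = k ∧ l.rev = i.rev then swapCoeff q i.rev k else 0)
      + (if (i = l ∧ j = k) ∧ i = k then q - q⁻¹ else 0)
      - (if (i = l ∧ j = k) ∧ k = i.rev then q - q⁻¹ else 0) := by
    clear e2 e3
    by_cases h : i = l ∧ j = k
    · obtain ⟨rfl, rfl⟩ := h
      rw [div_self hlp]
      unfold swapCoeff
      simp only [Fin.ext_iff, Fin.val_rev, true_and, if_true]
      split_ifs <;> first | (exfalso; omega) | simp
    · rw [if_neg h, if_neg (fun h' => h ⟨(Fin.rev_injective h'.2).symm, h'.1⟩),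
        if_neg (fun h' => h h'.1), if_neg (fun h' => h h'.1)]
      simp
  rw [e1, e2, e3]
  ring

theorem rEntry_crossing {q : ℝ} (hq : 0 < q) {m : ℕ} (i j k l : Fin m) :
    rEntry q m i j k l = wt q m i / wt q m l * rInv q m j l.rev i.rev k := by
  rw [rInv_crossing hq]
  have hw := rEntry_wt hq i j k l
  have hk := (wt_pos hq k).ne'
  have hlp := (wt_pos hq l).ne'
  rw [← rEntry_flip hq l.rev k.rev j.rev i.rev]
  simp only [Fin.rev_rev]
  rw [← rEntry_transpose hq i j k l]
  field_simp
  linear_combination -hw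

/-! ### The inverse of the braid matrix -/

theorem wt_sq {q : ℝ} (hq : 0 < q) {m : ℕ} (i : Fin m) :
    wt q m i ^ 2 = if 2 * (i : ℕ) + 1 < m then q ^ 2 * q ^ (2 * ((i : ℕ) : ℝ) - m)
      else if 2 * (i : ℕ) + 1 = m then 1 else q ^ (2 * ((i : ℕ) : ℝ) - m) := by
  unfold wt rho
  rw [← Real.rpow_natCast, ← Real.rpow_mul hq.le, ← Real.rpow_natCast q 2, ← Real.rpow_add hq]
  split_ifs
  · congr 1; push_cast; ring
  · simp
  · congr 1; push_cast; ring

/-- `∑_{p < n} w_p²` in closed form. -/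
theorem sum_wt_sq {q : ℝ} (hq : 0 < q) {m : ℕ} (n : ℕ) (hn : n ≤ m) :
    (q - q⁻¹) * ∑ p : Fin m, (if (p : ℕ) < n then wt q m p ^ 2 else 0) =
      (if 2 * n + 1 < m then q * q ^ (2 * (n : ℝ) - m)
        else if 2 * n + 1 = m then 1 else q⁻¹ * q ^ (2 * (n : ℝ) - m) + (q - q⁻¹))
      - q * q ^ (-(m : ℝ)) := by
  have hq' := hq.ne'
  induction n with
  | zero =>
    simp only [not_lt_zero, if_false, Finset.sum_const_zero, mul_zero, Nat.cast_zero, zero_sub]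
    split_ifs with h1 h2
    · ring
    · have : m = 1 := by omega
      subst this
      simp [Real.rpow_neg_one, hq']
    · have : m = 0 := by omega
      subst this
      simp
  | succ n ih =>
    have hs : ∑ p : Fin m, (if (p : ℕ) < n + 1 then wt q m p ^ 2 else 0) =
        ∑ p : Fin m, (if (p : ℕ) < n then wt q m p ^ 2 else 0) + wt q m ⟨n, hn⟩ ^ 2 := by
      rw [← Fintype.sum_ite_eq (⟨n, hn⟩ : Fin m) (fun p => wt q m p ^ 2), ← Finset.sum_add_distrib]
      refine Finset.sum_congr rfl fun p _ => ?_
      simp only [Fin.ext_iff]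
      split_ifs <;> first | (exfalso; omega) | simp
    have hX : q ^ (2 * ((n + 1 : ℕ) : ℝ) - m) = q ^ 2 * q ^ (2 * (n : ℝ) - m) := by
      rw [← Real.rpow_natCast q 2, ← Real.rpow_add hq]
      congr 1; push_cast; ring
    rw [hs, mul_add, ih (by omega), wt_sq hq, hX]
    simp only
    split_ifs <;> try (exfalso; omega)
    · field_simp; ring
    · have h4 : 2 * n + 3 = m := by omega
      have : q ^ (2 * (n : ℝ) - m) = (q ^ 3)⁻¹ := by
        rw [← h4, ← Real.rpow_natCast, ← Real.rpow_neg hq.le]; congr 1; push_cast; ring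
      rw [this]; field_simp; ring
    · have h5 : 2 * n + 2 = m := by omega
      have : q ^ (2 * (n : ℝ) - m) = (q ^ 2)⁻¹ := by
        rw [← h5, ← Real.rpow_natCast, ← Real.rpow_neg hq.le]; congr 1; push_cast; ring
      rw [this]; field_simp; ring
    · have h2 : 2 * n + 1 = m := by omega
      have : q ^ (2 * (n : ℝ) - m) = q⁻¹ := by
        rw [← h2, ← Real.rpow_neg_one]; congr 1; push_cast; ring
      rw [this]; field_simp; ring
    · field_simp; ring

/-- The truncated sums of the `w_p²` that occur in products of braid matrices. -/
theorem sum_wt_sq_lt {q : ℝ} (hq : 0 < q) {m : ℕ} (j : Fin m) :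
    (q - q⁻¹) * ∑ p : Fin m, (if p < j then wt q m p ^ 2 else 0) =
      swapCoeff q j j.rev * wt q m j ^ 2 + (if j.rev < j then q - q⁻¹ else 0)
        - q ^ (1 - (m : ℤ)) := by
  have h := sum_wt_sq hq (j : ℕ) j.isLt.le
  have hm : q * q ^ (-(m : ℝ)) = q ^ (1 - (m : ℤ)) := by
    rw [zpow_sub₀ hq.ne', zpow_one, zpow_natCast, Real.rpow_neg hq.le, Real.rpow_natCast]; rfl
  rw [hm] at h
  simp only [Fin.lt_def] at h ⊢
  rw [h, wt_sq hq]
  congr 1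
  have hj := j.isLt
  unfold swapCoeff
  simp only [Fin.ext_iff, Fin.val_rev, if_true]
  have hq' := hq.ne'
  split_ifs <;> first | (exfalso; omega) | (field_simp; done) | (field_simp; ring)

theorem sum_wt_sq_total {q : ℝ} (hq : 0 < q) {m : ℕ} (hm : 1 ≤ m) :
    (1 - q ^ 2) * ∑ p : Fin m, wt q m p ^ 2 = mu q m * (1 - q ^ m) := by
  have h := sum_wt_sq hq m le_rfl
  have hq' := hq.ne'
  simp only [Fin.is_lt, if_true] at h
  rw [if_neg (by omega), if_neg (by omega)] at h
  have e : (2 * (m : ℝ) - m) = m := by ring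
  rw [e, Real.rpow_neg hq.le, Real.rpow_natCast] at h
  unfold mu
  rw [zpow_sub₀ hq', zpow_natCast]
  have hz : q ^ (2 : ℤ) = q ^ 2 := by norm_cast
  rw [hz]
  field_simp at h ⊢
  linear_combination -h

/-- The metric is an eigenvector of the braid matrix. -/
theorem sum_metric_rEntry {q : ℝ} (hq : 0 < q) {m : ℕ} (k l : Fin m) :
    ∑ i, wt q m i * rEntry q m i i.rev k l = q ^ (1 - (m : ℤ)) * metric q m k l := by
  rw [metric_eq]
  by_cases h : l = k.rev
  · subst h
    have h1 : ∀ i, wt q m i * rEntry q m i i.rev k k.rev =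
        (if i = k.rev then wt q m i * swapCoeff q k k.rev else 0)
        + (if i = k then (if k < k.rev then wt q m i * (q - q⁻¹) else 0) else 0)
        - wt q m k * ((q - q⁻¹) * (if i < k.rev then wt q m i ^ 2 else 0)) := by
      intro i
      rw [rEntry_eq hq]
      have e1 : wt q m i * (if i = k.rev ∧ i.rev = k then swapCoeff q k k.rev else 0) =
          (if i = k.rev then wt q m i * swapCoeff q k k.rev else 0) := by
        by_cases h : i = k.rev
        · subst h; simp
        · simp [h]
      have e2 : wt q m i * (if k < k.rev ∧ i = k ∧ i.rev = k.rev then q - q⁻¹ else 0) =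
          (if i = k then (if k < k.rev then wt q m i * (q - q⁻¹) else 0) else 0) := by
        by_cases h : i = k
        · subst h; simp
        · simp [h]
      rw [mul_sub, mul_add, e1, e2]
      simp only [true_and]
      split_ifs <;> ring
    simp only [h1, Finset.sum_add_distrib, Finset.sum_sub_distrib, ← Finset.mul_sum,
      Finset.sum_ite_eq', Finset.mem_univ, if_true]
    rw [sum_wt_sq_lt hq k.rev]
    simp only [Fin.rev_rev]
    have hk := wt_mul_rev hq k
    rw [swapCoeff_comm k.rev k]
    split_ifs <;> linear_combination -(swapCoeff q k k.rev * wt q m k.rev) * hk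
  · rw [if_neg h, mul_zero]
    refine Finset.sum_eq_zero fun i _ => ?_
    rw [rEntry_eq hq, if_neg, if_neg, if_neg]
    · simp
    · exact fun h' => h h'.2.1
    · rintro ⟨-, rfl, rfl⟩; exact h rfl
    · rintro ⟨rfl, rfl⟩; simp at h

theorem sum_rEntry_metric {q : ℝ} (hq : 0 < q) {m : ℕ} (k l : Fin m) :
    ∑ i, wt q m i * rEntry q m k l i i.rev = q ^ (1 - (m : ℤ)) * metric q m k l := by
  rw [← sum_metric_rEntry hq]
  exact Finset.sum_congr rfl fun i _ => by rw [rEntry_transpose hq]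

/-- Composition on the left with the braid matrix, written out. -/
theorem sum_rEntry_mul {q : ℝ} (hq : 0 < q) {m : ℕ} (f : Fin m → Fin m → ℝ) (i j : Fin m) :
    ∑ p, ∑ r, rEntry q m i j p r * f p r = swapCoeff q i j * f j i
      + (if i < j then (q - q⁻¹) * f i j else 0)
      - (if j = i.rev then wt q m i * ((q - q⁻¹) *
          ∑ p, if p < i.rev then wt q m p * f p p.rev else 0) else 0) := by
  have h1 : ∀ p r, rEntry q m i j p r * f p r =
      (if j = p then (if i = r then swapCoeff q i j * f j i else 0) else 0)
      + (if i = p then (if j = r then (if i < j then (q - q⁻¹) * f i j else 0) else 0) else 0)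
      - (if r = p.rev then (if j = i.rev then
          (if p < i.rev then wt q m i * (q - q⁻¹) * (wt q m p * f p r) else 0) else 0) else 0) := by
    intro p r
    have h3 : (j = i.rev ∧ r = p.rev ∧ i < p.rev) ↔ (r = p.rev ∧ j = i.rev ∧ p < i.rev) := by
      simp only [Fin.ext_iff, Fin.lt_def, Fin.val_rev]; omega
    have ha : (if i = r ∧ j = p then swapCoeff q p r else 0) * f p r =
        (if j = p then (if i = r then swapCoeff q i j * f j i else 0) else 0) := by
      by_cases h : j = p
      · subst h
        by_cases h' : i = r
        · subst h'; simp [swapCoeff_comm]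
        · simp [h']
      · simp [h]
    have hb : (if p < r ∧ i = p ∧ j = r then q - q⁻¹ else 0) * f p r =
        (if i = p then (if j = r then (if i < j then (q - q⁻¹) * f i j else 0) else 0) else 0) := by
      by_cases h : i = p
      · subst h
        by_cases h' : j = r
        · subst h'; simp
        · simp [h']
      · simp [h]
    rw [rEntry_eq hq, sub_mul, add_mul, ha, hb]
    simp only [h3, ite_and]
    split_ifs <;> ring
  simp only [h1, Finset.sum_add_distrib, Finset.sum_sub_distrib, Finset.sum_ite_irrel,
    Finset.sum_ite_eq, Finset.sum_ite_eq', Finset.mem_univ, if_true, Finset.sum_const_zero]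
  congr 1
  split_ifs with h
  · rw [← mul_assoc, Finset.mul_sum]
    exact Finset.sum_congr rfl fun p _ => by split_ifs <;> simp
  · rfl

theorem sum_wt_sq_between {q : ℝ} (hq : 0 < q) {m : ℕ} (i j : Fin m) :
    (q - q⁻¹) * ∑ p : Fin m, (if p < j ∧ i ≤ p then wt q m p ^ 2 else 0) =
      if i ≤ j then (swapCoeff q j j.rev * wt q m j ^ 2 + (if j.rev < j then q - q⁻¹ else 0)) -
        (swapCoeff q i i.rev * wt q m i ^ 2 + (if i.rev < i then q - q⁻¹ else 0)) else 0 := by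
  by_cases h : i ≤ j
  · rw [if_pos h]
    have h1 : ∑ p : Fin m, (if p < j ∧ i ≤ p then wt q m p ^ 2 else 0) =
        ∑ p : Fin m, (if p < j then wt q m p ^ 2 else 0)
        - ∑ p : Fin m, (if p < i then wt q m p ^ 2 else 0) := by
      rw [← Finset.sum_sub_distrib]
      refine Finset.sum_congr rfl fun p _ => ?_
      simp only [Fin.lt_def, Fin.le_def] at h ⊢
      split_ifs <;> first | (exfalso; omega) | ring
    rw [h1, mul_sub, sum_wt_sq_lt hq, sum_wt_sq_lt hq]
    ring
  · rw [if_neg h, Finset.sum_eq_zero, mul_zero]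
    intro p _
    rw [if_neg]
    exact fun h' => h (h'.2.trans h'.1.le)

/-- `R̂⁻¹`, as defined by the skein relation, is the inverse of the braid matrix. In the sector of
weight zero, `j = i'` and `l = k'`, this comes down to the partial sums of the `w_p²`. -/
theorem sum_rEntry_rInv {q : ℝ} (hq : 0 < q) {m : ℕ} (i j k l : Fin m) :
    ∑ p, ∑ r, rEntry q m i j p r * rInv q m p r k l = if i = k ∧ j = l then 1 else 0 := by
  have hq' := hq.ne'
  rw [sum_rEntry_mul hq]
  -- Pairs `(i, j)` with `j = i'` have weight zero; the matrix does not mix them with the others.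
  by_cases hj : j = i.rev
  · subst hj
    by_cases hl : l = k.rev
    · subst hl
      have hi := wt_mul_rev hq i
      have hk := wt_mul_rev hq k
      -- The truncated part of `R̂` meets all three parts of `R̂⁻¹`.
      have hS : (q - q⁻¹) * ∑ p, (if p < i.rev then wt q m p * rInv q m p p.rev k k.rev else 0) =
          (q - q⁻¹) * ((if k.rev < i.rev then wt q m k.rev * swapCoeff q k k.rev else 0)
          - (if k.rev ≤ k ∧ k < i.rev then (q - q⁻¹) * wt q m k else 0)
          + wt q m k * ((q - q⁻¹) *
            ∑ p : Fin m, (if p < i.rev ∧ k.rev ≤ p then wt q m p ^ 2 else 0))) := by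
        congr 1
        have h1 : ∀ p, (if p < i.rev then wt q m p * rInv q m p p.rev k k.rev else 0) =
            (if p = k.rev then
              (if k.rev < i.rev then wt q m k.rev * swapCoeff q k k.rev else 0) else 0)
            - (if p = k then (if k.rev ≤ k ∧ k < i.rev then (q - q⁻¹) * wt q m k else 0) else 0)
            + wt q m k * ((q - q⁻¹) *
              (if p < i.rev ∧ k.rev ≤ p then wt q m p ^ 2 else 0)) := by
          intro p
          rw [rInv_eq hq]
          have e1 : wt q m p * (if p = k.rev ∧ p.rev = k then swapCoeff q k k.rev else 0) =
              (if p = k.rev then wt q m k.rev * swapCoeff q k k.rev else 0) := by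
            by_cases h : p = k.rev
            · subst h; simp
            · simp [h]
          have e2 : wt q m p * (if k.rev ≤ k ∧ p = k ∧ p.rev = k.rev then q - q⁻¹ else 0) =
              (if p = k then (if k.rev ≤ k then (q - q⁻¹) * wt q m k else 0) else 0) := by
            by_cases h : p = k
            · subst h; simp [mul_comm]
            · simp [h]
          rw [mul_add, mul_sub, e1, e2]
          by_cases h : p < i.rev
          · have e3 : p = k.rev → k.rev < i.rev := fun h' => h' ▸ h
            have e4 : p = k → k < i.rev := fun h' => h' ▸ h
            simp only [h, if_true, true_and, ite_and]
            congr 1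
            · congr 1
              · split_ifs with h5 h6
                · rfl
                · exact absurd (e3 h5) h6
                · rfl
              · split_ifs with h5 h6 h7
                · rfl
                · exact absurd (e4 h5) h7
                · rfl
                · rfl
            · split_ifs <;> ring
          · have e3 : p = k.rev → ¬ k.rev < i.rev := fun h' => h' ▸ h
            have e4 : p = k → ¬ k < i.rev := fun h' => h' ▸ h
            simp only [h, if_false, false_and, ite_and, mul_zero, add_zero]
            split_ifs with h5 h6 h7 h8 <;> first | (exfalso; tauto) | simp
        simp only [h1, Finset.sum_add_distrib, Finset.sum_sub_distrib, Finset.sum_ite_eq',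
          Finset.mem_univ, if_true, ← Finset.mul_sum]
      rw [if_pos rfl, hS, sum_wt_sq_between hq, rInv_eq hq, rInv_eq hq]
      simp only [Fin.rev_rev, true_and, Fin.rev_inj, and_self]
      have hi1 := i.isLt
      have hk1 := k.isLt
      have hwi := (wt_pos hq i).ne'
      have hwk := (wt_pos hq k).ne'
      have hi' : wt q m i.rev = (wt q m i)⁻¹ := eq_inv_of_mul_eq_one_right hi
      have hk' : wt q m k.rev = (wt q m k)⁻¹ := eq_inv_of_mul_eq_one_right hk
      by_cases e1 : i = k
      · subst e1
        by_cases e2 : i = i.rev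
        · have hα : swapCoeff q i i = 1 := by
            unfold swapCoeff; rw [if_pos rfl, if_pos e2]
          simp [← e2, hα, wt_eq_one e2]
        · have hα : swapCoeff q i i.rev = q⁻¹ := by
            unfold swapCoeff; rw [if_neg e2, if_pos rfl]
          rw [swapCoeff_comm i.rev i, hα, hi']
          simp only [Fin.ext_iff, Fin.lt_def, Fin.le_def, Fin.val_rev, and_true,
            le_refl, if_true] at e2 ⊢
          split_ifs <;> first | (exfalso; omega) | (field_simp; ring)
      · by_cases e2 : i = k.rev
        · subst e2
          rw [Fin.rev_rev, swapCoeff_comm k.rev k, hk']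
          simp only [Fin.ext_iff, Fin.lt_def, Fin.le_def, Fin.val_rev, and_true,
            le_refl, if_true] at e1 ⊢
          split_ifs <;> first | (exfalso; omega) | (field_simp; ring)
        · have e3 : ¬ (i.rev = k) := by rintro rfl; simp at e2
          rw [swapCoeff_comm i.rev i, swapCoeff_comm k.rev k, hi', hk']
          simp only [Fin.ext_iff, Fin.lt_def, Fin.le_def, Fin.val_rev] at e1 e2 e3 ⊢
          split_ifs <;> first | (exfalso; omega) | (field_simp; ring)
    · have h0 : ∀ p, rInv q m p p.rev k l = 0 := by
        intro p
        rw [rInv_eq hq, if_neg, if_neg, if_neg]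
        · simp
        · exact fun h => hl h.2.1
        · rintro ⟨-, rfl, rfl⟩; exact hl rfl
        · rintro ⟨rfl, rfl⟩; simp at hl
      have h1 := h0 i.rev
      rw [Fin.rev_rev] at h1
      rw [h0, h1, if_neg (show ¬ (i = k ∧ i.rev = l) from fun h => hl (by rw [← h.2, h.1]))]
      simp [h0]
  · rw [if_neg hj, rInv_eq hq, rInv_eq hq,
      if_neg (show ¬ (i = j.rev ∧ _) from fun h => hj (by rw [h.1, Fin.rev_rev])),
      if_neg (show ¬ (j = i.rev ∧ _) from fun h => hj h.1)]
    have hα : swapCoeff q i j = if i = j then q else 1 := by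
      simp only [swapCoeff, Fin.ext_iff, Fin.val_rev] at hj ⊢
      split_ifs <;> first | (exfalso; omega) | rfl
    have hkl : (if j = l ∧ i = k then swapCoeff q k l else 0) =
        if j = l ∧ i = k then swapCoeff q i j else 0 := by
      by_cases h : j = l ∧ i = k
      · obtain ⟨rfl, rfl⟩ := h; rfl
      · rw [if_neg h, if_neg h]
    have hkl' : (if i = l ∧ j = k then swapCoeff q k l else 0) =
        if i = l ∧ j = k then swapCoeff q i j else 0 := by
      by_cases h : i = l ∧ j = k
      · obtain ⟨rfl, rfl⟩ := h; simp [swapCoeff_comm]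
      · rw [if_neg h, if_neg h]
    rw [hkl, hkl', hα]
    simp only [Fin.ext_iff, Fin.lt_def, Fin.le_def]
    split_ifs <;> first | (exfalso; omega) | (field_simp; ring)

theorem rInv_transpose {q : ℝ} (hq : 0 < q) {m : ℕ} (i j k l : Fin m) :
    rInv q m i j k l = rInv q m k l i j := by
  unfold rInv kEntry
  rw [rEntry_transpose hq, mul_comm (metric q m i j)]
  simp only [eq_comm]

theorem rInv_flip {q : ℝ} (hq : 0 < q) {m : ℕ} (i j k l : Fin m) :
    rInv q m j.rev i.rev l.rev k.rev = rInv q m i j k l := by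
  unfold rInv
  rw [rEntry_flip hq, kEntry_eq, kEntry_eq]
  congr 2
  congr 1
  · simp only [Fin.rev_inj, and_comm]
  · by_cases h : j = i.rev ∧ l = k.rev
    · obtain ⟨rfl, rfl⟩ := h
      simp
    · rw [if_neg h, if_neg]
      rintro ⟨h1, h2⟩
      rw [Fin.rev_rev] at h1 h2
      exact h ⟨by rw [h1], by rw [h2]⟩

theorem rInv_wt {q : ℝ} (hq : 0 < q) {m : ℕ} (i j k l : Fin m) :
    rInv q m i j k l * (wt q m i * wt q m j) = rInv q m i j k l * (wt q m k * wt q m l) := by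
  by_cases h1 : i = k ∧ j = l
  · obtain ⟨rfl, rfl⟩ := h1; ring
  by_cases h3 : j = i.rev ∧ l = k.rev
  · rw [h3.1, h3.2, wt_mul_rev hq, wt_mul_rev hq]
  rw [rInv, kEntry_eq, if_neg h1, if_neg h3]
  simpa using rEntry_wt hq i j k l

theorem sum_rInv_rEntry {q : ℝ} (hq : 0 < q) {m : ℕ} (i j k l : Fin m) :
    ∑ p, ∑ r, rInv q m i j p r * rEntry q m p r k l = if i = k ∧ j = l then 1 else 0 := by
  have h := sum_rEntry_rInv hq k l i j
  simp only [eq_comm (a := k), eq_comm (a := l)] at h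
  rw [← h]
  refine Finset.sum_congr rfl fun p _ => Finset.sum_congr rfl fun r _ => ?_
  rw [rInv_transpose hq, rEntry_transpose hq, mul_comm]

/-! ### The Yang–Baxter equation -/

/-- A two-site matrix acting on the first two of three sites. -/
def siteOne {m : ℕ} (A : Fin m → Fin m → Fin m → Fin m → ℝ) :
    Matrix (Fin m × Fin m × Fin m) (Fin m × Fin m × Fin m) ℝ :=
  Matrix.of fun s t => if s.2.2 = t.2.2 then A s.1 s.2.1 t.1 t.2.1 else 0

/-- A two-site matrix acting on the last two of three sites. -/
def siteTwo {m : ℕ} (A : Fin m → Fin m → Fin m → Fin m → ℝ) :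
    Matrix (Fin m × Fin m × Fin m) (Fin m × Fin m × Fin m) ℝ :=
  Matrix.of fun s t => if s.1 = t.1 then A s.2.1 s.2.2 t.2.1 t.2.2 else 0

section
variable {m : ℕ} (A B C : Fin m → Fin m → Fin m → Fin m → ℝ)

theorem siteOne_mul_apply (M : Matrix (Fin m × Fin m × Fin m) (Fin m × Fin m × Fin m) ℝ)
    (a b c : Fin m) (t : Fin m × Fin m × Fin m) :
    (siteOne A * M) (a, b, c) t = ∑ p, ∑ r, A a b p r * M (p, r, c) t := by
  simp [Matrix.mul_apply, siteOne, Fintype.sum_prod_type, ite_mul]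

theorem siteTwo_mul_apply (M : Matrix (Fin m × Fin m × Fin m) (Fin m × Fin m × Fin m) ℝ)
    (a b c : Fin m) (t : Fin m × Fin m × Fin m) :
    (siteTwo A * M) (a, b, c) t = ∑ p, ∑ r, A b c p r * M (a, p, r) t := by
  simp [Matrix.mul_apply, siteTwo, Fintype.sum_prod_type, ite_mul, Finset.sum_ite_irrel]

theorem siteOne_mul_two_mul_one (a b c d e f : Fin m) :
    (siteOne A * (siteTwo B * siteOne C)) (a, b, c) (d, e, f) =
      ∑ p, ∑ r, ∑ s, A a b p r * B r c s f * C p s d e := by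
  rw [siteOne_mul_apply]
  simp only [siteTwo_mul_apply, siteOne, Matrix.of_apply, mul_ite, mul_zero, Finset.sum_ite_eq',
    Finset.mem_univ, if_true, Finset.mul_sum, mul_assoc]

theorem siteTwo_mul_one_mul_two (a b c d e f : Fin m) :
    (siteTwo A * (siteOne B * siteTwo C)) (a, b, c) (d, e, f) =
      ∑ p, ∑ r, ∑ s, A b c p r * B a p d s * C s r e f := by
  rw [siteTwo_mul_apply]
  refine Finset.sum_congr rfl fun p _ => Finset.sum_congr rfl fun r _ => ?_
  rw [siteOne_mul_apply, Finset.sum_comm, Finset.mul_sum]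
  simp only [siteTwo, Matrix.of_apply, mul_ite, mul_zero, Finset.sum_ite_eq',
    Finset.mem_univ, if_true, mul_assoc]

/-- Rotating the three sites by a half turn exchanges the two positions. -/
theorem siteOne_submatrix (hA : ∀ i j k l, A j.rev i.rev l.rev k.rev = A i j k l) :
    (siteOne A).submatrix (fun s => (s.2.2.rev, s.2.1.rev, s.1.rev))
      (fun s => (s.2.2.rev, s.2.1.rev, s.1.rev)) = siteTwo A := by
  ext s t
  simp [siteOne, siteTwo, hA]

theorem siteOne_mul_eq_one
    (h : ∀ i j k l, ∑ p, ∑ r, A i j p r * B p r k l = if i = k ∧ j = l then 1 else 0) :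
    siteOne A * siteOne B = 1 := by
  ext ⟨a, b, c⟩ ⟨d, e, f⟩
  rw [siteOne_mul_apply]
  simp only [siteOne, Matrix.of_apply, mul_ite, mul_zero, Matrix.one_apply, Prod.mk.injEq]
  by_cases hc : c = f
  · simp [hc, h]
  · simp [hc]

theorem siteTwo_mul_eq_one
    (h : ∀ i j k l, ∑ p, ∑ r, A i j p r * B p r k l = if i = k ∧ j = l then 1 else 0) :
    siteTwo A * siteTwo B = 1 := by
  ext ⟨a, b, c⟩ ⟨d, e, f⟩
  rw [siteTwo_mul_apply]
  simp only [siteTwo, Matrix.of_apply, mul_ite, mul_zero, Matrix.one_apply, Prod.mk.injEq]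
  by_cases hc : a = d
  · simp [hc, h]
  · simp [hc]

end

theorem sum_kEntry_mul {q : ℝ} {m : ℕ} (f : Fin m → Fin m → ℝ) (i j : Fin m) :
    ∑ p, ∑ r, kEntry q m i j p r * f p r = metric q m i j * ∑ p, wt q m p * f p p.rev := by
  simp only [kEntry, metric_eq q m _ _, Finset.mul_sum]
  refine Finset.sum_congr rfl fun p _ => ?_
  simp [mul_assoc]

/-- A string slides over a cap: `R̂₁₂ R̂₂₃ K₁₂ = K₂₃ R̂₁₂ R̂₂₃`. Crossing symmetry turns either
side into `R̂ R̂⁻¹`. -/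
theorem slide_one {q : ℝ} (hq : 0 < q) {m : ℕ} :
    siteOne (rEntry q m) * (siteTwo (rEntry q m) * siteOne (kEntry q m)) =
      siteTwo (kEntry q m) * (siteOne (rEntry q m) * siteTwo (rEntry q m)) := by
  ext ⟨a, b, c⟩ ⟨d, e, f⟩
  rw [siteOne_mul_two_mul_one, siteTwo_mul_one_mul_two]
  have hw := fun i => (wt_pos hq (m := m) i).ne'
  -- Turning the second crossing gives `R̂ R̂⁻¹`.
  have hl : ∑ p, ∑ r, ∑ s, rEntry q m a b p r * rEntry q m r c s f * kEntry q m p s d e =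
      (if a = f ∧ b = c.rev then 1 else 0) * (wt q m c.rev * metric q m d e) := by
    rw [← sum_rEntry_rInv hq, Finset.sum_mul]
    refine Finset.sum_congr rfl fun p _ => ?_
    rw [Finset.sum_mul]
    refine Finset.sum_congr rfl fun r _ => ?_
    have : ∀ s, rEntry q m a b p r * rEntry q m r c s f * kEntry q m p s d e =
        if s = p.rev then rEntry q m a b p r * rEntry q m r c p.rev f * (wt q m p * metric q m d e)
        else 0 := by
      intro s
      rw [kEntry, metric_eq q m p s]
      split_ifs with h
      · rw [h]
      · simp
    simp only [this, Finset.sum_ite_eq', Finset.mem_univ, if_true]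
    rw [rEntry_crossing hq r c, ← rInv_flip hq, Fin.rev_rev, Fin.rev_rev, Fin.rev_rev,
      rInv_transpose hq]
    have hwt := rInv_wt hq p r f c.rev
    have hf := hw f
    field_simp
    linear_combination rEntry q m a b p r * metric q m d e * hwt
  -- On this side, turning the first crossing gives `R̂⁻¹ R̂`.
  have hr : ∑ p, ∑ r, ∑ s, kEntry q m b c p r * rEntry q m a p d s * rEntry q m s r e f =
      metric q m b c * ((if a.rev = f.rev ∧ d = e.rev then 1 else 0) * wt q m d) := by
    rw [← sum_rInv_rEntry hq, Finset.sum_mul, Finset.mul_sum]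
    refine Finset.sum_congr rfl fun p _ => ?_
    have : ∀ r, ∑ s, kEntry q m b c p r * rEntry q m a p d s * rEntry q m s r e f =
        if r = p.rev then ∑ s, metric q m b c * wt q m p * rEntry q m a p d s *
          rEntry q m s p.rev e f else 0 := by
      intro r
      rw [kEntry, metric_eq q m p r]
      split_ifs with h
      · rw [h]
      · simp
    simp only [this, Finset.sum_ite_eq', Finset.mem_univ, if_true]
    rw [Finset.sum_mul, Finset.mul_sum, ← Equiv.sum_comp Fin.revPerm]
    refine Finset.sum_congr rfl fun t _ => ?_
    rw [Fin.revPerm_apply, ← rEntry_flip hq t.rev p.rev, rEntry_crossing hq a p, Fin.rev_rev,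
      Fin.rev_rev, ← rInv_transpose hq p t]
    have hwt := rInv_wt hq p t a.rev d
    have ha := wt_mul_rev hq a
    have ht := wt_mul_rev hq t
    have ht0 := hw t.rev
    field_simp
    linear_combination rEntry q m p t f.rev e.rev * metric q m b c * (wt q m a * wt q m t.rev * hwt
      + rInv q m p t a.rev d * wt q m t.rev * wt q m d * ha
      - rInv q m p t a.rev d * wt q m p * wt q m a * ht)
  rw [hl, hr, metric_eq, metric_eq]
  have : c = b.rev ↔ b = c.rev := ⟨fun h => by rw [h, Fin.rev_rev], fun h => by rw [h, Fin.rev_rev]⟩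
  have h2 : d = e.rev ↔ e = d.rev := ⟨fun h => by rw [h, Fin.rev_rev], fun h => by rw [h, Fin.rev_rev]⟩
  simp only [this, h2, Fin.rev_inj]
  by_cases h3 : a = f <;> by_cases h4 : b = c.rev <;> by_cases h5 : e = d.rev <;> simp [h3, h4, h5]

/-- The relation `slide_one`, rotated by a half turn. -/
theorem slide_two {q : ℝ} (hq : 0 < q) {m : ℕ} :
    siteTwo (rEntry q m) * (siteOne (rEntry q m) * siteTwo (kEntry q m)) =
      siteOne (kEntry q m) * (siteTwo (rEntry q m) * siteOne (rEntry q m)) := by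
  have hK : ∀ i j k l, kEntry q m j.rev i.rev l.rev k.rev = kEntry q m i j k l := by
    intro i j k l
    rw [kEntry_eq, kEntry_eq]
    by_cases h : j = i.rev ∧ l = k.rev
    · obtain ⟨rfl, rfl⟩ := h
      simp
    · rw [if_neg h, if_neg]
      rintro ⟨h1, h2⟩
      rw [Fin.rev_rev] at h1 h2
      exact h ⟨by rw [h1], by rw [h2]⟩
  let φ : Fin m × Fin m × Fin m ≃ Fin m × Fin m × Fin m :=
    ⟨fun s => (s.2.2.rev, s.2.1.rev, s.1.rev), fun s => (s.2.2.rev, s.2.1.rev, s.1.rev),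
      fun s => by simp, fun s => by simp⟩
  have h1 := fun A hA => siteOne_submatrix (m := m) A hA
  have h2 : ∀ A : Fin m → Fin m → Fin m → Fin m → ℝ,
      (∀ i j k l, A j.rev i.rev l.rev k.rev = A i j k l) →
      (siteTwo A).submatrix φ φ = siteOne A := by
    intro A hA
    rw [← h1 A hA]
    ext s t
    simp [φ]
  have h := congrArg (fun M => Matrix.submatrix M φ φ) (slide_one hq (m := m))
  simp only [← Matrix.submatrix_mul_equiv _ _ φ φ φ] at h
  have hR := rEntry_flip hq (m := m)
  have e1 : (siteOne (rEntry q m)).submatrix φ φ = siteTwo (rEntry q m) := h1 _ hR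
  have e2 : (siteOne (kEntry q m)).submatrix φ φ = siteTwo (kEntry q m) := h1 _ hK
  rw [e1, e2, h2 _ hR, h2 _ hK] at h
  exact h

/-- The skein relation on the first two sites. -/
theorem siteOne_skein (q : ℝ) (m : ℕ) :
    siteOne (rInv q m) = siteOne (rEntry q m) - (q - q⁻¹) • (1 - siteOne (kEntry q m)) := by
  ext ⟨a, b, c⟩ ⟨d, e, f⟩
  simp only [siteOne, rInv, Matrix.of_apply, Matrix.sub_apply, Matrix.smul_apply, smul_eq_mul,
    Matrix.one_apply, Prod.mk.injEq]
  by_cases h : c = f <;> simp [h]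

/-- The skein relation on the last two sites. -/
theorem siteTwo_skein (q : ℝ) (m : ℕ) :
    siteTwo (rInv q m) = siteTwo (rEntry q m) - (q - q⁻¹) • (1 - siteTwo (kEntry q m)) := by
  ext ⟨a, b, c⟩ ⟨d, e, f⟩
  simp only [siteTwo, rInv, Matrix.of_apply, Matrix.sub_apply, Matrix.smul_apply, smul_eq_mul,
    Matrix.one_apply, Prod.mk.injEq]
  by_cases h : a = d <;> simp [h]

/-- The defect of the Yang–Baxter equation. -/
def ybDefect (q : ℝ) (m : ℕ) : Matrix (Fin m × Fin m × Fin m) (Fin m × Fin m × Fin m) ℝ :=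
  siteOne (rEntry q m) * (siteTwo (rEntry q m) * siteOne (rEntry q m))
    - siteTwo (rEntry q m) * (siteOne (rEntry q m) * siteTwo (rEntry q m))

/-- The defect does not change when two crossings are inverted, by the skein relation and the
possibility to slide a string past a cup or cap. -/
theorem ybDefect_eq_mixed {q : ℝ} (hq : 0 < q) (m : ℕ) :
    ybDefect q m = siteOne (rEntry q m) * (siteTwo (rInv q m) * siteOne (rInv q m))
      - siteTwo (rInv q m) * (siteOne (rInv q m) * siteTwo (rEntry q m)) := by
  have s1 := slide_one hq (m := m)
  have s2 := slide_two hq (m := m)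
  have i1 := siteOne_mul_eq_one _ _ (sum_rEntry_rInv hq (m := m))
  have i2 := siteTwo_mul_eq_one _ _ (sum_rInv_rEntry hq (m := m))
  have k1 := siteOne_skein q m
  have k2 := siteTwo_skein q m
  unfold ybDefect
  set R := siteOne (rEntry q m)
  set S := siteTwo (rEntry q m)
  set R' := siteOne (rInv q m)
  set S' := siteTwo (rInv q m)
  set K := siteOne (kEntry q m)
  set L := siteTwo (kEntry q m)
  have s3 : R * (L * R') = S' * (K * S) := by
    calc R * (L * R') = (S' * S) * (R * (L * R')) := by rw [i2, one_mul]
      _ = S' * (S * (R * L)) * R' := by simp only [mul_assoc]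
      _ = S' * K * S * (R * R') := by rw [s2]; simp only [mul_assoc]
      _ = _ := by rw [i1, mul_one, mul_assoc]
  have hR : R = R' + (q - q⁻¹) • (1 - K) := by rw [k1]; abel
  have hS : S = S' + (q - q⁻¹) • (1 - L) := by rw [k2]; abel
  -- Invert the last crossing of the first product and the first one of the second product; the
  -- terms with `K` agree by `slide_one`.
  have step1 : R * (S * R) - S * (R * S) = R * (S * R') - S' * (R * S) := by
    have e1 : R * (S * R) = R * (S * R') + (q - q⁻¹) • (R * S - R * (S * K)) := by
      conv_lhs => rw [show R * (S * R) = R * (S * (R' + (q - q⁻¹) • (1 - K))) by rw [← hR]]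
      simp only [mul_add, mul_smul_comm, mul_sub, mul_one, smul_sub]
    have e2 : S * (R * S) = S' * (R * S) + (q - q⁻¹) • (R * S - L * (R * S)) := by
      conv_lhs => rw [show S * (R * S) = (S' + (q - q⁻¹) • (1 - L)) * (R * S) by rw [← hS]]
      simp only [add_mul, smul_mul_assoc, sub_mul, one_mul, smul_sub]
    rw [e1, e2, s1]; abel
  -- Invert the middle crossings.
  have step2 : R * (S * R') - S' * (R * S) = R * (S' * R') - S' * (R' * S) := by
    have e1 : R * (S * R') = R * (S' * R') + (q - q⁻¹) • (R * R' - R * (L * R')) := by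
      conv_lhs => rw [show R * (S * R') = R * ((S' + (q - q⁻¹) • (1 - L)) * R') by rw [← hS]]
      simp only [mul_add, add_mul, smul_mul_assoc, mul_smul_comm, sub_mul, mul_sub, one_mul,
        smul_sub]
    have e2 : S' * (R * S) = S' * (R' * S) + (q - q⁻¹) • (S' * S - S' * (K * S)) := by
      conv_lhs => rw [show S' * (R * S) = S' * ((R' + (q - q⁻¹) • (1 - K)) * S) by rw [← hR]]
      simp only [mul_add, add_mul, smul_mul_assoc, mul_smul_comm, sub_mul, mul_sub, one_mul,
        smul_sub]
    rw [e1, e2, s3, i1, i2]; abel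
  rw [step1, step2]

/-- Crossing symmetry of the defect: its six indices can be rotated. -/
theorem ybDefect_rotate {q : ℝ} (hq : 0 < q) {m : ℕ} (a b c d e f : Fin m) :
    ybDefect q m (a, b, c) (d, e, f) =
      -(wt q m a / wt q m f) * ybDefect q m (b, c, f.rev) (a.rev, d, e) := by
  have hw := fun i => (wt_pos hq (m := m) i).ne'
  conv_rhs => rw [ybDefect_eq_mixed hq]
  unfold ybDefect
  simp only [Matrix.sub_apply, siteOne_mul_two_mul_one, siteTwo_mul_one_mul_two]
  have h1 : ∑ p, ∑ r, ∑ s, rEntry q m a b p r * rEntry q m r c s f * rEntry q m p s d e =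
      wt q m a / wt q m f * ∑ p, ∑ r, ∑ s,
        rInv q m c f.rev p r * rInv q m b p a.rev s * rEntry q m s r d e := by
    simp only [Finset.mul_sum]
    rw [← Equiv.sum_comp Fin.revPerm (fun p => ∑ r, ∑ s, wt q m a / wt q m f *
      (rInv q m c f.rev p r * rInv q m b p a.rev s * rEntry q m s r d e)), Finset.sum_comm]
    refine Finset.sum_congr rfl fun r _ => ?_
    rw [Finset.sum_comm]
    refine Finset.sum_congr rfl fun s _ => Finset.sum_congr rfl fun p _ => ?_
    rw [Fin.revPerm_apply, rEntry_crossing hq a b, rEntry_crossing hq r c]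
    have := hw r
    field_simp
  have h2 : ∑ p, ∑ r, ∑ s, rEntry q m b c p r * rEntry q m a p d s * rEntry q m s r e f =
      wt q m a / wt q m f * ∑ p, ∑ r, ∑ s,
        rEntry q m b c p r * rInv q m r f.rev s e * rInv q m p s a.rev d := by
    simp only [Finset.mul_sum]
    refine Finset.sum_congr rfl fun p _ => Finset.sum_congr rfl fun r _ => ?_
    rw [← Equiv.sum_comp Fin.revPerm]
    refine Finset.sum_congr rfl fun s _ => ?_
    rw [Fin.revPerm_apply, rEntry_crossing hq a p, rEntry_crossing hq s.rev r, Fin.rev_rev]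
    have := hw s.rev
    field_simp
  rw [h1, h2]
  ring

theorem ybDefect_rotate_iff {q : ℝ} (hq : 0 < q) {m : ℕ} (a b c d e f : Fin m) :
    ybDefect q m (a, b, c) (d, e, f) = 0 ↔ ybDefect q m (b, c, f.rev) (a.rev, d, e) = 0 := by
  rw [ybDefect_rotate hq]
  have h1 := (wt_pos hq a).ne'
  have h2 := (wt_pos hq f).ne'
  simp [h1, h2]

theorem ybDefect_transpose {q : ℝ} (hq : 0 < q) {m : ℕ} (s t) :
    ybDefect q m s t = ybDefect q m t s := by
  have h1 : (siteOne (rEntry q m)).transpose = siteOne (rEntry q m) := by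
    ext s t
    simp only [siteOne, Matrix.transpose_apply, Matrix.of_apply, eq_comm,
      rEntry_transpose hq t.1]
  have h2 : (siteTwo (rEntry q m)).transpose = siteTwo (rEntry q m) := by
    ext s t
    simp only [siteTwo, Matrix.transpose_apply, Matrix.of_apply, eq_comm,
      rEntry_transpose hq t.2.1]
  have : (ybDefect q m).transpose = ybDefect q m := by
    unfold ybDefect
    simp only [Matrix.transpose_sub, Matrix.transpose_mul, h1, h2, mul_assoc]
  exact congrFun (congrFun this t) s |>.symm ▸ rfl

/-- If `k` is the largest index involved then `e_k` is moved past the others by a mere exchange. -/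
theorem rEntry_max {q : ℝ} (hq : 0 < q) {m : ℕ} {i j k l : Fin m} (_ : k.rev ≤ l) (_ : l ≤ k)
    (_ : k.rev ≤ i ∨ j ≤ k) :
    rEntry q m i j k l = if i = l ∧ j = k then swapCoeff q k l else 0 := by
  rw [rEntry_eq hq, if_neg (c := k < l ∧ _), if_neg (c := j = i.rev ∧ _)]
  · simp
  · simp only [Fin.ext_iff, Fin.lt_def, Fin.le_def, Fin.val_rev] at *; omega
  · simp only [Fin.ext_iff, Fin.lt_def, Fin.le_def, Fin.val_rev] at *; omega

/-- The defect vanishes if the lower left index is the largest of all indices and their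
conjugates: on both sides this index is moved to the opposite corner by mere exchanges, and what
remains is one crossing of the other two strings. -/
theorem ybDefect_max {q : ℝ} (hq : 0 < q) {m : ℕ} {a b c k e f : Fin m}
    (ha : k.rev ≤ a ∧ a ≤ k) (hb : k.rev ≤ b ∧ b ≤ k) (hc : k.rev ≤ c ∧ c ≤ k)
    (he : k.rev ≤ e ∧ e ≤ k) (hf : k.rev ≤ f ∧ f ≤ k) :
    ybDefect q m (a, b, c) (k, e, f) = 0 := by
  unfold ybDefect
  rw [Matrix.sub_apply, siteOne_mul_two_mul_one, siteTwo_mul_one_mul_two]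
  have h1 : ∀ p r s, rEntry q m a b p r * rEntry q m r c s f * rEntry q m p s k e =
      if p = e then (if r = f then (if s = k then
        (if c = k then rEntry q m a b e f * (swapCoeff q k e * swapCoeff q k f) else 0) else 0)
        else 0) else 0 := by
    intro p r s
    by_cases hp : k.rev ≤ p ∨ s ≤ k
    · rw [rEntry_max hq he.1 he.2 hp]
      by_cases h : p = e ∧ s = k
      · obtain ⟨rfl, rfl⟩ := h
        rw [rEntry_max hq hf.1 hf.2 (Or.inr hc.2)]
        by_cases h : r = f
        · subst h
          by_cases h' : c = s
          · subst h'; simp; ring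
          · simp [h']
        · simp [h]
      · rw [if_neg h, mul_zero]
        split_ifs with h3 h4 h5 <;> first | rfl | exact absurd ⟨h3, h5⟩ h
    · have hs : rEntry q m r c s f = 0 := by
        rw [rEntry_max hq, if_neg]
        all_goals simp only [Fin.ext_iff, Fin.le_def, Fin.val_rev] at *; omega
      have h3 : p ≠ e := by rintro rfl; exact hp (Or.inl he.1)
      rw [hs, if_neg h3]; ring
  have h2 : ∀ p r s, rEntry q m b c p r * rEntry q m a p k s * rEntry q m s r e f =
      if p = k then (if r = b then (if s = a then
        (if c = k then rEntry q m a b e f * (swapCoeff q k a * swapCoeff q k b) else 0) else 0)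
        else 0) else 0 := by
    intro p r s
    by_cases hs : k.rev ≤ s ∧ s ≤ k
    · rw [rEntry_max hq hs.1 hs.2 (Or.inl ha.1)]
      by_cases h : a = s ∧ p = k
      · obtain ⟨rfl, rfl⟩ := h
        by_cases hr : p.rev ≤ r ∧ r ≤ p
        · rw [rEntry_max hq hr.1 hr.2 (Or.inl hb.1)]
          by_cases h : b = r
          · subst h
            by_cases h' : c = p
            · subst h'; simp; ring
            · simp [h']
          · simp [h, Ne.symm h]
        · have h0 : rEntry q m a r e f = 0 := by
            rw [rEntry_eq hq, if_neg, if_neg, if_neg]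
            · simp
            all_goals simp only [Fin.ext_iff, Fin.lt_def, Fin.le_def, Fin.val_rev] at *; omega
          have h3 : r ≠ b := by rintro rfl; exact hr hb
          rw [h0, if_neg h3]; simp
      · rw [if_neg h]
        split_ifs with h3 h4 h5 <;> first | exact absurd ⟨Eq.symm (by assumption), h3⟩ h | simp
    · have h3 : s ≠ a := by rintro rfl; exact hs ha
      have h0 : rEntry q m a p k s * rEntry q m s r e f = 0 := by
        by_cases hsk : s < k.rev
        · rw [rEntry_eq hq a, if_neg, if_neg, if_neg]
          · simp
          all_goals simp only [Fin.ext_iff, Fin.lt_def, Fin.le_def, Fin.val_rev] at *; omega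
        · rw [rEntry_eq hq s, if_neg, if_neg, if_neg]
          · simp
          all_goals simp only [Fin.ext_iff, Fin.lt_def, Fin.le_def, Fin.val_rev] at *; omega
      rw [mul_assoc, h0, if_neg h3]; simp
  simp only [h1, h2, Finset.sum_ite_irrel, Finset.sum_ite_eq', Finset.mem_univ, if_true,
    Finset.sum_const_zero]
  by_cases hck : c = k
  · rw [if_pos hck, if_pos hck, sub_eq_zero]
    by_cases e1 : a = f ∧ b = e
    · rw [e1.1, e1.2, mul_comm (swapCoeff q k e)]
    by_cases e2 : a = e ∧ b = f
    · rw [e2.1, e2.2]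
    by_cases e3 : b = a.rev ∧ f = e.rev
    · rw [e3.1, e3.2, swapCoeff_mul_rev hq, swapCoeff_mul_rev hq]
    have h0 : rEntry q m a b e f = 0 := by
      rw [rEntry_eq hq, if_neg e1, if_neg (fun h => e2 h.2), if_neg (fun h => e3 ⟨h.1, h.2.1⟩)]
      simp
    rw [h0]; simp
  · rw [if_neg hck, if_neg hck, sub_zero]

/-- The Yang–Baxter equation. -/
theorem ybDefect_eq_zero {q : ℝ} (hq : 0 < q) (m : ℕ) : ybDefect q m = 0 := by
  ext ⟨a, b, c⟩ ⟨d, e, f⟩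
  rw [Matrix.zero_apply]
  -- The largest of the six indices and their conjugates, rotated to the upper or lower left corner.
  have key : ∀ a b c d e f k : Fin m, (k.rev ≤ a ∧ a ≤ k) → (k.rev ≤ b ∧ b ≤ k) →
      (k.rev ≤ c ∧ c ≤ k) → (k.rev ≤ d ∧ d ≤ k) → (k.rev ≤ e ∧ e ≤ k) → (k.rev ≤ f ∧ f ≤ k) →
      (a = k ∨ d = k) → ybDefect q m (a, b, c) (d, e, f) = 0 := by
    intro a b c d e f k ha hb hc hd he hf h
    rcases h with rfl | rfl
    · rw [ybDefect_transpose hq]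
      exact ybDefect_max hq hd he hf hb hc
    · exact ybDefect_max hq ha hb hc he hf
  obtain ⟨k, hk, ha, hb, hc, hd, he, hf⟩ : ∃ k : Fin m,
      (a = k ∨ b = k ∨ c = k ∨ d = k ∨ e = k ∨ f = k ∨
        a.rev = k ∨ b.rev = k ∨ c.rev = k ∨ d.rev = k ∨ e.rev = k ∨ f.rev = k) ∧
      (k.rev ≤ a ∧ a ≤ k) ∧ (k.rev ≤ b ∧ b ≤ k) ∧ (k.rev ≤ c ∧ c ≤ k) ∧ (k.rev ≤ d ∧ d ≤ k) ∧
      (k.rev ≤ e ∧ e ≤ k) ∧ (k.rev ≤ f ∧ f ≤ k) := by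
    let S : Finset (Fin m) := {a, b, c, d, e, f, a.rev, b.rev, c.rev, d.rev, e.rev, f.rev}
    have hS : S.Nonempty := ⟨a, by simp [S]⟩
    have hmem := Finset.max'_mem S hS
    have hle := fun x hx => Finset.le_max' S x hx
    set k := S.max' hS
    refine ⟨k, ?_, ?_⟩
    · simp only [S, Finset.mem_insert, Finset.mem_singleton] at hmem
      simpa only [eq_comm] using hmem
    · have hr : ∀ x, x.rev ∈ S → k.rev ≤ x := fun x hx => by
        have := hle _ hx
        rwa [← Fin.rev_le_rev, Fin.rev_rev] at this
      refine ⟨⟨hr _ ?_, hle _ ?_⟩, ⟨hr _ ?_, hle _ ?_⟩, ⟨hr _ ?_, hle _ ?_⟩, ⟨hr _ ?_, hle _ ?_⟩,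
        ⟨hr _ ?_, hle _ ?_⟩, ⟨hr _ ?_, hle _ ?_⟩⟩ <;> simp [S]
  have hrev : ∀ x : Fin m, (k.rev ≤ x ∧ x ≤ k) → (k.rev ≤ x.rev ∧ x.rev ≤ k) := by
    intro x hx
    simp only [Fin.le_def, Fin.val_rev] at *; omega
  have ha' := hrev a ha
  have hb' := hrev b hb
  have hc' := hrev c hc
  have hd' := hrev d hd
  have he' := hrev e he
  have hf' := hrev f hf
  have r1 := ybDefect_rotate_iff hq a b c d e f
  have r2 := ybDefect_rotate_iff hq b c f.rev a.rev d e
  have r3 := ybDefect_rotate_iff hq c f.rev e.rev b.rev a.rev d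
  have r4 := ybDefect_rotate_iff hq f.rev e.rev d.rev c.rev b.rev a.rev
  have r5 := ybDefect_rotate_iff hq e.rev d.rev a.rev.rev f.rev.rev c.rev b.rev
  simp only [Fin.rev_rev] at r1 r2 r3 r4 r5
  rcases hk with h | h | h | h | h | h | h | h | h | h | h | h
  · exact key a b c d e f k ha hb hc hd he hf (Or.inl h)
  · exact r1.2 (key _ _ _ _ _ _ k hb hc hf' ha' hd he (Or.inl h))
  · exact r1.2 (r2.2 (key _ _ _ _ _ _ k hc hf' he' hb' ha' hd (Or.inl h)))
  · exact key a b c d e f k ha hb hc hd he hf (Or.inr h)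
  · exact r1.2 (r2.2 (r3.2 (r4.2 (r5.2 (key _ _ _ _ _ _ k hd' ha hb he hf hc' (Or.inr h))))))
  · exact r1.2 (r2.2 (r3.2 (r4.2 (key _ _ _ _ _ _ k he' hd' ha hf hc' hb' (Or.inr h)))))
  · exact r1.2 (key _ _ _ _ _ _ k hb hc hf' ha' hd he (Or.inr h))
  · exact r1.2 (r2.2 (key _ _ _ _ _ _ k hc hf' he' hb' ha' hd (Or.inr h)))
  · exact r1.2 (r2.2 (r3.2 (key _ _ _ _ _ _ k hf' he' hd' hc' hb' ha' (Or.inr h))))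
  · exact r1.2 (r2.2 (r3.2 (r4.2 (r5.2 (key _ _ _ _ _ _ k hd' ha hb he hf hc' (Or.inl h))))))
  · exact r1.2 (r2.2 (r3.2 (r4.2 (key _ _ _ _ _ _ k he' hd' ha hf hc' hb' (Or.inl h)))))
  · exact r1.2 (r2.2 (r3.2 (key _ _ _ _ _ _ k hf' he' hd' hc' hb' ha' (Or.inl h))))

/-! ### Consequences of the Yang–Baxter equation -/

/-- The standing assumptions on the parameters. -/
class Admissible (q : ℝ) (m : ℕ) : Prop where
  pos : 0 < q
  lt_one : q < 1
  one_le : 1 ≤ m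

theorem q_pos (q : ℝ) (m : ℕ) [Admissible q m] : 0 < q := Admissible.pos (m := m)

theorem q_lt_one (q : ℝ) (m : ℕ) [Admissible q m] : q < 1 := Admissible.lt_one (m := m)

theorem q_ne_zero (q : ℝ) (m : ℕ) [Admissible q m] : q ≠ 0 := (q_pos q m).ne'

section
variable (q : ℝ) (m : ℕ) [Admissible q m]

theorem mu_pos : 0 < mu q m := by
  have := q_pos q m
  unfold mu; positivity

/-- The constant `τ = q ^ (1 - m) (1 - q²) / μ` in `R̂^{ij}_{kl} x^k x^l = q x^i x^j + τ C^{ij} 𝐱²`. -/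
def tau : ℝ := q ^ (1 - (m : ℤ)) * (1 - q ^ 2) / mu q m

/-- The antisymmetric projection without its normalization: `q - R̂ + τ K`. -/
def asym (i j k l : Fin m) : ℝ :=
  q * (if i = k ∧ j = l then 1 else 0) - rEntry q m i j k l + tau q m * kEntry q m i j k l

theorem antisymProj_eq (i j k l : Fin m) :
    antisymProj q m (i, j) (k, l) = (q + q⁻¹)⁻¹ * asym q m i j k l := by
  have hq := q_pos q m
  have hq1 := q_lt_one q m
  have hm : 1 ≤ m := Admissible.one_le (q := q)
  have hCC : ∑ a, ∑ b, metric q m a b * metric q m a b = ∑ p, wt q m p ^ 2 := by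
    refine Finset.sum_congr rfl fun a _ => ?_
    simp [metric_eq, pow_two]
  have hpow : q ^ m < 1 := pow_lt_one₀ hq.le hq1 (by omega)
  have htot := sum_wt_sq_total hq hm
  have hmu := mu_pos q m
  have hpos : (∑ p, wt q m p ^ 2) ≠ 0 := by
    intro h
    rw [h, mul_zero] at htot
    have : 0 < mu q m * (1 - q ^ m) := mul_pos hmu (by linarith)
    linarith
  have hτ : (q ^ (1 - (m : ℤ)) - q) / (∑ p, wt q m p ^ 2) = tau q m := by
    unfold tau
    rw [div_eq_div_iff hpos hmu.ne', mul_assoc _ (1 - q ^ 2), htot, zpow_sub₀ hq.ne',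
      zpow_natCast, zpow_one]
    field_simp
  simp only [antisymProj, Matrix.smul_apply, Matrix.add_apply, Matrix.sub_apply, smul_eq_mul,
    Matrix.one_apply, singletProj, Matrix.of_apply, hCC, Prod.mk.injEq]
  rw [asym, ← hτ, kEntry, rEntry]
  ring

/-- The cubic relation of the braid matrix, in the form of a quadratic one up to `K`. -/
theorem sum_rEntry_rEntry (i j k l : Fin m) :
    ∑ p, ∑ r, rEntry q m i j p r * rEntry q m p r k l =
      (if i = k ∧ j = l then 1 else 0) + (q - q⁻¹) * rEntry q m i j k l
      - (q - q⁻¹) * q ^ (1 - (m : ℤ)) * kEntry q m i j k l := by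
  have hq := q_pos q m
  rw [← sum_rEntry_rInv hq i j k l]
  have h1 : ∀ p r, rEntry q m i j p r * rEntry q m p r k l =
      rEntry q m i j p r * rInv q m p r k l
      + (if p = k then (if r = l then (q - q⁻¹) * rEntry q m i j k l else 0) else 0)
      - (if r = p.rev then
          (q - q⁻¹) * metric q m k l * (wt q m p * rEntry q m i j p p.rev) else 0) := by
    intro p r
    have e1 : rEntry q m i j p r * (if p = k ∧ r = l then 1 else 0) =
        (if p = k then (if r = l then rEntry q m i j k l else 0) else 0) := by
      rw [ite_and]
      split_ifs with h1 h2
      · rw [h1, h2, mul_one]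
      · rw [mul_zero]
      · rw [mul_zero]
    have e2 : rEntry q m i j p r * metric q m p r =
        (if r = p.rev then wt q m p * rEntry q m i j p p.rev else 0) := by
      rw [metric_eq]
      split_ifs with h1
      · rw [h1, mul_comm]
      · rw [mul_zero]
    have e3 : (if p = k then (if r = l then (q - q⁻¹) * rEntry q m i j k l else 0) else 0) =
        (q - q⁻¹) * (if p = k then (if r = l then rEntry q m i j k l else 0) else 0) := by
      split_ifs <;> ring
    have e4 : (if r = p.rev then
          (q - q⁻¹) * metric q m k l * (wt q m p * rEntry q m i j p p.rev) else 0) =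
        (q - q⁻¹) * metric q m k l *
          (if r = p.rev then wt q m p * rEntry q m i j p p.rev else 0) := by
      split_ifs <;> ring
    rw [e3, e4, ← e1, ← e2, rInv, kEntry]
    ring
  simp only [h1, Finset.sum_add_distrib, Finset.sum_sub_distrib, Finset.sum_ite_irrel,
    Finset.sum_ite_eq', Finset.mem_univ, if_true, Finset.sum_const_zero, ← Finset.mul_sum,
    sum_rEntry_metric hq]
  rw [kEntry]
  ring

theorem sum_kEntry_rEntry (i j k l : Fin m) :
    ∑ p, ∑ r, kEntry q m i j p r * rEntry q m p r k l =
      q ^ (1 - (m : ℤ)) * kEntry q m i j k l := by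
  rw [sum_kEntry_mul, sum_metric_rEntry (q_pos q m), kEntry]
  ring

/-- `P_A (1 + q R̂) = 0`. -/
theorem sum_asym_mul (i j k l : Fin m) :
    ∑ p, ∑ r, asym q m i j p r * ((if p = k ∧ r = l then 1 else 0) + q * rEntry q m p r k l)
      = 0 := by
  have hq := q_ne_zero q m
  have h1 : ∀ p r, asym q m i j p r * ((if p = k ∧ r = l then 1 else 0) + q * rEntry q m p r k l) =
      (if p = k then (if r = l then asym q m i j k l else 0) else 0)
      + (if i = p then (if j = r then q ^ 2 * rEntry q m i j k l else 0) else 0)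
      - q * (rEntry q m i j p r * rEntry q m p r k l)
      + q * tau q m * (kEntry q m i j p r * rEntry q m p r k l) := by
    intro p r
    have e1 : asym q m i j p r * (if p = k ∧ r = l then 1 else 0) =
        (if p = k then (if r = l then asym q m i j k l else 0) else 0) := by
      rw [ite_and]
      split_ifs with h1 h2
      · rw [h1, h2, mul_one]
      · rw [mul_zero]
      · rw [mul_zero]
    have e2 : (if i = p ∧ j = r then 1 else 0) * rEntry q m p r k l =
        (if i = p then (if j = r then rEntry q m i j k l else 0) else 0) := by
      rw [ite_and]
      split_ifs with h1 h2
      · rw [h1, h2, one_mul]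
      · rw [zero_mul]
      · rw [zero_mul]
    have e3 : (if i = p then (if j = r then q ^ 2 * rEntry q m i j k l else 0) else 0) =
        q ^ 2 * (if i = p then (if j = r then rEntry q m i j k l else 0) else 0) := by
      split_ifs <;> ring
    rw [mul_add, e1, e3, ← e2]
    conv_lhs => rw [asym.eq_1 q m i j p r]
    ring
  simp only [h1, Finset.sum_add_distrib, Finset.sum_sub_distrib, Finset.sum_ite_irrel,
    Finset.sum_ite_eq', Finset.sum_ite_eq, Finset.mem_univ, if_true, Finset.sum_const_zero,
    ← Finset.mul_sum, sum_rEntry_rEntry, sum_kEntry_rEntry]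
  have hτ : tau q m * mu q m = q ^ (1 - (m : ℤ)) * (1 - q ^ 2) := by
    unfold tau; rw [div_mul_cancel₀ _ (mu_pos q m).ne']
  have hmu : mu q m = 1 + q * q ^ (1 - (m : ℤ)) := by
    unfold mu
    rw [← zpow_one_add₀ hq]; congr 2; ring
  rw [hmu] at hτ
  rw [asym]
  have hqq : q * q⁻¹ = 1 := mul_inv_cancel₀ hq
  linear_combination kEntry q m i j k l * hτ
    + (rEntry q m i j k l - q ^ (1 - (m : ℤ)) * kEntry q m i j k l) * hqq

end

/-- The relation `slide_two` for the inverse crossings. -/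
theorem siteTwo_inv_slide (q : ℝ) (m : ℕ) [Admissible q m] :
    siteTwo (kEntry q m) * (siteOne (rInv q m) * siteTwo (rInv q m)) =
      siteOne (rInv q m) * (siteTwo (rInv q m) * siteOne (kEntry q m)) := by
  have hq := q_pos q m
  have i1 := siteOne_mul_eq_one _ _ (sum_rEntry_rInv hq (m := m))
  have i2 := siteTwo_mul_eq_one _ _ (sum_rEntry_rInv hq (m := m))
  have j1 := siteOne_mul_eq_one _ _ (sum_rInv_rEntry hq (m := m))
  have j2 := siteTwo_mul_eq_one _ _ (sum_rInv_rEntry hq (m := m))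
  have s2 := slide_two hq (m := m)
  set R := siteOne (rEntry q m)
  set S := siteTwo (rEntry q m)
  set R' := siteOne (rInv q m)
  set S' := siteTwo (rInv q m)
  set K := siteOne (kEntry q m)
  set L := siteTwo (kEntry q m)
  calc L * (R' * S') = R' * (S' * S) * R * L * R' * S' := by rw [j2, mul_one, j1, one_mul, mul_assoc]
    _ = R' * S' * (S * (R * L)) * R' * S' := by simp only [mul_assoc]
    _ = R' * S' * K * S * (R * R') * S' := by rw [s2]; simp only [mul_assoc]
    _ = R' * S' * K * (S * S') := by rw [i1, mul_one]; simp only [mul_assoc]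
    _ = _ := by rw [i2, mul_one, mul_assoc]

/-- The relation `slide_one` for the inverse crossings. -/
theorem siteOne_inv_slide (q : ℝ) (m : ℕ) [Admissible q m] :
    siteOne (kEntry q m) * (siteTwo (rInv q m) * siteOne (rInv q m)) =
      siteTwo (rInv q m) * (siteOne (rInv q m) * siteTwo (kEntry q m)) := by
  have hq := q_pos q m
  have i1 := siteOne_mul_eq_one _ _ (sum_rEntry_rInv hq (m := m))
  have i2 := siteTwo_mul_eq_one _ _ (sum_rEntry_rInv hq (m := m))
  have j1 := siteOne_mul_eq_one _ _ (sum_rInv_rEntry hq (m := m))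
  have j2 := siteTwo_mul_eq_one _ _ (sum_rInv_rEntry hq (m := m))
  have s2 := slide_one hq (m := m)
  set S := siteOne (rEntry q m)
  set R := siteTwo (rEntry q m)
  set S' := siteOne (rInv q m)
  set R' := siteTwo (rInv q m)
  set L := siteOne (kEntry q m)
  set K := siteTwo (kEntry q m)
  calc L * (R' * S') = R' * (S' * S) * R * L * R' * S' := by rw [j1, mul_one, j2, one_mul, mul_assoc]
    _ = R' * S' * (S * (R * L)) * R' * S' := by simp only [mul_assoc]
    _ = R' * S' * K * S * (R * R') * S' := by rw [s2]; simp only [mul_assoc]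
    _ = R' * S' * K * (S * S') := by rw [i2, mul_one]; simp only [mul_assoc]
    _ = _ := by rw [i1, mul_one, mul_assoc]

/-- The Yang–Baxter equation with two inverted crossings. -/
theorem braid_inv_comm (q : ℝ) (m : ℕ) [Admissible q m] :
    siteTwo (rEntry q m) * (siteOne (rInv q m) * siteTwo (rInv q m)) =
      siteOne (rInv q m) * (siteTwo (rInv q m) * siteOne (rEntry q m)) ∧
    siteOne (rEntry q m) * (siteTwo (rInv q m) * siteOne (rInv q m)) =
      siteTwo (rInv q m) * (siteOne (rInv q m) * siteTwo (rEntry q m)) := by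
  have hq := q_pos q m
  have i1 := siteOne_mul_eq_one _ _ (sum_rEntry_rInv hq (m := m))
  have i2 := siteTwo_mul_eq_one _ _ (sum_rEntry_rInv hq (m := m))
  have j1 := siteOne_mul_eq_one _ _ (sum_rInv_rEntry hq (m := m))
  have j2 := siteTwo_mul_eq_one _ _ (sum_rInv_rEntry hq (m := m))
  have yb := ybDefect_eq_zero hq m
  have mixed := ybDefect_eq_mixed hq m
  rw [yb] at mixed
  refine ⟨?_, (sub_eq_zero.1 mixed.symm)⟩
  unfold ybDefect at yb
  rw [sub_eq_zero] at yb
  set R := siteOne (rEntry q m)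
  set S := siteTwo (rEntry q m)
  set R' := siteOne (rInv q m)
  set S' := siteTwo (rInv q m)
  calc S * (R' * S') = R' * (S' * S) * R * S * R' * S' := by rw [j2, mul_one, j1, one_mul, mul_assoc]
    _ = R' * S' * (S * (R * S)) * R' * S' := by simp only [mul_assoc]
    _ = R' * S' * R * S * (R * R') * S' := by rw [← yb]; simp only [mul_assoc]
    _ = R' * S' * R * (S * S') := by rw [i1, mul_one]; simp only [mul_assoc]
    _ = _ := by rw [i2, mul_one, mul_assoc]

theorem siteOne_asym (q : ℝ) (m : ℕ) :
    siteOne (asym q m) = q • 1 - siteOne (rEntry q m) + tau q m • siteOne (kEntry q m) := by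
  ext ⟨a, b, c⟩ ⟨d, e, f⟩
  simp only [siteOne, asym, Matrix.of_apply, Matrix.sub_apply, Matrix.add_apply, Matrix.smul_apply,
    smul_eq_mul, Matrix.one_apply, Prod.mk.injEq]
  by_cases h : c = f <;> simp [h]

theorem siteTwo_asym (q : ℝ) (m : ℕ) :
    siteTwo (asym q m) = q • 1 - siteTwo (rEntry q m) + tau q m • siteTwo (kEntry q m) := by
  ext ⟨a, b, c⟩ ⟨d, e, f⟩
  simp only [siteTwo, asym, Matrix.of_apply, Matrix.sub_apply, Matrix.add_apply, Matrix.smul_apply,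
    smul_eq_mul, Matrix.one_apply, Prod.mk.injEq]
  by_cases h : a = d <;> simp [h]

/-- `(P_A)_{23} R̂⁻¹_{12} R̂⁻¹_{23} = R̂⁻¹_{12} R̂⁻¹_{23} (P_A)_{12}` in components. -/
theorem asym_two_comm (q : ℝ) (m : ℕ) [Admissible q m] (a b c d e f : Fin m) :
    ∑ p, ∑ r, ∑ s, asym q m b c p r * rInv q m a p d s * rInv q m s r e f =
      ∑ p, ∑ r, ∑ s, rInv q m a b p r * rInv q m r c s f * asym q m p s d e := by
  rw [← siteTwo_mul_one_mul_two, ← siteOne_mul_two_mul_one, siteTwo_asym, siteOne_asym]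
  simp only [add_mul, sub_mul, mul_add, mul_sub, smul_mul_assoc, mul_smul_comm, one_mul, mul_one,
    (braid_inv_comm q m).1, siteTwo_inv_slide]

/-- `(P_A)_{12} R̂⁻¹_{23} R̂⁻¹_{12} = R̂⁻¹_{23} R̂⁻¹_{12} (P_A)_{23}` in components. -/
theorem asym_one_comm (q : ℝ) (m : ℕ) [Admissible q m] (a b c d e f : Fin m) :
    ∑ p, ∑ r, ∑ s, asym q m a b p r * rInv q m r c s f * rInv q m p s d e =
      ∑ p, ∑ r, ∑ s, rInv q m b c p r * rInv q m a p d s * asym q m s r e f := by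
  rw [← siteTwo_mul_one_mul_two, ← siteOne_mul_two_mul_one, siteTwo_asym, siteOne_asym]
  simp only [add_mul, sub_mul, mul_add, mul_sub, smul_mul_assoc, mul_smul_comm, one_mul, mul_one,
    (braid_inv_comm q m).2, siteOne_inv_slide]

/-- A cup slides through a string. -/
theorem sum_wt_rInv_rInv {q : ℝ} (hq : 0 < q) {m : ℕ} (a d e f : Fin m) :
    ∑ p, ∑ s, wt q m p * rInv q m a p d s * rInv q m s p.rev e f =
      if a = f then metric q m d e else 0 := by
  have hw := fun i => (wt_pos hq (m := m) i).ne'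
  have h : ∑ p, ∑ s, wt q m p * rInv q m a p d s * rInv q m s p.rev e f =
      (if a.rev = f.rev ∧ d = e.rev then 1 else 0) * wt q m d := by
    rw [← sum_rEntry_rInv hq, Finset.sum_mul]
    refine Finset.sum_congr rfl fun p _ => ?_
    rw [Finset.sum_mul, ← Equiv.sum_comp Fin.revPerm]
    refine Finset.sum_congr rfl fun t _ => ?_
    rw [Fin.revPerm_apply, ← rInv_flip hq t.rev p.rev, rInv_crossing hq a p, Fin.rev_rev,
      Fin.rev_rev, ← rEntry_transpose hq p t]
    have hwt := rEntry_wt hq p t a.rev d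
    have ha := wt_mul_rev hq a
    have ht := wt_mul_rev hq t
    have ht0 := hw t.rev
    field_simp
    linear_combination rInv q m p t f.rev e.rev * (wt q m a * wt q m t.rev * hwt
      + rEntry q m p t a.rev d * wt q m t.rev * wt q m d * ha
      - rEntry q m p t a.rev d * wt q m p * wt q m a * ht)
  rw [h, metric_eq]
  have h2 : d = e.rev ↔ e = d.rev := ⟨fun h => by rw [h, Fin.rev_rev], fun h => by rw [h, Fin.rev_rev]⟩
  simp only [h2, Fin.rev_inj]
  by_cases h3 : a = f <;> by_cases h5 : e = d.rev <;> simp [h3, h5]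

/-- The relation `sum_wt_rInv_rInv`, rotated by a half turn. -/
theorem sum_wt_rInv_rInv' {q : ℝ} (hq : 0 < q) {m : ℕ} (a g h f : Fin m) :
    ∑ k, ∑ e, wt q m k * rInv q m k.rev a e f * rInv q m k e g h =
      if a = g then metric q m h f else 0 := by
  have hh := sum_wt_rInv_rInv hq a.rev f.rev h.rev g.rev
  have hm : metric q m f.rev h.rev = metric q m h f := by
    rw [metric_eq, metric_eq, Fin.rev_rev]
    have : h.rev = f ↔ f = h.rev := eq_comm
    simp only [this]
    split_ifs with h1
    · rw [h1, Fin.rev_rev]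
    · rfl
  simp only [Fin.rev_inj] at hh
  rw [← hm, ← hh]
  refine Finset.sum_congr rfl fun k _ => ?_
  rw [← Equiv.sum_comp Fin.revPerm]
  refine Finset.sum_congr rfl fun e _ => ?_
  rw [Fin.revPerm_apply, ← rInv_flip hq k.rev a, ← rInv_flip hq k e.rev, Fin.rev_rev, Fin.rev_rev]

/-! ### Quadratic relations and the central square -/

section
variable {B : Type*} [Ring B] [Algebra ℂ B]

/-- The family `X` satisfies the relations of the coordinates of quantum Euclidean space. -/
def IsQuad (q : ℝ) (m : ℕ) (X : Fin m → B) : Prop :=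
  ∀ i j, ∑ k, ∑ l, ((asym q m i j k l : ℝ) : ℂ) • (X k * X l) = 0

/-- The square `X^i C_{ij} X^j` of a family. -/
def sqOf (q : ℝ) (m : ℕ) (X : Fin m → B) : B := ∑ i, ((wt q m i : ℝ) : ℂ) • (X i * X i.rev)

/-- The commutation relations `D^i X^j = C^{ij} + q (R̂⁻¹)^{ij}_{kl} X^k D^l`. -/
def IsWeyl (q : ℝ) (m : ℕ) (X D : Fin m → B) : Prop :=
  ∀ i j, D i * X j = ((metric q m i j : ℝ) : ℂ) • 1 +
    (q : ℂ) • ∑ k, ∑ l, ((rInv q m i j k l : ℝ) : ℂ) • (X k * D l)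

theorem sum_sum_delta {M : Type*} [AddCommMonoid M] [Module ℂ M] {m : ℕ} (c : ℝ) (i j : Fin m)
    (V : Fin m → Fin m → M) :
    ∑ k, ∑ l, (((if i = k ∧ j = l then c else 0 : ℝ)) : ℂ) • V k l = (c : ℂ) • V i j := by
  rw [Finset.sum_eq_single i, Finset.sum_eq_single j]
  · simp
  · intro l _ hl; simp [hl.symm]
  · simp
  · intro k _ hk; simp [hk.symm]
  · simp

theorem sum_sum_metric {M : Type*} [AddCommMonoid M] [Module ℂ M] {q : ℝ} {m : ℕ}
    (V : Fin m → Fin m → M) :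
    ∑ k, ∑ l, ((metric q m k l : ℝ) : ℂ) • V k l = ∑ k, ((wt q m k : ℝ) : ℂ) • V k k.rev := by
  refine Finset.sum_congr rfl fun k _ => ?_
  rw [Finset.sum_eq_single k.rev]
  · simp [metric_eq]
  · intro l _ hl; simp [metric_eq, hl]
  · simp

theorem sum_metric_row {M : Type*} [AddCommMonoid M] [Module ℂ M] {q : ℝ} {m : ℕ}
    (V : Fin m → M) (i : Fin m) :
    ∑ l, ((metric q m i l : ℝ) : ℂ) • V l = ((wt q m i : ℝ) : ℂ) • V i.rev := by
  rw [Finset.sum_eq_single i.rev]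
  · simp [metric_eq]
  · intro l _ hl; simp [metric_eq, hl]
  · simp

theorem metric_rev_eq {q : ℝ} {m : ℕ} (i l : Fin m) :
    metric q m i l.rev = if l = i then wt q m i else 0 := by
  simp [metric_eq]

variable (q : ℝ) (m : ℕ)

/-- Explicit form of the quadratic relations: `R̂^{ij}_{kl} X^k X^l = q X^i X^j + τ C^{ij} X²`. -/
theorem IsQuad.braid {X : Fin m → B} (hX : IsQuad q m X) (i j : Fin m) :
    ∑ k, ∑ l, ((rEntry q m i j k l : ℝ) : ℂ) • (X k * X l) =
      (q : ℂ) • (X i * X j) + ((tau q m * metric q m i j : ℝ) : ℂ) • sqOf q m X := by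
  have h := hX i j
  have e : ∀ k l, ((asym q m i j k l : ℝ) : ℂ) • (X k * X l) =
      (((if i = k ∧ j = l then q else 0 : ℝ)) : ℂ) • (X k * X l)
      - ((rEntry q m i j k l : ℝ) : ℂ) • (X k * X l)
      + ((tau q m * metric q m i j : ℝ) : ℂ) • ((metric q m k l : ℝ) : ℂ) • (X k * X l) := by
    intro k l
    rw [← sub_smul, smul_smul, ← add_smul]
    congr 1
    rw [asym, kEntry]
    split_ifs <;> push_cast <;> ring
  simp only [e, Finset.sum_add_distrib, Finset.sum_sub_distrib, ← Finset.smul_sum,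
    sum_sum_delta q i j fun k l => X k * X l, sum_sum_metric fun k l => X k * X l] at h
  rw [sqOf]
  linear_combination (norm := module) -h

/-- The constant in `(R̂⁻¹)^{ij}_{kl} x^k x^l = q⁻¹ x^i x^j + τ' C^{ij} 𝐱²`. -/
def tauInv (q : ℝ) (m : ℕ) : ℝ := -((1 - q ^ 2) / (q * mu q m))

theorem mu_eq [Admissible q m] : mu q m = 1 + q * q ^ (1 - (m : ℤ)) := by
  unfold mu
  rw [← zpow_one_add₀ (q_ne_zero q m)]; congr 2; ring

theorem tauInv_eq [Admissible q m] : tauInv q m = tau q m + (q - q⁻¹) := by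
  have := (mu_pos q m).ne'
  have := q_ne_zero q m
  unfold tauInv tau
  field_simp
  rw [mu_eq]
  ring

/-- The quadratic relations in terms of the inverse braid matrix. -/
theorem IsQuad.braidInv [Admissible q m] {X : Fin m → B} (hX : IsQuad q m X) (i j : Fin m) :
    ∑ k, ∑ l, ((rInv q m i j k l : ℝ) : ℂ) • (X k * X l) =
      ((q⁻¹ : ℝ) : ℂ) • (X i * X j) + ((tauInv q m * metric q m i j : ℝ) : ℂ) • sqOf q m X := by
  have e : ∀ k l, ((rInv q m i j k l : ℝ) : ℂ) • (X k * X l) =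
      ((rEntry q m i j k l : ℝ) : ℂ) • (X k * X l)
      - (((if i = k ∧ j = l then q - q⁻¹ else 0 : ℝ)) : ℂ) • (X k * X l)
      + (((q - q⁻¹) * metric q m i j : ℝ) : ℂ) • ((metric q m k l : ℝ) : ℂ) • (X k * X l) := by
    intro k l
    rw [← sub_smul, smul_smul, ← add_smul]
    congr 1
    rw [rInv, kEntry]
    push_cast
    split_ifs <;> push_cast <;> ring
  simp only [e, Finset.sum_add_distrib, Finset.sum_sub_distrib, ← Finset.smul_sum,
    sum_sum_delta (q - q⁻¹) i j fun k l => X k * X l, sum_sum_metric fun k l => X k * X l,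
    hX.braid]
  rw [tauInv_eq, ← sqOf]
  push_cast
  module

/-- The partial trace of `R̂⁻¹` over the second factor. -/
theorem sum_wt_sq_rInv [Admissible q m] (a d : Fin m) :
    ∑ p, wt q m p ^ 2 * rInv q m a p d p = if a = d then q ^ (1 - (m : ℤ)) else 0 := by
  have hq := q_pos q m
  have h : ∀ p, wt q m p ^ 2 * rInv q m a p d p =
      wt q m a * (wt q m p * rEntry q m p p.rev a.rev d) := by
    intro p
    have := (wt_pos hq p).ne'
    rw [rInv_crossing hq]
    field_simp
  simp only [h, ← Finset.mul_sum, sum_metric_rEntry hq, metric_eq, Fin.rev_rev]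
  by_cases e : d = a
  · subst e
    simp only [if_true]
    linear_combination q ^ (1 - (m : ℤ)) * wt_mul_rev hq d
  · simp [e, Ne.symm e]

/-- The square of the coordinates is central. Sliding the cup of `X²` through the string of `X^a`
gives a relation between `X² X^a` and `X^a X²`, in which both have the same coefficient `1 - q⁻¹
τ' ≠ 0`. -/
theorem IsQuad.sqOf_comm [Admissible q m] {X : Fin m → B} (hX : IsQuad q m X) (a : Fin m) :
    sqOf q m X * X a = X a * sqOf q m X := by
  have hq := q_pos q m
  have hmu := mu_pos q m
  -- contract the cup slide with `X^d X^e X^f`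
  have h1 : ∑ p, ∑ d, ∑ s, ((wt q m p * rInv q m a p d s : ℝ) : ℂ) •
      (X d * ∑ e, ∑ f, ((rInv q m s p.rev e f : ℝ) : ℂ) • (X e * X f)) = sqOf q m X * X a := by
    have : ∀ d e f, ∑ p, ∑ s, ((wt q m p * rInv q m a p d s : ℝ) : ℂ) •
        ((rInv q m s p.rev e f : ℝ) : ℂ) • (X d * (X e * X f)) =
        ((if a = f then metric q m d e else 0 : ℝ) : ℂ) • (X d * (X e * X f)) := by
      intro d e f
      rw [← sum_wt_rInv_rInv hq a d e f]
      simp only [smul_smul, ← Finset.sum_smul]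
      push_cast
      rfl
    calc _ = ∑ d, ∑ e, ∑ f, ∑ p, ∑ s, ((wt q m p * rInv q m a p d s : ℝ) : ℂ) •
        ((rInv q m s p.rev e f : ℝ) : ℂ) • (X d * (X e * X f)) := by
          simp only [Finset.mul_sum, Finset.smul_sum, mul_smul_comm]
          rw [Finset.sum_comm]
          refine Finset.sum_congr rfl fun d _ => ?_
          rw [Finset.sum_congr rfl fun p _ => Finset.sum_comm, Finset.sum_comm]
          refine Finset.sum_congr rfl fun e _ => ?_
          rw [Finset.sum_congr rfl fun p _ => Finset.sum_comm, Finset.sum_comm]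
      _ = ∑ d, ∑ e, ((metric q m d e : ℝ) : ℂ) • (X d * (X e * X a)) := by
          refine Finset.sum_congr rfl fun d _ => Finset.sum_congr rfl fun e _ => ?_
          simp only [this]
          rw [Finset.sum_eq_single a]
          · simp
          · intro f _ hf; simp [hf.symm]
          · simp
      _ = _ := by
          rw [sum_sum_metric fun d e => X d * (X e * X a), sqOf, Finset.sum_mul]
          simp only [smul_mul_assoc, mul_assoc]
  simp only [hX.braidInv, mul_add, mul_smul_comm, smul_add, Finset.sum_add_distrib] at h1
  -- Apply the quadratic relations to the second crossing, then to the first one.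
  have h2 : ∑ p, ∑ d, ∑ s, ((wt q m p * rInv q m a p d s : ℝ) : ℂ) • ((q⁻¹ : ℝ) : ℂ) •
      (X d * (X s * X p.rev)) = ((q⁻¹ : ℝ) : ℂ) • (((q⁻¹ : ℝ) : ℂ) • (X a * sqOf q m X)
        + ((tauInv q m : ℝ) : ℂ) • (sqOf q m X * X a)) := by
    have e : ∀ p, ∑ d, ∑ s, ((wt q m p * rInv q m a p d s : ℝ) : ℂ) • ((q⁻¹ : ℝ) : ℂ) •
      (X d * (X s * X p.rev)) = ((q⁻¹ : ℝ) : ℂ) • ((wt q m p : ℝ) : ℂ) •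
        ((∑ d, ∑ s, ((rInv q m a p d s : ℝ) : ℂ) • (X d * X s)) * X p.rev) := by
      intro p
      simp only [Finset.sum_mul, Finset.smul_sum, smul_mul_assoc, smul_smul, mul_assoc]
      refine Finset.sum_congr rfl fun d _ => Finset.sum_congr rfl fun s _ => ?_
      congr 1
      push_cast; ring
    simp only [e, hX.braidInv, add_mul, smul_add, Finset.sum_add_distrib, ← Finset.smul_sum]
    congr 2
    · rw [sqOf, Finset.mul_sum, Finset.smul_sum]
      refine Finset.sum_congr rfl fun p _ => ?_
      rw [smul_mul_assoc, mul_smul_comm, smul_comm, mul_assoc]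
    · rw [Finset.sum_eq_single a.rev]
      · rw [Fin.rev_rev, smul_mul_assoc, smul_smul, metric_eq, if_pos rfl]
        congr 1
        have := wt_mul_rev hq a
        norm_cast
        linear_combination tauInv q m * this
      · intro p _ hp
        rw [metric_eq, if_neg hp]; simp
      · simp
  -- The part with `X²` in the last two factors is a partial trace of `R̂⁻¹`.
  have h3 : ∑ p, ∑ d, ∑ s, ((wt q m p * rInv q m a p d s : ℝ) : ℂ) •
      ((tauInv q m * metric q m s p.rev : ℝ) : ℂ) • (X d * sqOf q m X) =
      ((tauInv q m * q ^ (1 - (m : ℤ)) : ℝ) : ℂ) • (X a * sqOf q m X) := by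
    rw [Finset.sum_comm]
    have e : ∀ d, ∑ p, ∑ s, ((wt q m p * rInv q m a p d s : ℝ) : ℂ) •
      ((tauInv q m * metric q m s p.rev : ℝ) : ℂ) • (X d * sqOf q m X) =
      ((if a = d then tauInv q m * q ^ (1 - (m : ℤ)) else 0 : ℝ) : ℂ) • (X d * sqOf q m X) := by
      intro d
      simp only [smul_smul, ← Finset.sum_smul]
      congr 1
      rw [← mul_ite_zero, ← sum_wt_sq_rInv, Finset.mul_sum]
      simp only [← Complex.ofReal_mul, ← Complex.ofReal_sum]
      congr 1
      refine Finset.sum_congr rfl fun p _ => ?_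
      rw [Finset.sum_eq_single p]
      · rw [metric_rev_eq, if_pos rfl]; ring
      · intro s _ hs; rw [metric_rev_eq, if_neg hs.symm]; ring
      · simp
    simp only [e]
    rw [Finset.sum_eq_single a]
    · simp
    · intro d _ hd; simp [hd.symm]
    · simp
  rw [h2, h3] at h1
  have hne : ((1 - q⁻¹ * tauInv q m : ℝ) : ℂ) ≠ 0 := by
    have h4 : 1 - q⁻¹ * tauInv q m = (1 + q ^ 2 * q * q ^ (1 - (m : ℤ))) / (q ^ 2 * mu q m) := by
      unfold tauInv
      field_simp
      rw [mu_eq]; ring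
    rw [h4]
    exact_mod_cast (by positivity : (1 + q ^ 2 * q * q ^ (1 - (m : ℤ))) / (q ^ 2 * mu q m) ≠ 0)
  have hsc : 1 - q⁻¹ * tauInv q m = q⁻¹ * q⁻¹ + tauInv q m * q ^ (1 - (m : ℤ)) := by
    unfold tauInv
    field_simp
    rw [mu_eq]; ring
  have h5 : ((1 - q⁻¹ * tauInv q m : ℝ) : ℂ) • (sqOf q m X * X a) =
      ((1 - q⁻¹ * tauInv q m : ℝ) : ℂ) • (X a * sqOf q m X) := by
    conv_rhs => rw [hsc]
    push_cast at h1 ⊢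
    linear_combination (norm := module) -h1
  exact smul_right_injective _ hne h5

/-- `∂^j 𝐱² = μ x^j + q² 𝐱² ∂^j`. -/
theorem IsWeyl.mul_sqOf [Admissible q m] {X D : Fin m → B} (h : IsWeyl q m X D) (j : Fin m) :
    D j * sqOf q m X = ((mu q m : ℝ) : ℂ) • X j + ((q ^ 2 : ℝ) : ℂ) • (sqOf q m X * D j) := by
  have hq := q_pos q m
  have e1 : ∀ a, D j * (((wt q m a : ℝ) : ℂ) • (X a * X a.rev)) =
      ((wt q m a * metric q m j a : ℝ) : ℂ) • X a.rev +
      ∑ k, ((q * (wt q m a ^ 2 * rInv q m j a k a) : ℝ) : ℂ) • X k +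
      ∑ k, ∑ e, ∑ f, ∑ l, ((q ^ 2 * (wt q m a * rInv q m j a k l * rInv q m l a.rev e f) : ℝ) : ℂ) •
        (X k * (X e * D f)) := by
    intro a
    rw [mul_smul_comm, ← mul_assoc, h, add_mul, smul_mul_assoc, one_mul, smul_mul_assoc,
      Finset.sum_mul, smul_add, smul_smul, add_assoc]
    congr 1
    · push_cast; rfl
    rw [← Finset.sum_add_distrib, smul_smul, Finset.smul_sum]
    refine Finset.sum_congr rfl fun k _ => ?_
    rw [Finset.sum_mul, Finset.smul_sum]
    have e2 : ∀ l, ((wt q m a : ℂ) * (q : ℂ)) • ((rInv q m j a k l : ℝ) : ℂ) • (X k * D l) * X a.rev =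
        ((q * wt q m a * rInv q m j a k l : ℝ) : ℂ) • ((metric q m l a.rev : ℝ) : ℂ) • X k +
        ∑ e, ∑ f, ((q ^ 2 * (wt q m a * rInv q m j a k l * rInv q m l a.rev e f) : ℝ) : ℂ) •
        (X k * (X e * D f)) := by
      intro l
      rw [smul_mul_assoc, smul_mul_assoc, mul_assoc, h, mul_add, smul_add, smul_add,
        mul_smul_comm, mul_one]
      congr 1
      · simp only [smul_smul]; congr 1; push_cast; ring
      · rw [mul_smul_comm]
        simp only [Finset.mul_sum, Finset.smul_sum, mul_smul_comm, smul_smul]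
        refine Finset.sum_congr rfl fun e _ => Finset.sum_congr rfl fun f _ => ?_
        congr 1; push_cast; ring
    have e3 : ∀ l, ((wt q m a : ℂ) * (q : ℂ)) • (((rInv q m j a k l : ℝ) : ℂ) • (X k * D l) * X a.rev) =
        ((wt q m a : ℂ) * (q : ℂ)) • ((rInv q m j a k l : ℝ) : ℂ) • (X k * D l) * X a.rev := by
      intro l; simp only [smul_mul_assoc]
    simp only [e3, e2, Finset.sum_add_distrib]
    congr 1
    · rw [Finset.sum_eq_single a]
      · rw [metric_rev_eq, if_pos rfl, smul_smul]; congr 1; push_cast; ring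
      · intro l _ hl
        rw [metric_rev_eq, if_neg hl.symm]; simp
      · simp
    · rw [Finset.sum_comm]
      refine Finset.sum_congr rfl fun e _ => ?_
      rw [Finset.sum_comm]
  rw [sqOf, Finset.mul_sum]
  simp only [e1, Finset.sum_add_distrib]
  have t1 : ∑ a, ((wt q m a * metric q m j a : ℝ) : ℂ) • X a.rev = X j := by
    rw [Finset.sum_eq_single j.rev]
    · have := wt_mul_rev hq j
      rw [metric_eq, if_pos rfl, mul_comm, this]; simp
    · intro a _ ha; rw [metric_eq, if_neg ha]; simp
    · simp
  have t2 : ∑ a, ∑ k, ((q * (wt q m a ^ 2 * rInv q m j a k a) : ℝ) : ℂ) • X k =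
      ((q * q ^ (1 - (m : ℤ)) : ℝ) : ℂ) • X j := by
    rw [Finset.sum_comm]
    simp only [← Finset.sum_smul, ← Complex.ofReal_sum, ← Finset.mul_sum, sum_wt_sq_rInv]
    rw [Finset.sum_eq_single j]
    · simp
    · intro a _ ha; simp [ha.symm]
    · simp
  have t3 : ∑ a, ∑ k, ∑ e, ∑ f, ∑ l,
      ((q ^ 2 * (wt q m a * rInv q m j a k l * rInv q m l a.rev e f) : ℝ) : ℂ) •
        (X k * (X e * D f)) = ((q ^ 2 : ℝ) : ℂ) • (sqOf q m X * D j) := by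
    have : ∀ k e f, ∑ a, ∑ l,
      ((q ^ 2 * (wt q m a * rInv q m j a k l * rInv q m l a.rev e f) : ℝ) : ℂ) •
        (X k * (X e * D f)) = ((q ^ 2 : ℝ) : ℂ) •
          ((if j = f then metric q m k e else 0 : ℝ) : ℂ) • (X k * (X e * D f)) := by
      intro k e f
      simp only [← Finset.sum_smul, ← Complex.ofReal_sum, ← Finset.mul_sum, sum_wt_rInv_rInv hq]
      rw [smul_smul]; push_cast; rfl
    rw [Finset.sum_comm]
    have r1 : ∀ k, ∑ a, ∑ e, ∑ f, ∑ l,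
      ((q ^ 2 * (wt q m a * rInv q m j a k l * rInv q m l a.rev e f) : ℝ) : ℂ) •
        (X k * (X e * D f)) = ∑ e, ((q ^ 2 : ℝ) : ℂ) • ((metric q m k e : ℝ) : ℂ) •
          (X k * (X e * D j)) := by
      intro k
      rw [Finset.sum_comm]
      refine Finset.sum_congr rfl fun e _ => ?_
      rw [Finset.sum_comm]
      simp only [this]
      rw [Finset.sum_eq_single j]
      · simp
      · intro f _ hf; simp [hf.symm]
      · simp
    simp only [r1, ← Finset.smul_sum]
    rw [sum_sum_metric fun k e => X k * (X e * D j), sqOf, Finset.sum_mul]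
    simp only [smul_mul_assoc, mul_assoc]
  rw [t1, t2, t3, mu_eq, ← sqOf]
  push_cast
  module

theorem sum_wt_sq_rInv' [Admissible q m] (j l : Fin m) :
    ∑ a, wt q m a ^ 2 * rInv q m a.rev j a.rev l = if j = l then q ^ (1 - (m : ℤ)) else 0 := by
  have hq := q_pos q m
  have := sum_wt_sq_rInv q m j.rev l.rev
  simp only [Fin.rev_inj] at this
  rw [← this]
  refine Finset.sum_congr rfl fun p _ => ?_
  rw [← rInv_flip hq j.rev, Fin.rev_rev, Fin.rev_rev]

/-- `Δ x^j = μ ∂^j + q² x^j Δ`. -/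
theorem IsWeyl.sqOf_mul [Admissible q m] {X D : Fin m → B} (h : IsWeyl q m X D) (j : Fin m) :
    sqOf q m D * X j = ((mu q m : ℝ) : ℂ) • D j + ((q ^ 2 : ℝ) : ℂ) • (X j * sqOf q m D) := by
  have hq := q_pos q m
  have e1 : ∀ a, ((wt q m a : ℝ) : ℂ) • (D a * D a.rev) * X j =
      ((wt q m a * metric q m a.rev j : ℝ) : ℂ) • D a +
      ∑ l, ((q * (wt q m a ^ 2 * rInv q m a.rev j a.rev l) : ℝ) : ℂ) • D l +
      ∑ l, ∑ e, ∑ f, ∑ k, ((q ^ 2 * (wt q m a * rInv q m a.rev j k l * rInv q m a k e f) : ℝ) : ℂ) •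
        (X e * (D f * D l)) := by
    intro a
    have e2 : ∀ k l, D a * (((rInv q m a.rev j k l : ℝ) : ℂ) • (X k * D l)) =
        ((rInv q m a.rev j k l : ℝ) : ℂ) • ((metric q m a k : ℝ) : ℂ) • D l +
        ∑ e, ∑ f, ((q * (rInv q m a.rev j k l * rInv q m a k e f) : ℝ) : ℂ) •
        (X e * (D f * D l)) := by
      intro k l
      rw [mul_smul_comm, ← mul_assoc, h, add_mul, smul_mul_assoc, one_mul, smul_add]
      congr 1
      simp only [Finset.sum_mul, Finset.smul_sum, smul_mul_assoc, smul_smul, mul_assoc]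
      refine Finset.sum_congr rfl fun e _ => Finset.sum_congr rfl fun f _ => ?_
      congr 1; push_cast; ring
    rw [smul_mul_assoc, mul_assoc, h, mul_add, mul_smul_comm, mul_one, mul_smul_comm,
      smul_add, smul_smul, add_assoc]
    congr 1
    · push_cast; rfl
    simp only [Finset.mul_sum, e2]
    rw [Finset.sum_comm, ← Finset.sum_add_distrib, smul_smul, Finset.smul_sum]
    refine Finset.sum_congr rfl fun l _ => ?_
    rw [Finset.sum_add_distrib, smul_add]
    congr 1
    · rw [Finset.sum_eq_single a.rev]
      · rw [metric_eq, if_pos rfl, smul_smul, smul_smul]; congr 1; push_cast; ring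
      · intro k _ hk
        rw [metric_eq, if_neg hk]; simp
      · simp
    · rw [Finset.sum_comm, Finset.smul_sum]
      refine Finset.sum_congr rfl fun e _ => ?_
      rw [Finset.sum_comm, Finset.smul_sum]
      refine Finset.sum_congr rfl fun f _ => ?_
      rw [Finset.smul_sum]
      refine Finset.sum_congr rfl fun k _ => ?_
      rw [smul_smul]; congr 1; push_cast; ring
  rw [sqOf, Finset.sum_mul]
  simp only [e1, Finset.sum_add_distrib]
  have t1 : ∑ a, ((wt q m a * metric q m a.rev j : ℝ) : ℂ) • D a = D j := by
    rw [Finset.sum_eq_single j]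
    · have := wt_mul_rev hq j
      rw [metric_eq, Fin.rev_rev, if_pos rfl, this]; simp
    · intro a _ ha; rw [metric_eq, Fin.rev_rev, if_neg ha.symm]; simp
    · simp
  have t2 : ∑ a, ∑ l, ((q * (wt q m a ^ 2 * rInv q m a.rev j a.rev l) : ℝ) : ℂ) • D l =
      ((q * q ^ (1 - (m : ℤ)) : ℝ) : ℂ) • D j := by
    rw [Finset.sum_comm]
    simp only [← Finset.sum_smul, ← Complex.ofReal_sum, ← Finset.mul_sum, sum_wt_sq_rInv']
    rw [Finset.sum_eq_single j]
    · simp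
    · intro a _ ha; simp [ha.symm]
    · simp
  have t3 : ∑ a, ∑ l, ∑ e, ∑ f, ∑ k,
      ((q ^ 2 * (wt q m a * rInv q m a.rev j k l * rInv q m a k e f) : ℝ) : ℂ) •
        (X e * (D f * D l)) = ((q ^ 2 : ℝ) : ℂ) • (X j * sqOf q m D) := by
    have : ∀ l e f, ∑ a, ∑ k,
      ((q ^ 2 * (wt q m a * rInv q m a.rev j k l * rInv q m a k e f) : ℝ) : ℂ) •
        (X e * (D f * D l)) = ((q ^ 2 : ℝ) : ℂ) •
          ((if j = e then metric q m f l else 0 : ℝ) : ℂ) • (X e * (D f * D l)) := by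
      intro l e f
      simp only [← Finset.sum_smul, ← Complex.ofReal_sum, ← Finset.mul_sum, sum_wt_rInv_rInv' hq]
      rw [smul_smul]; push_cast; rfl
    rw [Finset.sum_comm]
    have r1 : ∀ l, ∑ a, ∑ e, ∑ f, ∑ k,
      ((q ^ 2 * (wt q m a * rInv q m a.rev j k l * rInv q m a k e f) : ℝ) : ℂ) •
        (X e * (D f * D l)) = ∑ f, ((q ^ 2 : ℝ) : ℂ) • ((metric q m f l : ℝ) : ℂ) •
          (X j * (D f * D l)) := by
      intro l
      rw [Finset.sum_comm, Finset.sum_eq_single j]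
      · rw [Finset.sum_comm]
        simp only [this]
        simp
      · intro e _ he
        rw [Finset.sum_comm]
        simp only [this, if_neg he.symm]
        simp
      · simp
    simp only [r1, ← Finset.smul_sum]
    rw [Finset.sum_comm, sum_sum_metric fun f l => X j * (D f * D l), sqOf, Finset.mul_sum]
    simp only [mul_smul_comm]
  rw [t1, t2, t3, mu_eq, ← sqOf]
  push_cast
  module

/-- The Euler operator `C_{ab} X^a D^b`. -/
def euler (q : ℝ) (m : ℕ) (X D : Fin m → B) : B := ∑ a, ((wt q m a : ℝ) : ℂ) • (X a * D a.rev)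

/-- The commutation of the Euler operator with the coordinates. The term with `𝐱²` comes from the
quadratic relations, used for `x^a x^k`. -/
theorem IsWeyl.euler_mul [Admissible q m] {X D : Fin m → B} (h : IsWeyl q m X D)
    (hX : IsQuad q m X) (j : Fin m) :
    euler q m X D * X j = X j + ((q ^ 2 : ℝ) : ℂ) • (X j * euler q m X D) +
      ((q * tau q m : ℝ) : ℂ) • (sqOf q m X * D j) := by
  have hq := q_pos q m
  have e1 : ∀ a, ((wt q m a : ℝ) : ℂ) • (X a * D a.rev) * X j =
      ((wt q m a * metric q m a.rev j : ℝ) : ℂ) • X a +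
      ∑ l, ∑ k, ((q * wt q m l.rev : ℝ) : ℂ) • ((rEntry q m j l.rev a k : ℝ) : ℂ) •
        (X a * X k * D l) := by
    intro a
    rw [smul_mul_assoc, mul_assoc, h, mul_add, mul_smul_comm, mul_one, mul_smul_comm,
      smul_add, smul_smul]
    congr 1
    · push_cast; rfl
    rw [Finset.sum_comm]
    simp only [Finset.mul_sum, Finset.smul_sum, mul_smul_comm, smul_smul, mul_assoc]
    refine Finset.sum_congr rfl fun l _ => Finset.sum_congr rfl fun k _ => ?_
    congr 1
    have h1 := wt_mul_rev hq a
    have h2 := wt_mul_rev hq l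
    have := (wt_pos hq l).ne'
    have e : wt q m a * rInv q m a.rev j k l = wt q m l.rev * rEntry q m j l.rev a k := by
      rw [rInv_crossing hq, Fin.rev_rev]
      field_simp
      linear_combination rEntry q m j l.rev a k * (h1 - h2)
    norm_cast
    linear_combination q * e
  rw [euler, Finset.sum_mul]
  simp only [e1, Finset.sum_add_distrib]
  have t1 : ∑ a, ((wt q m a * metric q m a.rev j : ℝ) : ℂ) • X a = X j := by
    rw [Finset.sum_eq_single j]
    · have := wt_mul_rev hq j
      rw [metric_eq, Fin.rev_rev, if_pos rfl, this]; simp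
    · intro a _ ha; rw [metric_eq, Fin.rev_rev, if_neg ha.symm]; simp
    · simp
  have t2 : ∑ a, ∑ l, ∑ k, ((q * wt q m l.rev : ℝ) : ℂ) • ((rEntry q m j l.rev a k : ℝ) : ℂ) •
        (X a * X k * D l) = ((q ^ 2 : ℝ) : ℂ) • (X j * euler q m X D) +
      ((q * tau q m : ℝ) : ℂ) • (sqOf q m X * D j) := by
    rw [Finset.sum_comm]
    have r : ∀ l, ∑ a, ∑ k, ((q * wt q m l.rev : ℝ) : ℂ) • ((rEntry q m j l.rev a k : ℝ) : ℂ) •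
        (X a * X k * D l) = ((q * wt q m l.rev : ℝ) : ℂ) •
          ((q : ℂ) • (X j * X l.rev) + ((tau q m * metric q m j l.rev : ℝ) : ℂ) • sqOf q m X) * D l := by
      intro l
      rw [← hX.braid]
      simp only [Finset.sum_mul, Finset.smul_sum, smul_mul_assoc]
    simp only [r, add_mul, smul_add, smul_mul_assoc, Finset.sum_add_distrib]
    congr 1
    · rw [euler, ← Equiv.sum_comp Fin.revPerm, Finset.mul_sum, Finset.smul_sum]
      refine Finset.sum_congr rfl fun a _ => ?_
      rw [Fin.revPerm_apply, Fin.rev_rev, smul_smul, mul_smul_comm, smul_smul, mul_assoc]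
      congr 1
      push_cast; ring
    · rw [Finset.sum_eq_single j]
      · rw [metric_rev_eq, if_pos rfl, smul_smul]
        congr 1
        have := wt_mul_rev hq j
        norm_cast
        linear_combination q * tau q m * this
      · intro l _ hl
        rw [metric_rev_eq, if_neg hl]; simp
      · simp
  rw [t1, t2, euler, add_assoc]

/-- The contraction `∂^a C_{ab} x^b`: the metric is an eigenvector of `R̂⁻¹` with eigenvalue
`q^{m-1}`. -/
theorem IsWeyl.sum_mul_rev [Admissible q m] {X D : Fin m → B} (h : IsWeyl q m X D) :
    ∑ a, ((wt q m a : ℝ) : ℂ) • (D a * X a.rev) =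
      ((∑ a, wt q m a ^ 2 : ℝ) : ℂ) • 1 + ((q ^ m : ℝ) : ℂ) • euler q m X D := by
  have hq := q_pos q m
  have e1 : ∀ a, ((wt q m a : ℝ) : ℂ) • (D a * X a.rev) = ((wt q m a ^ 2 : ℝ) : ℂ) • (1 : B) +
      (q : ℂ) • ∑ k, ∑ l, ((wt q m a * rInv q m a a.rev k l : ℝ) : ℂ) • (X k * D l) := by
    intro a
    rw [h, smul_add, smul_smul, metric_eq, if_pos rfl, smul_comm]
    congr 1
    · push_cast; rw [pow_two]
    · simp only [Finset.smul_sum, smul_smul]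
      push_cast; rfl
  have e2 : ∀ k l, ∑ a, wt q m a * rInv q m a a.rev k l = q ^ ((m : ℤ) - 1) * metric q m k l := by
    intro k l
    have hm : 1 ≤ m := Admissible.one_le (q := q)
    have hr : ∀ a, wt q m a * rInv q m a a.rev k l = wt q m a * rEntry q m a a.rev k l
        - (if a = k then (if l = k.rev then (q - q⁻¹) * wt q m k else 0) else 0)
        + (q - q⁻¹) * metric q m k l * wt q m a ^ 2 := by
      intro a
      rw [rInv, kEntry, metric_eq q m a, if_pos rfl]
      by_cases e1 : a = k
      · subst e1
        by_cases e2 : l = a.rev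
        · simp [e2]; ring
        · simp [e2, Ne.symm e2]; ring
      · simp [e1]; ring
    simp only [hr, Finset.sum_add_distrib, Finset.sum_sub_distrib, sum_metric_rEntry hq,
      Finset.sum_ite_eq', Finset.mem_univ, if_true, ← Finset.mul_sum]
    have htot := sum_wt_sq_total hq hm
    have hm2 : (if l = k.rev then (q - q⁻¹) * wt q m k else 0) = (q - q⁻¹) * metric q m k l := by
      rw [metric_eq]; split_ifs <;> ring
    have hqq : q * q⁻¹ = 1 := mul_inv_cancel₀ hq.ne'
    have hz : q ^ (1 - (m : ℤ)) * q ^ m = q := by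
      rw [← zpow_natCast, ← zpow_add₀ hq.ne']; simp
    have hz2 : q ^ ((m : ℤ) - 1) = q⁻¹ * q ^ m := by
      rw [zpow_sub₀ hq.ne', zpow_natCast, zpow_one]; field_simp
    have key : (q - q⁻¹) * ∑ p, wt q m p ^ 2 = -q⁻¹ * (mu q m * (1 - q ^ m)) := by
      rw [← htot]; linear_combination (-q * ∑ p, wt q m p ^ 2) * hqq
    rw [mu_eq] at key
    rw [hm2, hz2]
    linear_combination metric q m k l * (key + (q ^ (1 - (m : ℤ)) * q ^ m - q ^ (1 - (m : ℤ))) * hqq + hz)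
  simp only [e1, Finset.sum_add_distrib, ← Finset.sum_smul, ← Finset.smul_sum]
  congr 1
  · push_cast; rfl
  rw [Finset.sum_comm]
  rw [Finset.sum_congr rfl fun k _ => Finset.sum_comm]
  simp only [← Finset.sum_smul, ← Complex.ofReal_sum, e2]
  have : ∀ k l, ((q ^ ((m : ℤ) - 1) * metric q m k l : ℝ) : ℂ) • (X k * D l) =
    ((q ^ ((m : ℤ) - 1) : ℝ) : ℂ) • ((metric q m k l : ℝ) : ℂ) • (X k * D l) := by
    intro k l; rw [smul_smul]; push_cast; rfl
  simp only [this, ← Finset.smul_sum]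
  rw [sum_sum_metric fun k l => X k * D l, ← euler, smul_smul]
  congr 1
  rw [← Complex.ofReal_mul, zpow_sub₀ hq.ne', zpow_natCast, zpow_one]
  congr 1
  field_simp

/-- The commutation of `Δ` with `𝐱²`. -/
theorem IsWeyl.sqOf_mul_sqOf [Admissible q m] {X D : Fin m → B} (h : IsWeyl q m X D) :
    sqOf q m D * sqOf q m X = ((mu q m * ∑ a, wt q m a ^ 2 : ℝ) : ℂ) • 1 +
      ((mu q m * (q ^ m + q ^ 2) : ℝ) : ℂ) • euler q m X D +
      ((q ^ 4 : ℝ) : ℂ) • (sqOf q m X * sqOf q m D) := by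
  have e1 : ∀ a, ((wt q m a : ℝ) : ℂ) • (D a * D a.rev) * sqOf q m X =
      ((mu q m : ℝ) : ℂ) • ((wt q m a : ℝ) : ℂ) • (D a * X a.rev) +
      ((mu q m * q ^ 2 : ℝ) : ℂ) • ((wt q m a : ℝ) : ℂ) • (X a * D a.rev) +
      ((q ^ 4 : ℝ) : ℂ) • ((wt q m a : ℝ) : ℂ) • (sqOf q m X * (D a * D a.rev)) := by
    intro a
    rw [smul_mul_assoc, mul_assoc, h.mul_sqOf, mul_add, mul_smul_comm, mul_smul_comm,
      ← mul_assoc, h.mul_sqOf, add_mul, smul_mul_assoc, smul_mul_assoc, mul_assoc]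
    push_cast
    module
  conv_lhs => rw [sqOf, Finset.sum_mul]
  simp only [e1, Finset.sum_add_distrib, ← Finset.smul_sum, h.sum_mul_rev]
  have e2 : ∑ a, ((wt q m a : ℝ) : ℂ) • (sqOf q m X * (D a * D a.rev)) =
      sqOf q m X * sqOf q m D := by
    rw [sqOf.eq_1 q m D, Finset.mul_sum]; simp only [mul_smul_comm]
  rw [e2, ← euler]
  push_cast
  module

end

/-! ### The partial derivatives -/

theorem braid_inv_apply {q : ℝ} (hq : 0 < q) {m : ℕ} (i j k l : Fin m) :
    (braid q m)⁻¹ (i, j) (k, l) = rInv q m i j k l := by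
  have h : (braid q m)⁻¹ = Matrix.of fun ij kl => rInv q m ij.1 ij.2 kl.1 kl.2 := by
    refine Matrix.inv_eq_right_inv ?_
    ext ⟨a, b⟩ ⟨c, d⟩
    rw [Matrix.mul_apply, Fintype.sum_prod_type, Matrix.one_apply]
    simp only [Matrix.of_apply, Prod.mk.injEq]
    exact sum_rEntry_rInv hq a b c d
  rw [h, Matrix.of_apply]

theorem sum_rotate {α β δ M : Type*} [Fintype α] [Fintype β] [Fintype δ] [AddCommMonoid M]
    (F : α → β → δ → M) : ∑ a, ∑ b, ∑ c, F a b c = ∑ c, ∑ a, ∑ b, F a b c := by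
  rw [Finset.sum_congr rfl fun a _ => Finset.sum_comm, Finset.sum_comm]

section
variable (q : ℝ) (m : ℕ)

/-- A subspace of `𝒫` that contains `1` and is stable under multiplication by the coordinates from
the left is everything. -/
theorem Pol.induction {p : Submodule ℂ (Pol q m)} (h1 : (1 : Pol q m) ∈ p)
    (hx : ∀ j, ∀ f ∈ p, x q m j * f ∈ p) (f : Pol q m) : f ∈ p := by
  obtain ⟨a, rfl⟩ := RingQuot.mkAlgHom_surjective ℂ (Rel q m) f
  have key : ∀ a : FreeAlgebra ℂ (Fin m), ∀ f ∈ p, RingQuot.mkAlgHom ℂ (Rel q m) a * f ∈ p := by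
    intro a
    induction a using FreeAlgebra.induction with
    | grade0 r =>
      intro f hf
      rw [AlgHom.commutes, ← Algebra.smul_def]
      exact p.smul_mem _ hf
    | grade1 j => exact fun f hf => hx j f hf
    | mul a b ha hb =>
      intro f hf
      rw [map_mul, mul_assoc]
      exact ha _ (hb f hf)
    | add a b ha hb =>
      intro f hf
      rw [map_add, add_mul]
      exact p.add_mem (ha f hf) (hb f hf)
  simpa using key a 1 h1

theorem Pol.hom_ext_left {M : Type*} [AddCommMonoid M] [Module ℂ M] {F G : Pol q m →ₗ[ℂ] M}
    (h1 : F 1 = G 1) (hx : ∀ j f, F f = G f → F (x q m j * f) = G (x q m j * f)) : F = G := by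
  refine LinearMap.ext fun f => ?_
  exact Pol.induction q m (p := LinearMap.eqLocus F G) h1 (fun j f hf => hx j f hf) f

theorem isQuad_x [Admissible q m] : IsQuad q m (x q m) := by
  intro i j
  have hq := q_pos q m
  have h := x_rel q m i j
  simp only [antisymProj_eq, Complex.ofReal_mul, mul_smul, ← Finset.smul_sum] at h
  have h2 : (((q + q⁻¹)⁻¹ : ℝ) : ℂ) ≠ 0 := by
    have : (q + q⁻¹)⁻¹ ≠ 0 := by positivity
    exact_mod_cast this
  exact (smul_eq_zero.1 h).resolve_left h2

theorem normSq_eq : normSq q m = sqOf q m (x q m) := by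
  unfold normSq sqOf
  exact sum_sum_metric fun i j => x q m i * x q m j

theorem normSq_comm_x [Admissible q m] (j : Fin m) :
    normSq q m * x q m j = x q m j * normSq q m := by
  rw [normSq_eq]
  exact (isQuad_x q m).sqOf_comm q m j

theorem normSq_comm [Admissible q m] (f : Pol q m) : normSq q m * f = f * normSq q m := by
  have : LinearMap.mulLeft ℂ (normSq q m) = LinearMap.mulRight ℂ (normSq q m) := by
    refine Pol.hom_ext_left q m (by simp) fun j f hf => ?_
    simp only [LinearMap.mulLeft_apply, LinearMap.mulRight_apply] at hf ⊢
    rw [← mul_assoc, normSq_comm_x, mul_assoc, hf, mul_assoc]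
  exact LinearMap.congr_fun this f

/-- The operator by which `x^j` acts on a polynomial together with its partial derivatives. -/
def jetStep (j : Fin m) : Module.End ℂ (Pol q m × (Fin m → Pol q m)) where
  toFun f := (x q m j * f.1, fun i => ((metric q m i j : ℝ) : ℂ) • f.1 +
    (q : ℂ) • ∑ k, ∑ l, ((rInv q m i j k l : ℝ) : ℂ) • (x q m k * f.2 l))
  map_add' f g := by
    refine Prod.ext (mul_add _ _ _) (funext fun i => ?_)
    simp only [Prod.fst_add, Prod.snd_add, Pi.add_apply, mul_add, smul_add,
      Finset.sum_add_distrib]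
    abel
  map_smul' c f := by
    refine Prod.ext (mul_smul_comm _ _ _) (funext fun i => ?_)
    simp only [Prod.smul_fst, Prod.smul_snd, Pi.smul_apply, mul_smul_comm, smul_add,
      Finset.smul_sum, RingHom.id_apply, smul_smul]
    congr 1
    · rw [mul_comm]
    · refine Finset.sum_congr rfl fun k _ => Finset.sum_congr rfl fun l _ => ?_
      congr 1; ring

/-- The inhomogeneous part of the compatibility of `∂` with the relations of the coordinates. -/
theorem sum_asym_metric_left [Admissible q m] (i a b t : Fin m) :
    ∑ k, ∑ l, asym q m a b k l * (metric q m i k * (if l = t then 1 else 0) +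
      q * ∑ c, rInv q m i k t c * metric q m c l) = 0 := by
  have hq := q_pos q m
  have h := sum_asym_mul q m a b i.rev t
  refine Eq.trans ?_ ((congrArg (wt q m i * ·) h).trans (mul_zero _))
  rw [Finset.mul_sum]
  refine Finset.sum_congr rfl fun k _ => ?_
  rw [Finset.mul_sum]
  refine Finset.sum_congr rfl fun l _ => ?_
  have e : ∑ c, rInv q m i k t c * metric q m c l = wt q m i * rEntry q m k l i.rev t := by
    rw [Finset.sum_eq_single l.rev]
    · rw [metric_eq, Fin.rev_rev, if_pos rfl, rInv_crossing hq, Fin.rev_rev]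
      have := (wt_pos hq l.rev).ne'
      field_simp
    · intro c _ hc
      have : l ≠ c.rev := fun h => hc (by rw [h, Fin.rev_rev])
      rw [metric_eq, if_neg this, mul_zero]
    · simp
  rw [e, metric_eq, ite_and]
  split_ifs with h3 h4 <;> ring1

/-- The action of `𝒫` on polynomials together with their partial derivatives. -/
def jetHom [Admissible q m] : Pol q m →ₐ[ℂ] Module.End ℂ (Pol q m × (Fin m → Pol q m)) :=
  RingQuot.liftAlgHom ℂ ⟨FreeAlgebra.lift ℂ (jetStep q m), by
    rintro _ _ ⟨a, b⟩
    have hq := q_pos q m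
    simp only [antisymProj_eq, map_sum, map_smul, map_mul, FreeAlgebra.lift_ι_apply, map_zero]
    simp only [Complex.ofReal_mul, mul_smul, ← Finset.smul_sum]
    refine smul_eq_zero_of_right _ (LinearMap.ext fun f => Prod.ext ?_ (funext fun i => ?_))
    · simp only [LinearMap.sum_apply, LinearMap.smul_apply, Module.End.mul_apply, Prod.fst_sum,
        Prod.smul_fst, LinearMap.zero_apply, Prod.fst_zero]
      change ∑ k, ∑ l, ((asym q m a b k l : ℝ) : ℂ) • (x q m k * (x q m l * f.1)) = 0
      have h := congrArg (fun u => u * f.1) (isQuad_x q m a b)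
      simpa only [Finset.sum_mul, smul_mul_assoc, mul_assoc, zero_mul] using h
    · simp only [LinearMap.sum_apply, LinearMap.smul_apply, Module.End.mul_apply, Prod.snd_sum,
        Prod.smul_snd, LinearMap.zero_apply, Prod.snd_zero, Finset.sum_apply, Pi.smul_apply,
        Pi.zero_apply]
      change ∑ k, ∑ l, ((asym q m a b k l : ℝ) : ℂ) • (((metric q m i k : ℝ) : ℂ) •
        (x q m l * f.1) + (q : ℂ) • ∑ t, ∑ c, ((rInv q m i k t c : ℝ) : ℂ) • (x q m t *
          (((metric q m c l : ℝ) : ℂ) • f.1 + (q : ℂ) • ∑ d, ∑ e, ((rInv q m c l d e : ℝ) : ℂ) •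
            (x q m d * f.2 e)))) = 0
      have e : ∀ k l, ((asym q m a b k l : ℝ) : ℂ) • (((metric q m i k : ℝ) : ℂ) •
        (x q m l * f.1) + (q : ℂ) • ∑ t, ∑ c, ((rInv q m i k t c : ℝ) : ℂ) • (x q m t *
          (((metric q m c l : ℝ) : ℂ) • f.1 + (q : ℂ) • ∑ d, ∑ e, ((rInv q m c l d e : ℝ) : ℂ) •
            (x q m d * f.2 e)))) =
          ∑ t, (((asym q m a b k l * (metric q m i k * (if l = t then 1 else 0) +
              q * ∑ c, rInv q m i k t c * metric q m c l) : ℝ) : ℂ) • (x q m t * f.1) +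
          ∑ e, ∑ d, ∑ c, ((q ^ 2 * (asym q m a b k l * rInv q m i k t c *
            rInv q m c l d e) : ℝ) : ℂ) • (x q m t * x q m d * f.2 e)) := by
        intro k l
        have e1 : ((metric q m i k : ℝ) : ℂ) • (x q m l * f.1) =
            ∑ t, ((metric q m i k * (if l = t then 1 else 0) : ℝ) : ℂ) • (x q m t * f.1) := by
          rw [Finset.sum_eq_single l]
          · simp
          · intro t _ ht; simp [ht.symm]
          · simp
        rw [e1, Finset.smul_sum, ← Finset.sum_add_distrib, Finset.smul_sum]
        refine Finset.sum_congr rfl fun t _ => ?_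
        simp only [mul_add, smul_add, Finset.mul_sum, Finset.smul_sum, mul_smul_comm,
          Finset.sum_add_distrib, smul_smul]
        rw [← add_assoc, ← Finset.sum_smul, ← add_smul]
        congr 1
        · congr 1
          push_cast
          simp only [mul_add, Finset.mul_sum]
        · rw [sum_rotate]
          refine Finset.sum_congr rfl fun e _ => ?_
          rw [Finset.sum_comm]
          refine Finset.sum_congr rfl fun d _ => Finset.sum_congr rfl fun c _ => ?_
          rw [← mul_assoc (x q m t)]
          congr 1
          push_cast; ring
      simp only [e]
      rw [sum_rotate]
      simp only [Finset.sum_add_distrib]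
      -- The terms of first order in `x`.
      have t1 : ∀ t, ∑ k, ∑ l, ((asym q m a b k l * (metric q m i k * (if l = t then 1 else 0) +
              q * ∑ c, rInv q m i k t c * metric q m c l) : ℝ) : ℂ) • (x q m t * f.1) = 0 := by
        intro t
        simp only [← Finset.sum_smul, ← Complex.ofReal_sum]
        rw [sum_asym_metric_left, Complex.ofReal_zero, zero_smul]
      -- The terms that contain derivatives: by the Yang–Baxter equation the antisymmetric
      -- projection moves through the two crossings and meets the coordinates.
      have t2 : ∑ t, ∑ k, ∑ l, ∑ e, ∑ d, ∑ c, ((q ^ 2 * (asym q m a b k l * rInv q m i k t c *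
            rInv q m c l d e) : ℝ) : ℂ) • (x q m t * x q m d * f.2 e) = 0 := by
        have r : ∀ t d e, ∑ k, ∑ l, ∑ c, ((q ^ 2 * (asym q m a b k l * rInv q m i k t c *
            rInv q m c l d e) : ℝ) : ℂ) • (x q m t * x q m d * f.2 e) =
            ∑ p, ∑ r, ∑ s, ((q ^ 2 * (rInv q m i a p r * rInv q m r b s e *
              asym q m p s t d) : ℝ) : ℂ) • (x q m t * x q m d * f.2 e) := by
          intro t d e
          simp only [← Finset.sum_smul, ← Complex.ofReal_sum, ← Finset.mul_sum,
            asym_two_comm q m i a b t d e]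
        rw [Finset.sum_congr rfl fun t _ => sum_rotate _, Finset.sum_comm]
        refine Finset.sum_eq_zero fun e _ => ?_
        rw [Finset.sum_congr rfl fun t _ => sum_rotate _]
        simp only [r]
        rw [sum_rotate]
        refine Finset.sum_eq_zero fun p _ => ?_
        rw [sum_rotate]
        refine Finset.sum_eq_zero fun r _ => ?_
        rw [sum_rotate]
        refine Finset.sum_eq_zero fun s _ => ?_
        have h := congrArg (fun u => ((q ^ 2 * (rInv q m i a p r * rInv q m r b s e) : ℝ) : ℂ) •
          (u * f.2 e)) (isQuad_x q m p s)
        simp only [Finset.sum_mul, Finset.smul_sum, smul_mul_assoc, smul_smul, zero_mul,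
          smul_zero] at h
        rw [← h]
        refine Finset.sum_congr rfl fun t _ => Finset.sum_congr rfl fun d _ => ?_
        congr 1
        push_cast; ring
      simp only [t1, t2, Finset.sum_const_zero, add_zero]⟩

theorem jetHom_x_mul [Admissible q m] (j : Fin m) (f : Pol q m) :
    jetHom q m (x q m j * f) (1, 0) = jetStep q m j (jetHom q m f (1, 0)) := by
  rw [map_mul, Module.End.mul_apply]
  congr 1
  simp [jetHom, x]

theorem jetHom_fst [Admissible q m] (f : Pol q m) : (jetHom q m f (1, 0)).1 = f := by
  have : LinearMap.fst ℂ _ _ ∘ₗ LinearMap.applyₗ (1, 0) ∘ₗ (jetHom q m).toLinearMap =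
      LinearMap.id := by
    refine Pol.hom_ext_left q m (by simp) fun j f hf => ?_
    simp only [LinearMap.comp_apply, AlgHom.toLinearMap_apply, LinearMap.applyₗ_apply_apply,
      LinearMap.fst_apply, LinearMap.id_apply] at hf ⊢
    rw [jetHom_x_mul]
    change x q m j * _ = _
    rw [hf]
  exact LinearMap.congr_fun this f

/-- The partial derivatives exist: they are read off from the second component of the action of
`𝒫` on `(1, 0)`. -/
theorem isPartial_pd [Admissible q m] : IsPartial q m (braid q m)⁻¹ q (pd q m) := by
  refine Classical.epsilon_spec (p := IsPartial q m (braid q m)⁻¹ q)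
    ⟨fun i => LinearMap.proj i ∘ₗ LinearMap.snd ℂ _ _ ∘ₗ LinearMap.applyₗ (1, 0) ∘ₗ
      (jetHom q m).toLinearMap, fun i => by simp, fun i j f => ?_⟩
  simp only [LinearMap.comp_apply, AlgHom.toLinearMap_apply, LinearMap.applyₗ_apply_apply,
      LinearMap.snd_apply, LinearMap.proj_apply, jetHom_x_mul, braid_inv_apply (q_pos q m)]
  change ((metric q m i j : ℝ) : ℂ) • _ + _ = _
  rw [jetHom_fst]

theorem IsPartial.unique {A : Matrix (Fin m × Fin m) (Fin m × Fin m) ℝ} {p : ℝ}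
    {D D' : Fin m → Pol q m →ₗ[ℂ] Pol q m} (h : IsPartial q m A p D) (h' : IsPartial q m A p D') :
    D = D' := by
  have key : ∀ f, ∀ i, D i f = D' i f := by
    intro f
    refine Pol.induction q m (p := ⨅ i, LinearMap.eqLocus (D i) (D' i)) ?_ ?_ f |> fun h i => by
      simpa using (Submodule.mem_iInf _).1 h i
    · simp [h.1, h'.1]
    · intro j f hf
      simp only [Submodule.mem_iInf, LinearMap.mem_eqLocus] at hf ⊢
      intro i
      rw [h.2, h'.2]
      simp only [hf]
  exact funext fun i => LinearMap.ext fun f => key f i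

theorem pd_one [Admissible q m] (i : Fin m) : pd q m i 1 = 0 := (isPartial_pd q m).1 i

theorem pd_x_mul [Admissible q m] (i j : Fin m) (f : Pol q m) :
    pd q m i (x q m j * f) = ((metric q m i j : ℝ) : ℂ) • f +
      (q : ℂ) • ∑ k, ∑ l, ((rInv q m i j k l : ℝ) : ℂ) • (x q m k * pd q m l f) := by
  rw [(isPartial_pd q m).2]
  simp only [braid_inv_apply (q_pos q m)]

/-- Multiplication by the coordinate `x^j` as an operator on `𝒫`. -/
def mulXPol (j : Fin m) : Module.End ℂ (Pol q m) := Algebra.lmul ℂ (Pol q m) (x q m j)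

theorem isWeyl_pd [Admissible q m] : IsWeyl q m (mulXPol q m) (pd q m) := by
  intro i j
  refine LinearMap.ext fun f => ?_
  simp only [mulXPol, Module.End.mul_apply, Algebra.coe_lmul_eq_mul, LinearMap.mul_apply_apply, pd_x_mul,
    LinearMap.add_apply, LinearMap.smul_apply, LinearMap.sum_apply, Module.End.one_apply]

theorem isQuad_mulXPol [Admissible q m] : IsQuad q m (mulXPol q m) := by
  intro i j
  have := congrArg (Algebra.lmul ℂ (Pol q m)) (isQuad_x q m i j)
  simpa only [map_sum, map_smul, map_mul, map_zero, mulXPol] using this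

theorem sqOf_mulXPol [Admissible q m] :
    sqOf q m (mulXPol q m) = Algebra.lmul ℂ (Pol q m) (normSq q m) := by
  rw [normSq_eq, sqOf, sqOf]
  simp only [map_sum, map_smul, map_mul, mulXPol]

theorem laplacePol_eq [Admissible q m] : laplacePol q m = sqOf q m (pd q m) := by
  unfold laplacePol sqOf
  exact sum_sum_metric fun i j => pd q m i ∘ₗ pd q m j

/-- The inhomogeneous part of the compatibility of the quadratic relations of the `∂^i` with the
coordinates. -/
theorem sum_asym_metric_right [Admissible q m] (u v j t : Fin m) :
    ∑ a, ∑ b, asym q m u v a b * (metric q m b j * (if a = t then 1 else 0) +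
      q * ∑ k, rInv q m b j k t * metric q m a k) = 0 := by
  have hq := q_pos q m
  have h := sum_asym_mul q m u v t j.rev
  refine Eq.trans ?_ ((congrArg (wt q m j.rev * ·) h).trans (mul_zero _))
  rw [Finset.mul_sum]
  refine Finset.sum_congr rfl fun a _ => ?_
  rw [Finset.mul_sum]
  refine Finset.sum_congr rfl fun b _ => ?_
  have e : ∑ k, rInv q m b j k t * metric q m a k = wt q m j.rev * rEntry q m a b t j.rev := by
    rw [Finset.sum_eq_single a.rev]
    · have e1 : rEntry q m j t.rev b.rev a.rev = rEntry q m a b t j.rev := by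
        rw [← rEntry_flip hq, rEntry_transpose hq, Fin.rev_rev, Fin.rev_rev, Fin.rev_rev]
      rw [metric_eq, if_pos rfl, rInv_crossing hq, e1]
      have h3 := rEntry_wt hq a b t j.rev
      have := (wt_pos hq t).ne'
      field_simp
      linear_combination h3
    · intro c _ hc
      rw [metric_eq, if_neg hc, mul_zero]
    · simp
  have e2 : metric q m b j = if b = j.rev then wt q m j.rev else 0 := by
    rw [metric_eq]
    have : j = b.rev ↔ b = j.rev :=
      ⟨fun h => by rw [h, Fin.rev_rev], fun h => by rw [h, Fin.rev_rev]⟩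
    simp only [this]
    split_ifs with h3
    · rw [h3]
    · rfl
  rw [e, e2]
  by_cases h1 : a = t <;> by_cases h2 : b = j.rev <;> simp [h1, h2] <;> ring

/-- The quadratic relations of the `∂^i` are stable under multiplication by coordinates. -/
theorem sum_asym_pd_x_mul [Admissible q m] (f : Pol q m)
    (hf : ∀ s r, ∑ a, ∑ b, ((asym q m s r a b : ℝ) : ℂ) • pd q m a (pd q m b f) = 0)
    (u v j : Fin m) :
    ∑ a, ∑ b, ((asym q m u v a b : ℝ) : ℂ) • pd q m a (pd q m b (x q m j * f)) = 0 := by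
  have hq := q_pos q m
  have e : ∀ a b, ((asym q m u v a b : ℝ) : ℂ) • pd q m a (pd q m b (x q m j * f)) =
      ∑ t, (((asym q m u v a b * (metric q m b j * (if a = t then 1 else 0) +
        q * ∑ k, rInv q m b j k t * metric q m a k) : ℝ) : ℂ) • pd q m t f +
      ∑ d, ∑ e, ∑ k, ((q ^ 2 * (asym q m u v a b * rInv q m b j k t *
        rInv q m a k d e) : ℝ) : ℂ) • (x q m d * pd q m e (pd q m t f))) := by
    intro a b
    have e1 : ((metric q m b j : ℝ) : ℂ) • pd q m a f =
        ∑ t, ((metric q m b j * (if a = t then 1 else 0) : ℝ) : ℂ) • pd q m t f := by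
      rw [Finset.sum_eq_single a]
      · simp
      · intro t _ ht; simp [ht.symm]
      · simp
    simp only [pd_x_mul, map_add, map_smul, map_sum, e1, smul_add, Finset.smul_sum,
      Finset.sum_add_distrib, smul_smul]
    rw [← add_assoc]
    congr 1
    · rw [Finset.sum_comm (γ := Fin m), ← Finset.sum_add_distrib]
      refine Finset.sum_congr rfl fun t _ => ?_
      rw [← Finset.sum_smul, ← add_smul]
      congr 1
      push_cast
      simp only [mul_add, Finset.mul_sum]
      congr 1
      refine Finset.sum_congr rfl fun c _ => ?_
      ring
    · rw [Finset.sum_comm (γ := Fin m)]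
      refine Finset.sum_congr rfl fun t _ => ?_
      rw [Finset.sum_comm (γ := Fin m)]
      refine Finset.sum_congr rfl fun d _ => ?_
      rw [Finset.sum_comm (γ := Fin m)]
      refine Finset.sum_congr rfl fun e _ => Finset.sum_congr rfl fun k _ => ?_
      congr 1
      push_cast; ring
  simp only [e]
  rw [sum_rotate]
  simp only [Finset.sum_add_distrib]
  -- The terms of first order in `∂`.
  have t1 : ∀ t, ∑ a, ∑ b, ((asym q m u v a b * (metric q m b j * (if a = t then 1 else 0) +
        q * ∑ k, rInv q m b j k t * metric q m a k) : ℝ) : ℂ) • pd q m t f = 0 := by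
    intro t
    simp only [← Finset.sum_smul, ← Complex.ofReal_sum]
    rw [sum_asym_metric_right, Complex.ofReal_zero, zero_smul]
  -- The terms that contain a coordinate: by the Yang–Baxter equation the antisymmetric projection
  -- moves through the two crossings and meets the derivatives.
  have t2 : ∑ t, ∑ a, ∑ b, ∑ d, ∑ e, ∑ k, ((q ^ 2 * (asym q m u v a b * rInv q m b j k t *
        rInv q m a k d e) : ℝ) : ℂ) • (x q m d * pd q m e (pd q m t f)) = 0 := by
    have r : ∀ d e t, ∑ a, ∑ b, ∑ k, ((q ^ 2 * (asym q m u v a b * rInv q m b j k t *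
        rInv q m a k d e) : ℝ) : ℂ) • (x q m d * pd q m e (pd q m t f)) =
        ∑ p, ∑ r, ∑ s, ((q ^ 2 * (rInv q m v j p r * rInv q m u p d s *
          asym q m s r e t) : ℝ) : ℂ) • (x q m d * pd q m e (pd q m t f)) := by
      intro d e t
      simp only [← Finset.sum_smul, ← Complex.ofReal_sum, ← Finset.mul_sum,
        asym_one_comm q m u v j d e t]
    rw [Finset.sum_congr rfl fun t _ => sum_rotate _, Finset.sum_comm]
    refine Finset.sum_eq_zero fun d _ => ?_
    rw [Finset.sum_congr rfl fun t _ => sum_rotate _, Finset.sum_comm]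
    simp only [r]
    rw [sum_rotate]
    refine Finset.sum_eq_zero fun p _ => ?_
    rw [sum_rotate]
    refine Finset.sum_eq_zero fun r _ => ?_
    rw [sum_rotate]
    refine Finset.sum_eq_zero fun s _ => ?_
    have h := congrArg (fun w => ((q ^ 2 * (rInv q m v j p r * rInv q m u p d s) : ℝ) : ℂ) •
      (x q m d * w)) (hf s r)
    simp only [Finset.mul_sum, Finset.smul_sum, mul_smul_comm, smul_smul, mul_zero,
      smul_zero] at h
    rw [← h]
    refine Finset.sum_congr rfl fun t _ => Finset.sum_congr rfl fun d _ => ?_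
    congr 1
    push_cast; ring
  simp only [t1, t2, Finset.sum_const_zero, add_zero]

/-- The partial derivatives satisfy the relations of the coordinates. -/
theorem isQuad_pd [Admissible q m] : IsQuad q m (pd q m) := by
  have key : ∀ f u v, ∑ a, ∑ b, ((asym q m u v a b : ℝ) : ℂ) • pd q m a (pd q m b f) = 0 := by
    intro f
    have := Pol.induction q m (p := ⨅ u, ⨅ v, LinearMap.ker
      (∑ a, ∑ b, ((asym q m u v a b : ℝ) : ℂ) • (pd q m a ∘ₗ pd q m b))) (by simp [pd_one])
      (fun j f hf => by
        simp only [Submodule.mem_iInf, LinearMap.mem_ker, LinearMap.sum_apply,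
          LinearMap.smul_apply, LinearMap.comp_apply] at hf ⊢
        exact fun u v => sum_asym_pd_x_mul q m f hf u v j) f
    simpa only [Submodule.mem_iInf, LinearMap.mem_ker, LinearMap.sum_apply,
      LinearMap.smul_apply, LinearMap.comp_apply] using this
  intro u v
  refine LinearMap.ext fun f => ?_
  simpa only [LinearMap.sum_apply, LinearMap.smul_apply, Module.End.mul_apply,
    LinearMap.zero_apply] using key f u v

end

/-! ### The grading and the scaling automorphisms -/

section
variable (q : ℝ) (m : ℕ)

/-- The homogeneous component of degree `d` of a polynomial. -/
def homComp (d : ℕ) : Pol q m →ₗ[ℂ] Pol q m where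
  toFun f := (grade q m f).coeff d
  map_add' f g := by rw [map_add, Polynomial.coeff_add]
  map_smul' c f := by rw [map_smul, Polynomial.coeff_smul, RingHom.id_apply]

theorem grade_x (j : Fin m) : grade q m (x q m j) = Polynomial.monomial 1 (x q m j) := by
  simp [grade, x]

theorem homComp_one (d : ℕ) : homComp q m d 1 = if d = 0 then 1 else 0 := by
  change (grade q m 1).coeff d = _
  rw [map_one, Polynomial.coeff_one]

theorem homComp_zero_x_mul (j : Fin m) (f : Pol q m) : homComp q m 0 (x q m j * f) = 0 := by
  change (grade q m (x q m j * f)).coeff 0 = _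
  rw [map_mul, grade_x, Polynomial.mul_coeff_zero, Polynomial.coeff_monomial]
  simp

theorem homComp_succ_x_mul (j : Fin m) (d : ℕ) (f : Pol q m) :
    homComp q m (d + 1) (x q m j * f) = x q m j * homComp q m d f := by
  change (grade q m (x q m j * f)).coeff (d + 1) = x q m j * (grade q m f).coeff d
  rw [map_mul, grade_x, ← Polynomial.C_mul_X_pow_eq_monomial, pow_one, mul_assoc,
    Polynomial.coeff_C_mul, Polynomial.X_mul, Polynomial.coeff_mul_X]

theorem grade_homComp (d : ℕ) (f : Pol q m) :
    grade q m (homComp q m d f) = Polynomial.monomial d (homComp q m d f) := by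
  have : ∀ d, grade q m (homComp q m d f) = Polynomial.monomial d (homComp q m d f) := by
    refine Pol.induction q m (p :=
      { carrier := {f | ∀ d, grade q m (homComp q m d f) = Polynomial.monomial d (homComp q m d f)}
        add_mem' := fun hf hg d => by rw [map_add, map_add, map_add, hf d, hg d]
        zero_mem' := fun d => by simp
        smul_mem' := fun c f hf d => by
          rw [map_smul, map_smul, hf d, Polynomial.smul_monomial] }) ?_ ?_ f
    · intro d
      rw [homComp_one]
      split_ifs with h
      · rw [h, map_one]; rfl
      · simp
    · rintro j f hf (_ | d)
      · rw [homComp_zero_x_mul]; simp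
      · rw [homComp_succ_x_mul, map_mul, grade_x, hf d, Polynomial.monomial_mul_monomial, add_comm]
  exact this d

/-- `f` is homogeneous of degree `d`. -/
def IsHomog (d : ℕ) (f : Pol q m) : Prop := grade q m f = Polynomial.monomial d f

variable {q m}

theorem IsHomog.homComp {d : ℕ} {f : Pol q m} (h : IsHomog q m d f) (e : ℕ) :
    homComp q m e f = if e = d then f else 0 := by
  change (grade q m f).coeff e = _
  rw [h, Polynomial.coeff_monomial]
  simp only [eq_comm]

theorem IsHomog.add {d : ℕ} {f g : Pol q m} (hf : IsHomog q m d f) (hg : IsHomog q m d g) :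
    IsHomog q m d (f + g) := by
  unfold IsHomog at *; rw [map_add, hf, hg, map_add]

theorem IsHomog.sub {d : ℕ} {f g : Pol q m} (hf : IsHomog q m d f) (hg : IsHomog q m d g) :
    IsHomog q m d (f - g) := by
  unfold IsHomog at *; rw [map_sub, hf, hg, map_sub]

theorem IsHomog.smul {d : ℕ} {f : Pol q m} (c : ℂ) (hf : IsHomog q m d f) :
    IsHomog q m d (c • f) := by
  unfold IsHomog at *; rw [map_smul, hf, Polynomial.smul_monomial]

theorem isHomog_zero (d : ℕ) : IsHomog q m d 0 := by
  unfold IsHomog; rw [map_zero, map_zero]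

theorem IsHomog.sum {d : ℕ} {ι : Type*} {s : Finset ι} {f : ι → Pol q m}
    (h : ∀ i ∈ s, IsHomog q m d (f i)) : IsHomog q m d (∑ i ∈ s, f i) := by
  unfold IsHomog at *; rw [map_sum, map_sum]; exact Finset.sum_congr rfl h

theorem IsHomog.mul {d e : ℕ} {f g : Pol q m} (hf : IsHomog q m d f) (hg : IsHomog q m e g) :
    IsHomog q m (d + e) (f * g) := by
  unfold IsHomog at *; rw [map_mul, hf, hg, Polynomial.monomial_mul_monomial]

theorem isHomog_one : IsHomog q m 0 1 := by
  unfold IsHomog; rw [map_one]; rfl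

theorem IsHomog.pow {d : ℕ} {f : Pol q m} (hf : IsHomog q m d f) (n : ℕ) :
    IsHomog q m (d * n) (f ^ n) := by
  unfold IsHomog at *; rw [map_pow, hf, Polynomial.monomial_pow]

variable (q m)

theorem isHomog_x (j : Fin m) : IsHomog q m 1 (x q m j) := grade_x q m j

theorem isHomog_homComp (d : ℕ) (f : Pol q m) : IsHomog q m d (homComp q m d f) :=
  grade_homComp q m d f

theorem isHomog_normSq : IsHomog q m 2 (normSq q m) :=
  IsHomog.sum fun i _ => IsHomog.sum fun j _ => ((isHomog_x q m i).mul (isHomog_x q m j)).smul _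

theorem isHomog_normSq_pow (n : ℕ) : IsHomog q m (2 * n) (normSq q m ^ n) :=
  (isHomog_normSq q m).pow n

/-- The automorphism `x^j ↦ c x^j`. -/
def scale (c : ℂ) : Pol q m →ₐ[ℂ] Pol q m :=
  RingQuot.liftAlgHom ℂ ⟨FreeAlgebra.lift ℂ fun j => c • x q m j, by
    rintro _ _ ⟨i, j⟩
    simp only [map_sum, map_smul, map_mul, FreeAlgebra.lift_ι_apply, map_zero, smul_mul_smul_comm]
    simp only [smul_comm _ (c * c), ← Finset.smul_sum, x_rel, smul_zero]⟩

theorem scale_x (c : ℂ) (j : Fin m) : scale q m c (x q m j) = c • x q m j := by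
  simp [scale, x]

theorem scale_x_mul (c : ℂ) (j : Fin m) (f : Pol q m) :
    scale q m c (x q m j * f) = c • (x q m j * scale q m c f) := by
  rw [map_mul, scale_x, smul_mul_assoc]

theorem scale_eq_sum (c : ℂ) (f : Pol q m) :
    scale q m c f = (grade q m f).sum fun d a => c ^ d • a := by
  have h1 : ∀ p : Polynomial (Pol q m), Polynomial.lsum (R := ℂ)
      (fun d => (c ^ d) • (LinearMap.id : Pol q m →ₗ[ℂ] Pol q m)) p = p.sum fun d a => c ^ d • a := by
    intro p; rfl
  rw [← h1]
  have : (scale q m c).toLinearMap = Polynomial.lsum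
      (fun d => (c ^ d) • (LinearMap.id : Pol q m →ₗ[ℂ] Pol q m)) ∘ₗ (grade q m).toLinearMap := by
    refine Pol.hom_ext_left q m ?_ fun j f hf => ?_
    · simp only [AlgHom.toLinearMap_apply, LinearMap.comp_apply, map_one, h1]
      rw [← Polynomial.C_1, Polynomial.sum_C_index] <;> simp
    · simp only [AlgHom.toLinearMap_apply, LinearMap.comp_apply] at hf ⊢
      rw [scale_x_mul, hf, map_mul, grade_x]
      generalize grade q m f = p
      induction p using Polynomial.induction_on' with
      | add p r hp hr => rw [mul_add, map_add, map_add, mul_add, smul_add, hp, hr]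
      | monomial n a =>
        rw [Polynomial.monomial_mul_monomial]
        simp only [h1]
        rw [Polynomial.sum_monomial_index _ _ (by simp), Polynomial.sum_monomial_index _ _ (by simp),
          pow_add, pow_one, mul_smul, mul_smul_comm]
  exact LinearMap.congr_fun this f

theorem scale_one (f : Pol q m) : scale q m 1 f = f := by
  have : (scale q m 1).toLinearMap = LinearMap.id := by
    refine Pol.hom_ext_left q m (by simp) fun j f hf => ?_
    simp only [AlgHom.toLinearMap_apply, LinearMap.id_apply] at hf ⊢
    rw [scale_x_mul, hf, one_smul]
  exact LinearMap.congr_fun this f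

theorem sum_homComp (f : Pol q m) : ((grade q m f).sum fun _ a => a) = f := by
  have := scale_eq_sum q m 1 f
  rw [scale_one] at this
  conv_rhs => rw [this]
  simp

/-- Homogeneous elements span `𝒫`. -/
theorem Pol.homog_induction {p : Submodule ℂ (Pol q m)}
    (h : ∀ d f, IsHomog q m d f → f ∈ p) (f : Pol q m) : f ∈ p := by
  rw [← sum_homComp q m f, Polynomial.sum_def]
  exact p.sum_mem fun d _ => h d _ (isHomog_homComp q m d f)

theorem Pol.hom_ext_homog {M : Type*} [AddCommMonoid M] [Module ℂ M] {F G : Pol q m →ₗ[ℂ] M}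
    (h : ∀ d f, IsHomog q m d f → F f = G f) : F = G :=
  LinearMap.ext fun f => Pol.homog_induction q m (p := LinearMap.eqLocus F G) h f

variable {q m} in
theorem IsHomog.scale {d : ℕ} {f : Pol q m} (hf : IsHomog q m d f) (c : ℂ) :
    scale q m c f = c ^ d • f := by
  rw [scale_eq_sum, hf, Polynomial.sum_monomial_index _ _ (by simp)]

theorem evalZero_x_mul (j : Fin m) (f : Pol q m) : evalZero q m (x q m j * f) = 0 := by
  have : evalZero q m (x q m j) = 0 := by simp [evalZero, x]
  rw [map_mul, this, zero_mul]

theorem homComp_zero (f : Pol q m) : homComp q m 0 f = evalZero q m f • 1 := by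
  have : homComp q m 0 = (LinearMap.toSpanSingleton ℂ _ 1) ∘ₗ (evalZero q m).toLinearMap := by
    refine Pol.hom_ext_left q m (by simp [homComp_one]) fun j f _ => ?_
    simp [homComp_zero_x_mul, evalZero_x_mul]
  exact LinearMap.congr_fun this f

theorem evalZero_homComp (d : ℕ) (f : Pol q m) :
    evalZero q m (homComp q m d f) = if d = 0 then evalZero q m f else 0 := by
  have h := homComp_zero q m (homComp q m d f)
  rw [(isHomog_homComp q m d f).homComp] at h
  rcases d with _ | d
  · rw [homComp_zero]; simp
  · rw [if_neg (by omega)] at h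
    have h2 := congrArg (evalZero q m) h
    simp only [map_smul, map_zero, map_one, smul_eq_mul, mul_one] at h2
    rw [← h2, if_neg (by omega)]

variable {q m} in
theorem IsHomog.evalZero {d : ℕ} {f : Pol q m} (hf : IsHomog q m (d + 1) f) :
    evalZero q m f = 0 := by
  have := evalZero_homComp q m (d + 1) f
  rwa [hf.homComp, if_pos rfl, if_neg (by omega)] at this

variable {q m} in
theorem IsHomog.eq_smul_one {f : Pol q m} (hf : IsHomog q m 0 f) :
    f = QEuclid.evalZero q m f • 1 := by
  have := homComp_zero q m f
  rwa [hf.homComp, if_pos rfl] at this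

/-! ### Operator identities on polynomials -/

variable [Admissible q m]

theorem homComp_pd (j : Fin m) (d : ℕ) (f : Pol q m) :
    homComp q m d (pd q m j f) = pd q m j (homComp q m (d + 1) f) := by
  have : ∀ d j, homComp q m d (pd q m j f) = pd q m j (homComp q m (d + 1) f) := by
    refine Pol.induction q m (p :=
      ⨅ d, ⨅ j, LinearMap.eqLocus (homComp q m d ∘ₗ pd q m j) (pd q m j ∘ₗ homComp q m (d + 1)))
      ?_ ?_ f |> fun h d j => by simpa using (Submodule.mem_iInf _).1 ((Submodule.mem_iInf _).1 h d) j
    · simp [pd_one, homComp_one]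
    · intro i f hf
      simp only [Submodule.mem_iInf, LinearMap.mem_eqLocus, LinearMap.comp_apply] at hf ⊢
      intro d j
      rw [homComp_succ_x_mul, pd_x_mul, pd_x_mul, map_add, map_smul, map_smul, map_sum]
      simp only [map_sum, map_smul]
      congr 2
      refine Finset.sum_congr rfl fun k _ => Finset.sum_congr rfl fun l _ => ?_
      rcases d with _ | d
      · rw [homComp_zero_x_mul, homComp_zero, map_smul, pd_one]
        simp only [smul_zero, mul_zero]
      · rw [homComp_succ_x_mul, hf]
  exact this d j

variable {q m}

theorem IsHomog.pd {d : ℕ} {f : Pol q m} (hf : IsHomog q m (d + 1) f) (j : Fin m) :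
    IsHomog q m d (pd q m j f) := by
  have := homComp_pd q m j d f
  rw [hf.homComp, if_pos rfl] at this
  rw [← this]
  exact isHomog_homComp q m d _

theorem IsHomog.pd_zero {f : Pol q m} (hf : IsHomog q m 0 f) (j : Fin m) :
    QEuclid.pd q m j f = 0 := by
  rw [hf.eq_smul_one, map_smul, pd_one, smul_zero]

variable (q m)

theorem laplacePol_apply (f : Pol q m) :
    laplacePol q m f = ∑ i, ((wt q m i : ℝ) : ℂ) • pd q m i (pd q m i.rev f) := by
  rw [laplacePol_eq, sqOf]; simp [-Complex.coe_smul]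

variable {q m} in
theorem IsHomog.laplacePol {d : ℕ} {f : Pol q m} (hf : IsHomog q m (d + 2) f) :
    IsHomog q m d (laplacePol q m f) := by
  rw [laplacePol_apply]
  exact IsHomog.sum fun i _ => ((hf.pd _).pd _).smul _

variable {q m} in
theorem IsHomog.laplacePol_eq_zero {d : ℕ} {f : Pol q m} (hf : IsHomog q m d f) (hd : d < 2) :
    QEuclid.laplacePol q m f = 0 := by
  rw [laplacePol_apply]
  refine Finset.sum_eq_zero fun i _ => ?_
  rcases d with _ | d
  · rw [hf.pd_zero, map_zero, smul_zero]
  · obtain rfl : d = 0 := by omega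
    rw [(hf.pd _).pd_zero, smul_zero]

theorem pd_normSq_mul (j : Fin m) (f : Pol q m) :
    pd q m j (normSq q m * f) = ((mu q m : ℝ) : ℂ) • (x q m j * f) +
      ((q ^ 2 : ℝ) : ℂ) • (normSq q m * pd q m j f) := by
  have h := LinearMap.congr_fun ((isWeyl_pd q m).mul_sqOf q m j) f
  rw [sqOf_mulXPol] at h
  exact h

theorem laplacePol_x_mul (j : Fin m) (f : Pol q m) :
    laplacePol q m (x q m j * f) = ((mu q m : ℝ) : ℂ) • pd q m j f +
      ((q ^ 2 : ℝ) : ℂ) • (x q m j * laplacePol q m f) := by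
  have h := LinearMap.congr_fun ((isWeyl_pd q m).sqOf_mul q m j) f
  rw [laplacePol_eq]
  exact h

theorem laplacePol_pd (j : Fin m) (f : Pol q m) :
    laplacePol q m (pd q m j f) = pd q m j (laplacePol q m f) := by
  have h := LinearMap.congr_fun ((isQuad_pd q m).sqOf_comm q m j) f
  rw [laplacePol_eq]
  exact h

/-- The constant in `C_{ab} x^a ∂^b = [deg]_{q²} + λ 𝐱² Δ`. -/
def eulerConst : ℝ := q ^ (2 - (m : ℤ)) * (1 - q ^ 2) / mu q m ^ 2

theorem eulerConst_mul_mu : eulerConst q m * mu q m = q * tau q m := by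
  have := (mu_pos q m).ne'
  have h : q ^ (2 - (m : ℤ)) = q * q ^ (1 - (m : ℤ)) := by
    rw [← zpow_one_add₀ (q_ne_zero q m)]; congr 1; ring
  unfold eulerConst tau
  rw [h]
  field_simp

theorem one_sub_sq_ne (q : ℝ) (m : ℕ) [Admissible q m] : ((1 - q ^ 2 : ℝ) : ℂ) ≠ 0 := by
  have h1 := q_pos q m
  have h2 := q_lt_one q m
  have : 1 - q ^ 2 ≠ 0 := by nlinarith
  exact_mod_cast this

/-- The Euler operator acts as `[deg]_{q²}` up to a multiple of `𝐱² Δ`. -/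
theorem euler_pd_eq (f : Pol q m) : ((1 - q ^ 2 : ℝ) : ℂ) • euler q m (mulXPol q m) (pd q m) f =
    f - scale q m (q ^ 2 : ℝ) f +
      (((1 - q ^ 2) * eulerConst q m : ℝ) : ℂ) • (normSq q m * laplacePol q m f) := by
  have : ((1 - q ^ 2 : ℝ) : ℂ) • euler q m (mulXPol q m) (pd q m) =
      LinearMap.id - (scale q m (q ^ 2 : ℝ)).toLinearMap +
      (((1 - q ^ 2) * eulerConst q m : ℝ) : ℂ) •
        (LinearMap.mulLeft ℂ (normSq q m) ∘ₗ laplacePol q m) := by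
    refine Pol.hom_ext_left q m ?_ fun j f hf => ?_
    · simp [euler, pd_one, laplacePol_apply]
    · have h := LinearMap.congr_fun ((isWeyl_pd q m).euler_mul q m (isQuad_mulXPol q m) j) f
      rw [sqOf_mulXPol] at h
      simp only [mulXPol, Module.End.mul_apply, Algebra.coe_lmul_eq_mul,
        LinearMap.mul_apply_apply, LinearMap.add_apply, LinearMap.smul_apply,
        LinearMap.sub_apply, LinearMap.id_apply, AlgHom.toLinearMap_apply, LinearMap.comp_apply,
        LinearMap.mulLeft_apply] at h hf ⊢
      have hf2 := congrArg (fun u => x q m j * u) hf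
      simp only [mul_smul_comm, mul_add, mul_sub] at hf2
      rw [h, smul_add, smul_add, smul_comm _ ((q ^ 2 : ℝ) : ℂ), hf2, scale_x_mul,
        laplacePol_x_mul, ← eulerConst_mul_mu, mul_add, mul_smul_comm, mul_smul_comm,
        ← mul_assoc (normSq q m), ← mul_assoc (x q m j), normSq_comm_x]
      push_cast
      module
  exact LinearMap.congr_fun this f

theorem euler_pd_apply (f : Pol q m) : euler q m (mulXPol q m) (pd q m) f =
    ∑ a, ((wt q m a : ℝ) : ℂ) • (x q m a * pd q m a.rev f) := by
  rw [euler]; simp [mulXPol, -Complex.coe_smul]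

theorem qNumber_sq_natCast (q : ℝ) (m : ℕ) [Admissible q m] (n : ℕ) :
    (1 - q ^ 2) * qNumber (q ^ 2) n = 1 - (q ^ 2) ^ n := by
  have h1 := q_pos q m
  have h2 := q_lt_one q m
  have : q ^ 2 - 1 ≠ 0 := by nlinarith
  unfold qNumber
  rw [Real.rpow_natCast]
  field_simp
  ring

variable {q m} in
/-- The Euler operator on homogeneous polynomials: `x^a C_{ab} ∂^b f = [d]_{q²} f + λ 𝐱² Δ f`. -/
theorem IsHomog.euler {d : ℕ} {f : Pol q m} (hf : IsHomog q m d f) :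
    ∑ a, ((wt q m a : ℝ) : ℂ) • (x q m a * QEuclid.pd q m a.rev f) =
      ((qNumber (q ^ 2) d : ℝ) : ℂ) • f +
      ((eulerConst q m : ℝ) : ℂ) • (normSq q m * QEuclid.laplacePol q m f) := by
  refine smul_right_injective _ (one_sub_sq_ne q m) ?_
  simp only
  rw [← euler_pd_apply, euler_pd_eq, hf.scale, smul_add, smul_smul, smul_smul,
    ← Complex.ofReal_mul, ← Complex.ofReal_mul, qNumber_sq_natCast q m]
  push_cast
  module

variable {q m} in
theorem IsHomog.laplacePol_normSq_mul {d : ℕ} {f : Pol q m} (hf : IsHomog q m d f) :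
    QEuclid.laplacePol q m (normSq q m * f) =
      ((q ^ 2 : ℝ) : ℂ) • (normSq q m * QEuclid.laplacePol q m f) +
      ((mu q m ^ 2 * qNumber (q ^ 2) (d + (m : ℝ) / 2) : ℝ) : ℂ) • f := by
  have hq := q_pos q m
  have h2 := q_lt_one q m
  have h := LinearMap.congr_fun ((isWeyl_pd q m).sqOf_mul_sqOf q m) f
  rw [sqOf_mulXPol] at h
  simp only [Module.End.mul_apply, Algebra.coe_lmul_eq_mul, LinearMap.add_apply,
    LinearMap.mul_apply_apply, LinearMap.smul_apply, Module.End.one_apply, ← laplacePol_eq] at h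
  rw [h, euler_pd_apply, hf.euler]
  have hm : mu q m * (q ^ m + q ^ 2) = mu q m ^ 2 * q ^ m := by
    have h3 : q ^ 2 = q ^ (2 - (m : ℤ)) * q ^ m := by
      rw [← zpow_natCast q m, ← zpow_add₀ hq.ne']; simp
    have h4 : mu q m = 1 + q ^ (2 - (m : ℤ)) := rfl
    rw [h3, pow_two, h4]; ring
  have hne : (1 - q ^ 2) ≠ 0 := by nlinarith
  have e1 : q ^ 4 + mu q m * (q ^ m + q ^ 2) * eulerConst q m = q ^ 2 := by
    have h5 : mu q m ^ 2 * q ^ m * eulerConst q m = q ^ 2 * (1 - q ^ 2) := by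
      have := (mu_pos q m).ne'
      have h3 : q ^ 2 = q ^ (2 - (m : ℤ)) * q ^ m := by
        rw [← zpow_natCast q m, ← zpow_add₀ hq.ne']; simp
      unfold eulerConst
      field_simp
      rw [mul_comm, ← h3]
    rw [hm, h5]; ring
  have e2 : mu q m * ∑ a, wt q m a ^ 2 + mu q m * (q ^ m + q ^ 2) * qNumber (q ^ 2) d =
      mu q m ^ 2 * qNumber (q ^ 2) (d + (m : ℝ) / 2) := by
    have ht := sum_wt_sq_total hq (Admissible.one_le (q := q) (m := m))
    have hn : (1 - q ^ 2) * qNumber (q ^ 2) (d + (m : ℝ) / 2) = 1 - (q ^ 2) ^ d * q ^ m := by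
      have : q ^ 2 - 1 ≠ 0 := by nlinarith
      have h6 : (q ^ 2) ^ ((m : ℝ) / 2) = q ^ m := by
        rw [← Real.rpow_natCast q 2, ← Real.rpow_mul hq.le, ← Real.rpow_natCast]
        congr 1; push_cast; ring
      unfold qNumber
      rw [Real.rpow_add (by positivity), Real.rpow_natCast, h6]
      field_simp
      ring
    have hn2 := qNumber_sq_natCast q m d
    refine mul_left_cancel₀ hne ?_
    linear_combination mu q m * ht + (1 - q ^ 2) * qNumber (q ^ 2) d * hm
      + mu q m ^ 2 * q ^ m * hn2 - mu q m ^ 2 * hn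
  generalize qNumber (q ^ 2) (d + (m : ℝ) / 2) = N at e2 ⊢
  generalize qNumber (q ^ 2) (d : ℝ) = n at e2 ⊢
  generalize normSq q m * QEuclid.laplacePol q m f = Z
  have e1' : ((q ^ 2 : ℝ) : ℂ) • Z =
    ((q ^ 4 + mu q m * (q ^ m + q ^ 2) * eulerConst q m : ℝ) : ℂ) • Z := by rw [e1]
  rw [e1', ← e2]
  push_cast
  module

/-! ### The derivatives of the second calculus -/

theorem scale_scale (c d : ℂ) (f : Pol q m) : scale q m c (scale q m d f) = scale q m (c * d) f := by
  have : (scale q m c).toLinearMap ∘ₗ (scale q m d).toLinearMap = (scale q m (c * d)).toLinearMap := by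
    refine Pol.hom_ext_left q m (by simp) fun j f hf => ?_
    simp only [AlgHom.toLinearMap_apply, LinearMap.comp_apply] at hf ⊢
    rw [scale_x_mul, scale_x_mul, map_smul, scale_x_mul, hf, smul_smul, mul_comm]
  exact LinearMap.congr_fun this f

/-- The skein relation, contracted with an arbitrary family. -/
theorem sum_rInv_smul {M : Type*} [AddCommGroup M] [Module ℂ M] (q : ℝ) (m : ℕ) (i j : Fin m)
    (V : Fin m → Fin m → M) : ∑ k, ∑ l, ((rInv q m i j k l : ℝ) : ℂ) • V k l =
      ∑ k, ∑ l, ((rEntry q m i j k l : ℝ) : ℂ) • V k l - ((q - q⁻¹ : ℝ) : ℂ) • V i j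
      + (((q - q⁻¹) * metric q m i j : ℝ) : ℂ) • ∑ a, ((wt q m a : ℝ) : ℂ) • V a a.rev := by
  have e : ∀ k l, ((rInv q m i j k l : ℝ) : ℂ) • V k l =
      ((rEntry q m i j k l : ℝ) : ℂ) • V k l
      - (((if i = k ∧ j = l then q - q⁻¹ else 0 : ℝ)) : ℂ) • V k l
      + (((q - q⁻¹) * metric q m i j : ℝ) : ℂ) • ((metric q m k l : ℝ) : ℂ) • V k l := by
    intro k l
    rw [← sub_smul, smul_smul, ← add_smul]
    congr 1
    rw [rInv, kEntry]
    push_cast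
    split_ifs <;> push_cast <;> ring
  simp only [e, Finset.sum_add_distrib, Finset.sum_sub_distrib, ← Finset.smul_sum,
    sum_sum_delta (q - q⁻¹) i j V, sum_sum_metric V]

/-- The operators `f ↦ (∂^i f - (1 - q²) μ⁻¹ x^i Δ f)(q⁻² 𝐱)` satisfy the defining relations of
`∂̄^i`. The skein relation exchanges `R̂⁻¹` for `R̂`; the Euler operator that it produces cancels
against the commutator of `Δ` and `x^j`, up to the dilation. -/
theorem isPartial_pdBar_aux : IsPartial q m (braid q m) q⁻¹ fun i =>
    (scale q m ((q ^ 2)⁻¹ : ℝ)).toLinearMap ∘ₗ (pd q m i -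
      (((1 - q ^ 2) / mu q m : ℝ) : ℂ) • (mulXPol q m i ∘ₗ laplacePol q m)) := by
  have hq := q_ne_zero q m
  have hmu := (mu_pos q m).ne'
  refine ⟨fun i => by simp [pd_one, laplacePol_apply], fun i j f => ?_⟩
  simp only [LinearMap.comp_apply, LinearMap.sub_apply, LinearMap.smul_apply, mulXPol,
    Algebra.coe_lmul_eq_mul, LinearMap.mul_apply_apply, AlgHom.toLinearMap_apply]
  have hs : ∀ k g, x q m k * scale q m ((q ^ 2)⁻¹ : ℝ) g =
      ((q ^ 2 : ℝ) : ℂ) • scale q m ((q ^ 2)⁻¹ : ℝ) (x q m k * g) := by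
    intro k g
    rw [scale_x_mul, smul_smul, ← Complex.ofReal_mul, mul_inv_cancel₀ (pow_ne_zero 2 hq)]
    simp
  have hf : f = scale q m ((q ^ 2)⁻¹ : ℝ) (scale q m (q ^ 2 : ℝ) f) := by
    rw [scale_scale, ← Complex.ofReal_mul, inv_mul_cancel₀ (pow_ne_zero 2 hq)]
    simp [scale_one]
  simp only [hs]
  rw [show ((metric q m i j : ℝ) : ℂ) • f = scale q m ((q ^ 2)⁻¹ : ℝ)
    (((metric q m i j : ℝ) : ℂ) • scale q m (q ^ 2 : ℝ) f) by rw [map_smul, ← hf]]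
  simp only [← map_smul, ← map_sum, ← map_add]
  congr 1
  have he := euler_pd_eq q m f
  rw [euler_pd_apply] at he
  have hb := congrArg (fun u => u * laplacePol q m f) ((isQuad_x q m).braid q m i j)
  simp only [Finset.sum_mul, add_mul, smul_mul_assoc, mul_assoc, ← normSq_eq] at hb
  -- expand `R̂⁻¹ = R̂ - (q - q⁻¹) (1 - K)`
  have hr : ∑ k, ∑ l, ((rInv q m i j k l : ℝ) : ℂ) • (x q m k * pd q m l f) =
      ∑ k, ∑ l, ((rEntry q m i j k l : ℝ) : ℂ) • (x q m k * pd q m l f)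
      - ((q - q⁻¹ : ℝ) : ℂ) • (x q m i * pd q m j f)
      + (((q - q⁻¹) * metric q m i j : ℝ) : ℂ) •
        ∑ a, ((wt q m a : ℝ) : ℂ) • (x q m a * pd q m a.rev f) := by
    exact sum_rInv_smul q m i j fun k l => x q m k * pd q m l f
  have hR : ∑ k, ∑ l, ((braid q m (i, j) (k, l) : ℝ) : ℂ) • ((q ^ 2 : ℝ) : ℂ) • (x q m k *
      (pd q m l f - (((1 - q ^ 2) / mu q m : ℝ) : ℂ) • (x q m l * laplacePol q m f))) =
      ((q ^ 2 : ℝ) : ℂ) • (∑ k, ∑ l, ((rEntry q m i j k l : ℝ) : ℂ) • (x q m k * pd q m l f)) -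
      ((q ^ 2 * ((1 - q ^ 2) / mu q m) : ℝ) : ℂ) •
        ∑ k, ∑ l, ((rEntry q m i j k l : ℝ) : ℂ) • (x q m k * (x q m l * laplacePol q m f)) := by
    simp only [Finset.smul_sum, ← Finset.sum_sub_distrib]
    refine Finset.sum_congr rfl fun k _ => Finset.sum_congr rfl fun l _ => ?_
    rw [mul_sub, mul_smul_comm]
    change ((rEntry q m i j k l : ℝ) : ℂ) • _ = _
    push_cast
    module
  have hE : (((q - q⁻¹) * metric q m i j : ℝ) : ℂ) •
        ∑ a, ((wt q m a : ℝ) : ℂ) • (x q m a * pd q m a.rev f) =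
      ((-q⁻¹ * metric q m i j : ℝ) : ℂ) • (f - scale q m (q ^ 2 : ℝ) f +
      (((1 - q ^ 2) * eulerConst q m : ℝ) : ℂ) • (normSq q m * laplacePol q m f)) := by
    rw [← he, smul_smul, ← Complex.ofReal_mul]
    congr 2
    field_simp
    ring
  rw [map_smul (scale q m (q ^ 2 : ℝ)), pd_x_mul, laplacePol_x_mul, hr, hE, hR, hb,
    mul_add, mul_smul_comm, mul_smul_comm]
  have hqq : (q : ℂ) * (q : ℂ)⁻¹ = 1 := mul_inv_cancel₀ (by exact_mod_cast hq)
  have hmm : (mu q m : ℂ) * (mu q m : ℂ)⁻¹ = 1 := mul_inv_cancel₀ (by exact_mod_cast hmu)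
  have hl : ((eulerConst q m : ℝ) : ℂ) = (q : ℂ) * (tau q m : ℂ) * (mu q m : ℂ)⁻¹ := by
    have h := eulerConst_mul_mu q m
    have h' : ((eulerConst q m : ℝ) : ℂ) * (mu q m : ℂ) = (q : ℂ) * (tau q m : ℂ) := by
      exact_mod_cast h
    rw [← h', mul_assoc, hmm, mul_one]
  push_cast
  rw [hl]
  have hqc : (q : ℂ) ≠ 0 := by exact_mod_cast hq
  have hmc : (mu q m : ℂ) ≠ 0 := by exact_mod_cast hmu
  match_scalars
  · linear_combination (-(metric q m i j : ℂ)) * hqq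
  all_goals
    field_simp
    try ring

end

section
variable (q : ℝ) (m : ℕ) [Admissible q m]

/-- The second calculus in terms of the first one. -/
theorem pdBar_apply (j : Fin m) (f : Pol q m) : pdBar q m j f =
    scale q m ((q ^ 2)⁻¹ : ℝ) (pd q m j f -
      (((1 - q ^ 2) / mu q m : ℝ) : ℂ) • (x q m j * laplacePol q m f)) := by
  have h : IsPartial q m (braid q m) q⁻¹ (pdBar q m) :=
    Classical.epsilon_spec (p := IsPartial q m (braid q m) q⁻¹) ⟨_, isPartial_pdBar_aux q m⟩
  rw [h.unique q m (isPartial_pdBar_aux q m)]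
  rfl

variable {q m} in
theorem IsHomog.pd_sub {d : ℕ} {f : Pol q m} (hf : IsHomog q m (d + 1) f) (j : Fin m) :
    IsHomog q m d (QEuclid.pd q m j f -
      (((1 - q ^ 2) / mu q m : ℝ) : ℂ) • (x q m j * QEuclid.laplacePol q m f)) := by
  rcases d with _ | d
  · rw [hf.laplacePol_eq_zero (by omega), mul_zero, smul_zero, sub_zero]
    exact hf.pd j
  · refine (hf.pd j).sub (IsHomog.smul _ ?_)
    rw [add_comm d 1]
    exact (isHomog_x q m j).mul hf.laplacePol

variable {q m} in
theorem IsHomog.pdBar_eq {d : ℕ} {f : Pol q m} (hf : IsHomog q m (d + 1) f) (j : Fin m) :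
    QEuclid.pdBar q m j f = (((q ^ 2)⁻¹ ^ d : ℝ) : ℂ) • (QEuclid.pd q m j f -
      (((1 - q ^ 2) / mu q m : ℝ) : ℂ) • (x q m j * QEuclid.laplacePol q m f)) := by
  rw [pdBar_apply, (hf.pd_sub j).scale]
  push_cast; rfl

variable {q m} in
theorem IsHomog.pdBar {d : ℕ} {f : Pol q m} (hf : IsHomog q m (d + 1) f) (j : Fin m) :
    IsHomog q m d (QEuclid.pdBar q m j f) := by
  rw [hf.pdBar_eq]
  exact (hf.pd_sub j).smul _

variable {q m} in
theorem IsHomog.pdBar_zero {f : Pol q m} (hf : IsHomog q m 0 f) (j : Fin m) :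
    QEuclid.pdBar q m j f = 0 := by
  rw [pdBar_apply, hf.pd_zero, hf.laplacePol_eq_zero (by omega)]
  simp

theorem sq_ne_one (q : ℝ) (m : ℕ) [Admissible q m] : q ^ 2 - 1 ≠ 0 := by
  have h1 := q_pos q m
  have h2 := q_lt_one q m
  nlinarith

theorem one_sub_mul_qNumber {p : ℝ} (hp : p ≠ 1) (u : ℝ) : (1 - p) * qNumber p u = 1 - p ^ u := by
  have : p - 1 ≠ 0 := sub_ne_zero.2 hp
  unfold qNumber
  field_simp
  ring

theorem sq_rpow_half : (q ^ 2) ^ ((m : ℝ) / 2) = q ^ m := by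
  have hq := q_pos q m
  rw [← Real.rpow_natCast q 2, ← Real.rpow_mul hq.le, ← Real.rpow_natCast]
  congr 1; push_cast; ring

theorem sq_lt_one' (q : ℝ) (m : ℕ) [Admissible q m] : q ^ 2 < 1 := by
  have h1 := q_pos q m
  have h2 := q_lt_one q m
  nlinarith

theorem qNumber_pos {p u : ℝ} (hp0 : 0 < p) (hp1 : p < 1) (hu : 0 < u) : 0 < qNumber p u := by
  unfold qNumber
  exact div_pos_of_neg_of_neg (by have := Real.rpow_lt_one hp0.le hp1 hu; linarith) (by linarith)

/-- `∂̄^j 𝐱² = q^{m-2} μ x^j + q⁻² 𝐱² ∂̄^j`. -/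
theorem pdBar_normSq_mul (j : Fin m) (f : Pol q m) :
    pdBar q m j (normSq q m * f) =
      ((q ^ ((m : ℤ) - 2) * mu q m : ℝ) : ℂ) • (x q m j * f) +
      (((q ^ 2)⁻¹ : ℝ) : ℂ) • (normSq q m * pdBar q m j f) := by
  have hq := q_pos q m
  have hmu := (mu_pos q m).ne'
  have : pdBar q m j ∘ₗ LinearMap.mulLeft ℂ (normSq q m) =
      ((q ^ ((m : ℤ) - 2) * mu q m : ℝ) : ℂ) • LinearMap.mulLeft ℂ (x q m j) +
      (((q ^ 2)⁻¹ : ℝ) : ℂ) • (LinearMap.mulLeft ℂ (normSq q m) ∘ₗ pdBar q m j) := by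
    refine Pol.hom_ext_homog q m fun d f hf => ?_
    simp only [LinearMap.comp_apply, LinearMap.mulLeft_apply, LinearMap.add_apply,
      LinearMap.smul_apply]
    have h2 : IsHomog q m (d + 1 + 1) (normSq q m * f) := by
      rw [show d + 1 + 1 = 2 + d by ring]
      exact (isHomog_normSq q m).mul hf
    rw [h2.pdBar_eq, pd_normSq_mul, hf.laplacePol_normSq_mul]
    have e : (((q ^ 2)⁻¹ : ℝ) : ℂ) • (normSq q m * pdBar q m j f) =
        (((q ^ 2)⁻¹ ^ (d + 1) * q ^ 2 : ℝ) : ℂ) • (normSq q m * (pd q m j f -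
        (((1 - q ^ 2) / mu q m : ℝ) : ℂ) • (x q m j * laplacePol q m f))) := by
      rcases d with _ | d
      · rw [hf.pdBar_zero, hf.pd_zero, hf.laplacePol_eq_zero (by omega)]
        simp
      · rw [hf.pdBar_eq, mul_smul_comm, smul_smul, ← Complex.ofReal_mul]
        congr 2
        have h3 : (q ^ 2)⁻¹ * q ^ 2 = 1 := inv_mul_cancel₀ (by positivity)
        rw [pow_succ _ (d + 1), pow_succ _ d]
        linear_combination (-((q ^ 2)⁻¹ ^ d * (q ^ 2)⁻¹)) * h3
    have e1 : q ^ ((m : ℤ) - 2) * mu q m = (q ^ 2)⁻¹ ^ (d + 1) *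
        (mu q m - (1 - q ^ 2) / mu q m * (mu q m ^ 2 * qNumber (q ^ 2) (d + (m : ℝ) / 2))) := by
      have hn := one_sub_mul_qNumber (sq_lt_one' q m).ne (d + (m : ℝ) / 2)
      rw [Real.rpow_add (by positivity), Real.rpow_natCast, sq_rpow_half] at hn
      have h3 : (1 - q ^ 2) / mu q m * (mu q m ^ 2 * qNumber (q ^ 2) (d + (m : ℝ) / 2)) =
          mu q m * (1 - (q ^ 2) ^ d * q ^ m) := by
        rw [← hn]; field_simp
      rw [h3, zpow_sub₀ hq.ne', zpow_natCast, inv_pow]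
      have : q ^ (2 : ℤ) = q ^ 2 := by norm_cast
      rw [this, pow_succ (q ^ 2) d]
      field_simp
      ring
    rw [e, e1]
    generalize qNumber (q ^ 2) (d + (m : ℝ) / 2) = N
    generalize (q ^ 2)⁻¹ ^ (d + 1) = t
    rw [mul_add (x q m j), mul_sub (normSq q m), mul_smul_comm, mul_smul_comm, mul_smul_comm,
      ← mul_assoc (x q m j), ← mul_assoc (normSq q m) (x q m j), normSq_comm_x]
    push_cast
    module
  exact LinearMap.congr_fun this f

/-! ### Spherical polynomials and the Fischer decomposition -/

/-- The identity of `q`-numbers behind the action of `Δ` on `𝐱^{2n} S_k`. -/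
theorem fischer_qNumber {p a : ℝ} (hp0 : 0 < p) (hp1 : p ≠ 1) (n : ℕ) :
    p * (qNumber p n * qNumber p (a + n - 1)) + qNumber p (2 * n + a) =
      qNumber p (n + 1) * qNumber p (a + n) := by
  have hne : (1 - p) ≠ 0 := sub_ne_zero.2 hp1.symm
  have h1 := one_sub_mul_qNumber hp1 n
  have h2 := one_sub_mul_qNumber hp1 (a + n - 1)
  have h3 := one_sub_mul_qNumber hp1 (2 * n + a)
  have h4 := one_sub_mul_qNumber hp1 (n + 1)
  have h5 := one_sub_mul_qNumber hp1 (a + n)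
  rw [Real.rpow_sub hp0, Real.rpow_add hp0, Real.rpow_one] at h2
  rw [two_mul, Real.rpow_add hp0, Real.rpow_add hp0] at h3
  rw [Real.rpow_add hp0, Real.rpow_one] at h4
  rw [Real.rpow_add hp0] at h5
  have h6 : p * (p ^ a * p ^ (n : ℝ) / p) = p ^ a * p ^ (n : ℝ) := by field_simp
  rw [← two_mul] at h3
  refine mul_left_cancel₀ hne (mul_left_cancel₀ hne ?_)
  set X := p ^ (n : ℝ)
  set Y := p ^ a
  linear_combination p * (1 - p) * qNumber p (a + n - 1) * h1 + p * (1 - X) * h2 + (1 - p) * h3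
    - (1 - p) * qNumber p (a + n) * h4 - (1 - X * p) * h5 - (1 - X) * h6

variable {q m}

/-- The scalar by which `Δ` lowers the power of `𝐱²` in `𝐱^{2(n+1)} S_k`. -/
def laplaceCoeff (q : ℝ) (m k n : ℕ) : ℝ :=
  mu q m ^ 2 * (qNumber (q ^ 2) (n + 1) * qNumber (q ^ 2) (k + (m : ℝ) / 2 + n))

theorem IsSpherical.laplacePol_mul {k : ℕ} {S : Pol q m} (hS : IsSpherical q m k S) (n : ℕ) :
    laplacePol q m (normSq q m ^ (n + 1) * S) =
      ((laplaceCoeff q m k n : ℝ) : ℂ) • (normSq q m ^ n * S) := by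
  have hq := q_pos q m
  have hp : (0 : ℝ) < q ^ 2 := by positivity
  have hp1 := (sq_lt_one' q m).ne
  have key : ∀ n : ℕ, laplacePol q m (normSq q m ^ n * S) =
      ((mu q m ^ 2 * (qNumber (q ^ 2) n * qNumber (q ^ 2) (k + (m : ℝ) / 2 + n - 1)) : ℝ) : ℂ) •
        (normSq q m ^ (n - 1) * S) := by
    intro n
    induction n with
    | zero => rw [pow_zero, one_mul, hS.2]; simp [qNumber]
    | succ n ih =>
      have hh : IsHomog q m (2 * n + k) (normSq q m ^ n * S) :=
        (isHomog_normSq_pow q m n).mul hS.1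
      rw [pow_succ', mul_assoc, hh.laplacePol_normSq_mul, ih]
      have hf := fischer_qNumber (a := k + (m : ℝ) / 2) hp hp1 n
      have e : mu q m ^ 2 * (qNumber (q ^ 2) (n + 1 : ℕ) *
          qNumber (q ^ 2) (k + (m : ℝ) / 2 + (n + 1 : ℕ) - 1)) =
          q ^ 2 * (mu q m ^ 2 * (qNumber (q ^ 2) n * qNumber (q ^ 2) (k + (m : ℝ) / 2 + n - 1))) +
          mu q m ^ 2 * qNumber (q ^ 2) ((2 * n + k : ℕ) + (m : ℝ) / 2) := by
        push_cast
        rw [show (k : ℝ) + m / 2 + (n + 1) - 1 = k + m / 2 + n by ring, ← hf,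
          show (2 * (n : ℝ) + k + m / 2) = 2 * n + (k + m / 2) by ring]
        ring
      rw [e]
      rcases n with _ | n
      · have : qNumber (q ^ 2) ((0 : ℕ) : ℝ) = 0 := by simp [qNumber]
        rw [this]
        simp
      · simp only [Nat.add_sub_cancel]
        rw [mul_smul_comm, ← mul_assoc (normSq q m) (normSq q m ^ n), ← pow_succ']
        push_cast
        module
  rw [key, laplaceCoeff]
  push_cast
  rw [show (k : ℝ) + m / 2 + (n + 1) - 1 = k + m / 2 + n by ring]

theorem one_le_m (q : ℝ) (m : ℕ) [Admissible q m] : 1 ≤ m := Admissible.one_le (q := q)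

theorem laplaceCoeff_pos (k n : ℕ) : 0 < laplaceCoeff q m k n := by
  have hq := q_pos q m
  have hp : (0 : ℝ) < q ^ 2 := by positivity
  have hm : (0 : ℝ) < m := by exact_mod_cast one_le_m q m
  have := mu_pos q m
  unfold laplaceCoeff
  have h1 : 0 < qNumber (q ^ 2) (n + 1) := qNumber_pos hp (sq_lt_one' q m) (by positivity)
  have h2 : 0 < qNumber (q ^ 2) (k + (m : ℝ) / 2 + n) :=
    qNumber_pos hp (sq_lt_one' q m) (by positivity)
  positivity

theorem IsSpherical.laplacePol_pow {k : ℕ} {S : Pol q m} (hS : IsSpherical q m k S) (N n : ℕ) :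
    (laplacePol q m ^ N) (normSq q m ^ (n + N) * S) =
      ((∏ i ∈ Finset.range N, laplaceCoeff q m k (n + i) : ℝ) : ℂ) • (normSq q m ^ n * S) := by
  induction N with
  | zero => simp
  | succ N ih =>
    rw [pow_succ, Module.End.mul_apply, ← add_assoc, hS.laplacePol_mul, map_smul, ih, smul_smul,
      Finset.prod_range_succ, mul_comm]
    push_cast; rfl

theorem IsSpherical.laplacePol_pow_eq_zero {k : ℕ} {S : Pol q m} (hS : IsSpherical q m k S)
    {N n : ℕ} (h : n < N) : (laplacePol q m ^ N) (normSq q m ^ n * S) = 0 := by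
  obtain ⟨M, rfl⟩ : ∃ M, N = M + (n + 1) := ⟨N - (n + 1), by omega⟩
  have := hS.laplacePol_pow n 0
  rw [zero_add] at this
  rw [pow_add, Module.End.mul_apply, pow_succ', Module.End.mul_apply, this, map_smul, pow_zero,
    one_mul, hS.2, smul_zero, map_zero]

/-- The coefficient in `x^j S_k = S_{k+1} + c_k 𝐱² ∂^j S_k`. For `k = 0` its value, possibly the
inverse of zero, does not matter, as `∂^j S_0 = 0`. -/
def contractCoeff (q : ℝ) (m k : ℕ) : ℝ := (mu q m * qNumber (q ^ 2) (k - 1 + (m : ℝ) / 2))⁻¹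

theorem IsSpherical.pd {k : ℕ} {S : Pol q m} (hS : IsSpherical q m (k + 1) S) (j : Fin m) :
    IsSpherical q m k (pd q m j S) :=
  ⟨IsHomog.pd hS.1 j, by rw [laplacePol_pd, hS.2, map_zero]⟩

theorem IsSpherical.pd_zero {S : Pol q m} (hS : IsSpherical q m 0 S) (j : Fin m) :
    QEuclid.pd q m j S = 0 := IsHomog.pd_zero hS.1 j

/-- The harmonic part of `x^j S_k`. -/
theorem IsSpherical.raise {k : ℕ} {S : Pol q m} (hS : IsSpherical q m k S) (j : Fin m) :
    IsSpherical q m (k + 1) (x q m j * S -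
      ((contractCoeff q m k : ℝ) : ℂ) • (normSq q m * QEuclid.pd q m j S)) := by
  rcases k with _ | k
  · rw [hS.pd_zero, mul_zero, smul_zero, sub_zero]
    have h : IsHomog q m (0 + 1) (x q m j * S) := by
      rw [add_comm]; exact (isHomog_x q m j).mul hS.1
    exact ⟨h, h.laplacePol_eq_zero (by omega)⟩
  · have hT := hS.pd j
    refine ⟨IsHomog.sub ?_ (IsHomog.smul _ ?_), ?_⟩
    · rw [add_comm]; exact (isHomog_x q m j).mul hS.1
    · rw [show k + 1 + 1 = 2 + k by ring]; exact (isHomog_normSq q m).mul hT.1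
    · have h := hT.laplacePol_mul 0
      rw [zero_add, pow_one, pow_zero, one_mul] at h
      rw [map_sub, map_smul, h, laplacePol_x_mul, hS.2, mul_zero, smul_zero, add_zero, smul_smul,
        ← Complex.ofReal_mul]
      have hq := q_pos q m
      have hp : (0 : ℝ) < q ^ 2 := by positivity
      have hm : (0 : ℝ) < m := by exact_mod_cast one_le_m q m
      have hmu := mu_pos q m
      have h2 : 0 < qNumber (q ^ 2) (k + (m : ℝ) / 2) :=
        qNumber_pos hp (sq_lt_one' q m) (by positivity)
      have h1 : qNumber (q ^ 2) 1 = 1 := by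
        have := sq_ne_one q m
        unfold qNumber; rw [Real.rpow_one]; field_simp
      have e : contractCoeff q m (k + 1) * laplaceCoeff q m k 0 = mu q m := by
        unfold contractCoeff laplaceCoeff
        push_cast
        rw [add_sub_cancel_right, add_zero, zero_add, h1]
        generalize qNumber (q ^ 2) (k + (m : ℝ) / 2) = Q at h2
        field_simp
      rw [e, sub_self]

theorem IsSpherical.x_mul {k : ℕ} {S : Pol q m} (_ : IsSpherical q m k S) (j : Fin m) :
    x q m j * S = (x q m j * S -
      ((contractCoeff q m k : ℝ) : ℂ) • (normSq q m * QEuclid.pd q m j S)) +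
      ((contractCoeff q m k : ℝ) : ℂ) • (normSq q m * QEuclid.pd q m j S) := by
  abel

theorem IsSpherical.pdBar_eq {k : ℕ} {S : Pol q m} (hS : IsSpherical q m (k + 1) S) (j : Fin m) :
    pdBar q m j S = (((q ^ 2)⁻¹ ^ k : ℝ) : ℂ) • QEuclid.pd q m j S := by
  rw [IsHomog.pdBar_eq hS.1, hS.2, mul_zero, smul_zero, sub_zero]

variable (q m)

/-- The space `𝒮_k` of spherical polynomials. -/
def sphSpace (k : ℕ) : Submodule ℂ (Pol q m) where
  carrier := {S | IsSpherical q m k S}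
  add_mem' hf hg := ⟨IsHomog.add hf.1 hg.1, by rw [map_add, hf.2, hg.2, add_zero]⟩
  zero_mem' := ⟨isHomog_zero k, map_zero _⟩
  smul_mem' c _ hf := ⟨IsHomog.smul c hf.1, by rw [map_smul, hf.2, smul_zero]⟩

theorem isSpherical_one : IsSpherical q m 0 1 :=
  ⟨isHomog_one, (isHomog_one (q := q) (m := m)).laplacePol_eq_zero (by omega)⟩

/-- The polynomials `S_k 𝐱^{2n}` with `S_k` spherical span `𝒫`. -/
theorem Pol.spherical_induction {p : Submodule ℂ (Pol q m)}
    (h : ∀ k n S, IsSpherical q m k S → S * normSq q m ^ n ∈ p) (f : Pol q m) : f ∈ p := by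
  have : f ∈ Submodule.span ℂ {P | ∃ k n S, IsSpherical q m k S ∧ P = S * normSq q m ^ n} := by
    refine Pol.induction q m
      (p := Submodule.span ℂ {P | ∃ k n S, IsSpherical q m k S ∧ P = S * normSq q m ^ n})
      (Submodule.subset_span ⟨0, 0, 1, isSpherical_one q m, by simp⟩) ?_ f
    intro j f hf
    induction hf using Submodule.span_induction with
    | mem P hP =>
      obtain ⟨k, n, S, hS, rfl⟩ := hP
      have e : x q m j * (S * normSq q m ^ n) = (x q m j * S -
          ((contractCoeff q m k : ℝ) : ℂ) • (normSq q m * pd q m j S)) * normSq q m ^ n +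
          ((contractCoeff q m k : ℝ) : ℂ) • (pd q m j S * normSq q m ^ (n + 1)) := by
        conv_lhs => rw [← mul_assoc, hS.x_mul j, add_mul, smul_mul_assoc]
        congr 2
        rw [normSq_comm, mul_assoc, pow_succ']
      rw [e]
      refine Submodule.add_mem _ (Submodule.subset_span ⟨k + 1, n, _, hS.raise j, rfl⟩)
        (Submodule.smul_mem _ _ ?_)
      rcases k with _ | k
      · rw [hS.pd_zero, zero_mul]; exact Submodule.zero_mem _
      · exact Submodule.subset_span ⟨k, n + 1, _, hS.pd j, rfl⟩
    | zero => rw [mul_zero]; exact Submodule.zero_mem _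
    | add f g _ _ hf hg => rw [mul_add]; exact Submodule.add_mem _ hf hg
    | smul c f _ hf => rw [mul_smul_comm]; exact Submodule.smul_mem _ _ hf
  refine (Submodule.span_le.2 ?_) this
  rintro _ ⟨k, n, S, hS, rfl⟩
  exact h k n S hS

theorem Pol.hom_ext_spherical {M : Type*} [AddCommMonoid M] [Module ℂ M] {F G : Pol q m →ₗ[ℂ] M}
    (h : ∀ k n S, IsSpherical q m k S → F (S * normSq q m ^ n) = G (S * normSq q m ^ n)) :
    F = G :=
  LinearMap.ext fun f => Pol.spherical_induction q m (p := LinearMap.eqLocus F G) h f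

/-- The map that assembles a polynomial from its spherical components: the component at `(k, n)` is
multiplied by `𝐱^{2n}`. -/
def fischerMap : ((ℕ × ℕ) →₀ Pol q m) →ₗ[ℂ] Pol q m :=
  Finsupp.lsum ℂ fun kn => LinearMap.mulRight ℂ (normSq q m ^ kn.2)

theorem fischerMap_apply (S : (ℕ × ℕ) →₀ Pol q m) :
    fischerMap q m S = S.sum fun kn P => P * normSq q m ^ kn.2 := by
  rw [fischerMap, Finsupp.lsum_apply]
  rfl

/-- The families whose component at `(k, n)` is spherical of degree `k`. -/
def sphFamilies : Submodule ℂ ((ℕ × ℕ) →₀ Pol q m) where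
  carrier := {S | ∀ kn, IsSpherical q m kn.1 (S kn)}
  add_mem' hf hg kn := (sphSpace q m kn.1).add_mem (hf kn) (hg kn)
  zero_mem' := fun kn => show IsSpherical q m kn.1 0 from (sphSpace q m kn.1).zero_mem
  smul_mem' c _ hf kn := (sphSpace q m kn.1).smul_mem c (hf kn)

theorem normSq_pow_comm (n : ℕ) (f : Pol q m) : f * normSq q m ^ n = normSq q m ^ n * f := by
  have : Commute f (normSq q m) := (normSq_comm q m f).symm
  exact this.pow_right n

/-- Uniqueness of the spherical components. -/
theorem eq_zero_of_fischerMap {S : (ℕ × ℕ) →₀ Pol q m} (hS : S ∈ sphFamilies q m)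
    (h : fischerMap q m S = 0) : S = 0 := by
  by_contra hne
  -- Take a component with the highest power `N` of `𝐱²`. The part of degree `k` of `Δ^N` of the sum
  -- is a nonzero multiple of it.
  obtain ⟨⟨k, N⟩, hkN, hmax⟩ := S.support.exists_max_image (fun kn => kn.2)
    (Finsupp.support_nonempty_iff.2 hne)
  rw [fischerMap_apply, Finsupp.sum] at h
  have h2 := congrArg (fun f => homComp q m k ((laplacePol q m ^ N) f)) h
  simp only [map_sum, map_zero] at h2
  rw [Finset.sum_eq_single (k, N)] at h2
  · have h3 := (hS (k, N)).laplacePol_pow N 0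
    simp only [zero_add, pow_zero, one_mul] at h3
    rw [normSq_pow_comm, h3, map_smul, IsHomog.homComp (hS (k, N)).1, if_pos rfl, smul_eq_zero] at h2
    rcases h2 with h2 | h2
    · have h4 : 0 < ∏ i ∈ Finset.range N, laplaceCoeff q m k i :=
        Finset.prod_pos fun i _ => laplaceCoeff_pos k i
      exact h4.ne' (by exact_mod_cast h2)
    · exact (Finsupp.mem_support_iff.1 hkN) h2
  · rintro ⟨k', n⟩ hk' hn
    have hle : n ≤ N := hmax _ hk'
    rcases hle.lt_or_eq with hlt | rfl
    · rw [normSq_pow_comm, (hS (k', n)).laplacePol_pow_eq_zero hlt, map_zero]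
    · have h3 := (hS (k', n)).laplacePol_pow n 0
      simp only [zero_add, pow_zero, one_mul] at h3
      have hk : k ≠ k' := fun h => hn (by rw [h])
      rw [normSq_pow_comm, h3, map_smul, IsHomog.homComp (hS (k', n)).1, if_neg hk, smul_zero]
  · intro hn; exact absurd hkN hn

/-- The Fischer decomposition: every polynomial is uniquely a sum of terms `S_k 𝐱^{2n}`. -/
def fischerEquiv : sphFamilies q m ≃ₗ[ℂ] Pol q m :=
  LinearEquiv.ofBijective (fischerMap q m ∘ₗ (sphFamilies q m).subtype) (by
    constructor
    · intro S T h
      have h1 : fischerMap q m S.1 = fischerMap q m T.1 := h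
      have h2 : fischerMap q m (S.1 + (-1 : ℂ) • T.1) = 0 := by
        rw [map_add, map_smul, h1]
        module
      have h3 := eq_zero_of_fischerMap q m
        ((sphFamilies q m).add_mem S.2 ((sphFamilies q m).smul_mem (-1) T.2)) h2
      refine Subtype.ext (Finsupp.ext fun kn => ?_)
      have h4 : S.1 kn + (-1 : ℂ) • T.1 kn = 0 := by
        simpa only [Finsupp.add_apply, Finsupp.smul_apply, Finsupp.zero_apply] using
          DFunLike.congr_fun h3 kn
      calc S.1 kn = (S.1 kn + (-1 : ℂ) • T.1 kn) + T.1 kn := by module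
        _ = T.1 kn := by rw [h4, zero_add]
    · intro f
      refine Pol.spherical_induction q m (p := LinearMap.range _) (fun k n S hS => ?_) f
      refine ⟨⟨Finsupp.single (k, n) S, fun kn => ?_⟩, ?_⟩
      · rw [Finsupp.single_apply]
        split_ifs with h
        · rw [← h]; exact hS
        · exact (sphSpace q m kn.1).zero_mem
      · simp [fischerMap])

/-- The linear map on `𝒫` with prescribed values on the terms `S_k 𝐱^{2n}`. -/
def fischerLift {M : Type*} [AddCommMonoid M] [Module ℂ M] (φ : ℕ × ℕ → Pol q m →ₗ[ℂ] M) :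
    Pol q m →ₗ[ℂ] M :=
  Finsupp.lsum ℂ φ ∘ₗ (sphFamilies q m).subtype ∘ₗ (fischerEquiv q m).symm.toLinearMap

theorem fischerLift_fischerMap {M : Type*} [AddCommMonoid M] [Module ℂ M]
    (φ : ℕ × ℕ → Pol q m →ₗ[ℂ] M) {S : (ℕ × ℕ) →₀ Pol q m} (hS : S ∈ sphFamilies q m) :
    fischerLift q m φ (fischerMap q m S) = S.sum fun kn P => φ kn P := by
  have : (fischerEquiv q m).symm (fischerMap q m S) = ⟨S, hS⟩ := by
    rw [LinearEquiv.symm_apply_eq]; rfl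
  rw [fischerLift, LinearMap.comp_apply, LinearMap.comp_apply, LinearEquiv.coe_coe, this]
  simp [Finsupp.lsum_apply]

theorem fischerLift_apply {M : Type*} [AddCommMonoid M] [Module ℂ M]
    (φ : ℕ × ℕ → Pol q m →ₗ[ℂ] M) {k : ℕ} {S : Pol q m} (hS : IsSpherical q m k S) (n : ℕ) :
    fischerLift q m φ (S * normSq q m ^ n) = φ (k, n) S := by
  have h : Finsupp.single (k, n) S ∈ sphFamilies q m := by
    intro kn
    rw [Finsupp.single_apply]
    split_ifs with h
    · rw [← h]; exact hS
    · exact (sphSpace q m kn.1).zero_mem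
  have h2 : fischerMap q m (Finsupp.single (k, n) S) = S * normSq q m ^ n := by
    simp [fischerMap, Finsupp.lsum_apply]
  rw [← h2, fischerLift_fischerMap q m φ h]
  simp

end

/-! ### The `q`-Gamma function -/

theorem summable_geom_mul {p : ℝ} (hp0 : 0 < p) (hp1 : p < 1) (a : ℝ) :
    Summable fun k : ℕ => ‖-(a * p ^ k)‖ := by
  have h : Summable fun k : ℕ => ‖a‖ * p ^ k :=
    (summable_geometric_of_lt_one hp0.le hp1).mul_left _
  refine h.congr fun k => ?_
  rw [norm_neg, norm_mul, Real.norm_of_nonneg (pow_nonneg hp0.le k)]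

theorem multipliable_qPoch {p : ℝ} (hp0 : 0 < p) (hp1 : p < 1) (a : ℝ) :
    Multipliable fun k : ℕ => 1 - a * p ^ k := by
  have := multipliable_one_add_of_summable (summable_geom_mul hp0 hp1 a)
  simpa only [← sub_eq_add_neg] using this

theorem qPochInf_eq_mul {p : ℝ} (hp0 : 0 < p) (hp1 : p < 1) (a : ℝ) :
    qPochInf a p = (1 - a) * qPochInf (a * p) p := by
  unfold qPochInf
  have h : ∀ k : ℕ, 1 - a * p * p ^ k = 1 - a * p ^ (k + 1) := fun k => by rw [pow_succ']; ring
  simp only [h]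
  rw [tprod_eq_zero_mul' (f := fun k : ℕ => 1 - a * p ^ k)]
  · simp
  · simpa only [← h] using multipliable_qPoch hp0 hp1 (a * p)

theorem qPochInf_ne_zero {p : ℝ} (hp0 : 0 < p) (hp1 : p < 1) {a : ℝ} (ha : ∀ k : ℕ, a * p ^ k ≠ 1) :
    qPochInf a p ≠ 0 := by
  have := tprod_one_add_ne_zero_of_summable (f := fun k : ℕ => -(a * p ^ k))
    (fun k h => ha k (by linarith)) (summable_geom_mul hp0 hp1 a)
  simpa only [← sub_eq_add_neg, qPochInf] using this

theorem qPochInf_rpow_ne_zero {p : ℝ} (hp0 : 0 < p) (hp1 : p < 1) {t : ℝ} (ht : 0 < t) :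
    qPochInf (p ^ t) p ≠ 0 := by
  refine qPochInf_ne_zero hp0 hp1 fun k => ?_
  have h1 := Real.rpow_lt_one hp0.le hp1 ht
  have h2 : p ^ k ≤ 1 := pow_le_one₀ hp0.le hp1.le
  have h3 : 0 < p ^ t := Real.rpow_pos_of_pos hp0 t
  have h4 : 0 < p ^ k := pow_pos hp0 k
  nlinarith

theorem qGamma_ne_zero {p : ℝ} (hp0 : 0 < p) (hp1 : p < 1) {t : ℝ} (ht : 0 < t) :
    qGamma p t ≠ 0 := by
  unfold qGamma
  have h1 := qPochInf_rpow_ne_zero hp0 hp1 ht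
  have h2 := qPochInf_rpow_ne_zero hp0 hp1 one_pos
  rw [Real.rpow_one] at h2
  have h3 : (1 - p) ^ (1 - t) ≠ 0 := (Real.rpow_pos_of_pos (by linarith) _).ne'
  exact mul_ne_zero (div_ne_zero h2 h1) h3

theorem qGamma_add_one {p : ℝ} (hp0 : 0 < p) (hp1 : p < 1) {t : ℝ} (ht : 0 < t) :
    qGamma p (t + 1) = qNumber p t * qGamma p t := by
  have h1 := qPochInf_rpow_ne_zero hp0 hp1 ht
  have h2 := qPochInf_rpow_ne_zero hp0 hp1 (t := t + 1) (by linarith)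
  have h3 := qPochInf_eq_mul hp0 hp1 (p ^ t)
  rw [← Real.rpow_add_one hp0.ne'] at h3
  have h4 : (1 - p) ^ (1 - t) = (1 - p) ^ (1 - (t + 1)) * (1 - p) := by
    rw [← Real.rpow_add_one (by linarith : (1 - p) ≠ 0)]
    congr 1; ring
  have h5 := one_sub_mul_qNumber hp1.ne t
  have h6 : 1 - p ^ t ≠ 0 := fun h => h1 (by rw [h3, h, zero_mul])
  unfold qGamma
  rw [h4, h3]
  field_simp
  rw [← h5]; ring

theorem qFactorial_succ (p : ℝ) (n : ℕ) :
    qFactorial p (n + 1) = qFactorial p n * qNumber p ((n : ℝ) + 1) := by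
  unfold qFactorial; rw [Finset.prod_range_succ]

theorem qFactorial_pos {p : ℝ} (hp0 : 0 < p) (hp1 : p < 1) (n : ℕ) : 0 < qFactorial p n :=
  Finset.prod_pos fun k _ => qNumber_pos hp0 hp1 (by positivity)

/-! ### The integral over the quantum sphere -/

section
variable (q : ℝ) (m : ℕ) [Admissible q m]

/-- The coefficients of the Pizzetti formula. -/
def pizzetti (q : ℝ) (m k : ℕ) : ℝ :=
  2 * qGamma (q ^ 2) (1 / 2) ^ m /
      (mu q m ^ (2 * k) * qFactorial (q ^ 2) k * qGamma (q ^ 2) ((k : ℝ) + (m : ℝ) / 2))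

theorem sq_pos' (q : ℝ) (m : ℕ) [Admissible q m] : 0 < q ^ 2 := pow_pos (q_pos q m) 2

theorem half_m_pos (q : ℝ) (m : ℕ) [Admissible q m] : 0 < (m : ℝ) / 2 := by
  have : (0 : ℝ) < m := by exact_mod_cast one_le_m q m
  positivity

/-- The coefficients of the Pizzetti formula compensate the action of `Δ` on the powers of `𝐱²`.
-/
theorem pizzetti_succ (k : ℕ) : pizzetti q m (k + 1) * laplaceCoeff q m 0 k = pizzetti q m k := by
  have hp := sq_pos' q m
  have hp1 := sq_lt_one' q m
  have hm := half_m_pos q m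
  have h0 : 0 < (k : ℝ) + m / 2 := by positivity
  have h1 := qGamma_ne_zero hp hp1 h0
  have h2 := qGamma_add_one hp hp1 h0
  have h3 := (qFactorial_pos hp hp1 k).ne'
  have h4 := (qNumber_pos hp hp1 (u := (k : ℝ) + 1) (by positivity)).ne'
  have h5 := (qNumber_pos hp hp1 h0).ne'
  have h6 := (mu_pos q m).ne'
  unfold pizzetti laplaceCoeff
  push_cast
  rw [show (k : ℝ) + 1 + m / 2 = k + m / 2 + 1 by ring, h2, qFactorial_succ,
    show (0 : ℝ) + m / 2 + k = k + m / 2 by ring, show 2 * (k + 1) = 2 * k + 2 by ring, pow_add]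
  generalize qGamma (q ^ 2) ((k : ℝ) + m / 2) = G at h1
  generalize qNumber (q ^ 2) ((k : ℝ) + m / 2) = A at h5
  field_simp

theorem pizzetti_mul_prod (n : ℕ) :
    pizzetti q m n * ∏ i ∈ Finset.range n, laplaceCoeff q m 0 i = pizzetti q m 0 := by
  induction n with
  | zero => simp
  | succ n ih =>
    rw [Finset.prod_range_succ, mul_comm (∏ i ∈ _, _), ← mul_assoc, pizzetti_succ, ih]

variable {q m} in
theorem IsHomog.laplacePol_pow {d : ℕ} {f : Pol q m} (N : ℕ) (hf : IsHomog q m (d + 2 * N) f) :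
    IsHomog q m d ((QEuclid.laplacePol q m ^ N) f) := by
  induction N generalizing d with
  | zero => simpa using hf
  | succ N ih =>
    rw [pow_succ', Module.End.mul_apply]
    exact IsHomog.laplacePol (ih (by rw [show d + 2 + 2 * N = d + 2 * (N + 1) by ring]; exact hf))

variable {q m} in
theorem IsHomog.evalZero_laplacePol_pow {d N : ℕ} {f : Pol q m} (hf : IsHomog q m d f)
    (h : d ≠ 2 * N) : QEuclid.evalZero q m ((QEuclid.laplacePol q m ^ N) f) = 0 := by
  rcases Nat.lt_or_ge d (2 * N) with h1 | h1
  · have key : ∀ N d, ∀ f : Pol q m, IsHomog q m d f → d < 2 * N →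
        (QEuclid.laplacePol q m ^ N) f = 0 := by
      intro N
      induction N with
      | zero => intro d f _ h; omega
      | succ N ih =>
        intro d f hf h
        rw [pow_succ, Module.End.mul_apply]
        rcases Nat.lt_or_ge d 2 with h2 | h2
        · rw [hf.laplacePol_eq_zero h2, map_zero]
        · obtain ⟨e, rfl⟩ : ∃ e, d = e + 2 := ⟨d - 2, by omega⟩
          exact ih e _ hf.laplacePol (by omega)
    rw [key N d f hf h1, map_zero]
  · obtain ⟨e, rfl⟩ : ∃ e, d = e + 1 + 2 * N := ⟨d - 2 * N - 1, by omega⟩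
    exact (hf.laplacePol_pow N).evalZero

variable {q m} in
theorem IsHomog.sphereInt {d : ℕ} {f : Pol q m} (hf : IsHomog q m d f) :
    QEuclid.sphereInt q m f = ∑ k ∈ Finset.range (d + 1),
      ((pizzetti q m k : ℝ) : ℂ) • QEuclid.evalZero q m ((QEuclid.laplacePol q m ^ k) f) := by
  rw [QEuclid.sphereInt, LinearMap.comp_apply, AlgHom.toLinearMap_apply, hf]
  rw [Polynomial.lsum_apply, Polynomial.sum_monomial_index _ _ (by simp)]
  simp only [LinearMap.sum_apply, LinearMap.smul_apply, LinearMap.comp_apply,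
    AlgHom.toLinearMap_apply]
  rfl

variable {q m} in
theorem IsHomog.sphereInt_even {N : ℕ} {f : Pol q m} (hf : IsHomog q m (2 * N) f) :
    QEuclid.sphereInt q m f =
      ((pizzetti q m N : ℝ) : ℂ) * QEuclid.evalZero q m ((QEuclid.laplacePol q m ^ N) f) := by
  rw [hf.sphereInt, Finset.sum_eq_single N]
  · rw [smul_eq_mul]
  · intro k _ hk
    rw [hf.evalZero_laplacePol_pow (by omega), smul_zero]
  · intro h; exact absurd (Finset.mem_range.2 (by omega)) h

variable {q m} in
theorem IsHomog.sphereInt_odd {d : ℕ} {f : Pol q m} (hf : IsHomog q m d f) (hd : ¬ Even d) :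
    QEuclid.sphereInt q m f = 0 := by
  rw [hf.sphereInt]
  refine Finset.sum_eq_zero fun k _ => ?_
  rw [hf.evalZero_laplacePol_pow (fun h => hd ⟨k, by omega⟩), smul_zero]

/-- Among the terms `S_k 𝐱^{2n}` only those with `k = 0` contribute to the integral over the
sphere. -/
theorem sphereInt_spherical {k n : ℕ} {S : Pol q m} (hS : IsSpherical q m k S) :
    sphereInt q m (S * normSq q m ^ n) =
      if k = 0 then ((pizzetti q m 0 : ℝ) : ℂ) * evalZero q m S else 0 := by
  have hh : IsHomog q m (k + 2 * n) (S * normSq q m ^ n) :=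
    IsHomog.mul hS.1 (isHomog_normSq_pow q m n)
  split_ifs with hk
  · subst hk
    rw [zero_add] at hh
    have h := hS.laplacePol_pow n 0
    rw [zero_add, pow_zero, one_mul] at h
    rw [hh.sphereInt_even, normSq_pow_comm, h, map_smul, smul_eq_mul, ← mul_assoc,
      ← Complex.ofReal_mul]
    simp only [zero_add, pizzetti_mul_prod]
  · by_cases he : Even (k + 2 * n)
    · obtain ⟨N, hN⟩ := he
      rw [show N + N = 2 * N by ring] at hN
      rw [hN] at hh
      rw [hh.sphereInt_even, normSq_pow_comm, hS.laplacePol_pow_eq_zero (by omega), map_zero,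
        mul_zero]
    · exact hh.sphereInt_odd he

/-- `𝐱² = 1` on the sphere. -/
theorem sphereInt_mul_normSq_pow (f : Pol q m) (n : ℕ) :
    sphereInt q m (f * normSq q m ^ n) = sphereInt q m f := by
  have : sphereInt q m ∘ₗ LinearMap.mulRight ℂ (normSq q m ^ n) = sphereInt q m := by
    refine Pol.hom_ext_spherical q m fun k i S hS => ?_
    rw [LinearMap.comp_apply, LinearMap.mulRight_apply, mul_assoc, ← pow_add,
      sphereInt_spherical q m hS, sphereInt_spherical q m hS]
  exact LinearMap.congr_fun this f

end

/-! ### Spherical polynomials under powers of the Laplace operator -/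

section
variable (q : ℝ) (m : ℕ) [Admissible q m]

/-- The differential operator `R(∂)` of a polynomial `R`. -/
def diffOp : Pol q m →ₐ[ℂ] Module.End ℂ (Pol q m) :=
  RingQuot.liftAlgHom ℂ ⟨FreeAlgebra.lift ℂ (pd q m), by
    rintro _ _ ⟨i, j⟩
    simp only [map_sum, map_smul, map_mul, FreeAlgebra.lift_ι_apply, map_zero, antisymProj_eq,
      Complex.ofReal_mul, mul_smul, ← Finset.smul_sum]
    rw [isQuad_pd q m i j, smul_zero]⟩

theorem diffOp_x (j : Fin m) : diffOp q m (x q m j) = pd q m j := by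
  simp [diffOp, x]

theorem diffOp_normSq : diffOp q m (normSq q m) = laplacePol q m := by
  rw [normSq_eq, laplacePol_eq, sqOf, sqOf]
  simp only [map_sum, map_smul, map_mul, diffOp_x]

theorem diffOp_laplace_comm (R : Pol q m) :
    diffOp q m R * laplacePol q m = laplacePol q m * diffOp q m R := by
  rw [← diffOp_normSq, ← map_mul, ← map_mul, normSq_comm]

variable {q m} in
theorem IsSpherical.euler {k : ℕ} {S : Pol q m} (hS : IsSpherical q m k S) :
    ∑ a, ((wt q m a : ℝ) : ℂ) • (x q m a * QEuclid.pd q m a.rev S) =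
      ((qNumber (q ^ 2) k : ℝ) : ℂ) • S := by
  rw [IsHomog.euler hS.1, hS.2, mul_zero, smul_zero, add_zero]

/-- For `S ∈ 𝒮_{d+r}`, the normally ordered operator with `d` coordinates and `r` derivatives that
is obtained from `S` by polarization. It interpolates between the multiplication by `S` and
`S(∂)`. -/
def polarize : ℕ → ℕ → Pol q m →ₗ[ℂ] Module.End ℂ (Pol q m)
  | 0, _ => (diffOp q m).toLinearMap
  | d + 1, r => ((((qNumber (q ^ 2) (d + 1 + r : ℕ))⁻¹ : ℝ)) : ℂ) •
      ∑ a, ((wt q m a : ℝ) : ℂ) •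
        (LinearMap.mulLeft ℂ (mulXPol q m a) ∘ₗ polarize d r ∘ₗ pd q m a.rev)

theorem polarize_zero (r : ℕ) (S : Pol q m) : polarize q m 0 r S = diffOp q m S := rfl

theorem qNumber_succ_ne (q : ℝ) (m : ℕ) [Admissible q m] (n : ℕ) :
    ((qNumber (q ^ 2) (n + 1 : ℕ) : ℝ) : ℂ) ≠ 0 := by
  have := qNumber_pos (sq_pos' q m) (sq_lt_one' q m) (u := (n + 1 : ℕ)) (by positivity)
  exact_mod_cast this.ne'

theorem polarize_succ (d r : ℕ) (S : Pol q m) :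
    ((qNumber (q ^ 2) (d + 1 + r : ℕ) : ℝ) : ℂ) • polarize q m (d + 1) r S =
      ∑ a, ((wt q m a : ℝ) : ℂ) • (mulXPol q m a * polarize q m d r (pd q m a.rev S)) := by
  have h : ((qNumber (q ^ 2) (d + 1 + r : ℕ) : ℝ) : ℂ) ≠ 0 := by
    rw [show d + 1 + r = d + r + 1 by ring]; exact qNumber_succ_ne q m _
  rw [polarize, LinearMap.smul_apply, smul_smul, Complex.ofReal_inv, mul_inv_cancel₀ h, one_smul]
  simp only [LinearMap.sum_apply, LinearMap.smul_apply, LinearMap.comp_apply,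
    LinearMap.mulLeft_apply]

/-- The contraction of a polarization with the derivatives, placed on the left, is again a
polarization. -/
theorem sum_pd_polarize (d r : ℕ) {S : Pol q m} (hS : IsSpherical q m (d + r + 1) S) :
    ∑ a, ((wt q m a : ℝ) : ℂ) • (pd q m a * polarize q m d r (pd q m a.rev S)) =
      ((qNumber (q ^ 2) (d + r + 1 : ℕ) : ℝ) : ℂ) • polarize q m d (r + 1) S := by
  have hq := q_pos q m
  induction d generalizing S with
  | zero =>
    simp only [polarize_zero]
    have h := congrArg (diffOp q m) hS.euler
    simpa only [map_sum, map_smul, map_mul, diffOp_x, zero_add] using h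
  | succ d ih =>
    have hne : ((qNumber (q ^ 2) (d + 1 + r : ℕ) : ℝ) : ℂ) ≠ 0 := by
      rw [show d + 1 + r = d + r + 1 by ring]; exact qNumber_succ_ne q m _
    refine smul_right_injective _ hne ?_
    simp only
    rw [Finset.smul_sum]
    have e1 : ∀ a, ((qNumber (q ^ 2) (d + 1 + r : ℕ) : ℝ) : ℂ) • ((wt q m a : ℝ) : ℂ) •
        (pd q m a * polarize q m (d + 1) r (pd q m a.rev S)) =
        ∑ b, ((wt q m a * wt q m b : ℝ) : ℂ) • (((metric q m a b : ℝ) : ℂ) •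
          polarize q m d r (pd q m b.rev (pd q m a.rev S)) +
          (q : ℂ) • ∑ k, ∑ l, ((rInv q m a b k l : ℝ) : ℂ) • (mulXPol q m k * (pd q m l *
            polarize q m d r (pd q m b.rev (pd q m a.rev S))))) := by
      intro a
      rw [smul_comm, ← mul_smul_comm _ (pd q m a), polarize_succ, Finset.mul_sum, Finset.smul_sum]
      refine Finset.sum_congr rfl fun b _ => ?_
      rw [mul_smul_comm, smul_smul, ← mul_assoc, isWeyl_pd, add_mul, smul_mul_assoc, one_mul,
        smul_mul_assoc, Finset.sum_mul]
      simp only [Finset.sum_mul, smul_mul_assoc, mul_assoc]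
      push_cast; rfl
    simp only [e1, smul_add, Finset.sum_add_distrib]
    -- The contraction of the two derivatives of `S` is `Δ S = 0`.
    have t1 : ∑ a, ∑ b, ((wt q m a * wt q m b : ℝ) : ℂ) • ((metric q m a b : ℝ) : ℂ) •
          polarize q m d r (pd q m b.rev (pd q m a.rev S)) = 0 := by
      have : ∀ a, ∑ b, ((wt q m a * wt q m b : ℝ) : ℂ) • ((metric q m a b : ℝ) : ℂ) •
          polarize q m d r (pd q m b.rev (pd q m a.rev S)) =
          polarize q m d r (((wt q m a : ℝ) : ℂ) • pd q m a (pd q m a.rev S)) := by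
        intro a
        rw [Finset.sum_eq_single a.rev]
        · rw [metric_eq, if_pos rfl, Fin.rev_rev, wt_mul_rev hq, map_smul]; simp
        · intro b _ hb; rw [metric_eq, if_neg hb]; simp
        · simp
      simp only [this, ← map_sum]
      rw [← laplacePol_apply, hS.2, map_zero]
    -- The two derivatives of `S` absorb the crossing, by their quadratic relations.
    have t2 : ∑ a, ∑ b, ((wt q m a * wt q m b : ℝ) : ℂ) • (q : ℂ) • ∑ k, ∑ l,
          ((rInv q m a b k l : ℝ) : ℂ) • (mulXPol q m k * (pd q m l *
            polarize q m d r (pd q m b.rev (pd q m a.rev S)))) =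
          ∑ k, ∑ l, ((wt q m k * wt q m l : ℝ) : ℂ) • (mulXPol q m k * (pd q m l *
            polarize q m d r (pd q m l.rev (pd q m k.rev S)))) := by
      have hd : ∀ k l : Fin m, ∑ a : Fin m, ∑ b : Fin m, ((rInv q m l.rev k.rev b.rev a.rev : ℝ) : ℂ) •
          pd q m b.rev (pd q m a.rev S) = ((q⁻¹ : ℝ) : ℂ) • pd q m l.rev (pd q m k.rev S) := by
        intro k l
        have h := LinearMap.congr_fun ((isQuad_pd q m).braidInv q m l.rev k.rev) S
        simp only [LinearMap.sum_apply, LinearMap.smul_apply, Module.End.mul_apply,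
          LinearMap.add_apply, ← laplacePol_eq, hS.2, smul_zero, add_zero] at h
        rw [← h, Finset.sum_comm, ← Equiv.sum_comp Fin.revPerm]
        refine Finset.sum_congr rfl fun b _ => ?_
        rw [← Equiv.sum_comp Fin.revPerm]
        simp only [Fin.revPerm_apply, Fin.rev_rev]
      have hc : ∀ a b k l, wt q m a * wt q m b * rInv q m a b k l =
          wt q m k * wt q m l * rInv q m l.rev k.rev b.rev a.rev := by
        intro a b k l
        have h1 := rInv_wt hq a b k l
        have h2 := rInv_flip hq a b k l
        have h3 := rInv_transpose hq b.rev a.rev l.rev k.rev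
        rw [← h3, h2]
        linear_combination h1
      have hs : ∀ k l, ∑ a, ∑ b, ((wt q m a * wt q m b * rInv q m a b k l * q : ℝ) : ℂ) •
          (mulXPol q m k * (pd q m l * polarize q m d r (pd q m b.rev (pd q m a.rev S)))) =
          ((wt q m k * wt q m l : ℝ) : ℂ) • (mulXPol q m k * (pd q m l *
            polarize q m d r (pd q m l.rev (pd q m k.rev S)))) := by
        intro k l
        have h := congrArg (fun u => ((q * (wt q m k * wt q m l) : ℝ) : ℂ) •
          (mulXPol q m k * (pd q m l * polarize q m d r u))) (hd k l)
        simp only [map_sum, map_smul, Finset.mul_sum, mul_smul_comm, Finset.smul_sum, smul_smul,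
          ← Complex.ofReal_mul] at h
        have hqq : q * (wt q m k * wt q m l) * q⁻¹ = wt q m k * wt q m l := by
          field_simp
        rw [hqq] at h
        rw [← h]
        refine Finset.sum_congr rfl fun a _ => Finset.sum_congr rfl fun b _ => ?_
        congr 2
        rw [hc]; ring
      simp only [← hs, Finset.smul_sum, smul_smul, ← Complex.ofReal_mul]
      rw [Finset.sum_congr rfl fun a _ => Finset.sum_comm, Finset.sum_comm]
      refine Finset.sum_congr rfl fun k _ => ?_
      rw [sum_rotate]
      refine Finset.sum_congr rfl fun l _ => Finset.sum_congr rfl fun a _ =>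
        Finset.sum_congr rfl fun b _ => ?_
      congr 2
      ring
    rw [t1, t2, zero_add]
    have e2 : ∀ k, ∑ l, ((wt q m k * wt q m l : ℝ) : ℂ) • (mulXPol q m k * (pd q m l *
            polarize q m d r (pd q m l.rev (pd q m k.rev S)))) =
        ((qNumber (q ^ 2) (d + r + 1 : ℕ) : ℝ) : ℂ) • ((wt q m k : ℝ) : ℂ) •
          (mulXPol q m k * polarize q m d (r + 1) (pd q m k.rev S)) := by
      intro k
      have hk : IsSpherical q m (d + r + 1) (pd q m k.rev S) := by
        refine IsSpherical.pd ?_ _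
        rw [show d + r + 1 + 1 = d + 1 + r + 1 by ring]; exact hS
      have h := congrArg (fun u => ((wt q m k : ℝ) : ℂ) • (mulXPol q m k * u)) (ih hk)
      simp only [Finset.mul_sum, mul_smul_comm, Finset.smul_sum, smul_smul,
        ← Complex.ofReal_mul] at h
      rw [h, smul_smul, ← Complex.ofReal_mul, mul_comm]
    simp only [e2, ← Finset.smul_sum]
    rw [← polarize_succ, show d + 1 + (r + 1) = d + 1 + r + 1 by ring,
      show d + r + 1 = d + 1 + r by ring]

/-- With coordinates only, the polarization is the multiplication by `S`. -/
theorem polarize_eq_mul (d : ℕ) {S : Pol q m} (hS : IsSpherical q m d S) :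
    polarize q m d 0 S = Algebra.lmul ℂ (Pol q m) S := by
  induction d generalizing S with
  | zero =>
    rw [polarize_zero, IsHomog.eq_smul_one hS.1, map_smul, map_smul, map_one, map_one]
  | succ d ih =>
    refine smul_right_injective _ (qNumber_succ_ne q m d) ?_
    simp only
    have h := polarize_succ q m d 0 S
    rw [add_zero] at h
    rw [h, ← map_smul, ← hS.euler, map_sum]
    refine Finset.sum_congr rfl fun a _ => ?_
    rw [ih (hS.pd _), map_smul, map_mul, mulXPol]

theorem qNumber_one {p : ℝ} (hp : p ≠ 1) : qNumber p 1 = 1 := by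
  have : p - 1 ≠ 0 := sub_ne_zero.2 hp
  unfold qNumber; rw [Real.rpow_one]; field_simp

theorem qNumber_add_one {p : ℝ} (hp0 : 0 < p) (hp : p ≠ 1) (u : ℝ) :
    qNumber p (u + 1) = 1 + p * qNumber p u := by
  have : p - 1 ≠ 0 := sub_ne_zero.2 hp
  unfold qNumber; rw [Real.rpow_add_one hp0.ne']; field_simp; ring

/-- Commuting `Δ` with a polarization turns one coordinate into a derivative. -/
theorem laplace_polarize (d r : ℕ) {S : Pol q m} (hS : IsSpherical q m (d + 1 + r) S) :
    laplacePol q m * polarize q m (d + 1) r S =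
      (((q ^ 2) ^ (d + 1) : ℝ) : ℂ) • (polarize q m (d + 1) r S * laplacePol q m) +
      ((mu q m * qNumber (q ^ 2) (d + 1 : ℕ) : ℝ) : ℂ) • polarize q m d (r + 1) S := by
  have hp := sq_pos' q m
  have hp1 := (sq_lt_one' q m).ne
  have hxL : ∀ a, laplacePol q m * mulXPol q m a = ((mu q m : ℝ) : ℂ) • pd q m a +
      ((q ^ 2 : ℝ) : ℂ) • (mulXPol q m a * laplacePol q m) := by
    intro a; rw [laplacePol_eq]; exact (isWeyl_pd q m).sqOf_mul q m a
  induction d generalizing S with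
  | zero =>
    have hne : ((qNumber (q ^ 2) (0 + 1 + r : ℕ) : ℝ) : ℂ) ≠ 0 := by
      rw [show 0 + 1 + r = 0 + r + 1 by ring]; exact qNumber_succ_ne q m _
    refine smul_right_injective _ hne ?_
    simp only
    have hpol := polarize_succ q m 0 r S
    have hD := sum_pd_polarize q m 0 r (S := S) (by rwa [show 0 + r + 1 = 0 + 1 + r by ring])
    rw [show 0 + r + 1 = 0 + 1 + r by ring] at hD
    have e : ∀ a, laplacePol q m * (((wt q m a : ℝ) : ℂ) • (mulXPol q m a *
        polarize q m 0 r (pd q m a.rev S))) =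
        ((mu q m : ℝ) : ℂ) • ((wt q m a : ℝ) : ℂ) •
          (pd q m a * polarize q m 0 r (pd q m a.rev S)) +
        ((q ^ 2 : ℝ) : ℂ) • (((wt q m a : ℝ) : ℂ) • (mulXPol q m a *
          polarize q m 0 r (pd q m a.rev S)) * laplacePol q m) := by
      intro a
      rw [mul_smul_comm, ← mul_assoc, hxL, add_mul, smul_mul_assoc, smul_mul_assoc, mul_assoc,
        smul_mul_assoc, mul_assoc, polarize_zero, diffOp_laplace_comm]
      module
    rw [smul_add, smul_comm _ (((q ^ 2) ^ (0 + 1) : ℝ) : ℂ),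
      ← mul_smul_comm _ (laplacePol q m) (polarize q m (0 + 1) r S),
      ← smul_mul_assoc _ (polarize q m (0 + 1) r S) (laplacePol q m), hpol, Finset.mul_sum]
    simp only [e, Finset.sum_add_distrib, ← Finset.smul_sum, ← Finset.sum_mul, hD]
    rw [zero_add, pow_one, Nat.cast_one, qNumber_one hp1, mul_one]
    push_cast
    module
  | succ d ih =>
    have hne : ((qNumber (q ^ 2) (d + 1 + 1 + r : ℕ) : ℝ) : ℂ) ≠ 0 := by
      rw [show d + 1 + 1 + r = d + 1 + r + 1 by ring]; exact qNumber_succ_ne q m _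
    refine smul_right_injective _ hne ?_
    simp only
    have hS2 : IsSpherical q m (d + 1 + r + 1) S := by
      rwa [show d + 1 + r + 1 = d + 1 + 1 + r by ring]
    have hpol := polarize_succ q m (d + 1) r S
    have hpol2 := polarize_succ q m d (r + 1) S
    rw [show d + 1 + (r + 1) = d + 1 + 1 + r by ring] at hpol2
    have hD := sum_pd_polarize q m (d + 1) r hS2
    rw [show d + 1 + r + 1 = d + 1 + 1 + r by ring] at hD
    have e : ∀ a, laplacePol q m * (((wt q m a : ℝ) : ℂ) • (mulXPol q m a *
        polarize q m (d + 1) r (pd q m a.rev S))) =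
        ((mu q m : ℝ) : ℂ) • ((wt q m a : ℝ) : ℂ) •
          (pd q m a * polarize q m (d + 1) r (pd q m a.rev S)) +
        (((q ^ 2) ^ (d + 1 + 1) : ℝ) : ℂ) • (((wt q m a : ℝ) : ℂ) • (mulXPol q m a *
          polarize q m (d + 1) r (pd q m a.rev S)) * laplacePol q m) +
        ((q ^ 2 * (mu q m * qNumber (q ^ 2) (d + 1 : ℕ)) : ℝ) : ℂ) • ((wt q m a : ℝ) : ℂ) •
          (mulXPol q m a * polarize q m d (r + 1) (pd q m a.rev S)) := by
      intro a
      rw [mul_smul_comm, ← mul_assoc, hxL, add_mul, smul_mul_assoc, smul_mul_assoc, mul_assoc,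
        ih (hS2.pd _), mul_add, mul_smul_comm, mul_smul_comm, ← mul_assoc, smul_mul_assoc,
        pow_succ _ (d + 1)]
      push_cast
      module
    rw [smul_add, smul_comm _ (((q ^ 2) ^ (d + 1 + 1) : ℝ) : ℂ),
      ← mul_smul_comm _ (laplacePol q m) (polarize q m (d + 1 + 1) r S),
      ← smul_mul_assoc _ (polarize q m (d + 1 + 1) r S) (laplacePol q m), hpol, Finset.mul_sum]
    simp only [e, Finset.sum_add_distrib, ← Finset.smul_sum, ← Finset.sum_mul, hD, ← hpol2]
    have hn : qNumber (q ^ 2) (d + 1 + 1 : ℕ) = 1 + q ^ 2 * qNumber (q ^ 2) (d + 1 : ℕ) := by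
      rw [← qNumber_add_one hp hp1]; push_cast; rfl
    rw [hn]
    push_cast
    module

/-- The product `[N]_{q²} [N - 1]_{q²} ⋯ [N - d + 1]_{q²}`. -/
def fallingQ (q : ℝ) (N d : ℕ) : ℝ := ∏ i ∈ Finset.range d, qNumber (q ^ 2) ((N : ℝ) - i)

/-- The `q`-Pascal rule. -/
theorem fallingQ_succ_succ (q : ℝ) (m : ℕ) [Admissible q m] (N d : ℕ) : fallingQ q (N + 1) (d + 1) =
    (q ^ 2) ^ (d + 1) * fallingQ q N (d + 1) + qNumber (q ^ 2) (d + 1 : ℕ) * fallingQ q N d := by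
  have hp := sq_pos' q m
  have hp1 := (sq_lt_one' q m).ne
  have h1 : fallingQ q (N + 1) (d + 1) = qNumber (q ^ 2) (N + 1 : ℕ) * fallingQ q N d := by
    unfold fallingQ
    rw [Finset.prod_range_succ']
    rw [mul_comm]
    congr 1
    · simp
    · refine Finset.prod_congr rfl fun i _ => ?_
      congr 1; push_cast; ring
  have h2 : fallingQ q N (d + 1) = fallingQ q N d * qNumber (q ^ 2) ((N : ℝ) - d) := by
    unfold fallingQ; rw [Finset.prod_range_succ]
  have h3 : qNumber (q ^ 2) (N + 1 : ℕ) =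
      (q ^ 2) ^ (d + 1) * qNumber (q ^ 2) ((N : ℝ) - d) + qNumber (q ^ 2) (d + 1 : ℕ) := by
    have hne : (1 - q ^ 2) ≠ 0 := sub_ne_zero.2 hp1.symm
    have e1 := one_sub_mul_qNumber hp1 (N + 1 : ℕ)
    have e2 := one_sub_mul_qNumber hp1 ((N : ℝ) - d)
    have e3 := one_sub_mul_qNumber hp1 (d + 1 : ℕ)
    have e4 : (q ^ 2) ^ (d + 1) * (q ^ 2) ^ ((N : ℝ) - d) = (q ^ 2) ^ ((N + 1 : ℕ) : ℝ) := by
      rw [← Real.rpow_natCast (q ^ 2) (d + 1), ← Real.rpow_add hp]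
      congr 1; push_cast; ring
    rw [Real.rpow_natCast] at e3
    refine mul_left_cancel₀ hne ?_
    linear_combination e1 - (q ^ 2) ^ (d + 1) * e2 - e3 + e4
  rw [h1, h2, h3]
  ring

theorem fallingQ_zero_succ (d : ℕ) : fallingQ q 0 (d + 1) = 0 := by
  unfold fallingQ
  rw [Finset.prod_range_succ']
  simp [qNumber]

theorem evalZero_polarize_succ (d r : ℕ) (S h : Pol q m) :
    evalZero q m (polarize q m (d + 1) r S h) = 0 := by
  rw [polarize, LinearMap.smul_apply, LinearMap.smul_apply, map_smul]
  simp only [LinearMap.sum_apply, LinearMap.smul_apply, LinearMap.comp_apply,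
    LinearMap.mulLeft_apply, Module.End.mul_apply, map_sum, map_smul]
  refine smul_eq_zero_of_right _ (Finset.sum_eq_zero fun a _ => ?_)
  have : mulXPol q m a (polarize q m d r (pd q m a.rev S) h) =
    x q m a * polarize q m d r (pd q m a.rev S) h := rfl
  rw [this, evalZero_x_mul, smul_zero]

/-- The value at zero of `Δ^N` applied to a polarization: each of the `d` coordinates has to be
turned into a derivative by one of the operators `Δ`. -/
theorem evalZero_laplace_polarize (N d r : ℕ) {S : Pol q m} (hS : IsSpherical q m (d + r) S)
    (h : Pol q m) : evalZero q m ((laplacePol q m ^ N) (polarize q m d r S h)) =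
      ((mu q m ^ d * fallingQ q N d : ℝ) : ℂ) *
        evalZero q m (diffOp q m S ((laplacePol q m ^ (N - d)) h)) := by
  induction N generalizing d r h with
  | zero =>
    rcases d with _ | d
    · simp [fallingQ, polarize_zero]
    · rw [pow_zero, Module.End.one_apply, evalZero_polarize_succ, fallingQ_zero_succ]
      simp
  | succ N ih =>
    rcases d with _ | d
    · have hc : ∀ n, diffOp q m S * laplacePol q m ^ n = laplacePol q m ^ n * diffOp q m S :=
        fun n => (Commute.pow_right (diffOp_laplace_comm q m S : Commute _ _) n)
      have h2 := LinearMap.congr_fun (hc (N + 1)) h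
      simp only [Module.End.mul_apply] at h2
      rw [polarize_zero, ← h2]
      simp [fallingQ]
    · have h2 := LinearMap.congr_fun (laplace_polarize q m d r hS) h
      simp only [Module.End.mul_apply, LinearMap.add_apply, LinearMap.smul_apply] at h2
      have hS2 : IsSpherical q m (d + (r + 1)) S := by
        rwa [show d + (r + 1) = d + 1 + r by ring]
      rw [pow_succ, Module.End.mul_apply, h2, map_add, map_smul, map_smul, map_add, map_smul,
        map_smul, ih (d + 1) r hS, ih d (r + 1) hS2, fallingQ_succ_succ q m]
      rw [show N + 1 - (d + 1) = N - d by omega]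
      by_cases hd : d + 1 ≤ N
      · rw [← Module.End.mul_apply (laplacePol q m ^ (N - (d + 1))), ← pow_succ,
          show N - (d + 1) + 1 = N - d by omega]
        simp only [smul_eq_mul]
        push_cast
        ring
      -- If `N ≤ d` the first term vanishes, so that the truncated difference `N - (d + 1)` does not
      -- matter.
      · have h0 : fallingQ q N (d + 1) = 0 := by
          unfold fallingQ
          refine Finset.prod_eq_zero (i := N) (Finset.mem_range.2 (by omega)) ?_
          simp [qNumber]
        rw [h0]
        simp only [smul_eq_mul]
        push_cast
        ring

/-- The reason for Bochner's relations: under `(Δ^N ·)(0)`, multiplication by a spherical polynomial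
`S` amounts to the differential operator `S(∂)`. -/
theorem evalZero_laplace_mul (N k : ℕ) {S : Pol q m} (hS : IsSpherical q m k S) (h : Pol q m) :
    evalZero q m ((laplacePol q m ^ N) (S * h)) = ((mu q m ^ k * fallingQ q N k : ℝ) : ℂ) *
      evalZero q m (diffOp q m S ((laplacePol q m ^ (N - k)) h)) := by
  have := evalZero_laplace_polarize q m N k 0 (by rwa [add_zero]) h (S := S)
  rwa [polarize_eq_mul q m k hS] at this

theorem fallingQ_add (i k : ℕ) :
    fallingQ q (k + i) k * qFactorial (q ^ 2) i = qFactorial (q ^ 2) (k + i) := by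
  induction k with
  | zero => simp [fallingQ]
  | succ k ih =>
    have h1 : fallingQ q (k + 1 + i) (k + 1) =
        qNumber (q ^ 2) (k + i + 1 : ℕ) * fallingQ q (k + i) k := by
      unfold fallingQ
      rw [Finset.prod_range_succ', mul_comm]
      congr 1
      · push_cast; congr 1; ring
      · refine Finset.prod_congr rfl fun i _ => ?_
        congr 1; push_cast; ring
    rw [h1, show k + 1 + i = k + i + 1 by ring, qFactorial_succ, ← ih]
    push_cast
    ring

/-- The coefficients in Bochner's relations for the sphere. -/
def sphereCoeff (q : ℝ) (m k i : ℕ) : ℝ :=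
  2 * qGamma (q ^ 2) (1 / 2) ^ m /
    (mu q m ^ (k + 2 * i) * qFactorial (q ^ 2) i * qGamma (q ^ 2) (((k + i : ℕ) : ℝ) + (m : ℝ) / 2))

variable {q m} in
/-- Bochner's relations for the integral over the sphere. -/
theorem IsSpherical.sphereInt_mul {k i : ℕ} {S h : Pol q m} (hS : IsSpherical q m k S)
    (hh : IsHomog q m (k + 2 * i) h) : sphereInt q m (S * h) =
      ((sphereCoeff q m k i : ℝ) : ℂ) *
        QEuclid.evalZero q m (diffOp q m (S * normSq q m ^ i) h) := by
  have hSh : IsHomog q m (2 * (k + i)) (S * h) := by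
    rw [show 2 * (k + i) = k + (k + 2 * i) by ring]; exact IsHomog.mul hS.1 hh
  rw [hSh.sphereInt_even, evalZero_laplace_mul q m _ k hS, map_mul, map_pow, diffOp_normSq,
    Module.End.mul_apply, show k + i - k = i by omega, ← mul_assoc, ← Complex.ofReal_mul]
  congr 2
  have hf := fallingQ_add q i k
  have hp := sq_pos' q m
  have h1 := (qFactorial_pos hp (sq_lt_one' q m) i).ne'
  have h2 := (qFactorial_pos hp (sq_lt_one' q m) (k + i)).ne'
  have h3 := (mu_pos q m).ne'
  have h4 : fallingQ q (k + i) k ≠ 0 := fun h => h2 (by rw [← hf, h, zero_mul])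
  unfold pizzetti sphereCoeff
  rw [← hf, show 2 * (k + i) = k + 2 * i + k by ring, pow_add _ (k + 2 * i)]
  generalize qGamma (q ^ 2) (((k + i : ℕ) : ℝ) + (m : ℝ) / 2) = G
  field_simp

variable {q m} in
theorem IsSpherical.sphereInt_mul_eq_zero {k l : ℕ} {S h : Pol q m} (hS : IsSpherical q m k S)
    (hh : IsHomog q m l h) (hl : ¬ ∃ i, l = k + 2 * i) : sphereInt q m (S * h) = 0 := by
  have hSh : IsHomog q m (k + l) (S * h) := IsHomog.mul hS.1 hh
  by_cases he : Even (k + l)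
  · obtain ⟨N, hN⟩ := he
    rw [show N + N = 2 * N by ring] at hN
    rw [hN] at hSh
    have hlk : N < k := by
      by_contra hc
      exact hl ⟨N - k, by omega⟩
    have h0 : fallingQ q N k = 0 := by
      unfold fallingQ
      refine Finset.prod_eq_zero (i := N) (Finset.mem_range.2 hlk) ?_
      simp [qNumber]
    rw [hSh.sphereInt_even, evalZero_laplace_mul q m _ k hS, h0]
    simp
  · exact hSh.sphereInt_odd he

end

/-! ### The Fourier kernel -/

section
variable (q : ℝ) (m : ℕ) [Admissible q m]

/-- Crossing symmetry in the form used for the exponential: `C_{ab}` moves a crossing to the dual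
variables. -/
theorem wt_mul_rInv (a j k c : Fin m) :
    wt q m a * rInv q m j a k c = wt q m k * rEntry q m k.rev j c a.rev := by
  have hq := q_pos q m
  have h1 := rInv_crossing hq j a k c
  have h2 := rEntry_flip hq j.rev k c.rev a
  have h3 := rEntry_transpose hq k.rev j c a.rev
  have h4 := rEntry_wt hq k.rev j c a.rev
  have ha := wt_mul_rev hq a
  have hk := wt_mul_rev hq k
  have hc := (wt_pos hq c).ne'
  simp only [Fin.rev_rev] at h2
  rw [h1, ← rEntry_flip hq a c.rev j.rev k]
  simp only [Fin.rev_rev]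
  rw [← h3]
  field_simp
  linear_combination wt q m a * wt q m k * h4 -
    wt q m a * rEntry q m k.rev j c a.rev * wt q m j * hk +
    wt q m k * rEntry q m k.rev j c a.rev * wt q m c * ha

section
variable {T : Type*} [AddCommGroup T] [Module ℂ T] {X D Y : Fin m → Module.End ℂ T}
  {Z : Module.End ℂ T}

/-- The operator `u ↦ C_{ab} x^a u y^b`. -/
def pairing (X Y : Fin m → Module.End ℂ T) : Module.End ℂ T :=
  ∑ a, ((wt q m a : ℝ) : ℂ) • (X a * Y a.rev)

/-- In the bimodule generated by the kernel, the coordinates `y` multiply from the right, so that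
their relations appear in opposite order. -/
theorem deriv_pairing (hW : IsWeyl q m X D) (hX : ∀ a b, X a * Y b = Y b * X a)
    (hD : ∀ a b, D a * Y b = Y b * D a)
    (hY : ∀ i j, ∑ c, ∑ a, ((rEntry q m i j c a : ℝ) : ℂ) • (Y a * Y c) =
      (q : ℂ) • (Y j * Y i) + ((tau q m * metric q m i j : ℝ) : ℂ) • Z)
    {u v : T} (huv : ∀ c, D c u = Y c v) (j : Fin m) :
    D j (pairing q m X Y u) = Y j u + ((q ^ 2 : ℝ) : ℂ) • Y j (pairing q m X Y v) +
      ((q * tau q m : ℝ) : ℂ) • X j (Z v) := by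
  have hq := q_pos q m
  have hW' : ∀ i j w, D i (X j w) = ((metric q m i j : ℝ) : ℂ) • w +
      (q : ℂ) • ∑ k, ∑ l, ((rInv q m i j k l : ℝ) : ℂ) • X k (D l w) := by
    intro i j w
    have := LinearMap.congr_fun (hW i j) w
    simpa only [Module.End.mul_apply, LinearMap.add_apply, LinearMap.smul_apply,
      LinearMap.sum_apply, Module.End.one_apply] using this
  have hX' : ∀ a b w, X a (Y b w) = Y b (X a w) := fun a b w => LinearMap.congr_fun (hX a b) w
  have hD' : ∀ a b w, D a (Y b w) = Y b (D a w) := fun a b w => LinearMap.congr_fun (hD a b) w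
  have hY' : ∀ i j w, ∑ c, ∑ a, ((rEntry q m i j c a : ℝ) : ℂ) • Y a (Y c w) =
      (q : ℂ) • Y j (Y i w) + ((tau q m * metric q m i j : ℝ) : ℂ) • Z w := by
    intro i j w
    have := LinearMap.congr_fun (hY i j) w
    simpa only [Module.End.mul_apply, LinearMap.add_apply, LinearMap.smul_apply,
      LinearMap.sum_apply] using this
  have e0 : ∀ w, pairing q m X Y w = ∑ a, ((wt q m a : ℝ) : ℂ) • X a (Y a.rev w) := by
    intro w
    simp only [pairing, LinearMap.sum_apply, LinearMap.smul_apply, Module.End.mul_apply]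
  rw [e0 u, map_sum]
  have e1 : ∀ a, D j (((wt q m a : ℝ) : ℂ) • X a (Y a.rev u)) =
      ((metric q m j a : ℝ) : ℂ) • ((wt q m a : ℝ) : ℂ) • Y a.rev u +
      ∑ k, ∑ c, ((q * (wt q m k * rEntry q m k.rev j c a.rev) : ℝ) : ℂ) •
        X k (Y a.rev (Y c v)) := by
    intro a
    rw [map_smul, hW', smul_add, smul_comm]
    congr 1
    simp only [Finset.smul_sum]
    refine Finset.sum_congr rfl fun k _ => Finset.sum_congr rfl fun c _ => ?_
    rw [hD', huv, ← wt_mul_rInv]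
    push_cast
    module
  simp only [e1, Finset.sum_add_distrib]
  have t1 : ∑ a, ((metric q m j a : ℝ) : ℂ) • ((wt q m a : ℝ) : ℂ) • Y a.rev u = Y j u := by
    rw [sum_metric_row (fun a => ((wt q m a : ℝ) : ℂ) • Y a.rev u), smul_smul, ← Complex.ofReal_mul,
      wt_mul_rev hq, Fin.rev_rev, Complex.ofReal_one, one_smul]
  have t2 : ∀ k, ∑ a : Fin m, ∑ c, ((q * (wt q m k * rEntry q m k.rev j c a.rev) : ℝ) : ℂ) •
        X k (Y a.rev (Y c v)) = ((q ^ 2 : ℝ) : ℂ) • ((wt q m k : ℝ) : ℂ) • Y j (X k (Y k.rev v)) +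
        ((q * tau q m : ℝ) : ℂ) • ((metric q m k.rev j * wt q m k : ℝ) : ℂ) • X k (Z v) := by
    intro k
    have h := congrArg (fun w => ((q * wt q m k : ℝ) : ℂ) • X k w) (hY' k.rev j v)
    simp only [map_add, map_sum, map_smul, smul_add, Finset.smul_sum] at h
    rw [Finset.sum_comm] at h
    rw [← Equiv.sum_comp Fin.revPerm]
    simp only [Fin.revPerm_apply, Fin.rev_rev]
    have h2 : ∑ a, ∑ c, ((q * (wt q m k * rEntry q m k.rev j c a) : ℝ) : ℂ) • X k (Y a (Y c v)) =
        ∑ a, ∑ c, ((q * wt q m k : ℝ) : ℂ) • ((rEntry q m k.rev j c a : ℝ) : ℂ) •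
          X k (Y a (Y c v)) := by
      refine Finset.sum_congr rfl fun a _ => Finset.sum_congr rfl fun c _ => ?_
      push_cast
      module
    rw [h2, h, hX' k j]
    push_cast
    module
  have t3 : ∑ k, ((metric q m k.rev j * wt q m k : ℝ) : ℂ) • X k (Z v) = X j (Z v) := by
    rw [Finset.sum_eq_single j]
    · rw [metric_eq, if_pos (Fin.rev_rev j).symm, mul_comm, wt_mul_rev hq, Complex.ofReal_one,
        one_smul]
    · intro k _ hk
      rw [metric_eq, Fin.rev_rev, if_neg (Ne.symm hk)]
      simp
    · simp
  rw [t1, add_assoc, Finset.sum_comm]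
  congr 1
  simp only [t2, Finset.sum_add_distrib, ← Finset.smul_sum, t3]
  rw [e0 v, map_sum]
  simp only [map_smul]

/-- The components of the kernel, shifted by one: the recursion
`[l + 1] e_{l+1} = C_{ab} x^a e_l y^b - λ 𝐱² e_{l-1} 𝐲²` comes from the Euler operator. -/
def shiftedKernel (X Y : Fin m → Module.End ℂ T) (Z : Module.End ℂ T) (u : T) : ℕ → T
  | 0 => 0
  | 1 => u
  | l + 2 => (((qNumber (q ^ 2) (l + 1 : ℕ))⁻¹ : ℝ) : ℂ) •
      (pairing q m X Y (shiftedKernel X Y Z u (l + 1)) -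
        ((eulerConst q m : ℝ) : ℂ) • sqOf q m X (Z (shiftedKernel X Y Z u l)))

/-- The components of the exponential satisfy `∂^j e_{l+1} = e_l y^j`. -/
theorem deriv_shiftedKernel (hW : IsWeyl q m X D) (hX : ∀ a b, X a * Y b = Y b * X a)
    (hD : ∀ a b, D a * Y b = Y b * D a)
    (hY : ∀ i j, ∑ c, ∑ a, ((rEntry q m i j c a : ℝ) : ℂ) • (Y a * Y c) =
      (q : ℂ) • (Y j * Y i) + ((tau q m * metric q m i j : ℝ) : ℂ) • Z)
    (hZD : ∀ a, D a * Z = Z * D a) (hZY : ∀ a, Y a * Z = Z * Y a)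
    {u : T} (hu : ∀ j, D j u = 0) (l : ℕ) (j : Fin m) :
    D j (shiftedKernel q m X Y Z u (l + 1)) = Y j (shiftedKernel q m X Y Z u l) := by
  have hX2 : ∀ j w, D j (sqOf q m X w) = ((mu q m : ℝ) : ℂ) • X j w +
      ((q ^ 2 : ℝ) : ℂ) • sqOf q m X (D j w) := by
    intro j w
    have := LinearMap.congr_fun (hW.mul_sqOf q m j) w
    simpa only [Module.End.mul_apply, LinearMap.add_apply, LinearMap.smul_apply] using this
  have hX2Y : ∀ j w, sqOf q m X (Y j w) = Y j (sqOf q m X w) := by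
    intro j w
    simp only [sqOf, LinearMap.sum_apply, LinearMap.smul_apply, Module.End.mul_apply, map_sum,
      map_smul]
    refine Finset.sum_congr rfl fun a _ => ?_
    have h1 := fun w => LinearMap.congr_fun (hX a j) w
    have h2 := fun w => LinearMap.congr_fun (hX a.rev j) w
    simp only [Module.End.mul_apply] at h1 h2
    rw [h2, h1]
  have hZD' : ∀ a w, D a (Z w) = Z (D a w) := fun a w => LinearMap.congr_fun (hZD a) w
  have hZY' : ∀ a w, Y a (Z w) = Z (Y a w) := fun a w => LinearMap.congr_fun (hZY a) w
  have hq2 := sq_pos' q m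
  have hq1 := (sq_lt_one' q m).ne
  have key : ∀ l, (∀ j, D j (shiftedKernel q m X Y Z u (l + 1)) =
      Y j (shiftedKernel q m X Y Z u l)) ∧ (∀ j, D j (shiftedKernel q m X Y Z u (l + 2)) =
      Y j (shiftedKernel q m X Y Z u (l + 1))) := by
    intro l
    induction l with
    | zero =>
      have h0 : ∀ j, D j (shiftedKernel q m X Y Z u (0 + 1)) =
          Y j (shiftedKernel q m X Y Z u 0) := by
        intro j
        rw [shiftedKernel, shiftedKernel, hu, map_zero]
      refine ⟨h0, fun j => ?_⟩
      have h1 : D j (pairing q m X Y u) = Y j u := by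
        have := deriv_pairing q m hW hX hD hY (u := u) (v := 0)
          (fun c => by rw [hu, map_zero]) j
        simpa only [map_zero, smul_zero, add_zero] using this
      simp only [shiftedKernel]
      rw [map_zero, map_zero, smul_zero, sub_zero, map_smul, h1, zero_add, Nat.cast_one,
        qNumber_one hq1, inv_one, Complex.ofReal_one, one_smul]
    | succ l ih =>
      refine ⟨ih.2, fun j => ?_⟩
      have h1 := deriv_pairing q m hW hX hD hY ih.2 j
      have hne := qNumber_succ_ne q m (l + 1)
      have hne' := qNumber_succ_ne q m l
      have hn : qNumber (q ^ 2) (l + 1 + 1 : ℕ) = 1 + q ^ 2 * qNumber (q ^ 2) (l + 1 : ℕ) := by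
        rw [← qNumber_add_one hq2 hq1]; push_cast; rfl
      have e2 : ((qNumber (q ^ 2) (l + 1 : ℕ) : ℝ) : ℂ) • shiftedKernel q m X Y Z u (l + 2) =
          pairing q m X Y (shiftedKernel q m X Y Z u (l + 1)) -
          ((eulerConst q m : ℝ) : ℂ) • sqOf q m X (Z (shiftedKernel q m X Y Z u l)) := by
        rw [shiftedKernel, smul_smul, Complex.ofReal_inv, mul_inv_cancel₀ hne', one_smul]
      have e3 : ((qNumber (q ^ 2) (l + 1 + 1 : ℕ) : ℝ) : ℂ) •
          shiftedKernel q m X Y Z u (l + 1 + 2) =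
          pairing q m X Y (shiftedKernel q m X Y Z u (l + 2)) -
          ((eulerConst q m : ℝ) : ℂ) • sqOf q m X (Z (shiftedKernel q m X Y Z u (l + 1))) := by
        rw [shiftedKernel, smul_smul, Complex.ofReal_inv, mul_inv_cancel₀ hne, one_smul]
      refine smul_right_injective _ hne ?_
      simp only
      rw [← map_smul, e3, map_sub, h1, map_smul, hX2, hZD', ih.1, ← hZY', hX2Y,
        ← eulerConst_mul_mu, hn]
      have e4 := congrArg (fun w => ((q ^ 2 : ℝ) : ℂ) • Y j w) e2
      simp only [map_sub, map_smul] at e4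
      rw [Complex.ofReal_add, add_smul, Complex.ofReal_mul (q ^ 2), mul_smul, e4]
      push_cast
      module
  exact (key l).1 j

end

/-! ### Existence of the kernel -/

section
variable {P M : Type*} [Ring P] [Algebra ℂ P] [AddCommGroup M] [Module ℂ M]

theorem rTensor_mul_tmul_one (F : P →ₗ[ℂ] P) (u : P ⊗[ℂ] P) (b : P) :
    F.rTensor P (u * (1 ⊗ₜ[ℂ] b)) = F.rTensor P u * (1 ⊗ₜ[ℂ] b) := by
  induction u using TensorProduct.induction_on with
  | zero => simp
  | tmul a c =>
    simp only [Algebra.TensorProduct.tmul_mul_tmul, LinearMap.rTensor_tmul, mul_one]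
  | add u v hu hv => rw [add_mul, map_add, map_add, add_mul, hu, hv]

theorem rTensor_tmul_one_mul (F : P →ₗ[ℂ] M) (a : P) (u : P ⊗[ℂ] P) :
    F.rTensor P ((a ⊗ₜ[ℂ] 1) * u) = (F ∘ₗ LinearMap.mulLeft ℂ a).rTensor P u := by
  induction u using TensorProduct.induction_on with
  | zero => simp
  | tmul b c =>
    simp only [Algebra.TensorProduct.tmul_mul_tmul, LinearMap.rTensor_tmul, one_mul,
      LinearMap.comp_apply, LinearMap.mulLeft_apply]
  | add u v hu hv => rw [mul_add, map_add, map_add, hu, hv]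

/-- Existence of the exponential. Only the quadratic relations of the coordinates and the
commutation relations of the derivatives matter, so that the algebra is left arbitrary. -/
theorem exists_kernel_of_derivs {z : Fin m → P} (hz : IsQuad q m z) {d : Fin m → P →ₗ[ℂ] P}
    (h1 : ∀ i, d i 1 = 0) (hm : ∀ i j f, d i (z j * f) = ((metric q m i j : ℝ) : ℂ) • f +
      (q : ℂ) • ∑ k, ∑ l, ((rInv q m i j k l : ℝ) : ℂ) • (z k * d l f)) {ε : P →ₗ[ℂ] M}
    (hε : ∀ j f, ε (z j * f) = 0) :
    ∃ e : ℕ → P ⊗[ℂ] P, e 0 = 1 ∧ (∀ l, ε.rTensor P (e (l + 1)) = 0) ∧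
      ∀ l j, (d j).rTensor P (e (l + 1)) = e l * (1 ⊗ₜ[ℂ] z j) := by
  let X : Fin m → Module.End ℂ (P ⊗[ℂ] P) := fun a => LinearMap.mulLeft ℂ (z a ⊗ₜ[ℂ] 1)
  let D : Fin m → Module.End ℂ (P ⊗[ℂ] P) := fun a => (d a).rTensor P
  let Y : Fin m → Module.End ℂ (P ⊗[ℂ] P) := fun a => LinearMap.mulRight ℂ (1 ⊗ₜ[ℂ] z a)
  let Z : Module.End ℂ (P ⊗[ℂ] P) := LinearMap.mulRight ℂ (1 ⊗ₜ[ℂ] sqOf q m z)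
  have hW : IsWeyl q m X D := by
    intro i j
    refine LinearMap.ext fun u => ?_
    simp only [X, D, Module.End.mul_apply, LinearMap.mulLeft_apply,
      LinearMap.add_apply, LinearMap.smul_apply, LinearMap.sum_apply, Module.End.one_apply]
    induction u using TensorProduct.induction_on with
    | zero => simp
    | tmul a b =>
      simp only [Algebra.TensorProduct.tmul_mul_tmul, LinearMap.rTensor_tmul, one_mul, hm,
        TensorProduct.add_tmul, TensorProduct.sum_tmul, ← TensorProduct.smul_tmul']
    | add u v hu hv =>
      simp only [mul_add, map_add, hu, hv, smul_add, Finset.sum_add_distrib]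
      abel
  have hX : ∀ a b, X a * Y b = Y b * X a := fun a b => LinearMap.ext fun u => by
    simp only [X, Y, Module.End.mul_apply, LinearMap.mulLeft_apply, LinearMap.mulRight_apply,
      mul_assoc]
  have hD : ∀ a b, D a * Y b = Y b * D a := fun a b => LinearMap.ext fun u => by
    simp only [D, Y, Module.End.mul_apply, LinearMap.mulRight_apply, rTensor_mul_tmul_one]
  have hZD : ∀ a, D a * Z = Z * D a := fun a => LinearMap.ext fun u => by
    simp only [D, Z, Module.End.mul_apply, LinearMap.mulRight_apply, rTensor_mul_tmul_one]
  have hZY : ∀ a, Y a * Z = Z * Y a := fun a => LinearMap.ext fun u => by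
    simp only [Y, Z, Module.End.mul_apply, LinearMap.mulRight_apply, mul_assoc,
      Algebra.TensorProduct.tmul_mul_tmul, one_mul, hz.sqOf_comm]
  have hY : ∀ i j, ∑ c, ∑ a, ((rEntry q m i j c a : ℝ) : ℂ) • (Y a * Y c) =
      (q : ℂ) • (Y j * Y i) + ((tau q m * metric q m i j : ℝ) : ℂ) • Z := by
    intro i j
    refine LinearMap.ext fun u => ?_
    have h := congrArg (fun f => u * ((1 : P) ⊗ₜ[ℂ] f)) (hz.braid q m i j)
    simp only [TensorProduct.tmul_sum, TensorProduct.tmul_add, TensorProduct.tmul_smul,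
      Finset.mul_sum, mul_add, mul_smul_comm] at h
    simp only [LinearMap.sum_apply, LinearMap.smul_apply, LinearMap.add_apply, Y, Z,
      Module.End.mul_apply, LinearMap.mulRight_apply, mul_assoc,
      Algebra.TensorProduct.tmul_mul_tmul, one_mul]
    exact h
  refine ⟨fun l => shiftedKernel q m X Y Z 1 (l + 1), rfl, fun l => ?_, fun l j => ?_⟩
  · have h0 : ∀ a w, ε.rTensor P (X a w) = 0 := by
      intro a w
      simp only [X, LinearMap.mulLeft_apply]
      rw [rTensor_tmul_one_mul]
      have : ε ∘ₗ LinearMap.mulLeft ℂ (z a) = 0 := LinearMap.ext fun f => hε a f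
      rw [this, LinearMap.rTensor_zero, LinearMap.zero_apply]
    simp only [shiftedKernel, pairing, sqOf, map_smul, map_sub, LinearMap.sum_apply,
      LinearMap.smul_apply, Module.End.mul_apply, map_sum, h0, smul_zero, Finset.sum_const_zero,
      sub_zero]
  · exact deriv_shiftedKernel q m hW hX hD hY hZD hZY (u := 1) (fun j => by
      simp only [D, Algebra.TensorProduct.one_def, LinearMap.rTensor_tmul, h1,
        TensorProduct.zero_tmul]) (l + 1) j

end

theorem rTensor_mul_right (F : Pol q m →ₗ[ℂ] Pol q m) (u : Pol q m ⊗[ℂ] Pol q m) (b : Pol q m) :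
    F.rTensor (Pol q m) (u * (1 ⊗ₜ[ℂ] b)) = F.rTensor (Pol q m) u * (1 ⊗ₜ[ℂ] b) :=
  rTensor_mul_tmul_one F u b

theorem exists_isKernel : ∃ e, IsKernel q m e :=
  exists_kernel_of_derivs q m (isQuad_x q m) (pd_one q m) (pd_x_mul q m)
    (ε := (evalZero q m).toLinearMap) (evalZero_x_mul q m)

theorem isKernel_kernel : IsKernel q m (kernel q m) := Classical.epsilon_spec (exists_isKernel q m)

/-! ### Homogeneity and reproducing property of the kernel -/

/-- The projection to degree `d + 1` in terms of the one to degree `d`, by the Euler operator. -/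
theorem homComp_succ_eq (d : ℕ) : ((qNumber (q ^ 2) (d + 1 : ℕ) : ℝ) : ℂ) • homComp q m (d + 1) =
    ∑ a : Fin m, ((wt q m a : ℝ) : ℂ) • ((mulXPol q m a -
      ((eulerConst q m : ℝ) : ℂ) • LinearMap.mulLeft ℂ (normSq q m) ∘ₗ pd q m a) ∘ₗ
        homComp q m d ∘ₗ pd q m a.rev) := by
  refine LinearMap.ext fun f => ?_
  have h := (isHomog_homComp q m (d + 1) f).euler
  simp only [laplacePol_apply, ← homComp_pd, Finset.mul_sum, mul_smul_comm, Finset.smul_sum] at h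
  simp only [LinearMap.smul_apply, LinearMap.sum_apply, LinearMap.comp_apply, LinearMap.sub_apply,
    LinearMap.mulLeft_apply, mulXPol, Algebra.coe_lmul_eq_mul, LinearMap.mul_apply_apply, smul_sub]
  rw [Finset.sum_sub_distrib, eq_sub_iff_add_eq, h]
  congr 1
  refine Finset.sum_congr rfl fun a _ => ?_
  rw [smul_comm]

/-- The component `e_l` has no part of degree `d ≠ l` in `x`. -/
theorem rTensor_homComp_kernel {l d : ℕ} (hd : d ≠ l) :
    (homComp q m d).rTensor (Pol q m) (kernel q m l) = 0 := by
  obtain ⟨h0, h1, h2⟩ := isKernel_kernel q m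
  induction l generalizing d with
  | zero =>
    rw [h0, Algebra.TensorProduct.one_def, LinearMap.rTensor_tmul, homComp_one, if_neg hd,
      TensorProduct.zero_tmul]
  | succ l ih =>
    rcases d with _ | d
    · have : homComp q m 0 = (Algebra.linearMap ℂ (Pol q m)) ∘ₗ (evalZero q m).toLinearMap :=
        LinearMap.ext fun f => by
          rw [homComp_zero, LinearMap.comp_apply, Algebra.linearMap_apply,
            Algebra.algebraMap_eq_smul_one]; rfl
      rw [this, LinearMap.rTensor_comp, LinearMap.comp_apply, h1, map_zero]
    · refine smul_right_injective _ (qNumber_succ_ne q m d) ?_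
      simp only
      rw [← LinearMap.smul_apply, ← LinearMap.rTensor_smul, homComp_succ_eq, smul_zero]
      have hs : ∀ F : Fin m → Pol q m →ₗ[ℂ] Pol q m, (∑ a, F a).rTensor (Pol q m) =
          ∑ a, (F a).rTensor (Pol q m) := fun F =>
        map_sum (LinearMap.rTensorHom (R := ℂ) (Pol q m)) F Finset.univ
      rw [hs, LinearMap.sum_apply]
      refine Finset.sum_eq_zero fun a _ => ?_
      rw [LinearMap.rTensor_smul, LinearMap.smul_apply, LinearMap.rTensor_comp,
        LinearMap.rTensor_comp, LinearMap.comp_apply, LinearMap.comp_apply, h2, rTensor_mul_right,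
        ih (by omega), zero_mul, map_zero, smul_zero]

theorem exists_sum_homComp (u : Pol q m ⊗[ℂ] Pol q m) : ∃ N, ∀ n ≥ N,
    ∑ d ∈ Finset.range n, (homComp q m d).rTensor (Pol q m) u = u := by
  induction u using TensorProduct.induction_on with
  | zero => exact ⟨0, fun n _ => by simp⟩
  | tmul a b =>
    refine ⟨(grade q m a).natDegree + 1, fun n hn => ?_⟩
    simp only [LinearMap.rTensor_tmul, ← TensorProduct.sum_tmul]
    congr 1
    have h := sum_homComp q m a
    rw [Polynomial.sum_over_range' _ (fun _ => rfl) n (by omega)] at h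
    exact h
  | add u v hu hv =>
    obtain ⟨N, hN⟩ := hu
    obtain ⟨M, hM⟩ := hv
    refine ⟨max N M, fun n hn => ?_⟩
    simp only [map_add, Finset.sum_add_distrib]
    rw [hN n (le_trans (le_max_left _ _) hn), hM n (le_trans (le_max_right _ _) hn)]

/-- The component `e_l` of the kernel is homogeneous of degree `l` in the coordinates `x`. -/
theorem rTensor_kernel_congr {M : Type*} [AddCommGroup M] [Module ℂ M] {F G : Pol q m →ₗ[ℂ] M}
    (l : ℕ) (h : ∀ f, IsHomog q m l f → F f = G f) :
    F.rTensor (Pol q m) (kernel q m l) = G.rTensor (Pol q m) (kernel q m l) := by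
  have hk : (homComp q m l).rTensor (Pol q m) (kernel q m l) = kernel q m l := by
    obtain ⟨N, hN⟩ := exists_sum_homComp q m (kernel q m l)
    have h1 := hN (max N (l + 1)) (le_max_left _ _)
    rw [Finset.sum_eq_single l (fun d _ hd => rTensor_homComp_kernel q m hd)
      (fun hl => absurd (Finset.mem_range.2 (by omega)) hl)] at h1
    exact h1
  have hFG : F ∘ₗ homComp q m l = G ∘ₗ homComp q m l :=
    LinearMap.ext fun f => h _ (isHomog_homComp q m l f)
  rw [← hk, ← LinearMap.comp_apply, ← LinearMap.comp_apply, ← LinearMap.rTensor_comp,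
    ← LinearMap.rTensor_comp, hFG]

/-- `R(∂_x) exp(𝐱|𝐲) = exp(𝐱|𝐲) R(𝐲)`, in each degree. -/
theorem rTensor_diffOp_kernel (R : Pol q m) (d l : ℕ) :
    (diffOp q m (homComp q m d R)).rTensor (Pol q m) (kernel q m (l + d)) =
      kernel q m l * (1 ⊗ₜ[ℂ] homComp q m d R) := by
  have key : ∀ d l, (diffOp q m (homComp q m d R)).rTensor (Pol q m) (kernel q m (l + d)) =
      kernel q m l * (1 ⊗ₜ[ℂ] homComp q m d R) := by
    refine Pol.induction q m (p :=
      { carrier := {R | ∀ d l, (diffOp q m (homComp q m d R)).rTensor (Pol q m)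
          (kernel q m (l + d)) = kernel q m l * (1 ⊗ₜ[ℂ] homComp q m d R)}
        add_mem' := fun hf hg d l => by
          rw [map_add, map_add, LinearMap.rTensor_add, LinearMap.add_apply, hf, hg,
            TensorProduct.tmul_add, mul_add]
        zero_mem' := fun d l => by
          rw [map_zero, map_zero, LinearMap.rTensor_zero, LinearMap.zero_apply,
            TensorProduct.tmul_zero, mul_zero]
        smul_mem' := fun c f hf d l => by
          rw [map_smul, map_smul, LinearMap.rTensor_smul, LinearMap.smul_apply, hf,
            TensorProduct.tmul_smul, mul_smul_comm] }) ?_ ?_ R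
    · intro d l
      rw [homComp_one]
      split_ifs with hd
      · subst hd
        rw [map_one, add_zero, ← Algebra.TensorProduct.one_def, mul_one]
        exact LinearMap.congr_fun (LinearMap.rTensor_id (Pol q m) (Pol q m)) _
      · rw [map_zero, LinearMap.rTensor_zero, LinearMap.zero_apply,
          TensorProduct.tmul_zero, mul_zero]
    · rintro j f hf (_ | d) l
      · rw [homComp_zero_x_mul, map_zero, LinearMap.rTensor_zero, LinearMap.zero_apply,
          TensorProduct.tmul_zero, mul_zero]
      · rw [homComp_succ_x_mul, map_mul, diffOp_x, Module.End.mul_eq_comp, LinearMap.rTensor_comp,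
          LinearMap.comp_apply, show l + (d + 1) = l + 1 + d by ring, hf d (l + 1),
          rTensor_mul_right, (isKernel_kernel q m).2.2, mul_assoc,
          Algebra.TensorProduct.tmul_mul_tmul, one_mul]
  exact key d l

variable {q m} in
/-- The reproducing property of the exponential: `(R(∂_x) exp(𝐱|𝐲))(0) = R(𝐲)`. -/
theorem IsHomog.lid_diffOp_kernel {l : ℕ} {R : Pol q m} (hR : IsHomog q m l R) :
    TensorProduct.lid ℂ (Pol q m) (((QEuclid.evalZero q m).toLinearMap ∘ₗ diffOp q m R).rTensor
      (Pol q m) (kernel q m l)) = R := by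
  have h := rTensor_diffOp_kernel q m R l 0
  rw [hR.homComp, if_pos rfl, zero_add, (isKernel_kernel q m).1, one_mul] at h
  rw [LinearMap.rTensor_comp, LinearMap.comp_apply, h, LinearMap.rTensor_tmul,
    TensorProduct.lid_tmul, AlgHom.toLinearMap_apply, map_one, one_smul]

variable {q m} in
theorem IsHomog.spaceInt {d : ℕ} {f : Pol q m} (hf : IsHomog q m d f) (γ : ℝ) (φ : ℝ → ℝ) :
    QEuclid.spaceInt q m γ φ f =
      ((jackson q γ fun r => r ^ (m + d - 1) * φ (r ^ 2) : ℝ) : ℂ) * QEuclid.sphereInt q m f := by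
  rw [QEuclid.spaceInt, LinearMap.comp_apply, AlgHom.toLinearMap_apply, hf, Polynomial.lsum_apply,
    Polynomial.sum_monomial_index _ _ (by simp), LinearMap.smul_apply, smul_eq_mul]

/-- Bochner's relations for the Fourier integral. -/
theorem lid_spaceInt_kernel {k i : ℕ} {S : Pol q m} (hS : IsSpherical q m k S) (n : ℕ) (γ : ℝ)
    (φ : ℝ → ℝ) : TensorProduct.lid ℂ (Pol q m) ((spaceInt q m γ φ).rTensor (Pol q m)
      (((S * normSq q m ^ n) ⊗ₜ[ℂ] 1) * kernel q m (k + 2 * i))) =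
      (((jackson q γ fun r => r ^ (m + (2 * (k + i + n)) - 1) * φ (r ^ 2)) *
        sphereCoeff q m k i : ℝ) : ℂ) • (S * normSq q m ^ i) := by
  have hSi : IsHomog q m (k + 2 * i) (S * normSq q m ^ i) :=
    IsHomog.mul hS.1 (isHomog_normSq_pow q m i)
  rw [rTensor_tmul_one_mul, rTensor_kernel_congr q m (k + 2 * i)
    (G := ((((jackson q γ fun r => r ^ (m + (2 * (k + i + n)) - 1) * φ (r ^ 2)) *
        sphereCoeff q m k i : ℝ) : ℂ)) •
      ((evalZero q m).toLinearMap ∘ₗ diffOp q m (S * normSq q m ^ i)))]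
  · rw [LinearMap.rTensor_smul, LinearMap.smul_apply, map_smul, hSi.lid_diffOp_kernel]
  · intro f hf
    have hn : S * normSq q m ^ n * f = (S * f) * normSq q m ^ n := by
      rw [mul_assoc, mul_assoc, normSq_pow_comm]
    have hh : IsHomog q m (2 * (k + i + n)) (S * normSq q m ^ n * f) := by
      rw [show 2 * (k + i + n) = k + 2 * n + (k + 2 * i) by ring]
      exact IsHomog.mul (IsHomog.mul hS.1 (isHomog_normSq_pow q m n)) hf
    rw [LinearMap.comp_apply, LinearMap.mulLeft_apply, hh.spaceInt, hn, sphereInt_mul_normSq_pow,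
      hS.sphereInt_mul hf, LinearMap.smul_apply, LinearMap.comp_apply, AlgHom.toLinearMap_apply,
      smul_eq_mul]
    push_cast
    ring

theorem lid_spaceInt_kernel_eq_zero {k l : ℕ} {S : Pol q m} (hS : IsSpherical q m k S) (n : ℕ)
    (γ : ℝ) (φ : ℝ → ℝ) (hl : ¬ ∃ i, l = k + 2 * i) :
    TensorProduct.lid ℂ (Pol q m) ((spaceInt q m γ φ).rTensor (Pol q m)
      (((S * normSq q m ^ n) ⊗ₜ[ℂ] 1) * kernel q m l)) = 0 := by
  rw [rTensor_tmul_one_mul, rTensor_kernel_congr q m l (G := 0), LinearMap.rTensor_zero,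
    LinearMap.zero_apply, map_zero]
  intro f hf
  have hn : S * normSq q m ^ n * f = (S * f) * normSq q m ^ n := by
    rw [mul_assoc, mul_assoc, normSq_pow_comm]
  have hh : IsHomog q m (k + 2 * n + l) (S * normSq q m ^ n * f) :=
    IsHomog.mul (IsHomog.mul hS.1 (isHomog_normSq_pow q m n)) hf
  rw [LinearMap.comp_apply, LinearMap.mulLeft_apply, hh.spaceInt, hn, sphereInt_mul_normSq_pow,
    hS.sphereInt_mul_eq_zero hf hl, mul_zero, LinearMap.zero_apply]

end

/-! ### Products of polynomials and radial power series -/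

section
variable (q : ℝ) (m : ℕ)

theorem coeff_ofPol (P : Pol q m) (d : ℕ) :
    PowerSeries.coeff d (ofPol q m P) = homComp q m d P := Polynomial.coeff_coe _ _

theorem ofPol_mul (P Q : Pol q m) : ofPol q m (P * Q) = ofPol q m P * ofPol q m Q := by
  rw [ofPol, map_mul, Polynomial.coe_mul]; rfl

theorem ofPol_add (P Q : Pol q m) : ofPol q m (P + Q) = ofPol q m P + ofPol q m Q := by
  rw [ofPol, map_add, Polynomial.coe_add]; rfl

theorem ofPol_smul (c : ℂ) (P : Pol q m) : ofPol q m (c • P) = c • ofPol q m P := by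
  refine PowerSeries.ext fun d => ?_
  rw [PowerSeries.coeff_smul, coeff_ofPol, coeff_ofPol, map_smul]

theorem ser_smul_mul (c : ℂ) (f g : Ser q m) : (c • f) * g = c • (f * g) := by
  refine PowerSeries.ext fun d => ?_
  rw [PowerSeries.coeff_smul, PowerSeries.coeff_mul, PowerSeries.coeff_mul, Finset.smul_sum]
  refine Finset.sum_congr rfl fun p _ => ?_
  rw [PowerSeries.coeff_smul, smul_mul_assoc]

theorem ser_mul_smul (c : ℂ) (f g : Ser q m) : f * (c • g) = c • (f * g) := by
  refine PowerSeries.ext fun d => ?_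
  rw [PowerSeries.coeff_smul, PowerSeries.coeff_mul, PowerSeries.coeff_mul, Finset.smul_sum]
  refine Finset.sum_congr rfl fun p _ => ?_
  rw [PowerSeries.coeff_smul, mul_smul_comm]

theorem coeff_radial_even (φ : PowerSeries ℝ) (i : ℕ) : PowerSeries.coeff (2 * i) (radial q m φ) =
    ((PowerSeries.coeff i φ : ℝ) : ℂ) • normSq q m ^ i := by
  rw [radial, PowerSeries.coeff_mk, if_pos (even_two_mul i), Nat.mul_div_cancel_left i two_pos]

theorem coeff_radial_odd (φ : PowerSeries ℝ) {d : ℕ} (hd : ¬ Even d) :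
    PowerSeries.coeff d (radial q m φ) = 0 := by
  rw [radial, PowerSeries.coeff_mk, if_neg hd]

theorem radial_add (φ ψ : PowerSeries ℝ) :
    radial q m (φ + ψ) = radial q m φ + radial q m ψ := by
  refine PowerSeries.ext fun d => ?_
  rw [map_add]
  simp only [radial, PowerSeries.coeff_mk]
  split_ifs
  · rw [map_add, Complex.ofReal_add, add_smul]
  · rw [add_zero]

theorem radial_smul (c : ℝ) (φ : PowerSeries ℝ) : radial q m (c • φ) = (c : ℂ) • radial q m φ := by
  refine PowerSeries.ext fun d => ?_
  rw [PowerSeries.coeff_smul]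
  simp only [radial, PowerSeries.coeff_mk]
  split_ifs
  · rw [PowerSeries.coeff_smul, smul_eq_mul, Complex.ofReal_mul, mul_smul]
  · rw [smul_zero]

/-- The linear map `P ↦ P(𝐱) φ(𝐱²)`. -/
def timesRadial (φ : PowerSeries ℝ) : Pol q m →ₗ[ℂ] Ser q m where
  toFun P := ofPol q m P * radial q m φ
  map_add' P Q := by rw [ofPol_add, add_mul]
  map_smul' c P := by rw [ofPol_smul, ser_smul_mul]; rfl

theorem timesRadial_apply (φ : PowerSeries ℝ) (P : Pol q m) :
    timesRadial q m φ P = ofPol q m P * radial q m φ := rfl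

theorem timesRadial_add (φ ψ : PowerSeries ℝ) (P : Pol q m) :
    timesRadial q m (φ + ψ) P = timesRadial q m φ P + timesRadial q m ψ P := by
  rw [timesRadial_apply, radial_add, mul_add]; rfl

theorem timesRadial_smul (c : ℝ) (φ : PowerSeries ℝ) (P : Pol q m) :
    timesRadial q m (c • φ) P = (c : ℂ) • timesRadial q m φ P := by
  rw [timesRadial_apply, radial_smul, ser_mul_smul]; rfl

theorem mulX_timesRadial (φ : PowerSeries ℝ) (j : Fin m) (P : Pol q m) :
    mulX q m j (timesRadial q m φ P) = timesRadial q m φ (x q m j * P) := by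
  rw [mulX, timesRadial_apply, timesRadial_apply, ofPol_mul, mul_assoc]

variable {q m} in
theorem IsHomog.coeff_timesRadial {d : ℕ} {P : Pol q m} (hP : IsHomog q m d P)
    (φ : PowerSeries ℝ) (i : ℕ) : PowerSeries.coeff (d + 2 * i) (QEuclid.timesRadial q m φ P) =
      ((PowerSeries.coeff i φ : ℝ) : ℂ) • (P * normSq q m ^ i) := by
  rw [QEuclid.timesRadial_apply, PowerSeries.coeff_mul, Finset.sum_eq_single (d, 2 * i)]
  · rw [coeff_ofPol, hP.homComp, if_pos rfl, coeff_radial_even, mul_smul_comm]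
  · rintro ⟨a, b⟩ hab hne
    rw [coeff_ofPol, hP.homComp, if_neg, zero_mul]
    rintro rfl
    rw [Finset.HasAntidiagonal.mem_antidiagonal] at hab
    exact hne (by rw [Prod.mk.injEq]; exact ⟨rfl, by simpa using hab⟩)
  · intro h; exact absurd (by rw [Finset.HasAntidiagonal.mem_antidiagonal]) h

variable {q m} in
theorem IsHomog.coeff_timesRadial_eq_zero {d : ℕ} {P : Pol q m} (hP : IsHomog q m d P)
    (φ : PowerSeries ℝ) {e : ℕ} (he : ¬ ∃ i, e = d + 2 * i) :
    PowerSeries.coeff e (QEuclid.timesRadial q m φ P) = 0 := by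
  rw [QEuclid.timesRadial_apply, PowerSeries.coeff_mul]
  refine Finset.sum_eq_zero ?_
  rintro ⟨a, b⟩ hab
  rw [Finset.HasAntidiagonal.mem_antidiagonal] at hab
  rw [coeff_ofPol, hP.homComp]
  split_ifs with h
  · rw [coeff_radial_odd, mul_zero]
    rintro ⟨c, hc⟩
    exact he ⟨c, by omega⟩
  · rw [zero_mul]

theorem mul_radial_injective {φ : PowerSeries ℝ} (h0 : PowerSeries.coeff 0 φ = 1) {f : Ser q m}
    (hf : f * radial q m φ = 0) : f = 0 := by
  refine PowerSeries.ext fun d => ?_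
  rw [map_zero]
  induction d using Nat.strong_induction_on with
  | _ d ih =>
    have h := congrArg (PowerSeries.coeff d) hf
    rw [map_zero, PowerSeries.coeff_mul, Finset.sum_eq_single (d, 0)] at h
    · have h1 := coeff_radial_even q m φ 0
      rw [mul_zero, h0, Complex.ofReal_one, one_smul, pow_zero] at h1
      rwa [h1, mul_one] at h
    · rintro ⟨a, b⟩ hab hne
      rw [Finset.HasAntidiagonal.mem_antidiagonal] at hab
      have hlt : a < d := by
        rcases Nat.eq_zero_or_pos b with hb | hb
        · exact absurd (by rw [Prod.mk.injEq]; exact ⟨by omega, hb⟩) hne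
        · omega
      rw [ih a hlt, zero_mul]
    · intro hn; exact absurd (by rw [Finset.HasAntidiagonal.mem_antidiagonal, add_zero]) hn

/-- A radial series with `φ(0) = 1` is not a zero divisor. -/
theorem timesRadial_injective {φ : PowerSeries ℝ} (h0 : PowerSeries.coeff 0 φ = 1) {P Q : Pol q m}
    (h : timesRadial q m φ P = timesRadial q m φ Q) : P = Q := by
  have h1 : timesRadial q m φ (P + (-1 : ℂ) • Q) = 0 := by
    rw [map_add, map_smul, h]; module
  have h2 := mul_radial_injective q m h0 h1
  have h3 : P + (-1 : ℂ) • Q = 0 := by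
    rw [← sum_homComp q m (P + (-1 : ℂ) • Q), Polynomial.sum_def]
    refine Finset.sum_eq_zero fun d _ => ?_
    have := congrArg (PowerSeries.coeff d) h2
    rw [coeff_ofPol, map_zero] at this
    exact this
  calc P = (P + (-1 : ℂ) • Q) + Q := by module
    _ = Q := by rw [h3, zero_add]

/-! ### Skew derivations -/

/-- The common features of `∂^j` and `∂̄^j` that determine their action on `S_k(𝐱) φ(𝐱²)`. -/
structure IsSkewDeriv (D : Fin m → Pol q m →ₗ[ℂ] Pol q m) (p M : ℝ) (θ : ℕ → ℝ) : Prop where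
  pos : 0 < p
  ne_one : p ≠ 1
  normSq_mul : ∀ j f, D j (normSq q m * f) =
    (M : ℂ) • (x q m j * f) + (p : ℂ) • (normSq q m * D j f)
  spherical : ∀ k S j, IsSpherical q m (k + 1) S → D j S = ((θ (k + 1) : ℝ) : ℂ) • pd q m j S
  homog : ∀ d f j, IsHomog q m (d + 1) f → IsHomog q m d (D j f)
  homog_zero : ∀ f j, IsHomog q m 0 f → D j f = 0

variable [Admissible q m]

theorem isSkewDeriv_pd : IsSkewDeriv q m (pd q m) (q ^ 2) (mu q m) fun _ => 1 where
  pos := sq_pos' q m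
  ne_one := (sq_lt_one' q m).ne
  normSq_mul := pd_normSq_mul q m
  spherical _ _ _ _ := by rw [Complex.ofReal_one, one_smul]
  homog _ _ j h := h.pd j
  homog_zero _ j h := h.pd_zero j

theorem isSkewDeriv_pdBar : IsSkewDeriv q m (pdBar q m) (q ^ 2)⁻¹ (q ^ ((m : ℤ) - 2) * mu q m)
    fun k => (q ^ 2)⁻¹ ^ (k - 1) where
  pos := inv_pos.2 (sq_pos' q m)
  ne_one := by rw [Ne, inv_eq_one]; exact (sq_lt_one' q m).ne
  normSq_mul := pdBar_normSq_mul q m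
  spherical _ _ j h := by rw [h.pdBar_eq]; rfl
  homog _ _ j h := h.pdBar j
  homog_zero _ j h := h.pdBar_zero j

/-- The `p`-derivative of a power series. -/
def qDeriv (p : ℝ) (φ : PowerSeries ℝ) : PowerSeries ℝ :=
  PowerSeries.mk fun i => qNumber p (i + 1 : ℕ) * PowerSeries.coeff (i + 1) φ

variable {q m} {D : Fin m → Pol q m →ₗ[ℂ] Pol q m} {p M : ℝ} {θ : ℕ → ℝ}

theorem IsSkewDeriv.mul_normSq_pow (hD : IsSkewDeriv q m D p M θ) (j : Fin m) (f : Pol q m)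
    (n : ℕ) : D j (f * normSq q m ^ (n + 1)) =
      ((M * qNumber p (n + 1 : ℕ) : ℝ) : ℂ) • ((x q m j * f) * normSq q m ^ n) +
      ((p ^ (n + 1) : ℝ) : ℂ) • (D j f * normSq q m ^ (n + 1)) := by
  induction n with
  | zero =>
    rw [zero_add, pow_one, pow_one, pow_zero, mul_one, Nat.cast_one, qNumber_one hD.ne_one,
      mul_one, ← normSq_comm, hD.normSq_mul, normSq_comm]
  | succ n ih =>
    rw [pow_succ _ (n + 1), ← mul_assoc, ← normSq_comm, hD.normSq_mul, ih, Nat.cast_succ (n + 1),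
      qNumber_add_one hD.pos hD.ne_one, normSq_comm, add_mul, smul_mul_assoc, smul_mul_assoc,
      mul_assoc (x q m j * f), ← pow_succ, mul_assoc (D j f), ← pow_succ, mul_assoc (x q m j)]
    push_cast
    module

theorem extend_add (F : Pol q m →ₗ[ℂ] Pol q m) (f g : Ser q m) :
    extend F (f + g) = extend F f + extend F g := by
  refine PowerSeries.ext fun d => ?_
  simp only [extend, PowerSeries.coeff_mk, map_add]

theorem extend_smul (F : Pol q m →ₗ[ℂ] Pol q m) (c : ℂ) (f : Ser q m) :
    extend F (c • f) = c • extend F f := by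
  refine PowerSeries.ext fun d => ?_
  simp only [extend, PowerSeries.coeff_mk, PowerSeries.coeff_smul, map_smul]

/-- The twisted Leibniz rule for products with radial series. -/
theorem IsSkewDeriv.timesRadial (hD : IsSkewDeriv q m D p M θ) (j : Fin m) (φ : PowerSeries ℝ)
    (P : Pol q m) : extend (D j) (QEuclid.timesRadial q m φ P) =
      QEuclid.timesRadial q m (M • qDeriv p φ) (x q m j * P) +
      QEuclid.timesRadial q m (PowerSeries.rescale p φ) (D j P) := by
  let L : Pol q m →ₗ[ℂ] Ser q m :=
    { toFun := fun P => extend (D j) (QEuclid.timesRadial q m φ P)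
      map_add' := fun P Q => by rw [map_add, extend_add]
      map_smul' := fun c P => by rw [map_smul, extend_smul]; rfl }
  have : L = QEuclid.timesRadial q m (M • qDeriv p φ) ∘ₗ LinearMap.mulLeft ℂ (x q m j) +
      QEuclid.timesRadial q m (PowerSeries.rescale p φ) ∘ₗ D j := by
    refine Pol.hom_ext_homog q m fun d P hP => PowerSeries.ext fun e => ?_
    have hx : IsHomog q m (d + 1) (x q m j * P) := by
      rw [add_comm]; exact (isHomog_x q m j).mul hP
    simp only [L, LinearMap.coe_mk, AddHom.coe_mk, LinearMap.add_apply, LinearMap.comp_apply,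
      LinearMap.mulLeft_apply]
    rw [map_add]
    simp only [extend, PowerSeries.coeff_mk]
    by_cases he : ∃ i, e + 1 = d + 2 * i
    · obtain ⟨i, hi⟩ := he
      rw [hi, hP.coeff_timesRadial, map_smul]
      rcases i with _ | i
      · have h1 : ¬ ∃ i, e = d + 1 + 2 * i := by rintro ⟨i, h⟩; omega
        rw [hx.coeff_timesRadial_eq_zero _ h1, zero_add]
        obtain rfl : d = e + 1 := by omega
        have h2 := (hD.homog e P j hP).coeff_timesRadial (PowerSeries.rescale p φ) 0
        rw [mul_zero, add_zero] at h2
        rw [h2, PowerSeries.coeff_rescale, pow_zero, pow_zero, one_mul, mul_one, mul_one]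
      · obtain rfl : e = d + 1 + 2 * i := by omega
        rw [hx.coeff_timesRadial, hD.mul_normSq_pow, PowerSeries.coeff_smul, qDeriv,
          PowerSeries.coeff_mk, smul_eq_mul]
        have h2 : PowerSeries.coeff (d + 1 + 2 * i)
            (QEuclid.timesRadial q m (PowerSeries.rescale p φ) (D j P)) =
            ((PowerSeries.coeff (i + 1) (PowerSeries.rescale p φ) : ℝ) : ℂ) •
              (D j P * normSq q m ^ (i + 1)) := by
          rcases d with _ | d
          · rw [hD.homog_zero P j hP, map_zero, map_zero, zero_mul, smul_zero]
          · rw [show d + 1 + 1 + 2 * i = d + 2 * (i + 1) by ring]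
            exact (hD.homog d P j hP).coeff_timesRadial _ _
        rw [h2, PowerSeries.coeff_rescale]
        push_cast
        module
    · have h1 : ¬ ∃ i, e = d + 1 + 2 * i := by
        rintro ⟨i, h⟩; exact he ⟨i + 1, by omega⟩
      rw [hP.coeff_timesRadial_eq_zero _ he, hx.coeff_timesRadial_eq_zero _ h1, map_zero, zero_add]
      rcases d with _ | d
      · rw [hD.homog_zero P j hP, map_zero, map_zero]
      · rw [(hD.homog d P j hP).coeff_timesRadial_eq_zero]
        rintro ⟨i, h⟩; exact he ⟨i, by omega⟩
  exact LinearMap.congr_fun this P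

theorem timesRadial_X_mul (φ : PowerSeries ℝ) (P : Pol q m) :
    timesRadial q m (PowerSeries.X * φ) P = timesRadial q m φ (normSq q m * P) := by
  have : timesRadial q m (PowerSeries.X * φ) =
      timesRadial q m φ ∘ₗ LinearMap.mulLeft ℂ (normSq q m) := by
    refine Pol.hom_ext_homog q m fun d P hP => PowerSeries.ext fun e => ?_
    have hx : IsHomog q m (d + 2) (normSq q m * P) := by
      rw [add_comm]; exact (isHomog_normSq q m).mul hP
    rw [LinearMap.comp_apply, LinearMap.mulLeft_apply]
    by_cases he : ∃ i, e = d + 2 * i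
    · obtain ⟨i, rfl⟩ := he
      rw [hP.coeff_timesRadial]
      rcases i with _ | i
      · rw [hx.coeff_timesRadial_eq_zero _ (by rintro ⟨i, h⟩; omega), PowerSeries.coeff_zero_X_mul,
          Complex.ofReal_zero, zero_smul]
      · rw [show d + 2 * (i + 1) = d + 2 + 2 * i by ring, hx.coeff_timesRadial,
          PowerSeries.coeff_succ_X_mul, normSq_comm, mul_assoc, ← pow_succ']
    · rw [hP.coeff_timesRadial_eq_zero _ he, hx.coeff_timesRadial_eq_zero]
      rintro ⟨i, h⟩; exact he ⟨i + 1, by omega⟩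
  exact LinearMap.congr_fun this P

end

/-! ### Transforms given by Bochner's relations -/

section
variable (q : ℝ) (m : ℕ) [Admissible q m]

theorem signI_sq (s : ℤˣ) : signI s ^ 2 = -1 := by
  rcases Int.units_eq_one_or s with rfl | rfl <;> simp [signI]

/-- The radial part of the transform of `S_k 𝐱^{2n}` times a Gaussian with moments `ν_N`. -/
def bochnerSeries (a : ℕ → ℕ → ℝ) (ν : ℕ → ℝ) (k n : ℕ) : PowerSeries ℝ :=
  PowerSeries.mk fun i => (-1) ^ i * a k i * ν (k + i + n)

/-- The transform of `P` times a Gaussian with moments `ν_N`, where Bochner's relations hold with the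
coefficients `a_{k,i}`. -/
def bochnerTransform (s : ℤˣ) (a : ℕ → ℕ → ℝ) (ν : ℕ → ℝ) : Pol q m →ₗ[ℂ] Ser q m :=
  fischerLift q m fun kn => signI s ^ kn.1 • timesRadial q m (bochnerSeries a ν kn.1 kn.2)

variable {q m}

theorem bochnerTransform_apply (s : ℤˣ) (a : ℕ → ℕ → ℝ) (ν : ℕ → ℝ) {k : ℕ} {S : Pol q m}
    (hS : IsSpherical q m k S) (n : ℕ) : bochnerTransform q m s a ν (S * normSq q m ^ n) =
      signI s ^ k • timesRadial q m (bochnerSeries a ν k n) S := by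
  rw [bochnerTransform, fischerLift_apply q m _ hS]
  rfl

theorem coeff_X_mul_qDeriv (p : ℝ) (φ : PowerSeries ℝ) (i : ℕ) :
    PowerSeries.coeff i (PowerSeries.X * qDeriv p φ) =
      qNumber p (i : ℕ) * PowerSeries.coeff i φ := by
  rcases i with _ | i
  · rw [PowerSeries.coeff_zero_X_mul]; simp [qNumber]
  · rw [PowerSeries.coeff_succ_X_mul, qDeriv, PowerSeries.coeff_mk]

variable {D : Fin m → Pol q m →ₗ[ℂ] Pol q m} {p M : ℝ} {θ : ℕ → ℝ}

/-- The spherical part of `x^j S`. -/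
def raise (j : Fin m) (k : ℕ) (S : Pol q m) : Pol q m :=
  x q m j * S - ((contractCoeff q m k : ℝ) : ℂ) • (normSq q m * pd q m j S)

theorem x_mul_eq_raise (j : Fin m) (k : ℕ) (S : Pol q m) : x q m j * S =
    raise j k S + ((contractCoeff q m k : ℝ) : ℂ) • (normSq q m * pd q m j S) := by
  rw [raise]; abel

theorem x_mul_mul_normSq_pow (j : Fin m) (k : ℕ) (S : Pol q m) (n : ℕ) :
    x q m j * (S * normSq q m ^ n) = raise j k S * normSq q m ^ n +
      ((contractCoeff q m k : ℝ) : ℂ) • (pd q m j S * normSq q m ^ (n + 1)) := by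
  rw [← mul_assoc, x_mul_eq_raise j k S, add_mul, smul_mul_assoc, normSq_comm, mul_assoc,
    ← pow_succ']

/-- A transform with Bochner's relations turns multiplication by `x^j` into a skew derivation. -/
theorem bochnerTransform_x_mul (hD : IsSkewDeriv q m D p M θ) (s : ℤˣ) {a : ℕ → ℕ → ℝ} {η : ℝ}
    (h1 : ∀ k i, η * (M * qNumber p (i + 1 : ℕ) * a k (i + 1)) = a (k + 1) i)
    (h2 : ∀ k i, contractCoeff q m (k + 1) * a k i = η * (a (k + 1) i *
      (p ^ i * θ (k + 1) + M * qNumber p (i : ℕ) * contractCoeff q m (k + 1))))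
    (ν : ℕ → ℝ) (j : Fin m) (P : Pol q m) :
    bochnerTransform q m s a ν (x q m j * P) =
      (-signI s * (η : ℂ)) • extend (D j) (bochnerTransform q m s a ν P) := by
  have hs := signI_sq s
  let L : Pol q m →ₗ[ℂ] Ser q m :=
    { toFun := fun P => (-signI s * (η : ℂ)) • extend (D j) (bochnerTransform q m s a ν P)
      map_add' := fun P Q => by rw [map_add, extend_add, smul_add]
      map_smul' := fun c P => by rw [map_smul, extend_smul, smul_comm]; rfl }
  have : bochnerTransform q m s a ν ∘ₗ LinearMap.mulLeft ℂ (x q m j) = L := by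
    refine Pol.hom_ext_spherical q m fun k n S hS => ?_
    simp only [L, LinearMap.coe_mk, AddHom.coe_mk, LinearMap.comp_apply, LinearMap.mulLeft_apply]
    have hR : IsSpherical q m (k + 1) (raise j k S) := hS.raise j
    have c1 : bochnerSeries a ν (k + 1) n = (-η) • (M • qDeriv p (bochnerSeries a ν k n)) := by
      refine PowerSeries.ext fun i => ?_
      rw [PowerSeries.coeff_smul, PowerSeries.coeff_smul]
      simp only [bochnerSeries, qDeriv, PowerSeries.coeff_mk, smul_eq_mul]
      rw [← h1, show k + 1 + i + n = k + (i + 1) + n by ring]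
      ring
    have c1' := congrArg (fun φ => timesRadial q m φ (raise j k S)) c1
    simp only [timesRadial_smul q m (-η)] at c1'
    rw [x_mul_mul_normSq_pow j k, map_add, map_smul, bochnerTransform_apply s a ν hS,
      bochnerTransform_apply s a ν hR, extend_smul, hD.timesRadial, x_mul_eq_raise j k S, map_add,
      map_smul, ← timesRadial_X_mul]
    rcases k with _ | k
    · rw [hS.pd_zero j, hD.homog_zero S j hS.1, zero_mul, map_zero, map_zero, map_zero, c1']
      push_cast
      module
    · have hT := hS.pd j
      have c2 : contractCoeff q m (k + 1) • bochnerSeries a ν k (n + 1) =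
          η • (contractCoeff q m (k + 1) • (PowerSeries.X *
            (M • qDeriv p (bochnerSeries a ν (k + 1) n))) +
            θ (k + 1) • PowerSeries.rescale p (bochnerSeries a ν (k + 1) n)) := by
        refine PowerSeries.ext fun i => ?_
        rw [mul_smul_comm]
        simp only [PowerSeries.coeff_smul, map_add, PowerSeries.coeff_rescale, coeff_X_mul_qDeriv,
          smul_eq_mul]
        simp only [bochnerSeries, PowerSeries.coeff_mk]
        rw [show k + 1 + i + n = k + i + (n + 1) by ring]
        linear_combination (-1) ^ i * ν (k + i + (n + 1)) * h2 k i
      have c2' := congrArg (fun φ => timesRadial q m φ (pd q m j S)) c2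
      simp only [timesRadial_smul q m η, timesRadial_add, timesRadial_smul q m (θ (k + 1)),
        timesRadial_smul q m (contractCoeff q m (k + 1))] at c2'
      rw [bochnerTransform_apply s a ν hT, hD.spherical k S j hS, map_smul, c1', smul_comm _ (signI s ^ k), c2',
        show signI s ^ (k + 1 + 1) = -signI s ^ k by rw [pow_add, pow_add]; linear_combination signI s ^ k * hs]
      have e : (-signI s * (η : ℂ)) * signI s ^ (k + 1) = η * signI s ^ k := by
        rw [pow_succ]; linear_combination -(η * signI s ^ k) * hs
      rw [smul_smul _ (signI s ^ (k + 1)), e]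
      push_cast
      module
  exact LinearMap.congr_fun this P

/-! ### Gaussians -/

/-- A Gaussian for the `p`-derivative: `ψ(p u) = (1 + (1 - p) A u) ψ(u)`, normalized by `ψ(0) = 1`. -/
structure IsGauss (p A : ℝ) (ψ : PowerSeries ℝ) : Prop where
  coeff_zero : PowerSeries.coeff 0 ψ = 1
  rescale_eq : PowerSeries.rescale p ψ = ψ + ((1 - p) * A) • (PowerSeries.X * ψ)

/-- The `p`-derivative of a Gaussian. -/
theorem IsGauss.qDeriv_eq {A : ℝ} {ψ : PowerSeries ℝ} (h : IsGauss p A ψ) (hp : p ≠ 1) :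
    qDeriv p ψ = (-A) • ψ := by
  refine PowerSeries.ext fun i => ?_
  have h1 := congrArg (PowerSeries.coeff (i + 1)) h.rescale_eq
  rw [PowerSeries.coeff_rescale, map_add, PowerSeries.coeff_smul, PowerSeries.coeff_succ_X_mul,
    smul_eq_mul] at h1
  rw [qDeriv, PowerSeries.coeff_mk, PowerSeries.coeff_smul, smul_eq_mul]
  have h2 := one_sub_mul_qNumber hp (i + 1 : ℕ)
  rw [Real.rpow_natCast] at h2
  refine mul_left_cancel₀ (sub_ne_zero.2 hp.symm) ?_
  linear_combination PowerSeries.coeff (i + 1) ψ * h2 - h1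

/-- The action of a skew derivation on the polynomial factor of `P(𝐱) ψ(𝐱²)`. -/
def gaussDeriv (D : Fin m → Pol q m →ₗ[ℂ] Pol q m) (p M A : ℝ) (j : Fin m) (P : Pol q m) :
    Pol q m := D j P + (((1 - p) * A : ℝ) : ℂ) • (normSq q m * D j P) +
      ((-(M * A) : ℝ) : ℂ) • (x q m j * P)

/-- Skew derivations preserve the space of polynomials times a fixed Gaussian. -/
theorem IsSkewDeriv.timesGauss (hD : IsSkewDeriv q m D p M θ) {A : ℝ} {ψ : PowerSeries ℝ}
    (h : IsGauss p A ψ) (j : Fin m) (P : Pol q m) :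
    extend (D j) (QEuclid.timesRadial q m ψ P) =
      QEuclid.timesRadial q m ψ (gaussDeriv D p M A j P) := by
  rw [hD.timesRadial, h.qDeriv_eq hD.ne_one, h.rescale_eq, timesRadial_smul, timesRadial_smul,
    timesRadial_add, timesRadial_smul, timesRadial_X_mul, gaussDeriv, map_add, map_add, map_smul,
    map_smul]
  push_cast
  module

/-- The action of a skew derivation in terms of the Fischer decomposition. -/
theorem IsSkewDeriv.spherical_mul_normSq_pow (hD : IsSkewDeriv q m D p M θ) {k : ℕ} {S : Pol q m}
    (hS : IsSpherical q m k S) (j : Fin m) (n : ℕ) : D j (S * normSq q m ^ n) =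
      ((M * qNumber p (n : ℕ) : ℝ) : ℂ) • (raise j k S * normSq q m ^ (n - 1)) +
      ((M * qNumber p (n : ℕ) * contractCoeff q m k + p ^ n * θ k : ℝ) : ℂ) •
        (pd q m j S * normSq q m ^ n) := by
  have hDS : D j S = ((θ k : ℝ) : ℂ) • pd q m j S := by
    rcases k with _ | k
    · rw [hD.homog_zero S j hS.1, hS.pd_zero, smul_zero]
    · exact hD.spherical k S j hS
  rcases n with _ | n
  · have h0 : qNumber p (0 : ℕ) = 0 := by simp [qNumber]
    simp only [h0, pow_zero, Nat.zero_sub, mul_one, hDS]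
    push_cast
    module
  · rw [hD.mul_normSq_pow, hDS, mul_assoc (x q m j), x_mul_mul_normSq_pow j k, smul_mul_assoc,
      Nat.add_sub_cancel]
    push_cast
    module

/-- The coefficient of the raised spherical polynomial in the transform of a derivative. -/
theorem bochnerSeries_raise {a : ℕ → ℕ → ℝ} {η p₀ A : ℝ} {ν : ℕ → ℝ} (hp : 0 < p) (hp1 : p ≠ 1)
    (hν : ∀ N, (1 - p) * A * ν (N + 1) = ((p₀ * p ^ N)⁻¹ - 1) * ν N)
    (h1 : ∀ k i, M * a (k + 1) i * (1 - (p₀ * p ^ (k + i))⁻¹) = -(η * (1 - p) * a k i)) (k n : ℕ) :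
    (M * qNumber p (n : ℕ)) • bochnerSeries a ν (k + 1) (n - 1) +
      ((1 - p) * A * (M * qNumber p (n : ℕ)) - M * A) • bochnerSeries a ν (k + 1) n =
      (-η) • bochnerSeries a ν k n := by
  have hp0 : 1 - p ≠ 0 := sub_ne_zero.2 hp1.symm
  have hn := one_sub_mul_qNumber hp1 (n : ℕ)
  rw [Real.rpow_natCast] at hn
  refine PowerSeries.ext fun i => mul_left_cancel₀ hp0 ?_
  have hY : (p₀ * p ^ (k + i))⁻¹ = p ^ n * (p₀ * p ^ (k + i + n))⁻¹ := by
    rw [pow_add p (k + i) n, ← mul_assoc, mul_inv (p₀ * p ^ (k + i)),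
      mul_comm (p₀ * p ^ (k + i))⁻¹, ← mul_assoc, mul_inv_cancel₀ (pow_pos hp n).ne', one_mul]
  have h := h1 k i
  rw [hY] at h
  have hN := hν (k + i + n)
  simp only [map_add, PowerSeries.coeff_smul, smul_eq_mul, bochnerSeries, PowerSeries.coeff_mk]
  rw [show k + 1 + i + n = k + i + n + 1 by ring]
  have hfirst : (M * qNumber p (n : ℕ)) * ((-1) ^ i * a (k + 1) i * ν (k + 1 + i + (n - 1))) =
      (M * qNumber p (n : ℕ)) * ((-1) ^ i * a (k + 1) i * ν (k + i + n)) := by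
    rcases n with _ | n
    · simp [qNumber]
    · rw [show k + 1 + i + (n + 1 - 1) = k + i + (n + 1) by omega]
  rw [hfirst]
  generalize qNumber p (n : ℕ) = Q at *
  linear_combination (-1) ^ i * ν (k + i + n) * h +
    (-1) ^ i * M * a (k + 1) i * (ν (k + i + n) + (1 - p) * A * ν (k + i + n + 1)) * hn +
    (-1) ^ i * M * a (k + 1) i * (-p ^ n) * hN

/-- The coefficient of the lowered spherical polynomial in the transform of a derivative. -/
theorem bochnerSeries_lower {a : ℕ → ℕ → ℝ} {η p₀ A c t : ℝ} {ν : ℕ → ℝ} (hp : 0 < p)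
    (hp1 : p ≠ 1) {k : ℕ}
    (hν : ∀ N, (1 - p) * A * ν (N + 1) = ((p₀ * p ^ N)⁻¹ - 1) * ν N)
    (h2 : a k 0 * ((1 - p) * t * (p₀ * p ^ k)⁻¹ + M * c * (1 - (p₀ * p ^ k)⁻¹)) = 0)
    (h3 : ∀ i, a k (i + 1) * ((1 - p) * t * (p₀ * p ^ (k + i + 1))⁻¹ +
      M * c * (1 - (p₀ * p ^ (k + i + 1))⁻¹)) = -(η * (1 - p) * c * a (k + 1) i)) (n : ℕ) :
    (M * qNumber p (n : ℕ) * c + p ^ n * t) • bochnerSeries a ν k n +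
      ((1 - p) * A * (M * qNumber p (n : ℕ) * c + p ^ n * t) - M * A * c) •
        bochnerSeries a ν k (n + 1) =
      (η * c) • (PowerSeries.X * bochnerSeries a ν (k + 1) n) := by
  have hp0 : 1 - p ≠ 0 := sub_ne_zero.2 hp1.symm
  have hn := one_sub_mul_qNumber hp1 (n : ℕ)
  rw [Real.rpow_natCast] at hn
  have key : ∀ i, (1 - p) * ((M * qNumber p (n : ℕ) * c + p ^ n * t) *
      ((-1) ^ i * a k i * ν (k + i + n)) +
      ((1 - p) * A * (M * qNumber p (n : ℕ) * c + p ^ n * t) - M * A * c) *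
        ((-1) ^ i * a k i * ν (k + i + n + 1))) = (-1) ^ i * ν (k + i + n) *
      (a k i * ((1 - p) * t * (p₀ * p ^ (k + i))⁻¹ + M * c * (1 - (p₀ * p ^ (k + i))⁻¹))) := by
    intro i
    have hY : (p₀ * p ^ (k + i))⁻¹ = p ^ n * (p₀ * p ^ (k + i + n))⁻¹ := by
      rw [pow_add p (k + i) n, ← mul_assoc, mul_inv (p₀ * p ^ (k + i)),
        mul_comm (p₀ * p ^ (k + i))⁻¹, ← mul_assoc, mul_inv_cancel₀ (pow_pos hp n).ne', one_mul]
    have hN := hν (k + i + n)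
    rw [hY]
    generalize qNumber p (n : ℕ) = Q at *
    linear_combination
      (-1) ^ i * a k i * M * c * (ν (k + i + n) + (1 - p) * A * ν (k + i + n + 1)) * hn +
      (-1) ^ i * a k i * (p ^ n * t * (1 - p) - M * c * p ^ n) * hN
  refine PowerSeries.ext fun i => mul_left_cancel₀ hp0 ?_
  simp only [map_add, PowerSeries.coeff_smul, smul_eq_mul]
  have hb : ∀ n i, PowerSeries.coeff i (bochnerSeries a ν k n) =
      (-1) ^ i * a k i * ν (k + i + n) := fun n i => by rw [bochnerSeries, PowerSeries.coeff_mk]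
  rw [hb, hb, ← add_assoc (k + i), key]
  rcases i with _ | i
  · rw [add_zero, h2, PowerSeries.coeff_zero_X_mul]; ring
  · rw [← add_assoc k, h3, PowerSeries.coeff_succ_X_mul, bochnerSeries, PowerSeries.coeff_mk,
      show k + i + 1 + n = k + 1 + i + n by ring]
    ring

/-- A transform with Bochner's relations turns a skew derivation into multiplication by `x^j`, by
the recursion for the moments of the Gaussian. -/
theorem bochnerTransform_gaussDeriv (hD : IsSkewDeriv q m D p M θ) (s : ℤˣ) {a : ℕ → ℕ → ℝ}
    {η p₀ A : ℝ} {ν : ℕ → ℝ} (hp₀ : p₀ ≠ 0)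
    (hν : ∀ N, ν N = p₀ * p ^ N * (ν N + (1 - p) * A * ν (N + 1)))
    (h1 : ∀ k i, M * a (k + 1) i * (1 - (p₀ * p ^ (k + i))⁻¹) = -(η * (1 - p) * a k i))
    (h2 : ∀ k, a k 0 * ((1 - p) * θ (k + 1) * (p₀ * p ^ k)⁻¹ +
      M * contractCoeff q m (k + 1) * (1 - (p₀ * p ^ k)⁻¹)) = 0)
    (h3 : ∀ k i, a k (i + 1) * ((1 - p) * θ (k + 1) * (p₀ * p ^ (k + i + 1))⁻¹ +
      M * contractCoeff q m (k + 1) * (1 - (p₀ * p ^ (k + i + 1))⁻¹)) =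
      -(η * (1 - p) * contractCoeff q m (k + 1) * a (k + 1) i))
    (j : Fin m) (P : Pol q m) :
    bochnerTransform q m s a ν (gaussDeriv D p M A j P) =
      (-signI s * (η : ℂ)) • mulX q m j (bochnerTransform q m s a ν P) := by
  have hs := signI_sq s
  have hp := hD.pos
  have hp1 : 1 - p ≠ 0 := sub_ne_zero.2 hD.ne_one.symm
  have hν' : ∀ N, (1 - p) * A * ν (N + 1) = ((p₀ * p ^ N)⁻¹ - 1) * ν N := by
    intro N
    have h0 : p₀ * p ^ N ≠ 0 := mul_ne_zero hp₀ (pow_pos hp N).ne'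
    refine mul_left_cancel₀ h0 ?_
    linear_combination -hν N - ν N * mul_inv_cancel₀ h0
  let Φ := bochnerTransform q m s a ν
  let L : Pol q m →ₗ[ℂ] Ser q m :=
    { toFun := fun P => (-signI s * (η : ℂ)) • mulX q m j (Φ P)
      map_add' := fun P Q => by rw [map_add, mulX, mulX, mulX, mul_add, smul_add]
      map_smul' := fun c P => by rw [map_smul, mulX, mulX, ser_mul_smul, smul_comm]; rfl }
  have : Φ ∘ₗ (D j + (((1 - p) * A : ℝ) : ℂ) • (LinearMap.mulLeft ℂ (normSq q m) ∘ₗ D j) +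
      ((-(M * A) : ℝ) : ℂ) • LinearMap.mulLeft ℂ (x q m j)) = L := by
    refine Pol.hom_ext_spherical q m fun k n S hS => ?_
    simp only [L, LinearMap.coe_mk, AddHom.coe_mk, LinearMap.comp_apply, LinearMap.mulLeft_apply,
      LinearMap.add_apply, LinearMap.smul_apply, map_add, map_smul]
    have hR : IsSpherical q m (k + 1) (raise j k S) := hS.raise j
    have hΦS : Φ (S * normSq q m ^ n) = _ := bochnerTransform_apply s a ν hS n
    have hΦR : ∀ n, Φ (raise j k S * normSq q m ^ n) = _ := bochnerTransform_apply s a ν hR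
    rw [hΦS, x_mul_mul_normSq_pow j k, map_add, map_smul, hΦR, mulX, ser_mul_smul]
    have hX : ofPol q m (x q m j) * timesRadial q m (bochnerSeries a ν k n) S =
        timesRadial q m (bochnerSeries a ν k n) (raise j k S) +
        ((contractCoeff q m k : ℝ) : ℂ) • timesRadial q m (PowerSeries.X * bochnerSeries a ν k n)
          (pd q m j S) := by
      have h := mulX_timesRadial q m (bochnerSeries a ν k n) j S
      rw [mulX] at h
      rw [h, x_mul_eq_raise j k S, map_add, map_smul, timesRadial_X_mul]
    rw [hX]
    have c1 := congrArg (fun φ => timesRadial q m φ (raise j k S))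
      (bochnerSeries_raise hp hD.ne_one hν' h1 k n)
    simp only [timesRadial_add, timesRadial_smul] at c1
    have e1 : Φ (D j (S * normSq q m ^ n)) + (((1 - p) * A : ℝ) : ℂ) •
        Φ (normSq q m * D j (S * normSq q m ^ n)) =
        ((M * qNumber p (n : ℕ) : ℝ) : ℂ) •
          (Φ (raise j k S * normSq q m ^ (n - 1)) +
            (((1 - p) * A : ℝ) : ℂ) • Φ (raise j k S * normSq q m ^ n)) +
        ((M * qNumber p (n : ℕ) * contractCoeff q m k + p ^ n * θ k : ℝ) : ℂ) •
          (Φ (pd q m j S * normSq q m ^ n) +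
            (((1 - p) * A : ℝ) : ℂ) • Φ (pd q m j S * normSq q m ^ (n + 1))) := by
      have hmul : ∀ (f : Pol q m) (i : ℕ), normSq q m * (f * normSq q m ^ i) =
          f * normSq q m ^ (i + 1) := by
        intro f i; rw [normSq_comm, mul_assoc, ← pow_succ]
      have hz : ((M * qNumber p (n : ℕ) : ℝ) : ℂ) •
          Φ (raise j k S * normSq q m ^ (n - 1 + 1)) =
          ((M * qNumber p (n : ℕ) : ℝ) : ℂ) • Φ (raise j k S * normSq q m ^ n) := by
        rcases n with _ | n
        · simp [qNumber]
        · rw [Nat.add_sub_cancel]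
      rw [hD.spherical_mul_normSq_pow hS, mul_add, mul_smul_comm, mul_smul_comm, hmul, hmul,
        map_add, map_add, map_smul, map_smul, map_smul, map_smul, smul_add, smul_add, smul_add,
        hz, smul_comm _ (((1 - p) * A : ℝ) : ℂ) (Φ (raise j k S * normSq q m ^ n)),
        smul_comm _ (((1 - p) * A : ℝ) : ℂ) (Φ (pd q m j S * normSq q m ^ (n + 1)))]
      abel
    rw [e1, hΦR, hΦR]
    rcases k with _ | k
    · rw [hS.pd_zero j, zero_mul, zero_mul, map_zero, map_zero]
      linear_combination (norm := skip) signI s • c1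
      push_cast
      module
    · have hT := hS.pd j
      have c2 := congrArg (fun φ => timesRadial q m φ (pd q m j S))
        (bochnerSeries_lower hp hD.ne_one hν' (h2 k) (h3 k) n)
      simp only [timesRadial_add, timesRadial_smul] at c2
      have hΦT : ∀ n, Φ (pd q m j S * normSq q m ^ n) = _ := bochnerTransform_apply s a ν hT
      rw [hΦT, hΦT]
      have es : signI s ^ (k + 1 + 1) = -signI s ^ k := by
        rw [pow_add, pow_add]; linear_combination signI s ^ k * hs
      have e : (-signI s * (η : ℂ)) * signI s ^ (k + 1) = η * signI s ^ k := by
        rw [pow_succ]; linear_combination -(η * signI s ^ k) * hs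
      rw [es, smul_smul _ (signI s ^ (k + 1)), e]
      linear_combination (norm := skip) (-signI s ^ k) • c1 + (signI s ^ k) • c2
      push_cast
      module
  exact LinearMap.congr_fun this P

end

/-! ### The `q`-exponentials -/

section
variable {p : ℝ}

theorem qNumber_natCast_pos (hp0 : 0 < p) (hp1 : p < 1) (n : ℕ) :
    0 < qNumber p (n + 1 : ℕ) := qNumber_pos hp0 hp1 (by positivity)

theorem one_le_qNumber (hp0 : 0 < p) (hp1 : p < 1) (n : ℕ) : 1 ≤ qNumber p (n + 1 : ℕ) := by
  rw [Nat.cast_succ, qNumber_add_one hp0 hp1.ne]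
  rcases n with _ | n
  · simp [qNumber]
  · have := qNumber_natCast_pos hp0 hp1 n
    have h := mul_pos hp0 this
    linarith

theorem coeff_bigExpSeries_pos (hp0 : 0 < p) (hp1 : p < 1) (j : ℕ) :
    0 < PowerSeries.coeff j (bigExpSeries p) := by
  rw [bigExpSeries, PowerSeries.coeff_mk]
  exact div_pos (pow_pos hp0 _) (qFactorial_pos hp0 hp1 j)

theorem coeff_bigExpSeries_succ (hp0 : 0 < p) (hp1 : p < 1) (j : ℕ) :
    qNumber p (j + 1 : ℕ) * PowerSeries.coeff (j + 1) (bigExpSeries p) =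
      p ^ j * PowerSeries.coeff j (bigExpSeries p) := by
  have h1 := (qFactorial_pos hp0 hp1 j).ne'
  have h2 := (qNumber_natCast_pos hp0 hp1 j).ne'
  rw [bigExpSeries, PowerSeries.coeff_mk, PowerSeries.coeff_mk, qFactorial_succ]
  have h3 : (j + 1) * (j + 1 - 1) / 2 = j * (j - 1) / 2 + j := by
    rcases j with _ | j
    · rfl
    · rw [Nat.add_sub_cancel, Nat.add_sub_cancel, ← Nat.add_mul_div_right _ _ two_pos]
      congr 1; ring
  rw [h3, pow_add]
  push_cast at h2 ⊢
  field_simp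

theorem coeff_smallExpSeries_succ (hp0 : 0 < p) (hp1 : p < 1) (j : ℕ) :
    qNumber p (j + 1 : ℕ) * PowerSeries.coeff (j + 1) (smallExpSeries p) =
      PowerSeries.coeff j (smallExpSeries p) := by
  have h1 := (qFactorial_pos hp0 hp1 j).ne'
  have h2 := (qNumber_natCast_pos hp0 hp1 j).ne'
  rw [smallExpSeries, PowerSeries.coeff_mk, PowerSeries.coeff_mk, qFactorial_succ]
  push_cast at h2 ⊢
  field_simp

theorem summable_bigExp (hp0 : 0 < p) (hp1 : p < 1) (t : ℝ) :
    Summable fun j => PowerSeries.coeff j (bigExpSeries p) * t ^ j := by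
  have hlim : Filter.Tendsto (fun j : ℕ => p ^ j * |t|) Filter.atTop (nhds 0) := by
    simpa using (tendsto_pow_atTop_nhds_zero_of_lt_one hp0.le hp1).mul_const |t|
  refine summable_of_ratio_norm_eventually_le (r := 1 / 2) (by norm_num) ?_
  filter_upwards [hlim.eventually (gt_mem_nhds (show (0 : ℝ) < 1 / 2 by norm_num))] with j hj
  have hb := coeff_bigExpSeries_pos hp0 hp1 j
  have hb' := coeff_bigExpSeries_pos hp0 hp1 (j + 1)
  have hle : PowerSeries.coeff (j + 1) (bigExpSeries p) ≤
      p ^ j * PowerSeries.coeff j (bigExpSeries p) := by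
    rw [← coeff_bigExpSeries_succ hp0 hp1]
    exact le_mul_of_one_le_left hb'.le (one_le_qNumber hp0 hp1 j)
  rw [norm_mul, norm_mul, norm_pow, norm_pow, Real.norm_eq_abs, Real.norm_eq_abs, Real.norm_eq_abs,
    abs_of_pos hb, abs_of_pos hb', pow_succ]
  calc PowerSeries.coeff (j + 1) (bigExpSeries p) * (|t| ^ j * |t|)
      ≤ p ^ j * PowerSeries.coeff j (bigExpSeries p) * (|t| ^ j * |t|) := by gcongr
    _ = (p ^ j * |t|) * (PowerSeries.coeff j (bigExpSeries p) * |t| ^ j) := by ring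
    _ ≤ 1 / 2 * (PowerSeries.coeff j (bigExpSeries p) * |t| ^ j) := by gcongr

/-- The functional equation of `E_p`. -/
theorem bigExp_eq_mul (hp0 : 0 < p) (hp1 : p < 1) (t : ℝ) :
    bigExp p t = (1 + (1 - p) * t) * bigExp p (p * t) := by
  have h1 := summable_bigExp hp0 hp1 t
  have h2 := summable_bigExp hp0 hp1 (p * t)
  have key : bigExp p t - bigExp p (p * t) = (1 - p) * t * bigExp p (p * t) := by
    unfold bigExp
    rw [← h1.tsum_sub h2, (h1.sub h2).tsum_eq_zero_add, ← tsum_mul_left]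
    simp only [pow_zero, sub_self, zero_add]
    refine tsum_congr fun j => ?_
    have h3 := coeff_bigExpSeries_succ hp0 hp1 j
    have h4 := one_sub_mul_qNumber hp1.ne (j + 1 : ℕ)
    rw [Real.rpow_natCast] at h4
    rw [mul_pow, mul_pow]
    linear_combination -PowerSeries.coeff (j + 1) (bigExpSeries p) * t ^ (j + 1) * h4 +
      (1 - p) * t ^ (j + 1) * h3
  linear_combination key

theorem le_bigExp (hp0 : 0 < p) (hp1 : p < 1) {t : ℝ} (ht : 0 ≤ t) (n : ℕ) :
    PowerSeries.coeff n (bigExpSeries p) * t ^ n ≤ bigExp p t :=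
  (summable_bigExp hp0 hp1 t).le_tsum n fun j _ =>
    mul_nonneg (coeff_bigExpSeries_pos hp0 hp1 j).le (pow_nonneg ht j)

theorem one_le_bigExp (hp0 : 0 < p) (hp1 : p < 1) {t : ℝ} (ht : 0 ≤ t) : 1 ≤ bigExp p t := by
  have := le_bigExp hp0 hp1 ht 0
  simpa [bigExpSeries, qFactorial] using this

theorem abs_bigExp_le (hp0 : 0 < p) (hp1 : p < 1) {t T : ℝ} (ht : |t| ≤ T) :
    |bigExp p t| ≤ bigExp p T := by
  have h1 := summable_bigExp hp0 hp1 t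
  have h2 := summable_bigExp hp0 hp1 T
  unfold bigExp
  rw [← Real.norm_eq_abs]
  refine tsum_of_norm_bounded h2.hasSum fun j => ?_
  rw [norm_mul, norm_pow, Real.norm_eq_abs, Real.norm_eq_abs,
    abs_of_pos (coeff_bigExpSeries_pos hp0 hp1 j)]
  gcongr
  exact (coeff_bigExpSeries_pos hp0 hp1 j).le

/-- The zeros of `E_p`. -/
theorem bigExp_eq_zero (hp0 : 0 < p) (hp1 : p < 1) (n : ℕ) :
    bigExp p (-((p ^ n)⁻¹ * (1 - p)⁻¹)) = 0 := by
  have h1 : 1 - p ≠ 0 := by linarith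
  induction n with
  | zero =>
    rw [bigExp_eq_mul hp0 hp1]
    have : 1 + (1 - p) * -((p ^ 0)⁻¹ * (1 - p)⁻¹) = 0 := by
      rw [pow_zero]; field_simp; ring
    rw [this, zero_mul]
  | succ n ih =>
    rw [bigExp_eq_mul hp0 hp1]
    have : p * -((p ^ (n + 1))⁻¹ * (1 - p)⁻¹) = -((p ^ n)⁻¹ * (1 - p)⁻¹) := by
      rw [pow_succ]; field_simp
    rw [this, ih, mul_zero]

theorem bigExp_neg_eq (hp0 : 0 < p) (hp1 : p < 1) (A u : ℝ) :
    bigExp p (-A * (p⁻¹ * u)) = (1 + (1 - p⁻¹) * A * u) * bigExp p (-A * u) := by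
  rw [bigExp_eq_mul hp0 hp1]
  have h1 : p * (-A * (p⁻¹ * u)) = -A * u := by field_simp
  have h2 : 1 + (1 - p) * (-A * (p⁻¹ * u)) = 1 + (1 - p⁻¹) * A * u := by field_simp; ring
  rw [h1, h2]

theorem smallExp_neg_eq (hp0 : 0 < p) (hp1 : p < 1) {A u : ℝ} (hA : 0 ≤ A) (hu : 0 ≤ u) :
    smallExp p (-A * (p * u)) = (1 + (1 - p) * A * u) * smallExp p (-A * u) := by
  have h := bigExp_eq_mul hp0 hp1 (A * u)
  have h1 : 0 < bigExp p (A * u) := by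
    have := one_le_bigExp hp0 hp1 (mul_nonneg hA hu); linarith
  have h2 : 0 < bigExp p (p * (A * u)) := by
    have := one_le_bigExp hp0 hp1 (mul_nonneg hp0.le (mul_nonneg hA hu)); linarith
  unfold smallExp
  rw [show -(-A * (p * u)) = p * (A * u) by ring, show -(-A * u) = A * u by ring]
  rw [h] at h1 ⊢
  generalize bigExp p (p * (A * u)) = a at *
  have h3 : 1 + (1 - p) * (A * u) ≠ 0 := left_ne_zero_of_mul h1.ne'
  rw [← mul_assoc] at h3
  rw [← mul_assoc (1 - p)]
  field_simp

/-- `E_p(-A u)` is a Gaussian for the derivative with base `p⁻¹`, which belongs to `∂̄`. -/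
theorem isGauss_bigExp (hp0 : 0 < p) (hp1 : p < 1) (A : ℝ) :
    IsGauss p⁻¹ A (PowerSeries.rescale (-A) (bigExpSeries p)) where
  coeff_zero := by simp [bigExpSeries, qFactorial]
  rescale_eq := by
    refine PowerSeries.ext fun i => ?_
    rw [map_add, PowerSeries.coeff_smul, PowerSeries.coeff_rescale, smul_eq_mul]
    rcases i with _ | i
    · simp
    · rw [PowerSeries.coeff_succ_X_mul, PowerSeries.coeff_rescale, PowerSeries.coeff_rescale]
      have h3 := coeff_bigExpSeries_succ hp0 hp1 i
      have h4 := one_sub_mul_qNumber hp1.ne (i + 1 : ℕ)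
      rw [Real.rpow_natCast] at h4
      have h5 : p⁻¹ ^ (i + 1) * p ^ (i + 1) = 1 := by rw [← mul_pow, inv_mul_cancel₀ hp0.ne', one_pow]
      have h6 : p⁻¹ ^ (i + 1) * p ^ i = p⁻¹ := by
        rw [pow_succ, mul_right_comm, ← mul_pow, inv_mul_cancel₀ hp0.ne', one_pow, one_mul]
      have h7 : p⁻¹ * p = 1 := inv_mul_cancel₀ hp0.ne'
      linear_combination (-A) ^ (i + 1) * (PowerSeries.coeff (i + 1) (bigExpSeries p) * h5
        - p⁻¹ ^ (i + 1) * PowerSeries.coeff (i + 1) (bigExpSeries p) * h4 +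
        p⁻¹ ^ (i + 1) * (1 - p) * h3 + (1 - p) * PowerSeries.coeff i (bigExpSeries p) * h6
        - PowerSeries.coeff i (bigExpSeries p) * h7)

/-- `e_p(-A u)` is a Gaussian for the derivative with base `p`, which belongs to `∂`. -/
theorem isGauss_smallExp (hp0 : 0 < p) (hp1 : p < 1) (A : ℝ) :
    IsGauss p A (PowerSeries.rescale (-A) (smallExpSeries p)) where
  coeff_zero := by simp [smallExpSeries, qFactorial]
  rescale_eq := by
    refine PowerSeries.ext fun i => ?_
    rw [map_add, PowerSeries.coeff_smul, PowerSeries.coeff_rescale, smul_eq_mul]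
    rcases i with _ | i
    · simp
    · rw [PowerSeries.coeff_succ_X_mul, PowerSeries.coeff_rescale, PowerSeries.coeff_rescale]
      have h3 := coeff_smallExpSeries_succ hp0 hp1 i
      have h4 := one_sub_mul_qNumber hp1.ne (i + 1 : ℕ)
      rw [Real.rpow_natCast] at h4
      linear_combination (-A) ^ (i + 1) * (PowerSeries.coeff (i + 1) (smallExpSeries p) * h4
        - (1 - p) * h3)

end

/-! ### Moments of Gaussians -/

section
variable {q : ℝ} {m : ℕ}

/-- The Jackson moments of the function `φ(r²)`. -/
def moment (q : ℝ) (m : ℕ) (γ : ℝ) (φ : ℝ → ℝ) (N : ℕ) : ℝ :=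
  jackson q γ fun r => r ^ (m + 2 * N - 1) * φ (r ^ 2)

theorem moment_eq (hm : 1 ≤ m) (γ : ℝ) (φ : ℝ → ℝ) (N : ℕ) : moment q m γ φ N =
    (1 - q) * ∑' k : ℤ, (q ^ k * γ) ^ (m + 2 * N) * φ ((q ^ k * γ) ^ 2) := by
  unfold moment jackson
  rw [mul_assoc, ← tsum_mul_left (a := γ)]
  congr 1
  refine tsum_congr fun k => ?_
  obtain ⟨M, hM⟩ : ∃ M, m + 2 * N = M + 1 := ⟨m + 2 * N - 1, by omega⟩
  rw [hM, Nat.add_sub_cancel, pow_succ]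
  ring

/-- The recursion for the moments of a function with a Gaussian functional equation, from the
invariance of the lattice under the dilation by `q^c`. -/
theorem moment_recursion (hq0 : 0 < q) (hm : 1 ≤ m) {γ A : ℝ} {φ : ℝ → ℝ} (c : ℤ)
    (hφ : ∀ u, 0 ≤ u → φ ((q ^ c) ^ 2 * u) = (1 + (1 - (q ^ c) ^ 2) * A * u) * φ u)
    (hs : ∀ N : ℕ, Summable fun k : ℤ => (q ^ k * γ) ^ (m + 2 * N) * φ ((q ^ k * γ) ^ 2))
    (N : ℕ) : moment q m γ φ N = (q ^ c) ^ m * ((q ^ c) ^ 2) ^ N *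
      (moment q m γ φ N + (1 - (q ^ c) ^ 2) * A * moment q m γ φ (N + 1)) := by
  have h : ∑' k : ℤ, (q ^ k * γ) ^ (m + 2 * N) * φ ((q ^ k * γ) ^ 2) =
      (q ^ c) ^ m * ((q ^ c) ^ 2) ^ N *
        (∑' k : ℤ, (q ^ k * γ) ^ (m + 2 * N) * φ ((q ^ k * γ) ^ 2) + (1 - (q ^ c) ^ 2) * A *
          ∑' k : ℤ, (q ^ k * γ) ^ (m + 2 * (N + 1)) * φ ((q ^ k * γ) ^ 2)) := by
    conv_lhs => rw [← (Equiv.addRight c).tsum_eq]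
    rw [← tsum_mul_left (a := (1 - (q ^ c) ^ 2) * A), ← (hs N).tsum_add ((hs (N + 1)).mul_left _),
      ← tsum_mul_left]
    refine tsum_congr fun k => ?_
    rw [Equiv.coe_addRight, zpow_add₀ hq0.ne',
      show (q ^ k * q ^ c * γ) ^ 2 = (q ^ c) ^ 2 * (q ^ k * γ) ^ 2 by ring, hφ _ (sq_nonneg _)]
    ring
  rw [moment_eq hm, moment_eq hm]
  linear_combination (1 - q) * h

/-- The lattice sums of the Gaussian `E_{q²}(-A r²)` are finite on one side, as `E_{q²}` vanishes at
the points `-q^{-2n}/(1 - q²)`. -/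
theorem summable_bigExp_moment (hq0 : 0 < q) (hq1 : q < 1) {γ A : ℝ} (hγ : 0 < γ) (hA : 0 ≤ A)
    (j : ℕ) (hAγ : A * γ ^ 2 = (q ^ 2) ^ j * (1 - q ^ 2)⁻¹) {M : ℕ} (hM : 1 ≤ M) :
    Summable fun k : ℤ => (q ^ k * γ) ^ M * bigExp (q ^ 2) (-A * (q ^ k * γ) ^ 2) := by
  have hp0 : 0 < q ^ 2 := by positivity
  have hp1 : q ^ 2 < 1 := by nlinarith
  -- Near zero the factor `q^{nM}` suffices; towards infinity only finitely many terms are nonzero.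
  refine Summable.of_nat_of_neg ?_ ?_
  · refine Summable.of_norm_bounded (g := fun n : ℕ => (γ ^ M * bigExp (q ^ 2) (A * γ ^ 2)) * q ^ n)
      ((summable_geometric_of_lt_one hq0.le hq1).mul_left _) fun n => ?_
    have hqn : (q ^ n) ^ M ≤ q ^ n :=
      pow_le_of_le_one (pow_nonneg hq0.le n) (pow_le_one₀ hq0.le hq1.le) (by omega)
    have hE : |bigExp (q ^ 2) (-A * (q ^ n * γ) ^ 2)| ≤ bigExp (q ^ 2) (A * γ ^ 2) := by
      refine abs_bigExp_le hp0 hp1 ?_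
      rw [abs_mul, abs_neg, abs_of_nonneg hA, abs_of_nonneg (sq_nonneg _), mul_pow]
      have h1 : (q ^ n) ^ 2 ≤ 1 := pow_le_one₀ (pow_nonneg hq0.le n) (pow_le_one₀ hq0.le hq1.le)
      have h2 : (q ^ n) ^ 2 * γ ^ 2 ≤ γ ^ 2 := mul_le_of_le_one_left (sq_nonneg _) h1
      gcongr
    rw [zpow_natCast, norm_mul, Real.norm_eq_abs, Real.norm_eq_abs,
      abs_of_pos (show 0 < (q ^ n * γ) ^ M by positivity), mul_pow]
    calc (q ^ n) ^ M * γ ^ M * |bigExp (q ^ 2) (-A * (q ^ n * γ) ^ 2)|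
        ≤ q ^ n * γ ^ M * bigExp (q ^ 2) (A * γ ^ 2) := by gcongr
      _ = _ := by ring
  · refine summable_of_ne_finset_zero (s := Finset.range j) fun n hn => ?_
    rw [Finset.mem_range, not_lt] at hn
    obtain ⟨i, rfl⟩ := Nat.exists_eq_add_of_le hn
    have : -A * (q ^ (-((j + i : ℕ) : ℤ)) * γ) ^ 2 = -(((q ^ 2) ^ i)⁻¹ * (1 - q ^ 2)⁻¹) := by
      rw [mul_pow, mul_left_comm, neg_mul, hAγ, zpow_neg, zpow_natCast]
      have h1 : (q ^ (j + i))⁻¹ ^ 2 * (q ^ 2) ^ j = ((q ^ 2) ^ i)⁻¹ := by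
        rw [inv_pow, ← pow_mul, ← pow_mul, ← pow_mul, show (j + i) * 2 = 2 * j + 2 * i by ring,
          pow_add]
        field_simp
      linear_combination -(1 - q ^ 2)⁻¹ * h1
    rw [this, bigExp_eq_zero hp0 hp1, mul_zero]

/-- The Gaussian `e_{q²}(-A r²)` decreases faster than any power. -/
theorem summable_smallExp_moment (hq0 : 0 < q) (hq1 : q < 1) {γ A : ℝ} (hγ : 0 < γ) (hA : 0 < A)
    {M : ℕ} (hM : 1 ≤ M) :
    Summable fun k : ℤ => (q ^ k * γ) ^ M * smallExp (q ^ 2) (-A * (q ^ k * γ) ^ 2) := by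
  have hp0 : 0 < q ^ 2 := by positivity
  have hp1 : q ^ 2 < 1 := by nlinarith
  have hE : ∀ t : ℝ, smallExp (q ^ 2) (-A * t ^ 2) = (bigExp (q ^ 2) (A * t ^ 2))⁻¹ := by
    intro t; rw [smallExp, neg_mul, neg_neg, one_div]
  have h0 : ∀ t : ℝ, 0 < bigExp (q ^ 2) (A * t ^ 2) := fun t => by
    have := one_le_bigExp hp0 hp1 (mul_nonneg hA.le (sq_nonneg t)); linarith
  simp only [hE]
  -- Near zero the factor `q^{nM}` suffices, as `e_{q²} ≤ 1` on the negative axis.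
  refine Summable.of_nat_of_neg ?_ ?_
  · refine Summable.of_norm_bounded (g := fun n : ℕ => γ ^ M * q ^ n)
      ((summable_geometric_of_lt_one hq0.le hq1).mul_left _) fun n => ?_
    have hqn : (q ^ n) ^ M ≤ q ^ n :=
      pow_le_of_le_one (pow_nonneg hq0.le n) (pow_le_one₀ hq0.le hq1.le) (by omega)
    have h1 : (bigExp (q ^ 2) (A * (q ^ n * γ) ^ 2))⁻¹ ≤ 1 :=
      inv_le_one_of_one_le₀ (one_le_bigExp hp0 hp1 (mul_nonneg hA.le (sq_nonneg _)))
    have h2 := h0 (q ^ n * γ)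
    rw [zpow_natCast, Real.norm_of_nonneg (by positivity), mul_pow]
    calc (q ^ n) ^ M * γ ^ M * (bigExp (q ^ 2) (A * (q ^ n * γ) ^ 2))⁻¹
        ≤ q ^ n * γ ^ M * 1 := by gcongr
      _ = _ := by ring
  · -- The bound by the term of degree `M` of the series makes the terms `O(q^{nM})`.
    have hb := coeff_bigExpSeries_pos hp0 hp1 M
    set b := PowerSeries.coeff M (bigExpSeries (q ^ 2)) with hb_def
    refine Summable.of_norm_bounded (g := fun n : ℕ => (b * A ^ M * γ ^ M)⁻¹ * q ^ n)
      ((summable_geometric_of_lt_one hq0.le hq1).mul_left _) fun n => ?_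
    have hqn : (q ^ n) ^ M ≤ q ^ n :=
      pow_le_of_le_one (pow_nonneg hq0.le n) (pow_le_one₀ hq0.le hq1.le) (by omega)
    have h2 := h0 (q ^ (-(n : ℤ)) * γ)
    have h3 := le_bigExp hp0 hp1 (mul_nonneg hA.le (sq_nonneg (q ^ (-(n : ℤ)) * γ))) M
    have ht : 0 < q ^ (-(n : ℤ)) * γ := by positivity
    rw [Real.norm_of_nonneg (by positivity)]
    have e : (q ^ (-(n : ℤ)) * γ) ^ M * (b * (A * (q ^ (-(n : ℤ)) * γ) ^ 2) ^ M)⁻¹ =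
        (b * A ^ M * γ ^ M)⁻¹ * (q ^ n) ^ M := by
      have hQ : q ^ n ≠ 0 := (pow_pos hq0 n).ne'
      rw [zpow_neg, zpow_natCast, mul_pow A, ← pow_mul _ 2 M, mul_comm 2 M, pow_mul, mul_pow]
      generalize q ^ n = Q at hQ
      rw [inv_pow]
      field_simp
    calc (q ^ (-(n : ℤ)) * γ) ^ M * (bigExp (q ^ 2) (A * (q ^ (-(n : ℤ)) * γ) ^ 2))⁻¹
        ≤ (q ^ (-(n : ℤ)) * γ) ^ M * (b * (A * (q ^ (-(n : ℤ)) * γ) ^ 2) ^ M)⁻¹ := by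
          gcongr
      _ = (b * A ^ M * γ ^ M)⁻¹ * (q ^ n) ^ M := e
      _ ≤ (b * A ^ M * γ ^ M)⁻¹ * q ^ n := by gcongr

end

/-! ### The coefficients in Bochner's relations -/

section
variable (q : ℝ) (m : ℕ) [Admissible q m]

theorem qNumber_natCast_eq (n : ℕ) (q : ℝ) (m : ℕ) [Admissible q m] :
    qNumber (q ^ 2) (n : ℕ) = (1 - (q ^ 2) ^ n) / (1 - q ^ 2) := by
  have h := one_sub_mul_qNumber (sq_lt_one' q m).ne (n : ℕ)
  rw [Real.rpow_natCast] at h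
  rw [← h, mul_div_cancel_left₀ _ (sub_ne_zero.2 (sq_lt_one' q m).ne')]

theorem qNumber_inv_natCast_eq (n : ℕ) (q : ℝ) (m : ℕ) [Admissible q m] :
    qNumber (q ^ 2)⁻¹ (n : ℕ) = (1 - ((q ^ 2) ^ n)⁻¹) / (1 - (q ^ 2)⁻¹) := by
  have h1 : (q ^ 2)⁻¹ ≠ 1 := by rw [Ne, inv_eq_one]; exact (sq_lt_one' q m).ne
  have h := one_sub_mul_qNumber h1 (n : ℕ)
  rw [Real.rpow_natCast, inv_pow] at h
  rw [← h, mul_div_cancel_left₀ _ (sub_ne_zero.2 h1.symm)]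

theorem qNumber_add_half_eq (N : ℕ) :
    qNumber (q ^ 2) ((N : ℝ) + (m : ℝ) / 2) = (1 - (q ^ 2) ^ N * q ^ m) / (1 - q ^ 2) := by
  have h := one_sub_mul_qNumber (sq_lt_one' q m).ne ((N : ℝ) + (m : ℝ) / 2)
  rw [Real.rpow_add (sq_pos' q m), sq_rpow_half, Real.rpow_natCast] at h
  rw [← h, mul_div_cancel_left₀ _ (sub_ne_zero.2 (sq_lt_one' q m).ne')]

theorem one_sub_pow_mul_pow_ne (N : ℕ) : 1 - (q ^ 2) ^ N * q ^ m ≠ 0 := by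
  have h1 : (q ^ 2) ^ N ≤ 1 := pow_le_one₀ (sq_pos' q m).le (sq_lt_one' q m).le
  have h2 : q ^ m < 1 := pow_lt_one₀ (q_pos q m).le (q_lt_one q m) (by have := one_le_m q m; omega)
  have h3 := pow_pos (q_pos q m) m
  have : (q ^ 2) ^ N * q ^ m < 1 := by nlinarith
  linarith

theorem contractCoeff_succ (k : ℕ) : contractCoeff q m (k + 1) =
    (1 - q ^ 2) / (mu q m * (1 - (q ^ 2) ^ k * q ^ m)) := by
  unfold contractCoeff
  rw [Nat.cast_succ, add_sub_cancel_right, qNumber_add_half_eq, ← mul_div_assoc, inv_div]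

variable {q m} {a : ℕ → ℕ → ℝ}

/-- The coefficients `a_{k,i}` of a Fourier integral. -/
structure IsIntegralCoeff (q : ℝ) (m : ℕ) (a : ℕ → ℕ → ℝ) : Prop where
  succ_right : ∀ k i, mu q m * qNumber (q ^ 2) (i + 1 : ℕ) * a k (i + 1) = a (k + 1) i
  succ_left : ∀ k i, a k i = mu q m * qNumber (q ^ 2) ((k + i : ℕ) + (m : ℝ) / 2) * a (k + 1) i

/-- The coefficients `a_{k,i}` of a transform by second `q`-Bessel functions. -/
structure IsHankelCoeff (q : ℝ) (m : ℕ) (a : ℕ → ℕ → ℝ) : Prop where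
  succ_right : ∀ k i, mu q m * qNumber (q ^ 2) (i + 1 : ℕ) * a k (i + 1) =
    (q ^ 2) ^ (i + 1) * a (k + 1) i
  succ_left : ∀ k i, (q ^ 2) ^ (k + i) * q ^ m * a k i =
    mu q m * qNumber (q ^ 2) ((k + i : ℕ) + (m : ℝ) / 2) * a (k + 1) i

theorem IsIntegralCoeff.transform_x_mul (h : IsIntegralCoeff q m a) (s : ℤˣ) (ν : ℕ → ℝ)
    (j : Fin m) (P : Pol q m) : bochnerTransform q m s a ν (x q m j * P) =
      (-signI s) • extend (pd q m j) (bochnerTransform q m s a ν P) := by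
  have hmu := (mu_pos q m).ne'
  have he : 1 - q ^ 2 ≠ 0 := sub_ne_zero.2 (sq_lt_one' q m).ne'
  rw [bochnerTransform_x_mul (isSkewDeriv_pd q m) s (η := 1) ?_ ?_ ν j P, Complex.ofReal_one,
    mul_one]
  · intro k i
    rw [one_mul, h.succ_right]
  · intro k i
    have h2 := h.succ_left k i
    have hk := one_sub_pow_mul_pow_ne q m k
    rw [contractCoeff_succ, qNumber_natCast_eq i q m, h2, qNumber_add_half_eq]
    rw [pow_add]
    generalize (q ^ 2) ^ k = y at *
    generalize (q ^ 2) ^ i = z at *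
    generalize q ^ m = w at *
    field_simp
    ring

theorem IsHankelCoeff.transform_x_mul (h : IsHankelCoeff q m a) (s : ℤˣ) (ν : ℕ → ℝ)
    (j : Fin m) (P : Pol q m) : bochnerTransform q m s a ν (x q m j * P) =
      (-signI s * (((q ^ m)⁻¹ : ℝ) : ℂ)) •
        extend (pdBar q m j) (bochnerTransform q m s a ν P) := by
  have hmu := (mu_pos q m).ne'
  have hq := (q_pos q m).ne'
  have he : 1 - q ^ 2 ≠ 0 := sub_ne_zero.2 (sq_lt_one' q m).ne'
  have he' : q ^ 2 - 1 ≠ 0 := sub_ne_zero.2 (sq_lt_one' q m).ne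
  have hz : q ^ ((m : ℤ) - 2) = q ^ m / q ^ 2 := by
    rw [zpow_sub₀ hq, zpow_natCast]; rfl
  have hw := (pow_pos (q_pos q m) m).ne'
  refine bochnerTransform_x_mul (isSkewDeriv_pdBar q m) s (η := (q ^ m)⁻¹) ?_ ?_ ν j P
  · intro k i
    have h1 := h.succ_right k i
    have hi := (pow_pos (sq_pos' q m) (i + 1)).ne'
    rw [qNumber_natCast_eq (i + 1) q m] at h1
    rw [qNumber_inv_natCast_eq (i + 1) q m, hz]
    have h3 : a (k + 1) i = ((q ^ 2) ^ (i + 1))⁻¹ *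
      (mu q m * ((1 - (q ^ 2) ^ (i + 1)) / (1 - q ^ 2)) * a k (i + 1)) := by
      rw [h1, ← mul_assoc, inv_mul_cancel₀ hi, one_mul]
    rw [h3]
    generalize (q ^ 2) ^ (i + 1) = z at *
    generalize q ^ m = w at *
    field_simp
    ring
  · intro k i
    have h2 := h.succ_left k i
    have hk := one_sub_pow_mul_pow_ne q m k
    have hy := (pow_pos (sq_pos' q m) k).ne'
    have hi := (pow_pos (sq_pos' q m) i).ne'
    rw [qNumber_add_half_eq, pow_add] at h2
    rw [contractCoeff_succ, qNumber_inv_natCast_eq i q m, hz, inv_pow, Nat.add_sub_cancel, inv_pow]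
    generalize (q ^ 2) ^ k = y at *
    generalize (q ^ 2) ^ i = z at *
    generalize q ^ m = w at *
    have h3 : a k i = (y * z * w)⁻¹ * (mu q m * ((1 - y * z * w) / (1 - q ^ 2)) * a (k + 1) i) := by
      rw [← h2, ← mul_assoc, inv_mul_cancel₀ (mul_ne_zero (mul_ne_zero hy hi) hw), one_mul]
    rw [h3]
    field_simp
    ring

theorem IsHankelCoeff.transform_gaussDeriv (h : IsHankelCoeff q m a) (s : ℤˣ) {ν : ℕ → ℝ} {A : ℝ}
    (hν : ∀ N, ν N = q ^ m * (q ^ 2) ^ N * (ν N + (1 - q ^ 2) * A * ν (N + 1)))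
    (j : Fin m) (P : Pol q m) :
    bochnerTransform q m s a ν (gaussDeriv (pd q m) (q ^ 2) (mu q m) A j P) =
      (-signI s) • mulX q m j (bochnerTransform q m s a ν P) := by
  have hmu := (mu_pos q m).ne'
  have hq := (q_pos q m).ne'
  have he : 1 - q ^ 2 ≠ 0 := sub_ne_zero.2 (sq_lt_one' q m).ne'
  have hw := (pow_pos (q_pos q m) m).ne'
  rw [bochnerTransform_gaussDeriv (isSkewDeriv_pd q m) s (η := 1) hw hν ?_ ?_ ?_ j P,
    Complex.ofReal_one, mul_one]
  · intro k i
    have h2 := h.succ_left k i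
    have hk := (pow_pos (sq_pos' q m) (k + i)).ne'
    rw [qNumber_add_half_eq] at h2
    generalize (q ^ 2) ^ (k + i) = y at *
    generalize q ^ m = w at *
    field_simp at h2 ⊢
    linear_combination h2
  · intro k
    have hk := one_sub_pow_mul_pow_ne q m k
    have hy := (pow_pos (sq_pos' q m) k).ne'
    rw [contractCoeff_succ]
    generalize (q ^ 2) ^ k = y at *
    generalize q ^ m = w at *
    have hk' : 1 - w * y ≠ 0 := fun h => hk (by linear_combination h)
    field_simp
    ring
  · intro k i
    have h1 := h.succ_right k i
    have hk := one_sub_pow_mul_pow_ne q m k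
    have hy := (pow_pos (sq_pos' q m) k).ne'
    have hi := (pow_pos (sq_pos' q m) (i + 1)).ne'
    rw [qNumber_natCast_eq (i + 1) q m] at h1
    rw [contractCoeff_succ, add_assoc, pow_add]
    have h3 : a (k + 1) i = ((q ^ 2) ^ (i + 1))⁻¹ *
      (mu q m * ((1 - (q ^ 2) ^ (i + 1)) / (1 - q ^ 2)) * a k (i + 1)) := by
      rw [h1, ← mul_assoc, inv_mul_cancel₀ hi, one_mul]
    rw [h3]
    generalize (q ^ 2) ^ k = y at *
    generalize (q ^ 2) ^ (i + 1) = z at *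
    generalize q ^ m = w at *
    have hk' : 1 - w * y ≠ 0 := fun h => hk (by linear_combination h)
    field_simp
    ring

theorem IsIntegralCoeff.transform_gaussDeriv (h : IsIntegralCoeff q m a) (s : ℤˣ) {ν : ℕ → ℝ}
    {A : ℝ} (hν : ∀ N, ν N = (q ^ m)⁻¹ * (q ^ 2)⁻¹ ^ N *
      (ν N + (1 - (q ^ 2)⁻¹) * A * ν (N + 1))) (j : Fin m) (P : Pol q m) :
    bochnerTransform q m s a ν
        (gaussDeriv (pdBar q m) (q ^ 2)⁻¹ (q ^ ((m : ℤ) - 2) * mu q m) A j P) =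
      (-signI s * ((q ^ m : ℝ) : ℂ)) • mulX q m j (bochnerTransform q m s a ν P) := by
  have hmu := (mu_pos q m).ne'
  have hq := (q_pos q m).ne'
  have he : 1 - q ^ 2 ≠ 0 := sub_ne_zero.2 (sq_lt_one' q m).ne'
  have hz : q ^ ((m : ℤ) - 2) = q ^ m / q ^ 2 := by
    rw [zpow_sub₀ hq, zpow_natCast]; rfl
  have hw := (pow_pos (q_pos q m) m).ne'
  refine bochnerTransform_gaussDeriv (isSkewDeriv_pdBar q m) s (η := q ^ m) (inv_ne_zero hw) hν
    ?_ ?_ ?_ j P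
  · intro k i
    have h2 := h.succ_left k i
    have hk := (pow_pos (sq_pos' q m) (k + i)).ne'
    rw [qNumber_add_half_eq] at h2
    rw [h2, hz, inv_pow]
    generalize (q ^ 2) ^ (k + i) = y at *
    generalize q ^ m = w at *
    field_simp
    ring
  · intro k
    have hk := one_sub_pow_mul_pow_ne q m k
    have hy := (pow_pos (sq_pos' q m) k).ne'
    rw [contractCoeff_succ, hz, Nat.add_sub_cancel, inv_pow]
    generalize (q ^ 2) ^ k = y at *
    generalize q ^ m = w at *
    field_simp
    ring
  · intro k i
    have h1 := h.succ_right k i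
    have hk := one_sub_pow_mul_pow_ne q m k
    have hy := (pow_pos (sq_pos' q m) k).ne'
    have hi := (pow_pos (sq_pos' q m) (i + 1)).ne'
    rw [← h1, qNumber_natCast_eq (i + 1) q m, contractCoeff_succ, hz, add_assoc,
      Nat.add_sub_cancel, inv_pow, inv_pow, pow_add _ k]
    generalize (q ^ 2) ^ k = y at *
    generalize (q ^ 2) ^ (i + 1) = z at *
    generalize q ^ m = w at *
    field_simp
    ring

/-- The recursion of the coefficients in `i`, from `[i + 1]_{q²}!`. -/
theorem sphereCoeff_succ_right (k i : ℕ) :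
    mu q m * qNumber (q ^ 2) (i + 1 : ℕ) * sphereCoeff q m k (i + 1) =
      sphereCoeff q m (k + 1) i := by
  have hp := sq_pos' q m
  have hp1 := sq_lt_one' q m
  have h1 := (qFactorial_pos hp hp1 i).ne'
  have h3 := (mu_pos q m).ne'
  have h2 := (qNumber_natCast_pos hp hp1 i).ne'
  have h4 : qGamma (q ^ 2) (((k + (i + 1) : ℕ) : ℝ) + (m : ℝ) / 2) ≠ 0 :=
    qGamma_ne_zero hp hp1 (by have := half_m_pos q m; positivity)
  unfold sphereCoeff
  rw [qFactorial_succ, show k + 1 + i = k + (i + 1) by ring,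
    show k + 2 * (i + 1) = k + 1 + 2 * i + 1 by ring, pow_succ _ (k + 1 + 2 * i)]
  generalize qGamma (q ^ 2) (((k + (i + 1) : ℕ) : ℝ) + (m : ℝ) / 2) = G at *
  rw [← Nat.cast_succ] at *
  generalize qNumber (q ^ 2) ((Nat.succ i : ℕ) : ℝ) = Q at *
  field_simp

/-- The recursion of the coefficients in `k`, from the functional equation of the `q`-Gamma
function. -/
theorem sphereCoeff_succ_left (k i : ℕ) : sphereCoeff q m k i =
    mu q m * qNumber (q ^ 2) ((k + i : ℕ) + (m : ℝ) / 2) * sphereCoeff q m (k + 1) i := by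
  have hp := sq_pos' q m
  have hp1 := sq_lt_one' q m
  have h1 := (qFactorial_pos hp hp1 i).ne'
  have h3 := (mu_pos q m).ne'
  have hpos : (0 : ℝ) < ((k + i : ℕ) : ℝ) + (m : ℝ) / 2 := by
    have := half_m_pos q m; positivity
  have h2 := (qNumber_pos hp hp1 hpos).ne'
  have h4 := qGamma_ne_zero hp hp1 hpos
  have h5 := qGamma_add_one hp hp1 hpos
  unfold sphereCoeff
  rw [show ((k + 1 + i : ℕ) : ℝ) + (m : ℝ) / 2 = ((k + i : ℕ) : ℝ) + (m : ℝ) / 2 + 1 by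
      push_cast; ring, h5, show k + 1 + 2 * i = k + 2 * i + 1 by ring, pow_succ (mu q m)]
  generalize qGamma (q ^ 2) (((k + i : ℕ) : ℝ) + (m : ℝ) / 2) = G at *
  generalize qNumber (q ^ 2) (((k + i : ℕ) : ℝ) + (m : ℝ) / 2) = Q at *
  field_simp

theorem isIntegralCoeff_sphereCoeff (c : ℝ) :
    IsIntegralCoeff q m fun k i => c * sphereCoeff q m k i where
  succ_right k i := by rw [← sphereCoeff_succ_right k i]; ring
  succ_left k i := by rw [sphereCoeff_succ_left k i]; ring

/-- The absolute values of the coefficients of the kernel of the `q`-Hankel transform of order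
`m/2 + k - 1`. -/
def hankelCoeff (q : ℝ) (m k i : ℕ) : ℝ :=
  (1 + q) / mu q m * (q * ((1 + q) / mu q m)) ^ ((m : ℝ) / 2 + k - 1) *
    (q ^ (((m : ℝ) / 2 + k - 1) ^ 2) / (1 + q) ^ ((m : ℝ) / 2 + k - 1)) *
    (q ^ (2 * (i : ℝ) * ((i : ℝ) + ((m : ℝ) / 2 + k - 1))) /
      (qFactorial (q ^ 2) i * qGamma (q ^ 2) ((i : ℝ) + ((m : ℝ) / 2 + k - 1) + 1))) *
    ((q * ((1 + q) / mu q m)) ^ 2 / (1 + q) ^ 2) ^ i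

/-- The recursion of the coefficients in `k`, from the functional equation of the `q`-Gamma
function. -/
theorem hankelCoeff_succ_left (k i : ℕ) : (q ^ 2) ^ (k + i) * q ^ m * hankelCoeff q m k i =
    mu q m * qNumber (q ^ 2) ((k + i : ℕ) + (m : ℝ) / 2) * hankelCoeff q m (k + 1) i := by
  have hq := q_pos q m
  have hp := sq_pos' q m
  have hp1 := sq_lt_one' q m
  have h1 := (qFactorial_pos hp hp1 i).ne'
  have h3 := (mu_pos q m)
  have hpos : (0 : ℝ) < ((k + i : ℕ) : ℝ) + (m : ℝ) / 2 := by
    have := half_m_pos q m; positivity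
  have h2 := (qNumber_pos hp hp1 hpos).ne'
  have h4 := qGamma_ne_zero hp hp1 hpos
  have h5 := qGamma_add_one hp hp1 hpos
  have hκ : 0 < q * ((1 + q) / mu q m) := by positivity
  have h1q : 0 < 1 + q := by positivity
  unfold hankelCoeff
  have e1 : (m : ℝ) / 2 + (k + 1 : ℕ) - 1 = ((m : ℝ) / 2 + k - 1) + 1 := by push_cast; ring
  have e2 : (i : ℝ) + ((m : ℝ) / 2 + k - 1) + 1 = ((k + i : ℕ) : ℝ) + (m : ℝ) / 2 := by
    push_cast; ring
  have e3 : (i : ℝ) + ((m : ℝ) / 2 + k - 1 + 1) + 1 = ((k + i : ℕ) : ℝ) + (m : ℝ) / 2 + 1 := by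
    push_cast; ring
  rw [e1, e3, e2, h5]
  have e4 : q ^ (((m : ℝ) / 2 + k - 1 + 1) ^ 2) *
      q ^ (2 * (i : ℝ) * ((i : ℝ) + ((m : ℝ) / 2 + k - 1 + 1))) * q =
      q ^ (((m : ℝ) / 2 + k - 1) ^ 2) * q ^ (2 * (i : ℝ) * ((i : ℝ) + ((m : ℝ) / 2 + k - 1))) *
      ((q ^ 2) ^ (k + i) * q ^ m) := by
    rw [← pow_mul, ← pow_add, ← Real.rpow_natCast q (2 * (k + i) + m), ← Real.rpow_add hq,
      ← Real.rpow_add hq, ← Real.rpow_add_one hq.ne', ← Real.rpow_add hq]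
    congr 1; push_cast; ring
  rw [Real.rpow_add_one hκ.ne', Real.rpow_add_one h1q.ne']
  have hr1 := (Real.rpow_pos_of_pos h1q ((m : ℝ) / 2 + k - 1)).ne'
  generalize q ^ (((m : ℝ) / 2 + k - 1 + 1) ^ 2) = E1 at *
  generalize q ^ (2 * (i : ℝ) * ((i : ℝ) + ((m : ℝ) / 2 + k - 1 + 1))) = E2 at *
  generalize q ^ (((m : ℝ) / 2 + k - 1) ^ 2) = F1 at *
  generalize q ^ (2 * (i : ℝ) * ((i : ℝ) + ((m : ℝ) / 2 + k - 1))) = F2 at *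
  generalize (q * ((1 + q) / mu q m)) ^ ((m : ℝ) / 2 + k - 1) = K at *
  generalize (1 + q) ^ ((m : ℝ) / 2 + k - 1) = K2 at *
  generalize qGamma (q ^ 2) (((k + i : ℕ) : ℝ) + (m : ℝ) / 2) = G at *
  generalize qNumber (q ^ 2) (((k + i : ℕ) : ℝ) + (m : ℝ) / 2) = Q at *
  generalize ((q * ((1 + q) / mu q m)) ^ 2 / (1 + q) ^ 2) ^ i = R at *
  generalize (q ^ 2) ^ (k + i) * q ^ m = W at *
  have hmu := h3.ne'
  field_simp
  linear_combination -(K * R) * e4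

/-- The recursion of the coefficients in `i`. The power of `q` comes from the factors `q^{ν²}` and
`q^{2i(i+ν)}` of the Bessel function. -/
theorem hankelCoeff_succ_right (k i : ℕ) :
    mu q m * qNumber (q ^ 2) (i + 1 : ℕ) * hankelCoeff q m k (i + 1) =
      (q ^ 2) ^ (i + 1) * hankelCoeff q m (k + 1) i := by
  have hq := q_pos q m
  have hp := sq_pos' q m
  have hp1 := sq_lt_one' q m
  have h1 := (qFactorial_pos hp hp1 i).ne'
  have h3 := (mu_pos q m)
  have h2 := (qNumber_natCast_pos hp hp1 i).ne'
  have hpos : (0 : ℝ) < ((k + i : ℕ) : ℝ) + (m : ℝ) / 2 := by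
    have := half_m_pos q m; positivity
  have h4 : qGamma (q ^ 2) (((k + i : ℕ) : ℝ) + (m : ℝ) / 2 + 1) ≠ 0 :=
    qGamma_ne_zero hp hp1 (by positivity)
  have hκ : 0 < q * ((1 + q) / mu q m) := by positivity
  have h1q : 0 < 1 + q := by positivity
  unfold hankelCoeff
  have e1 : (m : ℝ) / 2 + (k + 1 : ℕ) - 1 = ((m : ℝ) / 2 + k - 1) + 1 := by push_cast; ring
  have e2 : ((i + 1 : ℕ) : ℝ) + ((m : ℝ) / 2 + k - 1) + 1 =
      ((k + i : ℕ) : ℝ) + (m : ℝ) / 2 + 1 := by push_cast; ring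
  have e3 : (i : ℝ) + ((m : ℝ) / 2 + k - 1 + 1) + 1 = ((k + i : ℕ) : ℝ) + (m : ℝ) / 2 + 1 := by
    push_cast; ring
  rw [e1, e3, e2, qFactorial_succ]
  have e4 : q ^ (((m : ℝ) / 2 + k - 1) ^ 2) *
      q ^ (2 * ((i + 1 : ℕ) : ℝ) * (((i + 1 : ℕ) : ℝ) + ((m : ℝ) / 2 + k - 1))) * q =
      q ^ (((m : ℝ) / 2 + k - 1 + 1) ^ 2) *
        q ^ (2 * (i : ℝ) * ((i : ℝ) + ((m : ℝ) / 2 + k - 1 + 1))) * (q ^ 2) ^ (i + 1) := by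
    rw [← pow_mul, ← Real.rpow_natCast q (2 * (i + 1)), ← Real.rpow_add hq,
      ← Real.rpow_add hq, ← Real.rpow_add_one hq.ne', ← Real.rpow_add hq]
    congr 1; push_cast; ring
  rw [Real.rpow_add_one hκ.ne', Real.rpow_add_one h1q.ne', pow_succ _ i]
  have hr1 := (Real.rpow_pos_of_pos h1q ((m : ℝ) / 2 + k - 1)).ne'
  rw [← Nat.cast_succ] at *
  generalize q ^ (((m : ℝ) / 2 + k - 1 + 1) ^ 2) = E1 at *
  generalize q ^ (2 * (i : ℝ) * ((i : ℝ) + ((m : ℝ) / 2 + k - 1 + 1))) = E2 at *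
  generalize q ^ (((m : ℝ) / 2 + k - 1) ^ 2) = F1 at *
  generalize q ^ (2 * ((i + 1 : ℕ) : ℝ) * (((i + 1 : ℕ) : ℝ) + ((m : ℝ) / 2 + k - 1))) = F2 at *
  generalize (q * ((1 + q) / mu q m)) ^ ((m : ℝ) / 2 + k - 1) = K at *
  generalize (1 + q) ^ ((m : ℝ) / 2 + k - 1) = K2 at *
  generalize qGamma (q ^ 2) (((k + i : ℕ) : ℝ) + (m : ℝ) / 2 + 1) = G at *
  generalize qNumber (q ^ 2) ((Nat.succ i : ℕ) : ℝ) = Q at *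
  generalize ((q * ((1 + q) / mu q m)) ^ 2 / (1 + q) ^ 2) ^ i = R at *
  generalize (q ^ 2) ^ (i + 1) = W at *
  have hmu := h3.ne'
  field_simp
  linear_combination K * R * e4

theorem isHankelCoeff_hankelCoeff (c : ℝ) :
    IsHankelCoeff q m fun k i => c * hankelCoeff q m k i where
  succ_right k i := by linear_combination c * hankelCoeff_succ_right (q := q) (m := m) k i
  succ_left k i := by linear_combination c * hankelCoeff_succ_left (q := q) (m := m) k i

end

/-! ### Taylor expansion of the `q`-Hankel transform -/

section

/-- The Taylor coefficients of the sum of an everywhere convergent power series. -/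
theorem taylorAtZero_eq {G : ℝ → ℝ} {c : ℕ → ℝ} (hs : ∀ u : ℝ, Summable fun i => |c i| * |u| ^ i)
    (hG : ∀ u, G u = ∑' i, c i * u ^ i) : taylorAtZero G = PowerSeries.mk c := by
  have hsum : ∀ u : ℝ, HasSum (fun i => c i * u ^ i) (G u) := by
    intro u
    rw [hG u]
    refine Summable.hasSum (Summable.of_norm ?_)
    simpa only [norm_mul, norm_pow, Real.norm_eq_abs] using hs u
  have h : HasFPowerSeriesOnBall G (FormalMultilinearSeries.ofScalars ℝ c) 0 1 := by
    refine ⟨?_, one_pos, fun {y} _ => ?_⟩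
    · refine FormalMultilinearSeries.le_radius_of_summable _ (r := 1) ?_
      simpa [FormalMultilinearSeries.ofScalars_norm] using hs 1
    · simpa [FormalMultilinearSeries.ofScalars_apply_eq, mul_comm] using hsum y
  have h1 := h.hasFPowerSeriesAt
  have h2 := h1.analyticAt.hasFPowerSeriesAt
  have h3 := h2.eq_formalMultilinearSeries h1
  refine PowerSeries.ext fun n => ?_
  have h4 := congrArg (fun P => FormalMultilinearSeries.coeff P n) h3
  simp only [FormalMultilinearSeries.coeff_ofScalars] at h4
  rw [taylorAtZero, PowerSeries.coeff_mk, PowerSeries.coeff_mk, h4]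

theorem summable_of_ratio_geometric {c : ℕ → ℝ} {C r : ℝ} (hr0 : 0 ≤ r) (hr1 : r < 1)
    (h : ∀ i, |c (i + 1)| ≤ C * r ^ i * |c i|) (u : ℝ) : Summable fun i => |c i| * |u| ^ i := by
  have hlim : Filter.Tendsto (fun i : ℕ => (C * |u|) * r ^ i) Filter.atTop (nhds 0) := by
    simpa using (tendsto_pow_atTop_nhds_zero_of_lt_one hr0 hr1).const_mul (C * |u|)
  refine summable_of_ratio_norm_eventually_le (r := 1 / 2) (by norm_num) ?_
  filter_upwards [hlim.eventually (gt_mem_nhds (show (0 : ℝ) < 1 / 2 by norm_num))] with i hi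
  rw [Real.norm_of_nonneg (by positivity), Real.norm_of_nonneg (by positivity), pow_succ]
  calc |c (i + 1)| * (|u| ^ i * |u|) ≤ C * r ^ i * |c i| * (|u| ^ i * |u|) := by
        gcongr; exact h i
    _ = (C * |u|) * r ^ i * (|c i| * |u| ^ i) := by ring
    _ ≤ 1 / 2 * (|c i| * |u| ^ i) := by gcongr

variable {q : ℝ} {m : ℕ} [Admissible q m]

/-- The Taylor series of the `q`-Hankel transform of a Gaussian converges everywhere: the quotient
of successive coefficients decreases like `q^{2i}`, as the decay of the Bessel coefficients
outweighs the growth of the moments. -/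
theorem summable_hankelCoeff_mul_moment {A : ℝ} {ν : ℕ → ℝ} (hA : 0 < A)
    (hν : ∀ N, ν N = q ^ m * (q ^ 2) ^ N * (ν N + (1 - q ^ 2) * A * ν (N + 1))) (k n : ℕ) (u : ℝ) :
    Summable fun i => |(-1) ^ i * hankelCoeff q m k i * ν (k + i + n)| * |u| ^ i := by
  have hq := q_pos q m
  have hp := sq_pos' q m
  have hp1 := sq_lt_one' q m
  have he : 0 < 1 - q ^ 2 := by linarith
  have hmu := mu_pos q m
  have hw : 0 < q ^ m := pow_pos hq m
  have hw1 : q ^ m < 1 := pow_lt_one₀ hq.le (q_lt_one q m) (by have := one_le_m q m; omega)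
  set C : ℝ := mu q m ^ 2 * (1 - q ^ m) * ((1 - q ^ 2) * A) with hC
  have hC0 : 0 < C := by
    have : 0 < 1 - q ^ m := by linarith
    positivity
  refine summable_of_ratio_geometric (C := C⁻¹ * ((q ^ 2) ^ n)⁻¹) hp.le hp1 (fun i => ?_) u
  have hyn := pow_pos hp n
  have hyi := pow_pos hp i
  have hyk := pow_pos hp k
  -- The recursions for the coefficients and for the moments.
  have key : mu q m ^ 2 * qNumber (q ^ 2) (i + 1 : ℕ) *
      qNumber (q ^ 2) ((k + i : ℕ) + (m : ℝ) / 2) * ((1 - q ^ 2) * A) *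
      (hankelCoeff q m k (i + 1) * ν (k + (i + 1) + n)) =
      ((q ^ 2) ^ (i + 1) * (((q ^ 2) ^ n)⁻¹ - (q ^ 2) ^ (k + i) * q ^ m)) *
        (hankelCoeff q m k i * ν (k + i + n)) := by
    have h1 := hankelCoeff_succ_right (q := q) (m := m) k i
    have h2 := hankelCoeff_succ_left (q := q) (m := m) k i
    have h3 := hν (k + i + n)
    rw [pow_add _ (k + i)] at h3
    have h4 : (q ^ 2) ^ n * ((q ^ 2) ^ n)⁻¹ = 1 := mul_inv_cancel₀ hyn.ne'
    rw [show k + (i + 1) + n = k + i + n + 1 by ring]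
    have hyki := (pow_pos hp (k + i)).ne'
    generalize qNumber (q ^ 2) (i + 1 : ℕ) = Q1 at *
    generalize qNumber (q ^ 2) ((k + i : ℕ) + (m : ℝ) / 2) = Q2 at *
    generalize (q ^ 2) ^ (k + i) = y at *
    generalize (q ^ 2) ^ (i + 1) = x at *
    generalize (q ^ 2) ^ n = z at *
    generalize q ^ m = w at *
    have h5 : y * w * ((1 - q ^ 2) * A * ν (k + i + n + 1)) = (z⁻¹ - y * w) * ν (k + i + n) := by
      refine mul_left_cancel₀ hyn.ne' ?_
      linear_combination -h3 - ν (k + i + n) * h4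
    linear_combination mu q m * Q2 * ((1 - q ^ 2) * A) * ν (k + i + n + 1) * h1
      - x * ((1 - q ^ 2) * A) * ν (k + i + n + 1) * h2 + x * hankelCoeff q m k i * h5
  have hG : 1 - q ^ m ≤ qNumber (q ^ 2) ((k + i : ℕ) + (m : ℝ) / 2) := by
    rw [qNumber_add_half_eq, le_div_iff₀ he]
    have h1 : (q ^ 2) ^ (k + i) ≤ 1 := pow_le_one₀ hp.le hp1.le
    nlinarith
  have hQ := one_le_qNumber hp hp1 i
  have h1m : 0 < 1 - q ^ m := by linarith
  have hcoef : C ≤ mu q m ^ 2 * qNumber (q ^ 2) (i + 1 : ℕ) *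
      qNumber (q ^ 2) ((k + i : ℕ) + (m : ℝ) / 2) * ((1 - q ^ 2) * A) := by
    rw [hC]
    have : mu q m ^ 2 * 1 ≤ mu q m ^ 2 * qNumber (q ^ 2) (i + 1 : ℕ) := by gcongr
    rw [mul_one] at this
    gcongr
  have habs : ∀ j, |(-1 : ℝ) ^ j * hankelCoeff q m k j * ν (k + j + n)| =
      |hankelCoeff q m k j * ν (k + j + n)| := by
    intro j; rw [mul_assoc, abs_mul, abs_pow, abs_neg, abs_one, one_pow, one_mul]
  rw [habs, habs]
  have h6 : |(q ^ 2) ^ (i + 1) * (((q ^ 2) ^ n)⁻¹ - (q ^ 2) ^ (k + i) * q ^ m)| ≤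
      ((q ^ 2) ^ n)⁻¹ * (q ^ 2) ^ i := by
    have h7 : (q ^ 2) ^ (k + i) * q ^ m ≤ ((q ^ 2) ^ n)⁻¹ := by
      have h8 : (1 : ℝ) ≤ ((q ^ 2) ^ n)⁻¹ := one_le_inv_iff₀.2 ⟨hyn, pow_le_one₀ hp.le hp1.le⟩
      have h9 : (q ^ 2) ^ (k + i) ≤ 1 := pow_le_one₀ hp.le hp1.le
      nlinarith [mul_le_mul h9 hw1.le hw.le zero_le_one]
    have h10 : 0 < (q ^ 2) ^ (k + i) * q ^ m := by positivity
    rw [abs_of_nonneg (mul_nonneg (pow_pos hp _).le (by linarith)), mul_comm]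
    have h11 : (q ^ 2) ^ (i + 1) ≤ (q ^ 2) ^ i := pow_le_pow_of_le_one hp.le hp1.le (by omega)
    exact mul_le_mul (by linarith) h11 (pow_pos hp _).le (inv_pos.2 hyn).le
  have h12 := congrArg abs key
  rw [abs_mul, abs_mul _ (hankelCoeff q m k i * ν (k + i + n)), abs_of_pos (hC0.trans_le hcoef)]
    at h12
  rw [mul_assoc, mul_assoc C⁻¹, ← div_eq_inv_mul, le_div_iff₀ hC0, mul_comm, ← mul_assoc]
  calc C * |hankelCoeff q m k (i + 1) * ν (k + (i + 1) + n)| ≤ _ := by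
        gcongr
    _ = _ := h12
    _ ≤ _ := by gcongr

theorem summable_uncurry_mul {a : ℕ → ℝ} {b : ℕ → ℤ → ℝ} (hb0 : ∀ i l, 0 ≤ b i l)
    (hb : ∀ i, Summable (b i)) (h : Summable fun i => |a i| * ∑' l, b i l) :
    Summable (Function.uncurry fun i l => a i * b i l) := by
  refine Summable.of_norm ((summable_prod_of_nonneg fun x => norm_nonneg _).2 ⟨fun i => ?_, ?_⟩)
  · exact ((hb i).mul_left (a i)).norm
  · refine h.congr fun i => ?_
    rw [← tsum_mul_left]
    refine tsum_congr fun l => ?_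
    rw [Function.uncurry_apply_pair, norm_mul, Real.norm_of_nonneg (hb0 i l), Real.norm_eq_abs]

/-- Termwise integration of the Bessel series. -/
theorem taylorAtZero_radialHankel {A γ : ℝ} (hA : 0 < A) (hγ : 0 < γ) {φ : ℝ → ℝ}
    (hφ0 : ∀ u, 0 ≤ u → 0 ≤ φ u)
    (hφ : ∀ u, 0 ≤ u → φ (q ^ 2 * u) = (1 + (1 - q ^ 2) * A * u) * φ u)
    (hs : ∀ N : ℕ, Summable fun k : ℤ => (q ^ k * γ) ^ (m + 2 * N) * φ ((q ^ k * γ) ^ 2))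
    (k n : ℕ) :
    taylorAtZero (radialHankel q m ((m : ℝ) / 2 + k - 1) γ fun u => u ^ n * φ u) =
      bochnerSeries (hankelCoeff q m) (moment q m γ φ) k n := by
  have hq := q_pos q m
  have hm := one_le_m q m
  have h1q : 0 < 1 - q := sub_pos.2 (q_lt_one q m)
  have hν : ∀ N, moment q m γ φ N = q ^ m * (q ^ 2) ^ N *
      (moment q m γ φ N + (1 - q ^ 2) * A * moment q m γ φ (N + 1)) := by
    have h := moment_recursion hq hm (γ := γ) (A := A) (φ := φ) 1 (by simpa using hφ) hs
    simpa using h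
  have hsum := summable_hankelCoeff_mul_moment hA hν k n
  refine taylorAtZero_eq hsum fun u => ?_
  let F : ℕ → ℤ → ℝ := fun i l => (-1) ^ i * hankelCoeff q m k i * u ^ i *
    ((q ^ l * γ) ^ (m + 2 * (k + i + n)) * φ ((q ^ l * γ) ^ 2))
  have hpos : ∀ N (l : ℤ), 0 ≤ (q ^ l * γ) ^ (m + 2 * N) * φ ((q ^ l * γ) ^ 2) := fun N l =>
    mul_nonneg (by positivity) (hφ0 _ (sq_nonneg _))
  -- Absolute convergence of the double series, which allows the sums to be exchanged.
  have hF : Summable (Function.uncurry F) := by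
    refine summable_uncurry_mul (fun i l => hpos (k + i + n) l) (fun i => hs (k + i + n)) ?_
    refine ((hsum u).mul_left (1 - q)⁻¹).congr fun i => ?_
    have h3 : 0 ≤ moment q m γ φ (k + i + n) := by
      rw [moment_eq hm]
      exact mul_nonneg h1q.le (tsum_nonneg fun l => hpos _ l)
    have h4 : ∑' l : ℤ, (q ^ l * γ) ^ (m + 2 * (k + i + n)) * φ ((q ^ l * γ) ^ 2) =
        (1 - q)⁻¹ * moment q m γ φ (k + i + n) := by
      rw [moment_eq hm, inv_mul_cancel_left₀ h1q.ne']
    rw [h4, abs_mul, abs_mul _ (u ^ i), abs_pow u, abs_of_nonneg h3]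
    ring
  -- The values of the integrand. The exponent `2ν + 1 = m + 2k - 1` is a natural number.
  have hterm : ∀ l : ℤ, (1 + q) / mu q m * (γ * ((q * ((1 + q) / mu q m)) ^ ((m : ℝ) / 2 + k - 1) *
      besselTwoReduced q ((m : ℝ) / 2 + k - 1)
        ((q * ((1 + q) / mu q m)) ^ 2 * u * (q ^ l * γ) ^ 2) *
      (q ^ l * γ) ^ (2 * ((m : ℝ) / 2 + k - 1) + 1) *
      (((q ^ l * γ) ^ 2) ^ n * φ ((q ^ l * γ) ^ 2)) * q ^ l)) = ∑' i, F i l := by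
    intro l
    have ht : 0 < q ^ l * γ := by positivity
    obtain ⟨M, hM⟩ : ∃ M, m + 2 * k = M + 1 := ⟨m + 2 * k - 1, by omega⟩
    have e1 : (q ^ l * γ) ^ (2 * ((m : ℝ) / 2 + k - 1) + 1) = (q ^ l * γ) ^ M := by
      rw [← Real.rpow_natCast]
      congr 1
      have : (m : ℝ) + 2 * k = M + 1 := by exact_mod_cast hM
      linear_combination this
    rw [e1, besselTwoReduced, ← tsum_mul_left, ← tsum_mul_left, ← tsum_mul_right, ← tsum_mul_right,
      ← tsum_mul_right, ← tsum_mul_left, ← tsum_mul_left]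
    refine tsum_congr fun i => ?_
    simp only [F]
    rw [show m + 2 * (k + i + n) = M + 1 + 2 * i + 2 * n by omega]
    unfold hankelCoeff besselCoeff
    rw [show (q * ((1 + q) / mu q m)) ^ 2 * u * (q ^ l * γ) ^ 2 / (1 + q) ^ 2 =
      (q * ((1 + q) / mu q m)) ^ 2 / (1 + q) ^ 2 * u * (q ^ l * γ) ^ 2 by ring, mul_pow, mul_pow _ u,
      pow_add _ (M + 1 + 2 * i), pow_add _ (M + 1), pow_succ _ M, pow_mul _ 2 i, pow_mul _ 2 n]
    generalize ((q * ((1 + q) / mu q m)) ^ 2 / (1 + q) ^ 2) ^ i = R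
    ring
  unfold radialHankel jackson
  have e2 : (1 + q) / mu q m * ((1 - q) * γ * ∑' l : ℤ,
      ((q * ((1 + q) / mu q m)) ^ ((m : ℝ) / 2 + k - 1) *
      besselTwoReduced q ((m : ℝ) / 2 + k - 1)
        ((q * ((1 + q) / mu q m)) ^ 2 * u * (q ^ l * γ) ^ 2) *
      (q ^ l * γ) ^ (2 * ((m : ℝ) / 2 + k - 1) + 1) *
      (((q ^ l * γ) ^ 2) ^ n * φ ((q ^ l * γ) ^ 2)) * q ^ l)) =
      (1 - q) * ∑' l : ℤ, ∑' i, F i l := by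
    simp only [← hterm]
    rw [tsum_mul_left, tsum_mul_left]
    ring
  rw [e2, hF.tsum_comm, ← tsum_mul_left]
  refine tsum_congr fun i => ?_
  rw [moment_eq hm]
  simp only [F]
  rw [tsum_mul_left]
  ring

/-! ### The two Fourier transforms in terms of Bochner's relations -/

/-- The second transform of `S_k(𝐱) 𝐱^{2n}` times a Gaussian. -/
theorem bochner_eq {A γ : ℝ} (hA : 0 < A) (hγ : 0 < γ) {φ : ℝ → ℝ}
    (hφ0 : ∀ u, 0 ≤ u → 0 ≤ φ u)
    (hφ : ∀ u, 0 ≤ u → φ (q ^ 2 * u) = (1 + (1 - q ^ 2) * A * u) * φ u)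
    (hs : ∀ N : ℕ, Summable fun k : ℤ => (q ^ k * γ) ^ (m + 2 * N) * φ ((q ^ k * γ) ^ 2))
    (s : ℤˣ) (α : ℝ) (k n : ℕ) (S : Pol q m) :
    bochner q m s α γ k S (fun u => u ^ n * φ u) = signI s ^ k • timesRadial q m
      (bochnerSeries (fun k i => (normConst q m α γ)⁻¹ * hankelCoeff q m k i)
        (moment q m γ φ) k n) S := by
  rw [bochner, taylorAtZero_radialHankel hA hγ hφ0 hφ hs]
  have : bochnerSeries (fun k i => (normConst q m α γ)⁻¹ * hankelCoeff q m k i)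
      (moment q m γ φ) k n =
      (normConst q m α γ)⁻¹ • bochnerSeries (hankelCoeff q m) (moment q m γ φ) k n := by
    refine PowerSeries.ext fun i => ?_
    rw [PowerSeries.coeff_smul]
    simp only [bochnerSeries, PowerSeries.coeff_mk, smul_eq_mul]
    ring
  rw [this, timesRadial_smul]
  rfl

/-- The first transform satisfies Bochner's relations. -/
theorem fourierBarRep_eq (s : ℤˣ) (β b : ℝ) (P : Pol q m) : fourierBarRep q m s β b P =
    bochnerTransform q m s (fun k i => (1 + q) / (2 * mu q m ^ ((m : ℝ) / 2) *
        qGamma (q ^ 2) (1 / 2) ^ m) * sphereCoeff q m k i)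
      (moment q m (√(mu q m / ((1 - q ^ 2) * β))) fun u => bigExp (q ^ 2) (-(b / mu q m) * u))
      P := by
  let L : Pol q m →ₗ[ℂ] Ser q m :=
    { toFun := fourierBarRep q m s β b
      map_add' := fun P Q => by
        refine PowerSeries.ext fun l => ?_
        rw [map_add]
        simp only [fourierBarRep, PowerSeries.coeff_mk]
        rw [TensorProduct.add_tmul, add_mul, map_add, map_add, smul_add, smul_add]
      map_smul' := fun c P => by
        refine PowerSeries.ext fun l => ?_
        rw [PowerSeries.coeff_smul]
        simp only [fourierBarRep, PowerSeries.coeff_mk]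
        rw [← TensorProduct.smul_tmul', smul_mul_assoc, map_smul, map_smul, smul_comm _ c,
          smul_comm _ c]
        rfl }
  refine LinearMap.congr_fun (f := L) (Pol.hom_ext_spherical q m fun k n S hS => ?_) P
  rw [bochnerTransform_apply _ _ _ hS]
  change fourierBarRep q m s β b (S * normSq q m ^ n) = _
  refine PowerSeries.ext fun l => ?_
  rw [PowerSeries.coeff_smul, fourierBarRep, PowerSeries.coeff_mk]
  by_cases hl : ∃ i, l = k + 2 * i
  · obtain ⟨i, rfl⟩ := hl
    rw [lid_spaceInt_kernel q m hS, IsHomog.coeff_timesRadial hS.1, bochnerSeries,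
      PowerSeries.coeff_mk, pow_add, pow_mul, signI_sq]
    unfold moment
    simp only [smul_smul]
    congr 1
    push_cast
    ring
  · rw [lid_spaceInt_kernel_eq_zero q m hS n _ _ hl, IsHomog.coeff_timesRadial_eq_zero hS.1 _ hl,
      smul_zero, smul_zero, smul_zero]

end

/-! ### Independence of the level of the Gaussian -/

section

variable {q : ℝ} {m : ℕ} [Admissible q m]

/-- A sequence of Gaussians `ψ_j`, each the dilation by `p` of the next one, together with sequences
`ν_j` of numbers that are related as the moments of these Gaussians. -/
structure IsGaussFamily (p : ℝ) (A : ℕ → ℝ) (ψ : ℕ → PowerSeries ℝ) (ν : ℕ → ℕ → ℝ) : Prop where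
  isGauss : ∀ j, IsGauss p (A j) (ψ j)
  dilation : ∀ j, ψ j = PowerSeries.rescale p (ψ (j + 1))
  moment : ∀ j N, ν j N = ν (j + 1) N + (1 - p) * A (j + 1) * ν (j + 1) (N + 1)

/-- A change of the moments `ν_N` by a multiple of `ν_{N+1}` amounts to a multiplication by `1 + c
𝐱²`. -/
theorem bochnerTransform_level {ν ν' : ℕ → ℝ} {c : ℝ} (h : ∀ N, ν' N = ν N + c * ν (N + 1))
    (s : ℤˣ) (a : ℕ → ℕ → ℝ) (P : Pol q m) : bochnerTransform q m s a ν' P =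
      bochnerTransform q m s a ν (P + (c : ℂ) • (normSq q m * P)) := by
  have : bochnerTransform q m s a ν' = bochnerTransform q m s a ν ∘ₗ
      (LinearMap.id + (c : ℂ) • LinearMap.mulLeft ℂ (normSq q m)) := by
    refine Pol.hom_ext_spherical q m fun k n S hS => ?_
    have h1 : bochnerSeries a ν' k n = bochnerSeries a ν k n + c • bochnerSeries a ν k (n + 1) := by
      refine PowerSeries.ext fun i => ?_
      rw [map_add, PowerSeries.coeff_smul]
      simp only [bochnerSeries, PowerSeries.coeff_mk, h, smul_eq_mul, add_assoc]
      ring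
    rw [LinearMap.comp_apply, LinearMap.add_apply, LinearMap.smul_apply, LinearMap.id_apply,
      LinearMap.mulLeft_apply, normSq_pow_comm, ← mul_assoc, ← pow_succ', ← normSq_pow_comm,
      ← normSq_pow_comm, map_add, map_smul, bochnerTransform_apply _ _ _ hS,
      bochnerTransform_apply _ _ _ hS, bochnerTransform_apply _ _ _ hS, h1, timesRadial_add,
      timesRadial_smul, smul_add, smul_comm]
  rw [this]
  rfl

variable {p : ℝ} {A : ℕ → ℝ} {ψ : ℕ → PowerSeries ℝ} {ν : ℕ → ℕ → ℝ}

/-- A polynomial times the Gaussian `ψ_i` is a polynomial times `ψ_{i+n}`, with the same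
transform. -/
theorem IsGaussFamily.exists_level_add (h : IsGaussFamily p A ψ ν) (s : ℤˣ) (a : ℕ → ℕ → ℝ) (i n : ℕ)
    (P : Pol q m) : ∃ Q : Pol q m, timesRadial q m (ψ i) P = timesRadial q m (ψ (i + n)) Q ∧
      bochnerTransform q m s a (ν i) P = bochnerTransform q m s a (ν (i + n)) Q := by
  induction n with
  | zero => exact ⟨P, rfl, rfl⟩
  | succ n ih =>
    obtain ⟨Q, h1, h2⟩ := ih
    refine ⟨Q + (((1 - p) * A (i + n + 1) : ℝ) : ℂ) • (normSq q m * Q), ?_, ?_⟩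
    · rw [h1, h.dilation, (h.isGauss _).rescale_eq, timesRadial_add, timesRadial_smul,
        timesRadial_X_mul, map_add, map_smul]
      rfl
    · rw [h2, bochnerTransform_level (h.moment (i + n))]
      rfl

/-- The transform of a polynomial times a Gaussian does not depend on how it is written. -/
theorem IsGaussFamily.transform_eq (h : IsGaussFamily p A ψ ν) (s : ℤˣ) (a : ℕ → ℕ → ℝ) {i j : ℕ}
    {P Q : Pol q m} (hPQ : timesRadial q m (ψ i) P = timesRadial q m (ψ j) Q) :
    bochnerTransform q m s a (ν i) P = bochnerTransform q m s a (ν j) Q := by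
  obtain ⟨P', h1, h2⟩ := h.exists_level_add s a i j P
  obtain ⟨Q', h3, h4⟩ := h.exists_level_add s a j i Q
  rw [add_comm j i] at h3 h4
  rw [h2, h4, timesRadial_injective q m (h.isGauss (i + j)).coeff_zero (h1.symm.trans (hPQ.trans h3))]

/-! ### Quadratic operators -/

variable (q m) in
/-- The quadratic operator `U^i C_{ij} U^j`. -/
def quadOp (U : Fin m → Ser q m → Ser q m) (f : Ser q m) : Ser q m :=
  ∑ i, ((wt q m i : ℝ) : ℂ) • U i (U i.rev f)

theorem laplace_eq_quadOp (f : Ser q m) : laplace q m f = quadOp q m (dx q m) f := by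
  rw [laplace, sum_sum_metric fun i j => dx q m i (dx q m j f)]
  rfl

theorem mulNormSq_eq_quadOp (f : Ser q m) : mulNormSq q m f = quadOp q m (mulX q m) f := by
  let L : Pol q m →ₗ[ℂ] Ser q m := ⟨⟨ofPol q m, ofPol_add q m⟩, ofPol_smul q m⟩
  have h : L (normSq q m) = ∑ i, ((wt q m i : ℝ) : ℂ) •
      (ofPol q m (x q m i) * ofPol q m (x q m i.rev)) := by
    rw [normSq, sum_sum_metric fun i j => x q m i * x q m j, map_sum]
    refine Finset.sum_congr rfl fun i _ => ?_
    rw [map_smul, ← ofPol_mul]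
    rfl
  change L (normSq q m) * f = _
  rw [h, quadOp, Finset.sum_mul]
  refine Finset.sum_congr rfl fun i _ => ?_
  rw [mulX, mulX, ← mul_assoc]
  exact ser_smul_mul q m _ _ _

theorem laplaceStar_eq_quadOp (f : Ser q m) : laplaceStar q m f =
    ((((q ^ m)⁻¹ : ℝ) : ℂ) ^ 2) • quadOp q m (dxBar q m) f := by
  have h1 : ∀ j g, dxStar q m j g =
      (-(((q ^ m)⁻¹ : ℝ) : ℂ) * ((wt q m j.rev : ℝ) : ℂ)) • dxBar q m j.rev g := by
    intro j g
    rw [dxStar, mul_smul, Finset.sum_eq_single j.rev]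
    · rw [metric_eq, if_pos (Fin.rev_rev j).symm]
    · intro k _ hk
      rw [metric_eq, if_neg (fun h => hk (by rw [h, Fin.rev_rev])), Complex.ofReal_zero, zero_smul]
    · intro h; exact absurd (Finset.mem_univ _) h
  rw [laplaceStar, sum_sum_metric fun i j => dxStar q m j (dxStar q m i f), quadOp, Finset.smul_sum]
  refine Finset.sum_congr rfl fun i _ => ?_
  have h2 : ((wt q m i : ℝ) : ℂ) * ((wt q m i.rev : ℝ) : ℂ) = 1 := by
    exact_mod_cast wt_mul_rev (q_pos q m) i
  rw [h1, h1, Fin.rev_rev, dxBar, extend_smul, smul_smul, smul_smul, smul_smul]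
  congr 1
  linear_combination ((((q ^ m)⁻¹ : ℝ) : ℂ)) ^ 2 * ((wt q m i : ℝ) : ℂ) * h2

/-- If a transform `Φ` exchanges the operators `U` and `κ W`, it exchanges the quadratic operators
up to `κ²`. Here `ι` parametrizes the domain of the transform by polynomials. -/
theorem exists_quadOp {ι Φ : Pol q m →ₗ[ℂ] Ser q m} {U W : Fin m → Ser q m → Ser q m}
    {D : Fin m → Pol q m → Pol q m} {κ : ℂ} (hι : ∀ j P, U j (ι P) = ι (D j P))
    (hΦ : ∀ j P, Φ (D j P) = κ • W j (Φ P)) (hW : ∀ j (c : ℂ) f, W j (c • f) = c • W j f)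
    (P : Pol q m) :
    ∃ Q, quadOp q m U (ι P) = ι Q ∧ Φ Q = κ ^ 2 • quadOp q m W (Φ P) := by
  refine ⟨∑ i, ((wt q m i : ℝ) : ℂ) • D i (D i.rev P), ?_, ?_⟩
  · rw [quadOp, map_sum]
    refine Finset.sum_congr rfl fun i _ => ?_
    rw [hι, hι, map_smul]
  · rw [quadOp, map_sum, Finset.smul_sum]
    refine Finset.sum_congr rfl fun i _ => ?_
    rw [map_smul, hΦ, hΦ, hW, smul_smul, smul_smul, smul_smul]
    congr 1
    ring

/-- The quadratic consequences of the exchange relations, for the Laplacians `c U^i C_{ij} U^j`. -/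
theorem quadratic_relations {ι Φ : Pol q m →ₗ[ℂ] Ser q m} {T : Ser q m → Ser q m}
    (hT : ∀ P, T (ι P) = Φ P) {X Y X' Y' : Fin m → Ser q m → Ser q m}
    {DX DY : Fin m → Pol q m → Pol q m} {κ κ' c c' : ℂ}
    (hX : ∀ j P, X j (ι P) = ι (DX j P)) (hY : ∀ j P, Y j (ι P) = ι (DY j P))
    (hX' : ∀ j P, Φ (DX j P) = κ • Y' j (Φ P)) (hY' : ∀ j P, Φ (DY j P) = κ' • X' j (Φ P))
    (hX's : ∀ j (c : ℂ) f, X' j (c • f) = c • X' j f)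
    (hY's : ∀ j (c : ℂ) f, Y' j (c • f) = c • Y' j f)
    (hc : κ ^ 2 = -c') (hc' : c * κ' ^ 2 = -1) (P : Pol q m) :
    T (quadOp q m X (ι P)) = -(c' • quadOp q m Y' (T (ι P))) ∧
    T (c • quadOp q m Y (ι P)) = -quadOp q m X' (T (ι P)) ∧
    T ((1 / 2 : ℂ) • (-(c • quadOp q m Y (ι P)) + quadOp q m X (ι P))) =
      (1 / 2 : ℂ) • (-(c' • quadOp q m Y' (T (ι P))) + quadOp q m X' (T (ι P))) := by
  obtain ⟨Q, h1, h2⟩ := exists_quadOp hX hX' hY's P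
  obtain ⟨R, h3, h4⟩ := exists_quadOp hY hY' hX's P
  rw [hc] at h2
  have h5 : (1 / 2 : ℂ) • (-(c • ι R) + ι Q) = ι ((1 / 2 : ℂ) • ((-1 : ℂ) • c • R + Q)) := by
    rw [map_smul, map_add, map_smul, map_smul]
    module
  rw [h1, h3, ← map_smul, hT, hT, hT, map_smul, map_smul, h5, hT, map_smul, map_add, map_smul,
    map_smul, h2, h4, smul_smul c, hc']
  refine ⟨neg_smul _ _, neg_one_smul _ _, ?_⟩
  rw [neg_one_smul, neg_one_smul, neg_neg, neg_smul, add_comm]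

end

/-! ### The two Fourier transforms on their domains -/

section

variable {q : ℝ} {m : ℕ}

theorem moment_eq_add_of_eq_mul (hm : 1 ≤ m) {γ c : ℝ} {φ φ' : ℝ → ℝ}
    (hφ : ∀ u, 0 ≤ u → φ' u = (1 + c * u) * φ u)
    (hs : ∀ N : ℕ, Summable fun k : ℤ => (q ^ k * γ) ^ (m + 2 * N) * φ ((q ^ k * γ) ^ 2)) (N : ℕ) :
    moment q m γ φ' N = moment q m γ φ N + c * moment q m γ φ (N + 1) := by
  rw [moment_eq hm, moment_eq hm, moment_eq hm, mul_left_comm c, ← mul_add, ← tsum_mul_left (a := c),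
    ← (hs N).tsum_add ((hs (N + 1)).mul_left c)]
  congr 1
  refine tsum_congr fun k => ?_
  rw [hφ _ (sq_nonneg _)]
  ring

variable [Admissible q m]

variable (q m) in
/-- The exponents `q^{2j} β / μ` of the Gaussians `E_{q²}(-A 𝐱²)` in `V̄_{[β]}`. -/
def bigExponent (β : ℝ) (j : ℕ) : ℝ := q ^ (2 * j) * β / mu q m

variable (q m) in
/-- The exponents `q^{-2j} α q² / μ` of the Gaussians `e_{q²}(-A 𝐱²)` in `V_{[α]}`. -/
def smallExponent (α : ℝ) (j : ℕ) : ℝ := (q ^ (2 * j))⁻¹ * α * q ^ 2 / mu q m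

variable (q m) in
/-- The moments of the Gaussians in `V̄_{[β]}` over the lattice through `γ_β`. -/
def bigMoment (β : ℝ) (j : ℕ) : ℕ → ℝ :=
  moment q m (√(mu q m / ((1 - q ^ 2) * β))) fun u => bigExp (q ^ 2) (-bigExponent q m β j * u)

variable (q m) in
/-- The moments of the Gaussians in `V_{[α]}` over the lattice through `γ`. -/
def smallMoment (α γ : ℝ) (j : ℕ) : ℕ → ℝ :=
  moment q m γ fun u => smallExp (q ^ 2) (-smallExponent q m α j * u)

variable {α β γ : ℝ}

theorem bigExponent_pos (hβ : 0 < β) (j : ℕ) : 0 < bigExponent q m β j := by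
  have := q_pos q m
  have := mu_pos q m
  unfold bigExponent
  positivity

theorem smallExponent_pos (hα : 0 < α) (j : ℕ) : 0 < smallExponent q m α j := by
  have := q_pos q m
  have := mu_pos q m
  unfold smallExponent
  positivity

theorem bigExponent_eq (β : ℝ) (j : ℕ) :
    bigExponent q m β j = (q ^ 2)⁻¹ * bigExponent q m β (j + 1) := by
  have := (q_pos q m).ne'
  unfold bigExponent
  rw [mul_add, pow_add]
  field_simp

theorem smallExponent_eq (α : ℝ) (j : ℕ) :
    smallExponent q m α j = q ^ 2 * smallExponent q m α (j + 1) := by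
  have := (q_pos q m).ne'
  unfold smallExponent
  rw [mul_add, pow_add]
  field_simp

theorem summable_bigMoment (hβ : 0 < β) (j N : ℕ) :
    Summable fun k : ℤ => (q ^ k * √(mu q m / ((1 - q ^ 2) * β))) ^ (m + 2 * N) *
      bigExp (q ^ 2) (-bigExponent q m β j * (q ^ k * √(mu q m / ((1 - q ^ 2) * β))) ^ 2) := by
  have hmu := mu_pos q m
  have he : 0 < 1 - q ^ 2 := sub_pos.2 (sq_lt_one' q m)
  have hm := one_le_m q m
  refine summable_bigExp_moment (q_pos q m) (q_lt_one q m) (by positivity)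
    (bigExponent_pos hβ j).le j ?_ (by omega)
  rw [Real.sq_sqrt (by positivity), bigExponent, pow_mul]
  field_simp

theorem summable_smallMoment (hα : 0 < α) (hγ : 0 < γ) (j N : ℕ) :
    Summable fun k : ℤ => (q ^ k * γ) ^ (m + 2 * N) *
      smallExp (q ^ 2) (-smallExponent q m α j * (q ^ k * γ) ^ 2) := by
  have hm := one_le_m q m
  exact summable_smallExp_moment (q_pos q m) (q_lt_one q m) hγ (smallExponent_pos hα j) (by omega)

theorem isGaussFamily_bigExp (hβ : 0 < β) : IsGaussFamily (q ^ 2)⁻¹ (bigExponent q m β)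
    (fun j => PowerSeries.rescale (-bigExponent q m β j) (bigExpSeries (q ^ 2)))
    (bigMoment q m β) where
  isGauss j := isGauss_bigExp (sq_pos' q m) (sq_lt_one' q m) _
  dilation j := by
    rw [PowerSeries.rescale_rescale, bigExponent_eq]
    congr 2
    ring
  moment j N := by
    refine moment_eq_add_of_eq_mul (one_le_m q m) (c := (1 - (q ^ 2)⁻¹) * bigExponent q m β (j + 1))
      (φ := fun u => bigExp (q ^ 2) (-bigExponent q m β (j + 1) * u))
      (φ' := fun u => bigExp (q ^ 2) (-bigExponent q m β j * u))
      (fun u _ => ?_) (summable_bigMoment hβ (j + 1)) N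
    rw [← bigExp_neg_eq (sq_pos' q m) (sq_lt_one' q m), bigExponent_eq β j]
    congr 1
    ring

theorem isGaussFamily_smallExp (hα : 0 < α) (hγ : 0 < γ) :
    IsGaussFamily (q ^ 2) (smallExponent q m α)
      (fun j => PowerSeries.rescale (-smallExponent q m α j) (smallExpSeries (q ^ 2)))
      (smallMoment q m α γ) where
  isGauss j := isGauss_smallExp (sq_pos' q m) (sq_lt_one' q m) _
  dilation j := by
    rw [PowerSeries.rescale_rescale, smallExponent_eq]
    congr 2
    ring
  moment j N := by
    refine moment_eq_add_of_eq_mul (one_le_m q m) (c := (1 - q ^ 2) * smallExponent q m α (j + 1))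
      (φ := fun u => smallExp (q ^ 2) (-smallExponent q m α (j + 1) * u))
      (φ' := fun u => smallExp (q ^ 2) (-smallExponent q m α j * u))
      (fun u hu => ?_) (summable_smallMoment hα hγ (j + 1)) N
    rw [← smallExp_neg_eq (sq_pos' q m) (sq_lt_one' q m) (smallExponent_pos hα _).le hu,
      smallExponent_eq α j]
    congr 1
    ring

theorem bigMoment_recursion (hβ : 0 < β) (j N : ℕ) : bigMoment q m β j N =
    (q ^ m)⁻¹ * (q ^ 2)⁻¹ ^ N * (bigMoment q m β j N +
      (1 - (q ^ 2)⁻¹) * bigExponent q m β j * bigMoment q m β j (N + 1)) := by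
  have h := moment_recursion (A := bigExponent q m β j)
    (φ := fun u => bigExp (q ^ 2) (-bigExponent q m β j * u)) (q_pos q m) (one_le_m q m) (-1)
    (fun u _ => ?_) (summable_bigMoment hβ j) N
  · rw [zpow_neg_one, inv_pow, inv_pow] at h
    exact h
  · rw [zpow_neg_one, inv_pow]
    exact bigExp_neg_eq (sq_pos' q m) (sq_lt_one' q m) _ u

theorem smallMoment_recursion (hα : 0 < α) (hγ : 0 < γ) (j N : ℕ) : smallMoment q m α γ j N =
    q ^ m * (q ^ 2) ^ N * (smallMoment q m α γ j N +
      (1 - q ^ 2) * smallExponent q m α j * smallMoment q m α γ j (N + 1)) := by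
  have h := moment_recursion (A := smallExponent q m α j)
    (φ := fun u => smallExp (q ^ 2) (-smallExponent q m α j * u)) (q_pos q m) (one_le_m q m) 1
    (fun u hu => ?_) (summable_smallMoment hα hγ j) N
  · rw [zpow_one] at h
    exact h
  · rw [zpow_one]
    exact smallExp_neg_eq (sq_pos' q m) (sq_lt_one' q m) (smallExponent_pos hα j).le hu

variable (q m) in
/-- The coefficients of `𝓕̄^±`, as a transform satisfying Bochner's relations. -/
def barCoeff (k i : ℕ) : ℝ :=
  (1 + q) / (2 * mu q m ^ ((m : ℝ) / 2) * qGamma (q ^ 2) (1 / 2) ^ m) * sphereCoeff q m k i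

variable (q m) in
/-- The embedding of `𝒫` into `V̄_{[β]}` at the level `j`. -/
def bigEmb (β : ℝ) (j : ℕ) : Pol q m →ₗ[ℂ] Ser q m :=
  timesRadial q m (PowerSeries.rescale (-bigExponent q m β j) (bigExpSeries (q ^ 2)))

variable (q m) in
/-- The embedding of `𝒫` into `V_{[α]}` at the level `j`. -/
def smallEmb (α : ℝ) (j : ℕ) : Pol q m →ₗ[ℂ] Ser q m :=
  timesRadial q m (PowerSeries.rescale (-smallExponent q m α j) (smallExpSeries (q ^ 2)))

theorem mem_VBarClass {f : Ser q m} : f ∈ VBarClass q m β ↔ ∃ j P, f = bigEmb q m β j P := by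
  rw [VBarClass, Set.mem_iUnion]
  rfl

theorem mem_VClass {g : Ser q m} : g ∈ VClass q m α ↔ ∃ j P, g = smallEmb q m α j P := by
  rw [VClass, Set.mem_iUnion]
  rfl

/-- The first transform on the level `j`. The representation that its definition chooses may have
another level. -/
theorem fourierBar_bigEmb (hβ : 0 < β) (s : ℤˣ) (j : ℕ) (P : Pol q m) :
    fourierBar q m s β (bigEmb q m β j P) =
      bochnerTransform q m s (barCoeff q m) (bigMoment q m β j) P := by
  have h : ∃ r : ℕ × Pol q m,
      bigEmb q m β j P = ofPol q m r.2 * bigGauss q m (q ^ (2 * r.1) * β) := ⟨(j, P), rfl⟩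
  rw [fourierBar, dif_pos h, fourierBarRep_eq]
  exact (isGaussFamily_bigExp hβ).transform_eq s (barCoeff q m) (h.choose_spec.symm)

/-- The second transform on the level `j`. The harmonic representation that its definition chooses
may have another level. -/
theorem fourier_smallEmb (hα : 0 < α) (hγ : 0 < γ) (s : ℤˣ) (j : ℕ) (P : Pol q m) :
    fourier q m s α γ (smallEmb q m α j P) =
      bochnerTransform q m s (fun k i => (normConst q m α γ)⁻¹ * hankelCoeff q m k i)
        (smallMoment q m α γ j) P := by
  have h : ∃ r : ℕ × ((ℕ × ℕ) →₀ Pol q m),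
      IsHarmonicRep q m ((q ^ (2 * r.1))⁻¹ * α) r.2 (smallEmb q m α j P) := by
    obtain ⟨S, hS⟩ := (fischerEquiv q m).surjective P
    refine ⟨(j, S.1), fun k n => S.2 (k, n), ?_⟩
    rw [← fischerMap_apply]
    exact congrArg (smallEmb q m α j) hS.symm
  rw [fourier, dif_pos h]
  obtain ⟨h1, h2⟩ := h.choose_spec
  generalize h.choose = r at h1 h2 ⊢
  -- The chosen representation is the Fischer decomposition of a polynomial at the level `r.1`.
  have h3 : smallEmb q m α r.1 (fischerMap q m r.2) = smallEmb q m α j P := by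
    rw [h2, fischerMap_apply]
    rfl
  rw [← (isGaussFamily_smallExp hα hγ).transform_eq s _ h3, bochnerTransform,
    fischerLift_fischerMap q m _ (show r.2 ∈ sphFamilies q m from fun kn => h1 kn.1 kn.2)]
  refine Finsupp.sum_congr fun kn _ => ?_
  have hpos : 0 < smallExponent q m α r.1 := smallExponent_pos hα r.1
  refine bochner_eq hpos hγ (φ := fun u =>
    smallExp (q ^ 2) (-smallExponent q m α r.1 * u)) (fun u hu => ?_) (fun u hu => ?_)
    (summable_smallMoment hα hγ r.1) s α kn.1 kn.2 (r.2 kn)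
  · rw [smallExp, neg_mul, neg_neg]
    have := one_le_bigExp (sq_pos' q m) (sq_lt_one' q m)
      (mul_nonneg hpos.le hu)
    positivity
  · exact smallExp_neg_eq (sq_pos' q m) (sq_lt_one' q m) hpos.le hu

/-! ### The exchange relations -/

theorem mulX_smul (j : Fin m) (c : ℂ) (f : Ser q m) : mulX q m j (c • f) = c • mulX q m j f :=
  ser_mul_smul q m _ _ _

/-- `V̄_{[β]}` is stable under `∂̄^j`. -/
theorem dxBar_bigEmb (β : ℝ) (i : ℕ) (j : Fin m) (P : Pol q m) : dxBar q m j (bigEmb q m β i P) =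
    bigEmb q m β i (gaussDeriv (pdBar q m) (q ^ 2)⁻¹ (q ^ ((m : ℤ) - 2) * mu q m)
      (bigExponent q m β i) j P) :=
  (isSkewDeriv_pdBar q m).timesGauss (isGauss_bigExp (sq_pos' q m) (sq_lt_one' q m) _) j P

/-- `V_{[α]}` is stable under `∂^j`. -/
theorem dx_smallEmb (α : ℝ) (i : ℕ) (j : Fin m) (P : Pol q m) : dx q m j (smallEmb q m α i P) =
    smallEmb q m α i (gaussDeriv (pd q m) (q ^ 2) (mu q m) (smallExponent q m α i) j P) :=
  (isSkewDeriv_pd q m).timesGauss (isGauss_smallExp (sq_pos' q m) (sq_lt_one' q m) _) j P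

/-- The exchange relations of the first transform. -/
theorem fourierBar_relations (hβ : 0 < β) (s : ℤˣ) {f : Ser q m} (hf : f ∈ VBarClass q m β) :
    (∀ j : Fin m, mulX q m j f ∈ VBarClass q m β ∧
      fourierBar q m s β (mulX q m j f) = (-signI s) • dx q m j (fourierBar q m s β f)) ∧
    (∀ j : Fin m, dxBar q m j f ∈ VBarClass q m β ∧
      fourierBar q m s β (dxBar q m j f) =
        (-signI s * (q : ℂ) ^ m) • mulX q m j (fourierBar q m s β f)) ∧
    fourierBar q m s β (mulNormSq q m f) = -laplace q m (fourierBar q m s β f) ∧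
    fourierBar q m s β (laplaceStar q m f) = -mulNormSq q m (fourierBar q m s β f) ∧
    fourierBar q m s β (hamStar q m f) = ham q m (fourierBar q m s β f) := by
  obtain ⟨i, P, rfl⟩ := mem_VBarClass.1 hf
  have ha : IsIntegralCoeff q m (barCoeff q m) := isIntegralCoeff_sphereCoeff _
  have hX : ∀ j P, mulX q m j (bigEmb q m β i P) = bigEmb q m β i (x q m j * P) := fun j P =>
    mulX_timesRadial q m _ j P
  have hΦX := ha.transform_x_mul s (bigMoment q m β i)
  have hΦY := ha.transform_gaussDeriv s (bigMoment_recursion hβ i)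
  have hqm : (q : ℂ) ^ m ≠ 0 := by exact_mod_cast (pow_pos (q_pos q m) m).ne'
  have key := quadratic_relations (fun P => fourierBar_bigEmb hβ s i P) hX (dxBar_bigEmb β i)
    (X' := mulX q m) (Y' := dx q m) hΦX hΦY mulX_smul (fun j c f => extend_smul _ c f)
    (c := (((q ^ m)⁻¹ : ℝ) : ℂ) ^ 2) (c' := 1) (by rw [neg_sq, signI_sq])
    (by
      have := signI_sq s
      push_cast
      field_simp
      exact this) P
  refine ⟨fun j => ⟨?_, ?_⟩, fun j => ⟨?_, ?_⟩, ?_, ?_, ?_⟩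
  · rw [hX]; exact mem_VBarClass.2 ⟨_, _, rfl⟩
  · rw [hX, fourierBar_bigEmb hβ, fourierBar_bigEmb hβ]
    exact hΦX j P
  · rw [dxBar_bigEmb]; exact mem_VBarClass.2 ⟨_, _, rfl⟩
  · rw [dxBar_bigEmb, fourierBar_bigEmb hβ, fourierBar_bigEmb hβ, hΦY, Complex.ofReal_pow]
  · rw [mulNormSq_eq_quadOp, laplace_eq_quadOp, key.1, one_smul]
  · rw [mulNormSq_eq_quadOp, laplaceStar_eq_quadOp, key.2.1]
  · rw [ham, hamStar, mulNormSq_eq_quadOp, mulNormSq_eq_quadOp, laplaceStar_eq_quadOp,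
      laplace_eq_quadOp, key.2.2, one_smul]

/-- The exchange relations of the second transform. -/
theorem fourier_relations (hα : 0 < α) (hγ : 0 < γ) (s : ℤˣ) {g : Ser q m} (hg : g ∈ VClass q m α) :
    (∀ j : Fin m, mulX q m j g ∈ VClass q m α ∧
      fourier q m s α γ (mulX q m j g) =
        (-signI s / (q : ℂ) ^ m) • dxBar q m j (fourier q m s α γ g)) ∧
    (∀ j : Fin m, dx q m j g ∈ VClass q m α ∧
      fourier q m s α γ (dx q m j g) = (-signI s) • mulX q m j (fourier q m s α γ g)) ∧
    fourier q m s α γ (mulNormSq q m g) = -laplaceStar q m (fourier q m s α γ g) ∧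
    fourier q m s α γ (laplace q m g) = -mulNormSq q m (fourier q m s α γ g) ∧
    fourier q m s α γ (ham q m g) = hamStar q m (fourier q m s α γ g) := by
  obtain ⟨i, P, rfl⟩ := mem_VClass.1 hg
  have ha : IsHankelCoeff q m fun k i => (normConst q m α γ)⁻¹ * hankelCoeff q m k i :=
    isHankelCoeff_hankelCoeff _
  have hX : ∀ j P, mulX q m j (smallEmb q m α i P) = smallEmb q m α i (x q m j * P) := fun j P =>
    mulX_timesRadial q m _ j P
  have hΦX := ha.transform_x_mul s (smallMoment q m α γ i)
  have hΦY := ha.transform_gaussDeriv s (smallMoment_recursion hα hγ i)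
  have key := quadratic_relations (fun P => fourier_smallEmb hα hγ s i P) hX (dx_smallEmb α i)
    (X' := mulX q m) (Y' := dxBar q m) hΦX hΦY mulX_smul (fun j c f => extend_smul _ c f)
    (c := 1) (c' := (((q ^ m)⁻¹ : ℝ) : ℂ) ^ 2) (by rw [mul_pow, neg_sq, signI_sq, neg_one_mul])
    (by rw [neg_sq, signI_sq, one_mul]) P
  refine ⟨fun j => ⟨?_, ?_⟩, fun j => ⟨?_, ?_⟩, ?_, ?_, ?_⟩
  · rw [hX]; exact mem_VClass.2 ⟨_, _, rfl⟩
  · rw [hX, fourier_smallEmb hα hγ, fourier_smallEmb hα hγ, hΦX, div_eq_mul_inv, Complex.ofReal_inv,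
      Complex.ofReal_pow]
    rfl
  · rw [dx_smallEmb]; exact mem_VClass.2 ⟨_, _, rfl⟩
  · rw [dx_smallEmb, fourier_smallEmb hα hγ, fourier_smallEmb hα hγ]
    exact hΦY j P
  · rw [mulNormSq_eq_quadOp, laplaceStar_eq_quadOp, key.1]
  · rw [mulNormSq_eq_quadOp, laplace_eq_quadOp, ← key.2.1, one_smul]
  · rw [ham, hamStar, mulNormSq_eq_quadOp, mulNormSq_eq_quadOp, laplaceStar_eq_quadOp,
      laplace_eq_quadOp, ← key.2.2, one_smul]

end

end

end QEuclid

theorem theorem5p2 (q : ℝ) (hq0 : 0 < q) (hq1 : q < 1) (m : ℕ) (hm : 1 ≤ m) (s : ℤˣ)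
    (α β γ : ℝ) (hα : 0 < α) (hβ : 0 < β) (hγ : 0 < γ) :
    (∀ f ∈ QEuclid.VBarClass q m β,
      (∀ j : Fin m,
        QEuclid.mulX q m j f ∈ QEuclid.VBarClass q m β ∧
        QEuclid.fourierBar q m s β (QEuclid.mulX q m j f) =
          (-QEuclid.signI s) • QEuclid.dx q m j (QEuclid.fourierBar q m s β f)) ∧
      (∀ j : Fin m,
        QEuclid.dxBar q m j f ∈ QEuclid.VBarClass q m β ∧
        QEuclid.fourierBar q m s β (QEuclid.dxBar q m j f) =
          (-QEuclid.signI s * (q : ℂ) ^ m) •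
            QEuclid.mulX q m j (QEuclid.fourierBar q m s β f)) ∧
      QEuclid.fourierBar q m s β (QEuclid.mulNormSq q m f) =
        -QEuclid.laplace q m (QEuclid.fourierBar q m s β f) ∧
      QEuclid.fourierBar q m s β (QEuclid.laplaceStar q m f) =
        -QEuclid.mulNormSq q m (QEuclid.fourierBar q m s β f) ∧
      QEuclid.fourierBar q m s β (QEuclid.hamStar q m f) =
        QEuclid.ham q m (QEuclid.fourierBar q m s β f)) ∧
    (∀ g ∈ QEuclid.VClass q m α,
      (∀ j : Fin m,
        QEuclid.mulX q m j g ∈ QEuclid.VClass q m α ∧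
        QEuclid.fourier q m s α γ (QEuclid.mulX q m j g) =
          (-QEuclid.signI s / (q : ℂ) ^ m) •
            QEuclid.dxBar q m j (QEuclid.fourier q m s α γ g)) ∧
      (∀ j : Fin m,
        QEuclid.dx q m j g ∈ QEuclid.VClass q m α ∧
        QEuclid.fourier q m s α γ (QEuclid.dx q m j g) =
          (-QEuclid.signI s) • QEuclid.mulX q m j (QEuclid.fourier q m s α γ g)) ∧
      QEuclid.fourier q m s α γ (QEuclid.mulNormSq q m g) =
        -QEuclid.laplaceStar q m (QEuclid.fourier q m s α γ g) ∧
      QEuclid.fourier q m s α γ (QEuclid.laplace q m g) =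
        -QEuclid.mulNormSq q m (QEuclid.fourier q m s α γ g) ∧
      QEuclid.fourier q m s α γ (QEuclid.ham q m g) =
        QEuclid.hamStar q m (QEuclid.fourier q m s α γ g)) := by
  have : QEuclid.Admissible q m := ⟨hq0, hq1, hm⟩
  exact ⟨fun _ hf => QEuclid.fourierBar_relations hβ s hf,
    fun _ hg => QEuclid.fourier_relations hα hγ s hg⟩
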